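/- Let $(\Lambda,S_G,\Lambda^\vee,S_G^\vee)$ be a based (finite, reduced) root datum. For a subset $S\subseteq S_G$ of the simple roots consider the based root datum $(\Lambda,S,\Lambda^\vee,S^\vee)$. A *weak spherical system* with respect to it is a triple $(\Xi,\Sigma,S^p)$ with $\Xi\subseteq\Lambda$ a subgroup, $\Sigma\subseteq\Xi$ and $S^p\subseteq S$ such that 1. every $\sigma\in\Sigma$ is of the form $\sigma=\sum_{\alpha\in|\sigma|}n_\alpha\alpha$ with $|\sigma|\subseteq S$ and $n_\alpha\ge1$, where $(|\sigma|,(n_\alpha),|\sigma|\cap S^p)$ is isomorphic to an entry of Table 1; 2. $\langle\Xi\mid\alpha^\vee\rangle=0$ for all $\alpha\in S^p$; 3. if $\sigma=\alpha+\beta\in\Sigma$ with $\alpha,\beta\in S$, $\alpha\perp\beta$, then $\langle\Xi\mid\alpha^\vee-\beta^\vee\rangle=0$; 4. if $\alpha,\beta\in S$ and $\alpha,\alpha+\beta\in\Sigma$, then $\langle\beta\mid\alpha^\vee\rangle\ne-1$. It is *indecomposable* if there is no partition of $S$ into two non-empty, mutually orthogonal subsets $S_1,S_2$ such that every $\sigma\in\Sigma$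 has support in $S_1$ or in $S_2$ and $\Xi$ splits accordingly (every $\chi\in\Xi$ is $\chi_1+\chi_2$ with $\chi_i\in\Xi$, $\chi_1\perp S_2^\vee$, $\chi_2\perp S_1^\vee$; this is automatic if $\Xi=\mathbb Z\Sigma$). **Table 1** (simple roots numbered as in Bourbaki, so that in $\mathsf G_2$ the root $\alpha_1$ is short; the sets are $|\sigma|\setminus S^p$). $\mathsf A_1$: $\alpha_1$, $\{\alpha_1\}$. $\mathsf A_n$ ($n\ge2$): $\alpha_1+\dots+\alpha_n$, $\{\alpha_1,\alpha_n\}$. $\mathsf B_n$ ($n\ge2$): $\alpha_1+\dots+\alpha_n$, $\{\alpha_1\}$ or $\{\alpha_1,\alpha_n\}$. $\mathsf C_n$ ($n\ge3$): $\alpha_1+2\alpha_2+\dots+2\alpha_{n-1}+\alpha_n$, $\{\alpha_2\}$ or $\{\alpha_1,\alpha_2\}$. $\mathsf F_4$: $\alpha_1+2\alpha_2+3\alpha_3+2\alpha_4$, $\{\alpha_4\}$. $\mathsf G_2$: $2\alpha_1+\alpha_2$, $\{\alpha_1\}$. $\mathsf G_2$: $\alpha_1+\alpha_2$, $\{\alpha_1,\alpha_2\}$.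 $\mathsf D_2=\mathsf A_1+\mathsf A_1$: $\alpha_1+\alpha_2$, $\{\alpha_1,\alpha_2\}$. $\mathsf D_n$ ($n\ge3$): $2\alpha_1+\dots+2\alpha_{n-2}+\alpha_{n-1}+\alpha_n$, $\{\alpha_1\}$. $\mathsf B_3$: $\alpha_1+2\alpha_2+3\alpha_3$, $\{\alpha_3\}$. **Theorem.** Let $\sigma\ne\tau$ be elements of $\Lambda$, and let $|\sigma|$, $|\tau|\subseteq S_G$ be their supports (the simple roots occurring with non-zero coefficient; empty for elements outside of the root lattice). Let $S^p$ be a set of simple roots, and put $S=|\sigma|\cup|\tau|$. Then the triple $$(\mathbb Z\sigma+\mathbb Z\tau,\ \{\sigma,\tau\},\ (|\sigma|\cup|\tau|)\cap S^p)$$ is an indecomposable weak spherical system with respect to $(\Lambda,S,\Lambda^\vee,S^\vee)$ if and only if it is isomorphic to an entry of Table 2, i.e., there is an isomorphism of Dynkin diagrams from $S$ to the diagram of the entry that carries the unordered pair $\{\sigma,\tau\}$ and the set $S\setminus S^p$ to those of the entry. **Table 2** (diagram; $\sigma$, $\tau$; $S\setminus S^p$). Case A. * $\mathsf A_n$, $n\ge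 l+1\ge2$; $\alpha_1+\dots+\alpha_l$, $\alpha_{l+1}+\dots+\alpha_n$; $\{\alpha_1,\alpha_l,\alpha_{l+1},\alpha_n\}$ * $\mathsf A_n$, $n\ge4$; $\alpha_1+\alpha_n$, $\alpha_2+\dots+\alpha_{n-1}$; $\{\alpha_1,\alpha_2,\alpha_{n-1},\alpha_n\}$ * $\mathsf A_5$; $\alpha_1+2\alpha_2+\alpha_3$, $\alpha_3+2\alpha_4+\alpha_5$; $\{\alpha_2,\alpha_4\}$ * $\mathsf A_2+\mathsf A_2$; $\alpha_1+\alpha_1'$, $\alpha_2+\alpha_2'$; $S$ Case B. * $\mathsf B_n$, $n\ge p+1\ge2$; $\alpha_1+\dots+\alpha_p$, $\alpha_{p+1}+\dots+\alpha_n$; $\{\alpha_1,\alpha_p,\alpha_{p+1}\}$ or $\{\alpha_1,\alpha_p,\alpha_{p+1},\alpha_n\}$ * $\mathsf B_3$; $\alpha_1+\alpha_2$, $\alpha_2+\alpha_3$; $S$ * $\mathsf B_4$; $\alpha_1+\alpha_2+\alpha_3+\alpha_4$, $\alpha_2+2\alpha_3+3\alpha_4$; $\{\alpha_1,\alpha_4\}$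 Case C. * $\mathsf C_n$, $n\ge2$; $\alpha_1$, $\alpha_1+2\alpha_2+\dots+2\alpha_{n-1}+\alpha_n$; $\{\alpha_1,\alpha_2\}$ * $\mathsf C_n$, $n\ge3$; $\alpha_1+\alpha_2$, $\alpha_2+2\alpha_3+\dots+2\alpha_{n-1}+\alpha_n$; $\{\alpha_1,\alpha_2,\alpha_3\}$ * $\mathsf C_n$, $n\ge4$; $\alpha_1+2\alpha_2+\alpha_3$, $\alpha_3+2\alpha_4+\dots+2\alpha_{n-1}+\alpha_n$; $\{\alpha_2,\alpha_4\}$ * $\mathsf C_n$, $n\ge p+2\ge3$; $\alpha_1+\dots+\alpha_p$, $\alpha_{p+1}+2\alpha_{p+2}+\dots+2\alpha_{n-1}+\alpha_n$; $\{\alpha_1,\alpha_p,\alpha_{p+1},\alpha_{p+2}\}$ * $\mathsf C_n+\mathsf A_1$, $n\ge2$; $\alpha_1+\alpha_1'$, $\alpha_1+2\alpha_2+\dots+2\alpha_{n-1}+\alpha_n$; $\{\alpha_1,\alpha_2,\alpha_1'\}$ * $\mathsf C_n$, $n\ge2$; $\alpha_1+\dots+\alpha_{n-1}$, $\alpha_n$;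 $\{\alpha_1,\alpha_{n-1},\alpha_n\}$ * $\mathsf C_n$, $n\ge3$; $\alpha_1+\alpha_n$, $\alpha_2+\dots+\alpha_{n-1}$; $\{\alpha_1,\alpha_2,\alpha_{n-1},\alpha_n\}$ * $\mathsf C_2+\mathsf C_2$; $\alpha_1+\alpha_1'$, $\alpha_2+\alpha_2'$; $S$ Case D. * $\mathsf D_n$, $n\ge p+3\ge4$; $\alpha_1+\dots+\alpha_p$, $2\alpha_{p+1}+\dots+2\alpha_{n-2}+\alpha_{n-1}+\alpha_n$; $\{\alpha_1,\alpha_p,\alpha_{p+1}\}$ * $\mathsf D_n$, $n\ge3$; $\alpha_1+\dots+\alpha_{n-2}$, $\alpha_{n-1}+\alpha_n$; $\{\alpha_1,\alpha_{n-2},\alpha_{n-1},\alpha_n\}$ * $\mathsf D_5$; $\alpha_1+2\alpha_2+\alpha_3$, $\alpha_3+\alpha_4+\alpha_5$; $\{\alpha_2,\alpha_4,\alpha_5\}$ * $\mathsf D_n$, $n\ge3$; $\alpha_1+\dots+\alpha_{n-2}+\alpha_{n-1}$, $\alpha_1+\dots+\alpha_{n-2}+\alpha_n$; $\{\alpha_1,\alpha_{n-1},\alpha_n\}$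 Cases E, F, G. * $\mathsf E_6$; $2\alpha_1+2\alpha_3+2\alpha_4+\alpha_2+\alpha_5$, $2\alpha_6+2\alpha_5+2\alpha_4+\alpha_3+\alpha_2$; $\{\alpha_1,\alpha_6\}$ * $\mathsf E_6$; $\alpha_1+\alpha_3+\alpha_4+\alpha_5+\alpha_6$, $2\alpha_2+2\alpha_4+\alpha_3+\alpha_5$; $\{\alpha_1,\alpha_2,\alpha_6\}$ * $\mathsf F_4$; $\alpha_1+\alpha_2$, $\alpha_3+\alpha_4$; $S$ * $\mathsf F_4$; $\alpha_1+\alpha_2+\alpha_3$, $\alpha_4$; $\{\alpha_1,\alpha_3,\alpha_4\}$ * $\mathsf F_4$; $\alpha_1+\alpha_2+\alpha_3$, $\alpha_4+2\alpha_3+\alpha_2$; $\{\alpha_1,\alpha_3,\alpha_4\}$ * $\mathsf F_4$; $\alpha_1+\alpha_4$, $\alpha_2+\alpha_3$; $S$ * $\mathsf F_4$; $\alpha_1+2\alpha_2+3\alpha_3$, $\alpha_4$; $\{\alpha_3,\alpha_4\}$ * $\mathsf G_2$; $\alpha_1$, $\alpha_2$; $S$ * $\mathsf G_2$; $\alpha_1$,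 $\alpha_1+\alpha_2$; $S$ * $\mathsf G_2+\mathsf G_2$; $\alpha_1+\alpha_1'$, $\alpha_2+\alpha_2'$; $S$ -/

import Mathlib

namespace WeakSpherical

/-! ### Diagrams

A diagram is given by a number `n` of nodes, numbered `1, …, n`, and a Cartan matrix `C` with
entries `C i j = ⟨α_i | α_j^∨⟩`; row and column `i : Fin n` belong to node number `i + 1`.
Integral combinations of simple roots are given by their coefficients, as functions of the node
number, and sets of simple roots as sets of node numbers. For connected diagrams the numbering is
Bourbaki's. -/

/-- The simple root `α_k`. -/
def α (k : ℕ) : ℕ → ℕ := fun m => if m = k then 1 else 0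

/-- The sum `α_i + α_{i+1} + ⋯ + α_j`, which is `0` if `j < i`. -/
def seg (i j : ℕ) : ℕ → ℕ := fun m => if i ≤ m ∧ m ≤ j then 1 else 0

/-- The disjoint union of two Cartan matrices; the nodes of the second one are numbered after
those of the first one. -/
def disjointSum {m n : ℕ} (C : Matrix (Fin m) (Fin m) ℤ) (C' : Matrix (Fin n) (Fin n) ℤ) :
    Matrix (Fin (m + n)) (Fin (m + n)) ℤ :=
  Matrix.reindex finSumFinEquiv finSumFinEquiv (Matrix.fromBlocks C 0 0 C')

/-- Bourbaki's Cartan matrix of type `G₂`, with `α₁` short and `α₂` long. -/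
def cartanG₂ : Matrix (Fin 2) (Fin 2) ℤ := (CartanMatrix.G₂).transpose

/-- The table of weak spherical roots: `WeakRootTable n C l w` means that the Dynkin diagram with
Cartan matrix `C`, the labels `l` and the set `w` of white nodes form an entry of the table. The
remaining nodes are black. -/
inductive WeakRootTable : (n : ℕ) → Matrix (Fin n) (Fin n) ℤ → (ℕ → ℕ) → Set ℕ → Prop
  | A₁ : WeakRootTable 1 (CartanMatrix.A 1) (α 1) {1}
  | A (n : ℕ) (hn : 2 ≤ n) : WeakRootTable n (CartanMatrix.A n) (seg 1 n) {1, n}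
  | B (n : ℕ) (hn : 2 ≤ n) : WeakRootTable n (CartanMatrix.B n) (seg 1 n) {1}
  | B' (n : ℕ) (hn : 2 ≤ n) : WeakRootTable n (CartanMatrix.B n) (seg 1 n) {1, n}
  | C (n : ℕ) (hn : 3 ≤ n) :
      WeakRootTable n (CartanMatrix.C n) (α 1 + 2 • seg 2 (n - 1) + α n) {2}
  | C' (n : ℕ) (hn : 3 ≤ n) :
      WeakRootTable n (CartanMatrix.C n) (α 1 + 2 • seg 2 (n - 1) + α n) {1, 2}
  | F₄ : WeakRootTable 4 CartanMatrix.F₄ (α 1 + 2 • α 2 + 3 • α 3 + 2 • α 4) {4}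
  | G₂ : WeakRootTable 2 cartanG₂ (2 • α 1 + α 2) {1}
  | G₂' : WeakRootTable 2 cartanG₂ (α 1 + α 2) {1, 2}
  | D₂ : WeakRootTable 2 (CartanMatrix.D 2) (α 1 + α 2) {1, 2}
  | D (n : ℕ) (hn : 3 ≤ n) :
      WeakRootTable n (CartanMatrix.D n) (2 • seg 1 (n - 2) + α (n - 1) + α n) {1}
  | B₃ : WeakRootTable 3 (CartanMatrix.B 3) (α 1 + 2 • α 2 + 3 • α 3) {3}

/-- The table of weak spherical systems of rank two: `RankTwoTable n C s t w` means that there is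
an entry whose Dynkin diagram `S = |σ| ∪ |τ|` has Cartan matrix `C`, whose weak spherical roots
`σ`, `τ` are `s`, `t`, and for which `S \ S^p` is `w`. -/
inductive RankTwoTable :
    (n : ℕ) → Matrix (Fin n) (Fin n) ℤ → (ℕ → ℕ) → (ℕ → ℕ) → Set ℕ → Prop
  -- Case A
  | A_a (n l : ℕ) (hl : 1 ≤ l) (hn : l + 1 ≤ n) :
      RankTwoTable n (CartanMatrix.A n) (seg 1 l) (seg (l + 1) n) {1, l, l + 1, n}
  | A_b (n : ℕ) (hn : 4 ≤ n) :
      RankTwoTable n (CartanMatrix.A n) (α 1 + α n) (seg 2 (n - 1)) {1, 2, n - 1, n}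
  | A_c :
      RankTwoTable 5 (CartanMatrix.A 5) (α 1 + 2 • α 2 + α 3) (α 3 + 2 • α 4 + α 5) {2, 4}
  | AA :
      RankTwoTable (2 + 2) (disjointSum (CartanMatrix.A 2) (CartanMatrix.A 2))
        (α 1 + α 3) (α 2 + α 4) {1, 2, 3, 4}
  -- Case B
  | B_a (n p : ℕ) (hp : 1 ≤ p) (hn : p + 1 ≤ n) :
      RankTwoTable n (CartanMatrix.B n) (seg 1 p) (seg (p + 1) n) {1, p, p + 1, n}
  | B_a' (n p : ℕ) (hp : 1 ≤ p) (hn : p + 1 ≤ n) :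
      RankTwoTable n (CartanMatrix.B n) (seg 1 p) (seg (p + 1) n) {1, p, p + 1}
  | B_b :
      RankTwoTable 3 (CartanMatrix.B 3) (α 1 + α 2) (α 2 + α 3) {1, 2, 3}
  | B_c :
      RankTwoTable 4 (CartanMatrix.B 4) (α 1 + α 2 + α 3 + α 4) (α 2 + 2 • α 3 + 3 • α 4) {1, 4}
  -- Case C
  | C_a (n : ℕ) (hn : 2 ≤ n) :
      RankTwoTable n (CartanMatrix.C n) (α 1) (α 1 + 2 • seg 2 (n - 1) + α n) {1, 2}
  | C_b (n : ℕ) (hn : 3 ≤ n) :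
      RankTwoTable n (CartanMatrix.C n) (α 1 + α 2) (α 2 + 2 • seg 3 (n - 1) + α n) {1, 2, 3}
  | C_c (n : ℕ) (hn : 4 ≤ n) :
      RankTwoTable n (CartanMatrix.C n)
        (α 1 + 2 • α 2 + α 3) (α 3 + 2 • seg 4 (n - 1) + α n) {2, 4}
  | C_d (n p : ℕ) (hp : 1 ≤ p) (hn : p + 2 ≤ n) :
      RankTwoTable n (CartanMatrix.C n)
        (seg 1 p) (α (p + 1) + 2 • seg (p + 2) (n - 1) + α n) {1, p, p + 1, p + 2}
  | CA (n : ℕ) (hn : 2 ≤ n) :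
      RankTwoTable (n + 1) (disjointSum (CartanMatrix.C n) (CartanMatrix.A 1))
        (α 1 + α (n + 1)) (α 1 + 2 • seg 2 (n - 1) + α n) {1, 2, n + 1}
  | C_e (n : ℕ) (hn : 2 ≤ n) :
      RankTwoTable n (CartanMatrix.C n) (seg 1 (n - 1)) (α n) {1, n - 1, n}
  | C_f (n : ℕ) (hn : 3 ≤ n) :
      RankTwoTable n (CartanMatrix.C n) (α 1 + α n) (seg 2 (n - 1)) {1, 2, n - 1, n}
  | CC :
      RankTwoTable (2 + 2) (disjointSum (CartanMatrix.C 2) (CartanMatrix.C 2))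
        (α 1 + α 3) (α 2 + α 4) {1, 2, 3, 4}
  -- Case D
  | D_a (n p : ℕ) (hp : 1 ≤ p) (hn : p + 3 ≤ n) :
      RankTwoTable n (CartanMatrix.D n)
        (seg 1 p) (2 • seg (p + 1) (n - 2) + α (n - 1) + α n) {1, p, p + 1}
  | D_b (n : ℕ) (hn : 3 ≤ n) :
      RankTwoTable n (CartanMatrix.D n) (seg 1 (n - 2)) (α (n - 1) + α n) {1, n - 2, n - 1, n}
  | D_c :
      RankTwoTable 5 (CartanMatrix.D 5) (α 1 + 2 • α 2 + α 3) (α 3 + α 4 + α 5) {2, 4, 5}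
  | D_d (n : ℕ) (hn : 3 ≤ n) :
      RankTwoTable n (CartanMatrix.D n)
        (seg 1 (n - 2) + α (n - 1)) (seg 1 (n - 2) + α n) {1, n - 1, n}
  -- Cases E, F, G
  | E₆_a :
      RankTwoTable 6 CartanMatrix.E₆ (2 • α 1 + 2 • α 3 + 2 • α 4 + α 2 + α 5)
        (2 • α 6 + 2 • α 5 + 2 • α 4 + α 3 + α 2) {1, 6}
  | E₆_b :
      RankTwoTable 6 CartanMatrix.E₆ (α 1 + α 3 + α 4 + α 5 + α 6)
        (2 • α 2 + 2 • α 4 + α 3 + α 5) {1, 2, 6}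
  | F₄_a :
      RankTwoTable 4 CartanMatrix.F₄ (α 1 + α 2) (α 3 + α 4) {1, 2, 3, 4}
  | F₄_b :
      RankTwoTable 4 CartanMatrix.F₄ (α 1 + α 2 + α 3) (α 4) {1, 3, 4}
  | F₄_c :
      RankTwoTable 4 CartanMatrix.F₄ (α 1 + α 2 + α 3) (α 4 + 2 • α 3 + α 2) {1, 3, 4}
  | F₄_d :
      RankTwoTable 4 CartanMatrix.F₄ (α 1 + α 4) (α 2 + α 3) {1, 2, 3, 4}
  | F₄_e :
      RankTwoTable 4 CartanMatrix.F₄ (α 1 + 2 • α 2 + 3 • α 3) (α 4) {3, 4}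
  | G₂_a :
      RankTwoTable 2 cartanG₂ (α 1) (α 2) {1, 2}
  | G₂_b :
      RankTwoTable 2 cartanG₂ (α 1) (α 1 + α 2) {1, 2}
  | GG :
      RankTwoTable (2 + 2) (disjointSum cartanG₂ cartanG₂) (α 1 + α 3) (α 2 + α 4) {1, 2, 3, 4}

/-! ### Weak spherical systems

In what follows `P` is a root datum with lattices `X = Λ` and `Y = Λ^∨`, and `b` is a basis of
it, so that `P` and `b` form a based root datum. Simple roots are referred to by their index in
`b.support`. A subset `S` of `b.support` stands for the based root datum `(Λ, S, Λ^∨, S^∨)` (that of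
a Levi subgroup); `S = b.support` is `(P, b)` itself. -/

variable {ι X Y : Type*} [AddCommGroup X] [AddCommGroup Y] {P : RootDatum ι X Y}

/-- The support `|χ|` of an element `χ` of the root lattice: the simple roots that occur in `χ` with
non-zero coefficient. (The coefficients are unique; for other `χ` the support is empty.) -/
def supp (b : P.Base) (χ : X) : Set ι :=
  {i | i ∈ b.support ∧ ∃ c : ι → ℤ, χ = ∑ j ∈ b.support, c j • P.root j ∧ c i ≠ 0}

/-- The combination, with coefficients `s`, of the simple roots that a numbering `e` of simple roots
assigns to the nodes of a diagram. -/
def comb (P : RootDatum ι X Y) {n : ℕ} (e : Fin n → ι) (s : ℕ → ℕ) : X :=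
  ∑ i : Fin n, s (i + 1) • P.root (e i)

/-- `σ` is a weak spherical root for `S` and `S^p = Sp`: it is `∑ n_α α` with `α` in a subset `|σ|`
of `S`, and `(|σ|, n_*, |σ| ∩ S^p)` appears in the table of weak spherical roots. -/
def IsWeakSphericalRoot (P : RootDatum ι X Y) (S Sp : Set ι) (σ : X) : Prop :=
  ∃ (n : ℕ) (C : Matrix (Fin n) (Fin n) ℤ) (l : ℕ → ℕ) (w : Set ℕ), WeakRootTable n C l w ∧
    ∃ e : Fin n ↪ ι, (∀ i, e i ∈ S) ∧ (∀ i j, P.pairing (e i) (e j) = C i j) ∧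
      σ = comb P e l ∧ ∀ i : Fin n, e i ∈ Sp ↔ (i : ℕ) + 1 ∉ w

/-- `(Ξ, Sig, Sp)` is a weak spherical system with respect to `(Λ, S, Λ^∨, S^∨)`. -/
structure IsWeakSphericalSystem (b : P.Base) (S : Set ι) (Ξ : AddSubgroup X) (Sig : Set X)
    (Sp : Set ι) : Prop where
  simple : S ⊆ b.support
  roots_subset : Sig ⊆ Ξ
  parabolic_subset : Sp ⊆ S
  weakRoot : ∀ σ ∈ Sig, IsWeakSphericalRoot P S Sp σ
  parabolic : ∀ i ∈ Sp, ∀ χ ∈ Ξ, P.toLinearMap χ (P.coroot i) = 0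
  typeD₂ : ∀ i ∈ S, ∀ j ∈ S, P.pairing i j = 0 → P.root i + P.root j ∈ Sig →
    ∀ χ ∈ Ξ, P.toLinearMap χ (P.coroot i - P.coroot j) = 0
  simpleRoot : ∀ i ∈ S, ∀ j ∈ S, P.root i ∈ Sig → P.root i + P.root j ∈ Sig →
    P.pairing j i ≠ -1

/-- A weak spherical system `(Ξ, Sig, Sp)` with respect to `(Λ, S, Λ^∨, S^∨)` is indecomposable
unless `S` is the disjoint union of two non-empty mutually orthogonal parts such that `Ξ` and `Sig`
split accordingly; `Sp`, being a subset of `S`, always does. (If `Ξ` is generated by `Sig`, it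
splits as soon as `Sig` does.) -/
def IsIndecomposable (b : P.Base) (S : Set ι) (Ξ : AddSubgroup X) (Sig : Set X) : Prop :=
  ¬ ∃ S₁ S₂ : Set ι, S₁.Nonempty ∧ S₂.Nonempty ∧ Disjoint S₁ S₂ ∧ S₁ ∪ S₂ = S ∧
    (∀ i ∈ S₁, ∀ j ∈ S₂, P.pairing i j = 0 ∧ P.pairing j i = 0) ∧
    (∀ σ ∈ Sig, supp b σ ⊆ S₁ ∨ supp b σ ⊆ S₂) ∧
    ∀ χ ∈ Ξ, ∃ χ₁ ∈ Ξ, ∃ χ₂ ∈ Ξ, χ = χ₁ + χ₂ ∧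
      (∀ j ∈ S₂, P.toLinearMap χ₁ (P.coroot j) = 0) ∧
      (∀ i ∈ S₁, P.toLinearMap χ₂ (P.coroot i) = 0)

/-- `(S, {σ, τ}, Sp)` is isomorphic to the diagram `C` with the two weak spherical roots `s`, `t`
and the set `w` as complement of `Sp`: there is an isomorphism of Dynkin diagrams that matches the
two (unordered) pairs of roots and the two sets. -/
def IsIsomorphicTo (P : RootDatum ι X Y) (S : Set ι) (σ τ : X) (Sp : Set ι) {n : ℕ}
    (C : Matrix (Fin n) (Fin n) ℤ) (s t : ℕ → ℕ) (w : Set ℕ) : Prop :=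
  ∃ e : Fin n ≃ S, (∀ i j, P.pairing (e i) (e j) = C i j) ∧
    ({σ, τ} : Set X) = {comb P (fun i => (e i : ι)) s, comb P (fun i => (e i : ι)) t} ∧
    ∀ i : Fin n, (e i : ι) ∈ Sp ↔ (i : ℕ) + 1 ∉ w

end WeakSpherical

set_option linter.unusedSectionVars false

/-! All conditions depend only on the Cartan matrix `A` of `S` and on the coefficients of `σ` and
`τ`. Positive definiteness of an invariant form on the root span shows that no non-zero effective
combination of simple roots pairs nonpositively with all coroots of its own support (`finiteType`).
This single property takes the place of the classification of Dynkin diagrams: a configuration is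
excluded by exhibiting a forbidden combination, which is either the null root of an affine diagram
or is built from `σ` and `τ` themselves, most often `σ + τ` (`FiniteType.false_of_add`).

Call the simple roots outside `S^p` white and the others black. Four facts carry the classification.
First, a weak spherical root pairs to zero with the black coroots of its support, it has at most two
white nodes, and its pairings there are small (`Rt.pr_black`, `Prof`); only type `D₂`, whose support
is disconnected, needs a separate treatment. Second, both roots pair to zero with black coroots, so
a black node adjacent to one support belongs to it (`Sys.mem₁`, `WR.walk`). Third, at a white node
of a root not of type `A` or `D₂` at most one further node can be attached, by a simple edge, and
often none at all (`Heavy`, `SuperHeavy`, `Rt.heavy_or`). Fourth, indecomposability means that the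
two supports meet or are joined by an edge (`isIndecomposable_iff`).

Disjoint connected supports are joined by exactly one edge, with white ends (`Sys.unique_edge`). Two
heavy nodes cannot be joined, so one root is of type `A` and the other is attached to an end of its
chain (`disjoint_connected`). For a root of type `D₂`, axiom 3 equates the pairings of the other
root with its two nodes, which leaves few ways of attaching them (`d2_d2`, `d2_connected`). Equal
connected supports are impossible, because the pairings with the white coroots determine the root
(`Sys.false_of_same_supp`). If one support properly contains the other, the larger root has two
white nodes and the smaller root only one of them; axiom 4 enters here (`contained`). If neither
contains the other and they share a white node, `σ + τ` must pair positively with it, and comparing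
the two diagrams from that node on leaves a short list (`white_overlap`). If they share black nodes
only, `σ + τ` is antidominant unless one root is of type `D` and the other pairs to at least `-1`
with its white node; the subcases `D 3`, `D 4` and `D n` with `n ≥ 5` lead to types `A`, `C`, `D`
and `E₆` (`black_overlap`).

Conversely, each entry of the table is described by explicit embeddings of the diagrams of its two
roots (`Glue`). The same data serve to verify the axioms (`Glue.sys`, `InTable.sys`) and to
recognize the entry in the classification (`Glue.inTable`). -/

namespace WeakSpherical

/-! ### Generalized Cartan matrices of finite type -/

section Cartan

variable {κ : Type*} [Fintype κ] [DecidableEq κ]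

/-- The pairing of `∑ c_j α_j` with the simple coroot `α_i^∨`. -/
def pr (A : κ → κ → ℤ) (c : κ → ℤ) (i : κ) : ℤ := ∑ j, c j * A j i

/-- Cartan matrices of finite type, characterized by the absence of non-zero effective
combinations of simple roots that are antidominant on their support. -/
structure FiniteType (A : κ → κ → ℤ) : Prop where
  diag : ∀ i, A i i = 2
  nonpos : ∀ i j, i ≠ j → A i j ≤ 0
  symm : ∀ i j, A i j = 0 → A j i = 0
  effective : ∀ c : κ → ℤ, (∀ i, 0 ≤ c i) → (∀ i, c i ≠ 0 → pr A c i ≤ 0) → ∀ i, c i = 0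
  nondeg : ∀ c : κ → ℤ, (∀ i, pr A c i = 0) → ∀ i, c i = 0

variable {A : κ → κ → ℤ}

@[simp] lemma pr_add (c d : κ → ℤ) (i : κ) : pr A (c + d) i = pr A c i + pr A d i := by
  simp [pr, add_mul, Finset.sum_add_distrib]

@[simp] lemma pr_smul (a : ℤ) (c : κ → ℤ) (i : κ) : pr A (a • c) i = a * pr A c i := by
  simp [pr, mul_assoc, Finset.mul_sum]

@[simp] lemma pr_single (j : κ) (a : ℤ) (i : κ) : pr A (Pi.single j a) i = a * A j i := by
  rw [pr, Finset.sum_eq_single j] <;> simp +contextual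

namespace FiniteType

variable (h : FiniteType A)
include h

lemma neg {i j : κ} (hij : i ≠ j) (ha : A i j ≠ 0) : A i j ≤ -1 ∧ A j i ≤ -1 := by
  have h1 := h.nonpos i j hij
  have h2 := h.nonpos j i hij.symm
  have h3 : A j i ≠ 0 := fun h0 => ha (h.symm _ _ h0)
  omega

lemma ne_zero_symm {i j : κ} (ha : A i j ≠ 0) : A j i ≠ 0 := fun h0 => ha (h.symm _ _ h0)

/-- At a node outside the support all terms of the pairing are nonpositive, so any single term
bounds it from above. -/
lemma pr_le {c : κ → ℤ} (hc : ∀ i, 0 ≤ c i) {k : κ} (hk : c k = 0) (j : κ) :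
    pr A c k ≤ c j * A j k := by
  rw [pr, ← Finset.add_sum_erase _ _ (Finset.mem_univ j)]
  have : ∑ i ∈ Finset.univ.erase j, c i * A i k ≤ 0 := by
    refine Finset.sum_nonpos fun i _ => ?_
    rcases eq_or_ne i k with rfl | hik
    · simp [hk]
    · exact mul_nonpos_of_nonneg_of_nonpos (hc i) (h.nonpos i k hik)
  linarith

lemma pr_le_two {c : κ → ℤ} (hc : ∀ i, 0 ≤ c i) {k : κ} (hk : c k = 0) {j j' : κ} (hj : j ≠ j') :
    pr A c k ≤ c j * A j k + c j' * A j' k := by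
  have hm : j' ∈ Finset.univ.erase j := by simp [hj.symm]
  rw [pr, ← Finset.add_sum_erase _ _ (Finset.mem_univ j), ← Finset.add_sum_erase _ _ hm]
  have : ∑ i ∈ (Finset.univ.erase j).erase j', c i * A i k ≤ 0 := by
    refine Finset.sum_nonpos fun i _ => ?_
    rcases eq_or_ne i k with rfl | hik
    · simp [hk]
    · exact mul_nonpos_of_nonneg_of_nonpos (hc i) (h.nonpos i k hik)
  linarith

lemma pr_nonpos {c : κ → ℤ} (hc : ∀ i, 0 ≤ c i) {k : κ} (hk : c k = 0) : pr A c k ≤ 0 := by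
  simpa [hk] using h.pr_le hc hk k

lemma pr_neg {c : κ → ℤ} (hc : ∀ i, 0 ≤ c i) {k : κ} (hk : c k = 0) {j : κ} (hj : c j ≠ 0)
    (ha : A j k ≠ 0) : pr A c k ≤ - c j := by
  have hjk : j ≠ k := by rintro rfl; exact hj hk
  nlinarith [h.pr_le hc hk j, (h.neg hjk ha).1, hc j]

lemma false_of {c : κ → ℤ} (hc : ∀ i, 0 ≤ c i) (hk : ∀ i, c i ≠ 0 → pr A c i ≤ 0) {i : κ}
    (hi : c i ≠ 0) : False := hi (h.effective c hc hk i)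

/-- The form in which affine diagrams are used: the null root is given by a list of nodes and
positive coefficients, and what remains are linear inequalities between matrix entries. Since all
coefficients are positive there is no cancellation, so the nodes need not even be distinct. -/
lemma false_of_sum {m : ℕ} (x : Fin (m + 1) → κ) (a : Fin (m + 1) → ℤ) (ha : ∀ i, 0 < a i)
    (hk : ∀ j, ∑ i, a i * A (x i) (x j) ≤ 0) : False := by
  have hpr : ∀ k, pr A (∑ i, Pi.single (x i) (a i)) k = ∑ i, a i * A (x i) k := by
    intro k
    have : ∀ s : Finset (Fin (m + 1)),
        pr A (∑ i ∈ s, Pi.single (x i) (a i)) k = ∑ i ∈ s, a i * A (x i) k := by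
      intro s
      induction s using Finset.induction_on with
      | empty => simp [pr]
      | insert i s hi ih => simp [Finset.sum_insert hi, ih]
    exact this _
  have hnn : ∀ (i : Fin (m + 1)) k, 0 ≤ (Pi.single (x i) (a i) : κ → ℤ) k := by
    intro i k
    by_cases hk : k = x i
    · subst hk; simpa using (ha i).le
    · simp [hk]
  refine h.false_of (c := ∑ i, Pi.single (x i) (a i)) (i := x 0) ?_ ?_ ?_
  · intro k
    rw [Finset.sum_apply]
    exact Finset.sum_nonneg fun i _ => hnn i k
  · intro k hk0
    rw [Finset.sum_apply] at hk0
    obtain ⟨i, -, hi⟩ := Finset.exists_ne_zero_of_sum_ne_zero hk0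
    have : k = x i := by
      by_contra hne
      exact hi (by simp [hne])
    rw [hpr, this]
    exact hk i
  · rw [Finset.sum_apply]
    have h1 := Finset.single_le_sum (f := fun i => (Pi.single (x i) (a i) : κ → ℤ) (x 0))
      (fun i _ => hnn i (x 0)) (Finset.mem_univ 0)
    have h2 := ha 0
    simp only [Pi.single_eq_same] at h1
    omega

/-- The product of the two entries is at most 3. Otherwise one entry is at most `-4`, or both are at
most `-2`, and `α_i + 2 α_j`, `2 α_i + α_j` or `α_i + α_j` is a forbidden combination. -/
lemma edge_cases {i j : κ} (hij : i ≠ j) (ha : A i j ≠ 0) :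
    (A i j = -1 ∧ A j i = -1) ∨ (A i j = -2 ∧ A j i = -1) ∨ (A i j = -3 ∧ A j i = -1) ∨
      (A i j = -1 ∧ A j i = -2) ∨ (A i j = -1 ∧ A j i = -3) := by
  obtain ⟨h1, h2⟩ := h.neg hij ha
  have key : ∀ a b : ℤ, 0 < a → 0 < b → 2 * a + b * A j i ≤ 0 → 2 * b + a * A i j ≤ 0 → False := by
    intro a b ha hb h3 h4
    refine h.false_of_sum ![i, j] ![a, b] ?_ ?_
    · intro k; fin_cases k <;> simp [ha, hb]
    · intro k
      fin_cases k <;> simp [Fin.sum_univ_two, h.diag] <;> linarith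
  have h5 : -4 < A i j := by
    by_contra hc
    exact key 1 2 (by omega) (by omega) (by omega) (by omega)
  have h6 : -4 < A j i := by
    by_contra hc
    exact key 2 1 (by omega) (by omega) (by omega) (by omega)
  have h7 : -2 < A i j ∨ -2 < A j i := by
    by_contra hc
    exact key 1 1 (by omega) (by omega) (by omega) (by omega)
  omega

/-- A node attached to a triple edge produces an affine diagram of type `G₂` or its dual; the
coefficients `1, 2, 3` and `1, 2, 1` are those of the null roots. A further edge between `x` and `z`
would only lower the pairings. -/
lemma false_of_triple {x y z : κ} (hxy : x ≠ y) (hxz : x ≠ z) (hyz : y ≠ z) (h1 : A x y ≠ 0)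
    (h2 : A y z ≤ -3 ∨ A z y ≤ -3) : False := by
  obtain ⟨h3, h4⟩ := h.neg hxy h1
  have h5 : A y z ≠ 0 := by
    rcases h2 with h2 | h2
    · omega
    · exact h.ne_zero_symm (by omega)
  obtain ⟨h6, h7⟩ := h.neg hyz h5
  have h8 := h.nonpos x z hxz
  have h9 := h.nonpos z x hxz.symm
  rcases h2 with h2 | h2
  · refine h.false_of_sum ![x, y, z] ![1, 2, 3] (by decide) ?_
    intro k; fin_cases k <;> simp [Fin.sum_univ_three, h.diag] <;> linarith
  · refine h.false_of_sum ![x, y, z] ![1, 2, 1] (by decide) ?_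
    intro k; fin_cases k <;> simp [Fin.sum_univ_three, h.diag] <;> linarith

/-- Two multiple edges with a common node form an affine diagram of rank two. Each of the four
choices of orientations has its own null root. -/
lemma false_of_double {x y z : κ} (hxy : x ≠ y) (hxz : x ≠ z) (hyz : y ≠ z)
    (h1 : A x y ≤ -2 ∨ A y x ≤ -2) (h2 : A y z ≤ -2 ∨ A z y ≤ -2) : False := by
  have h3 : A x y ≠ 0 := by
    rcases h1 with h1 | h1
    · omega
    · exact h.ne_zero_symm (by omega)
  have h5 : A y z ≠ 0 := by
    rcases h2 with h2 | h2
    · omega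
    · exact h.ne_zero_symm (by omega)
  obtain ⟨h3, h4⟩ := h.neg hxy h3
  obtain ⟨h6, h7⟩ := h.neg hyz h5
  have h8 := h.nonpos x z hxz
  have h9 := h.nonpos z x hxz.symm
  rcases h1 with h1 | h1 <;> rcases h2 with h2 | h2
  · refine h.false_of_sum ![x, y, z] ![1, 2, 2] (by decide) ?_
    intro k; fin_cases k <;> simp [Fin.sum_univ_three, h.diag] <;> linarith
  · refine h.false_of_sum ![x, y, z] ![1, 2, 1] (by decide) ?_
    intro k; fin_cases k <;> simp [Fin.sum_univ_three, h.diag] <;> linarith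
  · refine h.false_of_sum ![x, y, z] ![1, 1, 1] (by decide) ?_
    intro k; fin_cases k <;> simp [Fin.sum_univ_three, h.diag] <;> linarith
  · refine h.false_of_sum ![x, y, z] ![2, 2, 1] (by decide) ?_
    intro k; fin_cases k <;> simp [Fin.sum_univ_three, h.diag] <;> linarith

/-- The sum of the three simple roots is the null root of a cycle. -/
lemma false_of_triangle {x y z : κ} (hxy : x ≠ y) (hxz : x ≠ z) (hyz : y ≠ z)
    (h1 : A x y ≠ 0) (h2 : A y z ≠ 0) (h3 : A x z ≠ 0) : False := by
  obtain ⟨h4, h5⟩ := h.neg hxy h1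
  obtain ⟨h6, h7⟩ := h.neg hyz h2
  obtain ⟨h8, h9⟩ := h.neg hxz h3
  refine h.false_of_sum ![x, y, z] ![1, 1, 1] (by decide) ?_
  intro k; fin_cases k <;> simp [Fin.sum_univ_three, h.diag] <;> linarith

/-- The twisted and untwisted affine diagrams of type `F₄`, and the one of type `B₃` (with its
dual), do not occur. -/
lemma false_of_F {x₁ x₂ x₃ x₄ x₅ : κ} (hd : [x₁, x₂, x₃, x₄, x₅].Nodup) (h1 : A x₁ x₂ ≠ 0)
    (h2 : A x₂ x₃ ≠ 0) (h3 : A x₃ x₄ ≠ 0) (h4 : A x₄ x₅ ≠ 0)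
    (h5 : A x₃ x₄ ≤ -2 ∨ A x₄ x₃ ≤ -2) : False := by
  simp only [List.nodup_cons, List.mem_cons, not_or, List.not_mem_nil, not_false_iff] at hd
  obtain ⟨⟨h12, h13, h14, h15, -⟩, ⟨h23, h24, h25, -⟩, ⟨h34, h35, -⟩, ⟨h45, -⟩, -⟩ := hd
  have a12 := h.neg h12 h1
  have a23 := h.neg h23 h2
  have a34 := h.neg h34 h3
  have a45 := h.neg h45 h4
  have a13 := h.nonpos _ _ h13
  have a14 := h.nonpos _ _ h14
  have a15 := h.nonpos _ _ h15
  have a24 := h.nonpos _ _ h24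
  have a25 := h.nonpos _ _ h25
  have a35 := h.nonpos _ _ h35
  have b13 := h.nonpos _ _ (Ne.symm h13)
  have b14 := h.nonpos _ _ (Ne.symm h14)
  have b15 := h.nonpos _ _ (Ne.symm h15)
  have b24 := h.nonpos _ _ (Ne.symm h24)
  have b25 := h.nonpos _ _ (Ne.symm h25)
  have b35 := h.nonpos _ _ (Ne.symm h35)
  rcases h5 with h5 | h5
  · refine h.false_of_sum ![x₁, x₂, x₃, x₄, x₅] ![1, 2, 3, 4, 2] (by decide) ?_
    intro k; fin_cases k <;> simp [Fin.sum_univ_five, h.diag] <;> linarith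
  · refine h.false_of_sum ![x₁, x₂, x₃, x₄, x₅] ![1, 2, 3, 2, 1] (by decide) ?_
    intro k; fin_cases k <;> simp [Fin.sum_univ_five, h.diag] <;> linarith

/-- A fork followed by a double edge is the affine diagram of type `B₃` or its dual, depending on
the direction of the double edge. -/
lemma false_of_fork {x x' y z : κ} (hd : [x, x', y, z].Nodup) (h1 : A x y ≠ 0) (h2 : A x' y ≠ 0)
    (h3 : A y z ≤ -2 ∨ A z y ≤ -2) : False := by
  simp only [List.nodup_cons, List.mem_cons, not_or, List.not_mem_nil, not_false_iff] at hd
  obtain ⟨⟨h12, h13, h14, -⟩, ⟨h23, h24, -⟩, ⟨h34, -⟩, -⟩ := hd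
  have h5 : A y z ≠ 0 := by
    rcases h3 with h2 | h2
    · omega
    · exact h.ne_zero_symm (by omega)
  have a13 := h.neg h13 h1
  have a23 := h.neg h23 h2
  have a34 := h.neg h34 h5
  have a12 := h.nonpos _ _ h12
  have a14 := h.nonpos _ _ h14
  have a24 := h.nonpos _ _ h24
  have b12 := h.nonpos _ _ (Ne.symm h12)
  have b14 := h.nonpos _ _ (Ne.symm h14)
  have b24 := h.nonpos _ _ (Ne.symm h24)
  rcases h3 with h3 | h3
  · refine h.false_of_sum ![x, x', y, z] ![1, 1, 2, 2] (by decide) ?_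
    intro k; fin_cases k <;> simp [Fin.sum_univ_four, h.diag] <;> linarith
  · refine h.false_of_sum ![x, x', y, z] ![1, 1, 2, 1] (by decide) ?_
    intro k; fin_cases k <;> simp [Fin.sum_univ_four, h.diag] <;> linarith

/-- No simple root adjacent to both ends of a chain. -/
lemma false_of_cycle {σ : κ → ℤ} (hσ : ∀ i, 0 ≤ σ i) {u u' a : κ} (hu : u ≠ u') (h1 : σ u ≠ 0)
    (h2 : σ u' ≠ 0) (ha : σ a = 0) (hau : A u a ≠ 0) (hau' : A u' a ≠ 0) (hp : pr A σ u ≤ 1)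
    (hp' : pr A σ u' ≤ 1) (hq : ∀ i, i ≠ u → i ≠ u' → σ i ≠ 0 → pr A σ i ≤ 0) : False := by
  have hua : u ≠ a := by rintro rfl; exact h1 ha
  have hua' : u' ≠ a := by rintro rfl; exact h2 ha
  -- Adding `α_a` lowers the pairing at both ends from at most 1 to at most 0, and at `a` itself the
  -- two ends outweigh the diagonal entry 2.
  refine h.false_of (c := σ + Pi.single a 1) (i := u) ?_ ?_ (by simp [hua, h1])
  · intro i
    have := hσ i
    rcases eq_or_ne i a with rfl | hi
    · simp; omega
    · simpa [hi] using this
  · intro i hi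
    simp only [pr_add, pr_single, one_mul]
    rcases eq_or_ne i a with rfl | hia
    · have := h.pr_le_two hσ ha hu
      have h3 : 1 ≤ σ u := by have := hσ u; omega
      have h4 : 1 ≤ σ u' := by have := hσ u'; omega
      rw [h.diag]
      nlinarith [(h.neg hua hau).1, (h.neg hua' hau').1]
    have hi' : σ i ≠ 0 := by simpa [hia] using hi
    rcases eq_or_ne i u with rfl | hiu
    · linarith [(h.neg hua hau).2]
    rcases eq_or_ne i u' with rfl | hiu'
    · linarith [(h.neg hua' hau').2]
    · linarith [hq i hiu hiu' hi', h.nonpos a i hia.symm]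

/-- The most frequent obstruction: in a weak spherical system of rank two, `σ + τ` must pair
positively with some simple coroot. -/
lemma false_of_add {σ τ : κ → ℤ} (hσ : ∀ i, 0 ≤ σ i) (hτ : ∀ i, 0 ≤ τ i)
    (hk : ∀ i, pr A σ i + pr A τ i ≤ 0) {i : κ} (hi : σ i ≠ 0) : False := by
  refine h.false_of (c := σ + τ) (i := i) (fun i => add_nonneg (hσ i) (hτ i)) ?_ ?_
  · intro i _; simpa using hk i
  · have := hσ i; have := hτ i
    simp only [Pi.add_apply]; omega

end FiniteType

/-! ### Heavy nodes -/

/-- A node `u` of the support of `σ` is heavy if there is an effective combination of simple roots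
in that support which shows that only simple chains can be attached at `u`. -/
def Heavy (A : κ → κ → ℤ) (σ : κ → ℤ) (u : κ) : Prop :=
  ∃ x : κ → ℤ, (∀ i, 0 ≤ x i) ∧ (∀ i, x i ≠ 0 → σ i ≠ 0) ∧ 0 < x u ∧ pr A x u ≤ x u ∧
    ∀ i, i ≠ u → x i ≠ 0 → pr A x i ≤ 0

/-- A node `u` of the support of `σ` is superheavy if there is an effective combination of simple
roots in that support which shows that nothing can be attached at `u`. -/
def SuperHeavy (A : κ → κ → ℤ) (σ : κ → ℤ) (u : κ) : Prop :=
  ∃ x : κ → ℤ, (∀ i, 0 ≤ x i) ∧ (∀ i, x i ≠ 0 → σ i ≠ 0) ∧ 0 < x u ∧ 2 * pr A x u ≤ x u ∧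
    ∀ i, i ≠ u → x i ≠ 0 → pr A x i ≤ 0

/-- The forbidden combination is `a x + b α_v`. Outside `u` and `v` it inherits nonpositivity from
`x`, so only the two stated inequalities are left to the choice of `a` and `b`. -/
lemma FiniteType.false_of_heavy_single (h : FiniteType A) {x : κ → ℤ} (hx : ∀ i, 0 ≤ x i) {u v : κ}
    (hu : 0 < x u) (hv : x v = 0) (hi : ∀ i, i ≠ u → x i ≠ 0 → pr A x i ≤ 0) {a b : ℤ} (ha : 0 < a)
    (hb : 0 < b) (h1 : a * pr A x u + b * A v u ≤ 0) (h2 : a * (x u * A u v) + 2 * b ≤ 0) :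
    False := by
  have huv : u ≠ v := by rintro rfl; omega
  refine h.false_of (c := a • x + Pi.single v b) (i := u) ?_ ?_ ?_
  · intro i
    have := mul_nonneg ha.le (hx i)
    rcases eq_or_ne i v with rfl | hiv
    · simp; omega
    · simpa [hiv] using this
  · intro i hi0
    simp only [pr_add, pr_smul, pr_single]
    rcases eq_or_ne i v with rfl | hiv
    · rw [h.diag]
      nlinarith [h.pr_le hx hv u]
    rcases eq_or_ne i u with rfl | hiu
    · exact h1
    have hxi : x i ≠ 0 := fun h0 => hi0 (by simp [h0, hiv])
    nlinarith [hi i hiu hxi, h.nonpos v i hiv.symm]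
  · have := mul_pos ha hu
    simp [huv]; omega

/-- If `v` were joined to `u`, then `2 x + x_u α_v` would be forbidden: at `u` it pairs to at most
`x_u - x_u`, at `v` to at most `-2 x_u + 2 x_u`. -/
lemma SuperHeavy.isolated (h : FiniteType A) {σ : κ → ℤ} {u v : κ} (hs : SuperHeavy A σ u)
    (hv : σ v = 0) : A u v = 0 := by
  obtain ⟨x, hx, hσ, hu, hp, hi⟩ := hs
  by_contra ha
  have hxv : x v = 0 := by by_contra h0; exact hσ v h0 hv
  have huv : u ≠ v := by rintro rfl; omega
  obtain ⟨h1, h2⟩ := h.neg huv ha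
  exact h.false_of_heavy_single hx hu hxv hi (a := 2) (b := x u) (by norm_num) hu
    (by nlinarith) (by nlinarith)

/-- The combination `x + x_u α_v` excludes `A u v ≤ -2`, and `2 x + x_u α_v` excludes `A v u ≤ -2`.
-/
lemma Heavy.simple (h : FiniteType A) {σ : κ → ℤ} {u v : κ} (hs : Heavy A σ u)
    (hv : σ v = 0) (ha : A u v ≠ 0) : A u v = -1 ∧ A v u = -1 := by
  obtain ⟨x, hx, hσ, hu, hp, hi⟩ := hs
  have hxv : x v = 0 := by by_contra h0; exact hσ v h0 hv
  have huv : u ≠ v := by rintro rfl; omega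
  obtain ⟨h1, h2⟩ := h.neg huv ha
  have h3 : -2 < A u v := by
    by_contra h3
    exact h.false_of_heavy_single hx hu hxv hi (a := 1) (b := x u) (by norm_num) hu
      (by nlinarith) (by nlinarith)
  have h4 : -2 < A v u := by
    by_contra h3
    exact h.false_of_heavy_single hx hu hxv hi (a := 2) (b := x u) (by norm_num) hu
      (by nlinarith) (by nlinarith)
  omega

/-- The witnesses are scaled so as to have the same coefficient at both ends of the edge: in `y_v x
+ x_u y` the excess of each at its heavy node is absorbed by the other. -/
lemma Heavy.false_of_heavy (h : FiniteType A) {σ τ : κ → ℤ} {u v : κ} (hu : Heavy A σ u)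
    (hv : Heavy A τ v) (hd : ∀ i, σ i = 0 ∨ τ i = 0) (ha : A u v ≠ 0) : False := by
  obtain ⟨x, hx, hσ, hxu, hp, hi⟩ := hu
  obtain ⟨y, hy, hτ, hyv, hq, hj⟩ := hv
  have hxy : ∀ i, x i ≠ 0 → y i = 0 := by
    intro i h0
    by_contra h1
    rcases hd i with h2 | h2
    · exact hσ i h0 h2
    · exact hτ i h1 h2
  have hyx : ∀ i, y i ≠ 0 → x i = 0 := fun i h0 => by
    by_contra h1
    exact h0 (hxy i h1)
  have hyu := hxy u hxu.ne'
  have hxv := hyx v hyv.ne'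
  have huv : u ≠ v := by rintro rfl; omega
  obtain ⟨h1, h2⟩ := h.neg huv ha
  refine h.false_of (c := y v • x + x u • y) (i := u) ?_ ?_ ?_
  · intro i
    simpa using add_nonneg (mul_nonneg hyv.le (hx i)) (mul_nonneg hxu.le (hy i))
  · intro i hi0
    simp only [pr_add, pr_smul]
    by_cases hxi : x i = 0
    · have hyi : y i ≠ 0 := fun h0 => hi0 (by simp [h0, hxi])
      rcases eq_or_ne i v with rfl | hiv
      · nlinarith [h.pr_neg hx hxv hxu.ne' ha]
      · nlinarith [hj i hiv hyi, h.pr_nonpos hx hxi]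
    · have hyi := hxy i hxi
      rcases eq_or_ne i u with rfl | hiu
      · nlinarith [h.pr_neg hy hyu hyv.ne' (h.ne_zero_symm ha)]
      · nlinarith [hi i hiu hxi, h.pr_nonpos hy hyi]
  · simp [hyu]; omega

/-- The combination `2 x + x_u (α_a + α_a')` is forbidden: the two attached nodes together absorb
the pairing `2 x_u` at `u`. -/
lemma Heavy.false_of_two (h : FiniteType A) {σ : κ → ℤ} {u a a' : κ} (hs : Heavy A σ u)
    (haa : a ≠ a') (ha : σ a = 0) (ha' : σ a' = 0) (hua : A u a ≠ 0) (hua' : A u a' ≠ 0) :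
    False := by
  obtain ⟨x, hx, hσ, hu, hp, hi⟩ := hs
  have hxa : x a = 0 := by by_contra h0; exact hσ a h0 ha
  have hxa' : x a' = 0 := by by_contra h0; exact hσ a' h0 ha'
  have h1 : u ≠ a := by rintro rfl; omega
  have h2 : u ≠ a' := by rintro rfl; omega
  obtain ⟨h3, h4⟩ := h.neg h1 hua
  obtain ⟨h5, h6⟩ := h.neg h2 hua'
  refine h.false_of (c := (2 : ℤ) • x + (Pi.single a (x u) + Pi.single a' (x u))) (i := u) ?_ ?_ ?_
  · intro i
    have := hx i
    rcases eq_or_ne i a with rfl | hia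
    · simp [haa]; omega
    rcases eq_or_ne i a' with rfl | hia'
    · simp [hia]; omega
    simp [hia, hia', this]
  · intro i hi0
    simp only [pr_add, pr_smul, pr_single]
    rcases eq_or_ne i a with rfl | hia
    · rw [h.diag]
      nlinarith [h.pr_neg hx hxa hu.ne' hua, h.nonpos a' i haa.symm]
    rcases eq_or_ne i a' with rfl | hia'
    · rw [h.diag]
      nlinarith [h.pr_neg hx hxa' hu.ne' hua', h.nonpos a i haa]
    rcases eq_or_ne i u with rfl | hiu
    · nlinarith
    have hxi : x i ≠ 0 := fun h0 => hi0 (by simp [h0, hia, hia'])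
    nlinarith [hi i hiu hxi, h.nonpos a i hia.symm, h.nonpos a' i hia'.symm]
  · simp [h1, h2]; omega

end Cartan
end WeakSpherical

namespace WeakSpherical

/-! ### Cartan matrices indexed by node numbers -/

/-- The Cartan matrix of type `A`, indexed by node numbers. -/
def cA (i j : ℕ) : ℤ := if i = j then 2 else if i + 1 = j ∨ j + 1 = i then -1 else 0

/-- The Cartan matrix of a chain with a double edge between the nodes `n - 1` and `n`, the nodes
`1, …, n - 1` being long. -/
def cB (n i j : ℕ) : ℤ :=
  if i = j then 2 else if i + 1 = j then (if j = n then -2 else -1) else if j + 1 = i then -1 else 0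

/-- The transpose of `cB`. -/
def cC (n i j : ℕ) : ℤ :=
  if i = j then 2 else if i + 1 = j then -1 else if j + 1 = i then (if i = n then -2 else -1) else 0

/-- The Cartan matrix of type `D`, indexed by node numbers. -/
def cD (n i j : ℕ) : ℤ :=
  if i = j then 2
  else if (i + 1 = j ∧ j < n) ∨ (j + 1 = i ∧ i < n) ∨ (i + 2 = j ∧ j = n) ∨ (j + 2 = i ∧ i = n) then
    -1
  else 0

/-- The Cartan matrix of type `G₂`, indexed by node numbers. -/
def cG (i j : ℕ) : ℤ :=
  if i = j then 2 else if i = 1 ∧ j = 2 then -1 else if i = 2 ∧ j = 1 then -3 else 0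

/-- A column of any matrix in the tables is concentrated within distance two of the diagonal, where
distance two occurs only at the fork of type `D`. The guards keep the truncated differences `j - 1`
and `j - 2` inside the range. -/
lemma sum_Icc_near (f : ℕ → ℤ) {n j : ℕ} (hj : 1 ≤ j) (hjn : j ≤ n)
    (h : ∀ i, 1 ≤ i → i ≤ n → i + 2 < j ∨ j + 2 < i → f i = 0) :
    ∑ i ∈ Finset.Icc 1 n, f i = (if 3 ≤ j then f (j - 2) else 0) + (if 2 ≤ j then f (j - 1) else 0) +
      f j + (if j + 1 ≤ n then f (j + 1) else 0) + (if j + 2 ≤ n then f (j + 2) else 0) := by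
  have h1 : ∑ i ∈ Finset.Icc 1 n, f i =
      ∑ i ∈ Finset.Icc (j - 2) (j + 2), if 1 ≤ i ∧ i ≤ n then f i else 0 := by
    rw [← Finset.sum_filter]
    symm
    refine Finset.sum_subset ?_ ?_
    · intro i; simp only [Finset.mem_filter, Finset.mem_Icc]; omega
    · intro i; simp only [Finset.mem_filter, Finset.mem_Icc]
      intro hi hi'
      exact h i (by omega) (by omega) (by omega)
  rw [h1]
  rcases j with _ | _ | _ | m
  · omega
  · rw [show (0 + 1 - 2 : ℕ) = 0 by rfl]
    simp [Finset.sum_Icc_succ_top, hjn]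
  · rw [show (0 + 1 + 1 - 2 : ℕ) = 0 by rfl]
    simp [Finset.sum_Icc_succ_top, hjn]
    intro; omega
  · rw [show (m + 1 + 1 + 1 - 2 : ℕ) = m + 1 by omega]
    have h2 : m + 1 ≤ n := by omega
    have h3 : m + 1 + 1 ≤ n := by omega
    have h4 : m + 1 + 1 + 1 ≤ n := by omega
    simp [Finset.sum_Icc_succ_top, h2, h3, h4]
    rfl

/-! ### Weak spherical roots by node numbers, and their pairings with simple coroots -/

section Roots

variable {κ : Type*} [Fintype κ] [DecidableEq κ] {A : κ → κ → ℤ} {W : κ → Prop} {σ : κ → ℤ}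

/-- The nodes `e 1, …, e n` form the support of `σ`; they carry the Cartan matrix `C`, the
labels `l`, and the white ones are those satisfying `w`. -/
structure WR (A : κ → κ → ℤ) (W : κ → Prop) (σ : κ → ℤ) (n : ℕ) (C : ℕ → ℕ → ℤ) (l : ℕ → ℤ)
    (w : ℕ → Prop) (e : ℕ → κ) : Prop where
  mat : ∀ i j, 1 ≤ i → i ≤ n → 1 ≤ j → j ≤ n → A (e i) (e j) = C i j
  val : ∀ i, 1 ≤ i → i ≤ n → σ (e i) = l i
  cov : ∀ k, σ k ≠ 0 → ∃ i, 1 ≤ i ∧ i ≤ n ∧ k = e i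
  wh : ∀ i, 1 ≤ i → i ≤ n → (W (e i) ↔ w i)
  inj : ∀ i j, 1 ≤ i → i ≤ n → 1 ≤ j → j ≤ n → e i = e j → i = j
  pos : ∀ i, 1 ≤ i → i ≤ n → 1 ≤ l i

/-- The labels of the root of type `C`. -/
def lC (n i : ℕ) : ℤ := if i = 1 ∨ i = n then 1 else 2

/-- The labels of the root of type `D`. -/
def lD (n i : ℕ) : ℤ := if i + 1 = n ∨ i = n then 1 else 2

/-- The labels of the root of type `F`. -/
def lF (i : ℕ) : ℤ := if i = 1 then 1 else if i = 3 then 3 else 2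

/-- The table of weak spherical roots, by node numbers. -/
inductive Rt (A : κ → κ → ℤ) (W : κ → Prop) (σ : κ → ℤ) : Prop
  | A (n : ℕ) (e : ℕ → κ) (hn : 1 ≤ n) (h : WR A W σ n cA (fun _ => 1) (fun i => i = 1 ∨ i = n) e)
  | B (n : ℕ) (e : ℕ → κ) (hn : 2 ≤ n) (h : WR A W σ n (cB n) (fun _ => 1) (fun i => i = 1) e)
  | B' (n : ℕ) (e : ℕ → κ) (hn : 2 ≤ n)
      (h : WR A W σ n (cB n) (fun _ => 1) (fun i => i = 1 ∨ i = n) e)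
  | C (n : ℕ) (e : ℕ → κ) (hn : 3 ≤ n) (h : WR A W σ n (cC n) (lC n) (fun i => i = 2) e)
  | C' (n : ℕ) (e : ℕ → κ) (hn : 3 ≤ n) (h : WR A W σ n (cC n) (lC n) (fun i => i = 1 ∨ i = 2) e)
  | F₄ (e : ℕ → κ) (h : WR A W σ 4 (cB 3) lF (fun i => i = 4) e)
  | G₂ (e : ℕ → κ) (h : WR A W σ 2 cG (fun i => 3 - i) (fun i => i = 1) e)
  | G₂' (e : ℕ → κ) (h : WR A W σ 2 cG (fun _ => 1) (fun i => i = 1 ∨ i = 2) e)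
  | D₂ (e : ℕ → κ) (h : WR A W σ 2 (cD 2) (fun _ => 1) (fun i => i = 1 ∨ i = 2) e)
  | D (n : ℕ) (e : ℕ → κ) (hn : 3 ≤ n) (h : WR A W σ n (cD n) (lD n) (fun i => i = 1) e)
  | B₃ (e : ℕ → κ) (h : WR A W σ 3 (cB 3) (fun i => i) (fun i => i = 3) e)

namespace WR

variable {n : ℕ} {C : ℕ → ℕ → ℤ} {l : ℕ → ℤ} {w : ℕ → Prop} {e : ℕ → κ}
  (h : WR A W σ n C l w e)
include h

lemma val_pos {i : ℕ} (h1 : 1 ≤ i) (h2 : i ≤ n) : 1 ≤ σ (e i) := by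
  rw [h.val i h1 h2]; exact h.pos i h1 h2

lemma val_ne {i : ℕ} (h1 : 1 ≤ i) (h2 : i ≤ n) : σ (e i) ≠ 0 := by
  have := h.val_pos h1 h2; omega

lemma nonneg (k : κ) : 0 ≤ σ k := by
  by_cases hk : σ k = 0
  · omega
  · obtain ⟨i, h1, h2, rfl⟩ := h.cov k hk
    have := h.val_pos h1 h2; omega

lemma ne {i j : ℕ} (h1 : 1 ≤ i) (h2 : i ≤ n) (h3 : 1 ≤ j) (h4 : j ≤ n) (hij : i ≠ j) :
    e i ≠ e j := fun he => hij (h.inj i j h1 h2 h3 h4 he)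

lemma pr_sum (k : κ) : pr A σ k = ∑ i ∈ Finset.Icc 1 n, l i * A (e i) k := by
  have h1 : pr A σ k = ∑ m ∈ (Finset.Icc 1 n).image e, σ m * A m k := by
    rw [pr]
    symm
    refine Finset.sum_subset (Finset.subset_univ _) ?_
    intro m _ hm
    have : σ m = 0 := by
      by_contra h0
      obtain ⟨i, h1, h2, rfl⟩ := h.cov m h0
      exact hm (Finset.mem_image_of_mem _ (Finset.mem_Icc.2 ⟨h1, h2⟩))
    simp [this]
  rw [h1, Finset.sum_image]
  · refine Finset.sum_congr rfl fun i hi => ?_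
    rw [Finset.mem_Icc] at hi
    rw [h.val i hi.1 hi.2]
  · intro i hi j hj hij
    simp only [Finset.coe_Icc, Set.mem_Icc] at hi hj
    exact h.inj i j hi.1 hi.2 hj.1 hj.2 hij

lemma pr_near (hC : ∀ i j, i + 2 < j ∨ j + 2 < i → C i j = 0) {j : ℕ} (hj : 1 ≤ j) (hjn : j ≤ n) :
    pr A σ (e j) = (if 3 ≤ j then l (j - 2) * C (j - 2) j else 0) +
      (if 2 ≤ j then l (j - 1) * C (j - 1) j else 0) + l j * C j j +
      (if j + 1 ≤ n then l (j + 1) * C (j + 1) j else 0) +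
      (if j + 2 ≤ n then l (j + 2) * C (j + 2) j else 0) := by
  have h1 : pr A σ (e j) = ∑ i ∈ Finset.Icc 1 n, l i * C i j := by
    rw [h.pr_sum]
    refine Finset.sum_congr rfl fun i hi => ?_
    rw [Finset.mem_Icc] at hi
    rw [h.mat i j hi.1 hi.2 hj hjn]
  rw [h1]
  exact sum_Icc_near (fun i => l i * C i j) hj hjn fun i _ _ hij => by simp [hC i j hij]

end WR

lemma cA_far (i j : ℕ) (h : i + 2 < j ∨ j + 2 < i) : cA i j = 0 := by unfold cA; split_ifs <;> omega
lemma cB_far (n i j : ℕ) (h : i + 2 < j ∨ j + 2 < i) : cB n i j = 0 := by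
  unfold cB; split_ifs <;> omega
lemma cC_far (n i j : ℕ) (h : i + 2 < j ∨ j + 2 < i) : cC n i j = 0 := by
  unfold cC; split_ifs <;> omega
lemma cD_far (n i j : ℕ) (h : i + 2 < j ∨ j + 2 < i) : cD n i j = 0 := by
  unfold cD; split_ifs <;> omega
lemma cG_far (i j : ℕ) (h : i + 2 < j ∨ j + 2 < i) : cG i j = 0 := by unfold cG; split_ifs <;> omega

variable {n : ℕ} {w : ℕ → Prop} {e : ℕ → κ} {j : ℕ}

/-- The indicators of the two ends are added, so that the value is 2 for `n = 1`. The five possible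
terms are evaluated one at a time, which keeps the case distinctions small; types `B`, `C` and `D`
are treated alike. -/
lemma pr_A (h : WR A W σ n cA (fun _ => 1) w e) (hj : 1 ≤ j) (hjn : j ≤ n) :
    pr A σ (e j) = (if j = 1 then 1 else 0) + (if j = n then 1 else 0) := by
  have h0 : (if 3 ≤ j then 1 * cA (j - 2) j else 0) =
      (0 : ℤ) := by
    unfold cA; split_ifs <;> omega
  have h1 : (if 2 ≤ j then 1 * cA (j - 1) j else 0) =
      (if 2 ≤ j then -1 else 0 : ℤ) := by
    unfold cA; split_ifs <;> omega
  have h2 : 1 * cA j j =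
      (2 : ℤ) := by
    unfold cA; split_ifs <;> omega
  have h3 : (if j + 1 ≤ n then 1 * cA (j + 1) j else 0) =
      (if j + 1 ≤ n then -1 else 0 : ℤ) := by
    unfold cA; split_ifs <;> omega
  have h4 : (if j + 2 ≤ n then 1 * cA (j + 2) j else 0) =
      (0 : ℤ) := by
    unfold cA; split_ifs <;> omega
  rw [h.pr_near cA_far hj hjn, h0, h1, h2, h3, h4]
  split_ifs <;> omega

lemma pr_B (hn : 2 ≤ n) (h : WR A W σ n (cB n) (fun _ => 1) w e) (hj : 1 ≤ j) (hjn : j ≤ n) :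
    pr A σ (e j) = if j = 1 then 1 else 0 := by
  have h0 : (if 3 ≤ j then 1 * cB n (j - 2) j else 0) =
      (0 : ℤ) := by
    unfold cB; split_ifs <;> omega
  have h1 : (if 2 ≤ j then 1 * cB n (j - 1) j else 0) =
      (if 2 ≤ j then (if j = n then -2 else -1) else 0 : ℤ) := by
    unfold cB; split_ifs <;> omega
  have h2 : 1 * cB n j j =
      (2 : ℤ) := by
    unfold cB; split_ifs <;> omega
  have h3 : (if j + 1 ≤ n then 1 * cB n (j + 1) j else 0) =
      (if j + 1 ≤ n then -1 else 0 : ℤ) := by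
    unfold cB; split_ifs <;> omega
  have h4 : (if j + 2 ≤ n then 1 * cB n (j + 2) j else 0) =
      (0 : ℤ) := by
    unfold cB; split_ifs <;> omega
  rw [h.pr_near (cB_far n) hj hjn, h0, h1, h2, h3, h4]
  split_ifs <;> omega

lemma pr_C (hn : 3 ≤ n) (h : WR A W σ n (cC n) (lC n) w e) (hj : 1 ≤ j) (hjn : j ≤ n) :
    pr A σ (e j) = if j = 2 then 1 else 0 := by
  have h0 : (if 3 ≤ j then lC n (j - 2) * cC n (j - 2) j else 0) =
      (0 : ℤ) := by
    unfold cC lC; split_ifs <;> omega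
  have h1 : (if 2 ≤ j then lC n (j - 1) * cC n (j - 1) j else 0) =
      (if 3 ≤ j then -2 else if j = 2 then -1 else 0 : ℤ) := by
    unfold cC lC; split_ifs <;> omega
  have h2 : lC n j * cC n j j =
      (if j = 1 ∨ j = n then 2 else 4 : ℤ) := by
    unfold cC lC; split_ifs <;> omega
  have h3 : (if j + 1 ≤ n then lC n (j + 1) * cC n (j + 1) j else 0) =
      (if j + 1 ≤ n then -2 else 0 : ℤ) := by
    unfold cC lC; split_ifs <;> omega
  have h4 : (if j + 2 ≤ n then lC n (j + 2) * cC n (j + 2) j else 0) =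
      (0 : ℤ) := by
    unfold cC lC; split_ifs <;> omega
  rw [h.pr_near (cC_far n) hj hjn, h0, h1, h2, h3, h4]
  split_ifs <;> omega

lemma pr_D (hn : 3 ≤ n) (h : WR A W σ n (cD n) (lD n) w e) (hj : 1 ≤ j) (hjn : j ≤ n) :
    pr A σ (e j) = if j = 1 then 2 else 0 := by
  have h0 : (if 3 ≤ j then lD n (j - 2) * cD n (j - 2) j else 0) =
      (if j = n then -2 else 0 : ℤ) := by
    unfold cD lD; split_ifs <;> omega
  have h1 : (if 2 ≤ j then lD n (j - 1) * cD n (j - 1) j else 0) =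
      (if 2 ≤ j then (if j = n then 0 else -2) else 0 : ℤ) := by
    unfold cD lD; split_ifs <;> omega
  have h2 : lD n j * cD n j j =
      (if j + 1 = n ∨ j = n then 2 else 4 : ℤ) := by
    unfold cD lD; split_ifs <;> omega
  have h3 : (if j + 1 ≤ n then lD n (j + 1) * cD n (j + 1) j else 0) =
      (if j + 1 = n ∨ j = n then 0 else if j + 2 = n then -1 else -2 : ℤ) := by
    unfold cD lD; split_ifs <;> omega
  have h4 : (if j + 2 ≤ n then lD n (j + 2) * cD n (j + 2) j else 0) =
      (if j + 2 = n then -1 else 0 : ℤ) := by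
    unfold cD lD; split_ifs <;> omega
  rw [h.pr_near (cD_far n) hj hjn, h0, h1, h2, h3, h4]
  split_ifs <;> omega

lemma pr_D₂ (h : WR A W σ 2 (cD 2) (fun _ => 1) w e) (hj : 1 ≤ j) (hjn : j ≤ 2) :
    pr A σ (e j) = 2 := by
  have h0 : (if 3 ≤ j then 1 * cD 2 (j - 2) j else 0) =
      (0 : ℤ) := by
    unfold cD; split_ifs <;> omega
  have h1 : (if 2 ≤ j then 1 * cD 2 (j - 1) j else 0) =
      (0 : ℤ) := by
    unfold cD; split_ifs <;> omega
  have h2 : 1 * cD 2 j j =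
      (2 : ℤ) := by
    unfold cD; split_ifs <;> omega
  have h3 : (if j + 1 ≤ 2 then 1 * cD 2 (j + 1) j else 0) =
      (0 : ℤ) := by
    unfold cD; split_ifs <;> omega
  have h4 : (if j + 2 ≤ 2 then 1 * cD 2 (j + 2) j else 0) =
      (0 : ℤ) := by
    unfold cD; split_ifs <;> omega
  rw [h.pr_near (cD_far 2) hj hjn, h0, h1, h2, h3, h4]
  norm_num

lemma pr_F₄ (h : WR A W σ 4 (cB 3) lF w e) (hj : 1 ≤ j) (hjn : j ≤ 4) :
    pr A σ (e j) = if j = 4 then 1 else 0 := by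
  rw [h.pr_near (cB_far 3) hj hjn]; interval_cases j <;> simp [cB, lF]

lemma pr_B₃ (h : WR A W σ 3 (cB 3) (fun i => i) w e) (hj : 1 ≤ j) (hjn : j ≤ 3) :
    pr A σ (e j) = if j = 3 then 2 else 0 := by
  rw [h.pr_near (cB_far 3) hj hjn]; interval_cases j <;> simp [cB]

lemma pr_G₂ (h : WR A W σ 2 cG (fun i => 3 - i) w e) (hj : 1 ≤ j) (hjn : j ≤ 2) :
    pr A σ (e j) = if j = 1 then 1 else 0 := by
  rw [h.pr_near cG_far hj hjn]; interval_cases j <;> simp [cG]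

lemma pr_G₂' (h : WR A W σ 2 cG (fun _ => 1) w e) (hj : 1 ≤ j) (hjn : j ≤ 2) :
    pr A σ (e j) = if j = 1 then -1 else 1 := by
  rw [h.pr_near cG_far hj hjn]; interval_cases j <;> simp [cG]

end Roots
end WeakSpherical

namespace WeakSpherical

section Systems

variable {κ : Type*} [Fintype κ] [DecidableEq κ] {A : κ → κ → ℤ} {W : κ → Prop} {σ τ : κ → ℤ}

/-! ### Weak spherical systems of rank two in terms of Cartan matrices -/

/-- Indecomposable weak spherical systems of rank two: `σ` and `τ` are given by their coefficients,
and `W` is the set of white nodes. -/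
structure Sys (A : κ → κ → ℤ) (W : κ → Prop) (σ τ : κ → ℤ) : Prop where
  ne : σ ≠ τ
  cover : ∀ k, σ k ≠ 0 ∨ τ k ≠ 0
  root₁ : Rt A W σ
  root₂ : Rt A W τ
  black : ∀ i, ¬ W i → pr A σ i = 0 ∧ pr A τ i = 0
  d2 : ∀ i j, A i j = 0 → (σ = Pi.single i 1 + Pi.single j 1 ∨ τ = Pi.single i 1 + Pi.single j 1) →
    pr A σ i = pr A σ j ∧ pr A τ i = pr A τ j
  sr : ∀ i j, (σ = Pi.single i 1 ∨ τ = Pi.single i 1) →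
    (σ = Pi.single i 1 + Pi.single j 1 ∨ τ = Pi.single i 1 + Pi.single j 1) → A j i ≠ -1
  conn : ∃ i j, σ i ≠ 0 ∧ τ j ≠ 0 ∧ A i j ≠ 0

/-- The diagram with coefficients `σ`, `τ` and white nodes `W` appears in the table. -/
def InTable (A : κ → κ → ℤ) (W : κ → Prop) (σ τ : κ → ℤ) : Prop :=
  ∃ (n : ℕ) (C : Matrix (Fin n) (Fin n) ℤ) (s t : ℕ → ℕ) (w : Set ℕ), RankTwoTable n C s t w ∧
    ∃ f : Fin n → κ, Function.Bijective f ∧ (∀ i j, A (f i) (f j) = C i j) ∧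
      (∀ i, W (f i) ↔ (i : ℕ) + 1 ∈ w) ∧
      ((∀ i, σ (f i) = s (i + 1) ∧ τ (f i) = t (i + 1)) ∨
        (∀ i, τ (f i) = s (i + 1) ∧ σ (f i) = t (i + 1)))

lemma InTable.swap (h : InTable A W τ σ) : InTable A W σ τ := by
  obtain ⟨n, C, s, t, w, hT, f, h1, h2, h3, h4⟩ := h
  exact ⟨n, C, s, t, w, hT, f, h1, h2, h3, h4.symm⟩

lemma Sys.swap (hA : FiniteType A) (h : Sys A W σ τ) : Sys A W τ σ := by
  obtain ⟨i, j, h1, h2, h3⟩ := h.conn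
  exact ⟨h.ne.symm, fun k => (h.cover k).symm, h.root₂, h.root₁, fun i hi => (h.black i hi).symm,
    fun i j h0 h1 => (h.d2 i j h0 h1.symm).symm, fun i j h0 h1 => h.sr i j h0.symm h1.symm,
    j, i, h2, h1, hA.ne_zero_symm h3⟩

/-- The numbering `f` identifies the diagram with the given one. -/
structure Fits (A : κ → κ → ℤ) (W : κ → Prop) (σ τ : κ → ℤ) (n : ℕ) (C : ℕ → ℕ → ℤ) (s t : ℕ → ℕ)
    (w : Set ℕ) (f : ℕ → κ) : Prop where
  mat : ∀ i j, 1 ≤ i → i ≤ n → 1 ≤ j → j ≤ n → A (f i) (f j) = C i j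
  val₁ : ∀ i, 1 ≤ i → i ≤ n → σ (f i) = s i
  val₂ : ∀ i, 1 ≤ i → i ≤ n → τ (f i) = t i
  wh : ∀ i, 1 ≤ i → i ≤ n → (W (f i) ↔ i ∈ w)
  surj : ∀ k, ∃ i, 1 ≤ i ∧ i ≤ n ∧ k = f i

/-- The disjoint union of Cartan matrices, indexed by node numbers. -/
def cSum (p : ℕ) (C C' : ℕ → ℕ → ℤ) (i j : ℕ) : ℤ :=
  if i ≤ p then (if j ≤ p then C i j else 0) else if j ≤ p then 0 else C' (i - p) (j - p)

lemma cartan_A (n : ℕ) (i j : Fin n) : CartanMatrix.A n i j = cA (i + 1) (j + 1) := by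
  simp only [CartanMatrix.A, Matrix.of_apply, cA, Fin.ext_iff]; split_ifs <;> omega

lemma cartan_B (n : ℕ) (i j : Fin n) : CartanMatrix.B n i j = cB n (i + 1) (j + 1) := by
  simp only [CartanMatrix.B, Matrix.of_apply, cB, Fin.ext_iff]; split_ifs <;> omega

lemma cartan_C (n : ℕ) (i j : Fin n) : CartanMatrix.C n i j = cC n (i + 1) (j + 1) := by
  simp only [CartanMatrix.C, Matrix.of_apply, cC, Fin.ext_iff]; split_ifs <;> omega

lemma cartan_D (n : ℕ) (hn : 2 ≤ n) (i j : Fin n) :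
    CartanMatrix.D n i j = cD n (i + 1) (j + 1) := by
  simp only [CartanMatrix.D, Matrix.of_apply, cD, Fin.ext_iff]; split_ifs <;> omega

/-- With a fourth node the matrix `cB 3` continues by a simple edge behind its double edge between
the nodes 2 and 3. Thus `F₄` needs no matrix of its own. -/
lemma cartan_F₄ (i j : Fin 4) : CartanMatrix.F₄ i j = cB 3 (i + 1) (j + 1) := by
  fin_cases i <;> fin_cases j <;> rfl

lemma cartan_G₂ (i j : Fin 2) : cartanG₂ i j = cG (i + 1) (j + 1) := by
  fin_cases i <;> fin_cases j <;> rfl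

lemma cartan_sum {m n : ℕ} {C : Matrix (Fin m) (Fin m) ℤ} {C' : Matrix (Fin n) (Fin n) ℤ}
    {D D' : ℕ → ℕ → ℤ} (h : ∀ i j, C i j = D (i + 1) (j + 1))
    (h' : ∀ i j, C' i j = D' (i + 1) (j + 1)) (i j : Fin (m + n)) :
    disjointSum C C' i j = cSum m D D' (i + 1) (j + 1) := by
  unfold disjointSum cSum
  refine Fin.addCases (fun i => ?_) (fun i => ?_) i <;>
    refine Fin.addCases (fun j => ?_) (fun j => ?_) j
  · have h1 : (i : ℕ) + 1 ≤ m := i.2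
    have h2 : (j : ℕ) + 1 ≤ m := j.2
    simp [h1, h2, h]
  · have h1 : (i : ℕ) + 1 ≤ m := i.2
    simp [h1, add_assoc]
  · have h2 : (j : ℕ) + 1 ≤ m := j.2
    simp [h2, add_assoc]
  · simp [h', add_assoc]

/-- This makes numberings injective: two nodes with the same image would give an off-diagonal entry
2. -/
lemma RankTwoTable.offdiag {n : ℕ} {C : Matrix (Fin n) (Fin n) ℤ} {s t : ℕ → ℕ} {w : Set ℕ}
    (h : RankTwoTable n C s t w) (i j : Fin n) (hij : i ≠ j) : C i j ≠ 2 := by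
  have hG : ∀ i j : Fin 2, i ≠ j → cartanG₂ i j ≤ 0 := by
    intro i j; fin_cases i <;> fin_cases j <;> simp [cartanG₂, CartanMatrix.G₂]
  have key : ∀ {m n : ℕ} {C : Matrix (Fin m) (Fin m) ℤ} {C' : Matrix (Fin n) (Fin n) ℤ},
      (∀ i j, i ≠ j → C i j ≤ 0) → (∀ i j, i ≠ j → C' i j ≤ 0) →
      ∀ i j, i ≠ j → disjointSum C C' i j ≤ 0 := by
    intro m n C C' h h' i j
    unfold disjointSum
    refine Fin.addCases (fun i => ?_) (fun i => ?_) i <;>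
      refine Fin.addCases (fun j => ?_) (fun j => ?_) j
    · intro hij; simpa using h i j (by simpa [Fin.ext_iff] using hij)
    · simp
    · simp
    · intro hij; simpa using h' i j (by simpa [Fin.ext_iff] using hij)
  suffices C i j ≤ 0 by omega
  cases h
  case AA => exact key (CartanMatrix.A_apply_le_zero_of_ne 2) (CartanMatrix.A_apply_le_zero_of_ne 2) i j hij
  case CA =>
    exact key (CartanMatrix.C_off_diag_nonpos _) (CartanMatrix.A_apply_le_zero_of_ne 1) i j hij
  case CC =>
    exact key (CartanMatrix.C_off_diag_nonpos _) (CartanMatrix.C_off_diag_nonpos _) i j hij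
  case GG => exact key hG hG i j hij
  all_goals first
    | exact CartanMatrix.A_apply_le_zero_of_ne _ i j hij
    | exact CartanMatrix.B_off_diag_nonpos _ i j hij
    | exact CartanMatrix.C_off_diag_nonpos _ i j hij
    | exact CartanMatrix.D_off_diag_nonpos _ i j hij
    | exact CartanMatrix.E₆_off_diag_nonpos i j hij
    | exact CartanMatrix.F₄_off_diag_nonpos i j hij
    | exact hG i j hij

lemma Fits.inTable (hA : FiniteType A) {n : ℕ} {C : Matrix (Fin n) (Fin n) ℤ} {s t : ℕ → ℕ}
    {w : Set ℕ} {D : ℕ → ℕ → ℤ} {f : ℕ → κ} (hF : Fits A W σ τ n D s t w f)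
    (hT : RankTwoTable n C s t w) (hC : ∀ i j, C i j = D (i + 1) (j + 1)) : InTable A W σ τ := by
  refine ⟨n, C, s, t, w, hT, fun i => f (i + 1), ⟨?_, ?_⟩, ?_, ?_, Or.inl ?_⟩
  · intro i j hij
    by_contra hne
    refine hT.offdiag i j hne ?_
    rw [hC, ← hF.mat _ _ (by omega) (by omega) (by omega) (by omega)]
    simp only at hij
    rw [hij, hA.diag]
  · intro k
    obtain ⟨i, h1, h2, rfl⟩ := hF.surj k
    exact ⟨⟨i - 1, by omega⟩, by simp [Nat.sub_add_cancel h1]⟩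
  · intro i j
    rw [hC, hF.mat _ _ (by omega) (by omega) (by omega) (by omega)]
  · intro i
    exact hF.wh _ (by omega) (by omega)
  · intro i
    exact ⟨hF.val₁ _ (by omega) (by omega), hF.val₂ _ (by omega) (by omega)⟩

/-- Numberings become total functions on `ℕ` by reduction modulo `n` after a shift by one; the
values outside `1, …, n` play no role. -/
lemma Fits.of_fin {n : ℕ} {C : Matrix (Fin n) (Fin n) ℤ} {s t : ℕ → ℕ}
    {w : Set ℕ} {D : ℕ → ℕ → ℤ} (g : Fin n → κ) (hn : 0 < n) (hg : Function.Bijective g)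
    (hm : ∀ i j, A (g i) (g j) = C i j) (hw : ∀ i, W (g i) ↔ (i : ℕ) + 1 ∈ w)
    (hv : ∀ i, σ (g i) = s (i + 1) ∧ τ (g i) = t (i + 1))
    (hC : ∀ i j, C i j = D (i + 1) (j + 1)) :
    ∃ f, Fits A W σ τ n D s t w f ∧
      ∀ i j, 1 ≤ i → i ≤ n → 1 ≤ j → j ≤ n → f i = f j → i = j := by
  have hi : ∀ i, 1 ≤ i → i ≤ n → (i - 1) % n + 1 = i := fun i h1 h2 => by
    rw [Nat.mod_eq_of_lt (by omega)]; omega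
  refine ⟨fun k => g ⟨(k - 1) % n, Nat.mod_lt _ hn⟩, ⟨?_, ?_, ?_, ?_, ?_⟩, ?_⟩
  · intro i j h1 h2 h3 h4
    simp only [hm, hC, hi i h1 h2, hi j h3 h4]
  · intro i h1 h2
    simp only [(hv _).1, hi i h1 h2]
  · intro i h1 h2
    simp only [(hv _).2, hi i h1 h2]
  · intro i h1 h2
    simp only [hw, hi i h1 h2]
  · intro k
    obtain ⟨i, rfl⟩ := hg.2 k
    exact ⟨i + 1, by omega, by omega, by simp [Nat.mod_eq_of_lt i.2]⟩
  · intro i j h1 h2 h3 h4 hij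
    have := congrArg Fin.val (hg.1 hij)
    simp only at this
    rw [← hi i h1 h2, ← hi j h3 h4, this]

end Systems
end WeakSpherical

namespace WeakSpherical

section Verification

variable {κ : Type*} [Fintype κ] [DecidableEq κ] {A : κ → κ → ℤ} {W : κ → Prop} {σ τ ρ : κ → ℤ}

/-! ### The entries of the table are indecomposable weak spherical systems -/

lemma FiniteType.pr_eq_zero {k : κ} (hk : ∀ j, ρ j ≠ 0 → A j k = 0) : pr A ρ k = 0 := by
  refine Finset.sum_eq_zero fun j _ => ?_
  by_cases hj : ρ j = 0
  · simp [hj]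
  · simp [hk j hj]

/-- Read off from the computed pairings. It makes axiom 2 automatic inside the support of a root, so
that for the entries of the table only black nodes outside of that support have to be checked. -/
lemma Rt.pr_black (h : Rt A W ρ) {k : κ} (hk : ρ k ≠ 0) (hW : ¬ W k) : pr A ρ k = 0 := by
  rcases h with ⟨n, e, hn, h⟩ | ⟨n, e, hn, h⟩ | ⟨n, e, hn, h⟩ | ⟨n, e, hn, h⟩ | ⟨n, e, hn, h⟩ |
    ⟨e, h⟩ | ⟨e, h⟩ | ⟨e, h⟩ | ⟨e, h⟩ | ⟨n, e, hn, h⟩ | ⟨e, h⟩ <;>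
    obtain ⟨i, h1, h2, rfl⟩ := h.cov k hk <;> rw [h.wh i h1 h2] at hW
  · rw [pr_A h h1 h2]; split_ifs <;> omega
  · rw [pr_B hn h h1 h2, if_neg hW]
  · rw [pr_B hn h h1 h2]; split_ifs <;> omega
  · rw [pr_C hn h h1 h2, if_neg hW]
  · rw [pr_C hn h h1 h2]; split_ifs <;> omega
  · rw [pr_F₄ h h1 h2, if_neg hW]
  · rw [pr_G₂ h h1 h2, if_neg hW]
  · omega
  · omega
  · rw [pr_D hn h h1 h2, if_neg hW]
  · rw [pr_B₃ h h1 h2, if_neg hW]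

/-- The condition on roots that are sums of two orthogonal simple roots, for a single root `ρ`. -/
def SumCond (A : κ → κ → ℤ) (σ τ ρ : κ → ℤ) : Prop :=
  ∀ i j, A i j = 0 → ρ = Pi.single i 1 + Pi.single j 1 → pr A σ i = pr A σ j ∧ pr A τ i = pr A τ j

/-- A sum of two orthogonal simple roots has exactly two nodes, and they are not joined; for all
other shapes axiom 3 is vacuous. -/
lemma WR.sumCond (hA : FiniteType A) {n : ℕ} {C : ℕ → ℕ → ℤ} {l : ℕ → ℤ} {w : ℕ → Prop}
    {e : ℕ → κ} (h : WR A W ρ n C l w e) (hn : n = 1 ∨ 3 ≤ n ∨ C 1 2 ≠ 0) : SumCond A σ τ ρ := by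
  intro i j hij hρ
  exfalso
  have hne : i ≠ j := by rintro rfl; rw [hA.diag] at hij; omega
  have hs : ∀ k, ρ k ≠ 0 → k = i ∨ k = j := by
    intro k hk
    by_contra hc
    push Not at hc
    exact hk (by simp [hρ, hc.1, hc.2])
  have hi : ρ i ≠ 0 := by simp [hρ, hne]
  have hj : ρ j ≠ 0 := by simp [hρ, hne.symm]
  obtain ⟨p, hp1, hp2, rfl⟩ := h.cov i hi
  obtain ⟨q, hq1, hq2, rfl⟩ := h.cov j hj
  have key : ∀ k, 1 ≤ k → k ≤ n → k = p ∨ k = q := by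
    intro k h1 h2
    rcases hs _ (h.val_ne h1 h2) with h3 | h3
    · exact Or.inl (h.inj _ _ h1 h2 hp1 hp2 h3)
    · exact Or.inr (h.inj _ _ h1 h2 hq1 hq2 h3)
  have hpq : p ≠ q := by rintro rfl; exact hne rfl
  rcases hn with hn | hn | hn
  · omega
  · have := key 1 (by omega) (by omega)
    have := key 2 (by omega) (by omega)
    have := key 3 (by omega) (by omega)
    omega
  · by_cases h3 : 3 ≤ n
    · have := key 1 (by omega) (by omega)
      have := key 2 (by omega) (by omega)
      have := key 3 (by omega) (by omega)
      omega
    have h5 : (p = 1 ∧ q = 2) ∨ (p = 2 ∧ q = 1) := by omega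
    rcases h5 with ⟨rfl, rfl⟩ | ⟨rfl, rfl⟩
    · rw [h.mat 1 2 (by omega) (by omega) (by omega) (by omega)] at hij
      exact hn hij
    · have := hA.symm _ _ hij
      rw [h.mat 1 2 (by omega) (by omega) (by omega) (by omega)] at this
      exact hn this

lemma WR.sumCond_two {C : ℕ → ℕ → ℤ} {l : ℕ → ℤ} {w : ℕ → Prop} {e : ℕ → κ}
    (h : WR A W ρ 2 C l w e)
    (hσ : pr A σ (e 1) = pr A σ (e 2)) (hτ : pr A τ (e 1) = pr A τ (e 2)) : SumCond A σ τ ρ := by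
  intro i j hij hρ
  have hs : ∀ k, ρ k ≠ 0 → k = e 1 ∨ k = e 2 := by
    intro k hk
    obtain ⟨p, hp1, hp2, rfl⟩ := h.cov k hk
    interval_cases p <;> simp
  have hne : i ≠ j := by
    rintro rfl
    have h1 := h.val_ne (i := 1) (by omega) (by omega)
    have h2 := h.val_ne (i := 2) (by omega) (by omega)
    have h3 : e 1 = i := by by_contra hc; exact h1 (by simp [hρ, hc])
    have h4 : e 2 = i := by by_contra hc; exact h2 (by simp [hρ, hc])
    exact h.ne (i := 1) (j := 2) (by omega) (by omega) (by omega) (by omega) (by omega)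
      (h3.trans h4.symm)
  have hi : ρ i ≠ 0 := by simp [hρ, hne]
  have hj : ρ j ≠ 0 := by simp [hρ, hne.symm]
  rcases hs i hi with rfl | rfl <;> rcases hs j hj with rfl | rfl
  · exact absurd rfl hne
  · exact ⟨hσ, hτ⟩
  · exact ⟨hσ.symm, hτ.symm⟩
  · exact absurd rfl hne

namespace Fits

variable {n : ℕ} {C : ℕ → ℕ → ℤ} {s t : ℕ → ℕ} {w : Set ℕ} {f : ℕ → κ}
  (hF : Fits A W σ τ n C s t w f)
include hF

lemma pr₁ (k : ℕ) (hk : 1 ≤ k) (hk' : k ≤ n)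
    (hinj : ∀ i j, 1 ≤ i → i ≤ n → 1 ≤ j → j ≤ n → f i = f j → i = j) :
    pr A σ (f k) = ∑ i ∈ Finset.Icc 1 n, s i * C i k := by
  symm
  refine Finset.sum_bij_ne_zero (fun i _ _ => f i) (fun _ _ _ => Finset.mem_univ _) ?_ ?_ ?_
  · intro i hi _ j hj _ h
    rw [Finset.mem_Icc] at hi hj
    exact hinj i j hi.1 hi.2 hj.1 hj.2 h
  · intro m _ hm
    obtain ⟨i, h1, h2, rfl⟩ := hF.surj m
    rw [hF.val₁ i h1 h2, hF.mat i k h1 h2 hk hk'] at hm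
    exact ⟨i, Finset.mem_Icc.2 ⟨h1, h2⟩, hm, rfl⟩
  · intro i hi _
    rw [Finset.mem_Icc] at hi
    rw [hF.val₁ i hi.1 hi.2, hF.mat i k hi.1 hi.2 hk hk']

lemma swap : Fits A W τ σ n C t s w f := ⟨hF.mat, hF.val₂, hF.val₁, hF.wh, hF.surj⟩

end Fits

/-- The table of weak spherical roots: number of nodes, Cartan matrix, labels and white nodes. -/
inductive RtEntry : ℕ → (ℕ → ℕ → ℤ) → (ℕ → ℤ) → (ℕ → Prop) → Prop
  | A (n : ℕ) (hn : 1 ≤ n) : RtEntry n cA (fun _ => 1) (fun i => i = 1 ∨ i = n)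
  | B (n : ℕ) (hn : 2 ≤ n) : RtEntry n (cB n) (fun _ => 1) (fun i => i = 1)
  | B' (n : ℕ) (hn : 2 ≤ n) : RtEntry n (cB n) (fun _ => 1) (fun i => i = 1 ∨ i = n)
  | C (n : ℕ) (hn : 3 ≤ n) : RtEntry n (cC n) (lC n) (fun i => i = 2)
  | C' (n : ℕ) (hn : 3 ≤ n) : RtEntry n (cC n) (lC n) (fun i => i = 1 ∨ i = 2)
  | F₄ : RtEntry 4 (cB 3) lF (fun i => i = 4)
  | G₂ : RtEntry 2 cG (fun i => 3 - i) (fun i => i = 1)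
  | G₂' : RtEntry 2 cG (fun _ => 1) (fun i => i = 1 ∨ i = 2)
  | D₂ : RtEntry 2 (cD 2) (fun _ => 1) (fun i => i = 1 ∨ i = 2)
  | D (n : ℕ) (hn : 3 ≤ n) : RtEntry n (cD n) (lD n) (fun i => i = 1)
  | B₃ : RtEntry 3 (cB 3) (fun i => i) (fun i => i = 3)

lemma RtEntry.rt {m : ℕ} {D : ℕ → ℕ → ℤ} {l : ℕ → ℤ} {v : ℕ → Prop} (h : RtEntry m D l v)
    {e : ℕ → κ} (hw : WR A W ρ m D l v e) : Rt A W ρ := by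
  cases h
  case A hn => exact .A _ _ hn hw
  case B hn => exact .B _ _ hn hw
  case B' hn => exact .B' _ _ hn hw
  case C hn => exact .C _ _ hn hw
  case C' hn => exact .C' _ _ hn hw
  case F₄ => exact .F₄ _ hw
  case G₂ => exact .G₂ _ hw
  case G₂' => exact .G₂' _ hw
  case D₂ => exact .D₂ _ hw
  case D hn => exact .D _ _ hn hw
  case B₃ => exact .B₃ _ hw

/-- In the diagram `D` with `n` nodes, white ones `w`, the coefficients `s` are a weak spherical
root of the type given by `m`, `D'`, `l` and `v`; the map `φ` embeds the smaller diagram. -/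
structure Sub (n : ℕ) (D : ℕ → ℕ → ℤ) (s : ℕ → ℕ) (w : Set ℕ) (m : ℕ) (D' : ℕ → ℕ → ℤ) (l : ℕ → ℤ)
    (v : ℕ → Prop) (φ ψ : ℕ → ℕ) : Prop where
  entry : RtEntry m D' l v
  node : ∀ i, 1 ≤ i → i ≤ m →
    1 ≤ φ i ∧ φ i ≤ n ∧ (s (φ i) : ℤ) = l i ∧ 1 ≤ l i ∧ (φ i ∈ w ↔ v i)
  mat : ∀ i j, 1 ≤ i → i ≤ m → 1 ≤ j → j ≤ m → D (φ i) (φ j) = D' i j ∧ (φ i = φ j → i = j)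
  cov : ∀ k, 1 ≤ k → k ≤ n → s k ≠ 0 → 1 ≤ ψ k ∧ ψ k ≤ m ∧ k = φ (ψ k)

/-- The condition on sums of two orthogonal simple roots for a root with `m` nodes `φ 1, …, φ m`,
in terms of node numbers. -/
def SumData (n : ℕ) (D : ℕ → ℕ → ℤ) (s t : ℕ → ℕ) (m : ℕ) (D' : ℕ → ℕ → ℤ) (φ : ℕ → ℕ) : Prop :=
  (m = 1 ∨ 3 ≤ m ∨ D' 1 2 ≠ 0) ∨ (m = 2 ∧
    ∑ i ∈ Finset.Icc 1 n, s i * D i (φ 1) = ∑ i ∈ Finset.Icc 1 n, s i * D i (φ 2) ∧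
    ∑ i ∈ Finset.Icc 1 n, t i * D i (φ 1) = ∑ i ∈ Finset.Icc 1 n, t i * D i (φ 2))

/-- The node `i` violates the condition on simple roots at `j`. -/
def BadSimple (n : ℕ) (s t : ℕ → ℕ) (i j : ℕ) : Prop :=
  s i ≠ 0 ∧ t i ≠ 0 ∧ t j ≠ 0 ∧ ∀ k, 1 ≤ k → k ≤ n → (k ≠ i → s k = 0) ∧ (k ≠ i → k ≠ j → t k = 0)

/-- The conditions on the pair of roots `s`, `t` in an indecomposable weak spherical system. -/
structure Compat (n : ℕ) (D : ℕ → ℕ → ℤ) (s t : ℕ → ℕ) (w : Set ℕ) : Prop where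
  ne : ∃ i, 1 ≤ i ∧ i ≤ n ∧ s i ≠ t i
  cov : ∀ i, 1 ≤ i → i ≤ n → s i ≠ 0 ∨ t i ≠ 0
  black : ∀ i j, 1 ≤ i → i ≤ n → 1 ≤ j → j ≤ n → i ∉ w →
    (s i = 0 → s j ≠ 0 → D j i = 0) ∧ (t i = 0 → t j ≠ 0 → D j i = 0)
  conn : ∃ i j, 1 ≤ i ∧ i ≤ n ∧ 1 ≤ j ∧ j ≤ n ∧ s i ≠ 0 ∧ t j ≠ 0 ∧ D i j ≠ 0


lemma Sub.wr {n : ℕ} {D : ℕ → ℕ → ℤ} {s t : ℕ → ℕ} {w : Set ℕ} {f : ℕ → κ} {m : ℕ}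
    {D' : ℕ → ℕ → ℤ} {l : ℕ → ℤ} {v : ℕ → Prop} {φ ψ : ℕ → ℕ} (h : Sub n D s w m D' l v φ ψ)
    (hF : Fits A W σ τ n D s t w f)
    (hinj : ∀ i j, 1 ≤ i → i ≤ n → 1 ≤ j → j ≤ n → f i = f j → i = j) :
    WR A W σ m D' l v (fun i => f (φ i)) where
  mat i j hi hi' hj hj' := by
    rw [hF.mat _ _ (h.node i hi hi').1 (h.node i hi hi').2.1 (h.node j hj hj').1
      (h.node j hj hj').2.1]
    exact (h.mat i j hi hi' hj hj').1
  val i hi hi' := by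
    rw [hF.val₁ _ (h.node i hi hi').1 (h.node i hi hi').2.1]
    exact (h.node i hi hi').2.2.1
  cov k hk := by
    obtain ⟨i, hi, hi', rfl⟩ := hF.surj k
    rw [hF.val₁ i hi hi'] at hk
    obtain ⟨hj, hj', h⟩ := h.cov i hi hi' (by exact_mod_cast hk)
    exact ⟨ψ i, hj, hj', congrArg f h⟩
  wh i hi hi' := by
    rw [hF.wh _ (h.node i hi hi').1 (h.node i hi hi').2.1]
    exact (h.node i hi hi').2.2.2.2
  inj i j hi hi' hj hj' hij :=
    (h.mat i j hi hi' hj hj').2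
      (hinj _ _ (h.node i hi hi').1 (h.node i hi hi').2.1 (h.node j hj hj').1
        (h.node j hj hj').2.1 hij)
  pos i hi hi' := (h.node i hi hi').2.2.2.1

lemma Sub.sumCond (hA : FiniteType A) {n : ℕ} {D : ℕ → ℕ → ℤ} {s t : ℕ → ℕ} {w : Set ℕ} {f : ℕ → κ}
    {m : ℕ} {D' : ℕ → ℕ → ℤ} {l : ℕ → ℤ} {v : ℕ → Prop} {φ ψ : ℕ → ℕ}
    (h : Sub n D s w m D' l v φ ψ) (hF : Fits A W σ τ n D s t w f)
    (hinj : ∀ i j, 1 ≤ i → i ≤ n → 1 ≤ j → j ≤ n → f i = f j → i = j)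
    (hs : SumData n D s t m D' φ) : SumCond A σ τ σ := by
  rcases hs with hs | ⟨rfl, h1, h2⟩
  · exact (h.wr hF hinj).sumCond hA hs
  · have h3 := h.node 1 (by omega) (by omega)
    have h4 := h.node 2 (by omega) (by omega)
    refine (h.wr hF hinj).sumCond_two ?_ ?_
    · rw [hF.pr₁ _ h3.1 h3.2.1 hinj, hF.pr₁ _ h4.1 h4.2.1 hinj, h1]
    · rw [hF.swap.pr₁ _ h3.1 h3.2.1 hinj, hF.swap.pr₁ _ h4.1 h4.2.1 hinj, h2]

lemma Fits.not_badSimple (hA : FiniteType A) {n : ℕ} {D : ℕ → ℕ → ℤ} {s t : ℕ → ℕ} {w : Set ℕ}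
    {f : ℕ → κ} (hF : Fits A W σ τ n D s t w f)
    (hinj : ∀ i j, 1 ≤ i → i ≤ n → 1 ≤ j → j ≤ n → f i = f j → i = j)
    (hs : ∀ i j, 1 ≤ i → i ≤ n → 1 ≤ j → j ≤ n → D j i = -1 → ¬ BadSimple n s t i j) {a b : κ}
    (ha : σ = Pi.single a 1) (hb : τ = Pi.single a 1 + Pi.single b 1) : A b a ≠ -1 := by
  intro hab
  have hne : a ≠ b := by rintro rfl; rw [hA.diag] at hab; omega
  obtain ⟨i, h1, h2, rfl⟩ := hF.surj a
  obtain ⟨j, h3, h4, rfl⟩ := hF.surj b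
  rw [hF.mat _ _ h3 h4 h1 h2] at hab
  refine hs i j h1 h2 h3 h4 hab ⟨fun h0 => ?_, fun h0 => ?_, fun h0 => ?_, fun k h5 h6 => ⟨fun h7 => ?_,
    fun h7 h8 => ?_⟩⟩
  · have := hF.val₁ i h1 h2
    simp [ha, h0] at this
  · have := hF.val₂ i h1 h2
    simp [hb, h0, hne] at this
  · have := hF.val₂ j h3 h4
    simp [hb, h0, hne.symm] at this
  · have := hF.val₁ k h5 h6
    rw [ha, Pi.single_eq_of_ne fun h => h7 (hinj k i h5 h6 h1 h2 h)] at this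
    exact_mod_cast this.symm
  · have := hF.val₂ k h5 h6
    rw [hb, Pi.add_apply, Pi.single_eq_of_ne fun h => h7 (hinj k i h5 h6 h1 h2 h),
      Pi.single_eq_of_ne fun h => h8 (hinj k j h5 h6 h3 h4 h)] at this
    exact_mod_cast this.symm

/-- Since each root is a weak spherical root, only conditions relating the two roots remain. A
violation of axiom 4 needs one simple root and one sum of two simple roots. The hypothesis `hs`
lists three ways to exclude this: neither root is simple, the second one has at least three nodes,
or no common node `i` has a `j` with `D j i = -1`. -/
lemma Fits.sys (hA : FiniteType A) {n : ℕ} {D : ℕ → ℕ → ℤ} {s t : ℕ → ℕ} {w : Set ℕ} {f : ℕ → κ}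
    (hF : Fits A W σ τ n D s t w f)
    (hinj : ∀ i j, 1 ≤ i → i ≤ n → 1 ≤ j → j ≤ n → f i = f j → i = j) {m m' : ℕ}
    {D₁ D₂ : ℕ → ℕ → ℤ} {l₁ l₂ : ℕ → ℤ} {v₁ v₂ : ℕ → Prop} {φ₁ ψ₁ φ₂ ψ₂ : ℕ → ℕ}
    (h₁ : Sub n D s w m D₁ l₁ v₁ φ₁ ψ₁) (h₂ : Sub n D t w m' D₂ l₂ v₂ φ₂ ψ₂)
    (d₁ : SumData n D s t m D₁ φ₁) (d₂ : SumData n D t s m' D₂ φ₂) (hc : Compat n D s t w)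
    (hs : (2 ≤ m ∧ 2 ≤ m') ∨ 3 ≤ m' ∨
      ∀ i j, 1 ≤ i → i ≤ n → 1 ≤ j → j ≤ n → D j i = -1 → s i = 0 ∨ t i = 0) :
    Sys A W σ τ := by
  have hs' : ∀ i j, 1 ≤ i → i ≤ n → 1 ≤ j → j ≤ n → D j i = -1 →
      ¬ BadSimple n s t i j ∧ ¬ BadSimple n t s i j := by
    have key : ∀ {s t : ℕ → ℕ} {m D' l v φ ψ}, 2 ≤ m → Sub n D s w m D' l v φ ψ →
        ∀ i j, ¬ BadSimple n s t i j := by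
      intro s t m D' l v φ ψ hm h i j hb
      have h1 := h.node 1 (by omega) (by omega)
      have h2 := h.node 2 (by omega) (by omega)
      have h3 := (h.mat 1 2 (by omega) (by omega) (by omega) (by omega)).2
      have h5 := (hb.2.2.2 _ h1.1 h1.2.1).1
      have h6 := (hb.2.2.2 _ h2.1 h2.2.1).1
      omega
    rcases hs with ⟨h3, h4⟩ | h3 | hs
    · exact fun i j _ _ _ _ _ => ⟨key h3 h₁ i j, key h4 h₂ i j⟩
    · refine fun i j _ _ _ _ _ => ⟨fun hb => ?_, key (by omega) h₂ i j⟩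
      have h4 := h₂.node 1 (by omega) (by omega)
      have h5 := h₂.node 2 (by omega) (by omega)
      have h6 := h₂.node 3 (by omega) (by omega)
      have h7 := (h₂.mat 1 2 (by omega) (by omega) (by omega) (by omega)).2
      have h8 := (h₂.mat 1 3 (by omega) (by omega) (by omega) (by omega)).2
      have h9 := (h₂.mat 2 3 (by omega) (by omega) (by omega) (by omega)).2
      have := (hb.2.2.2 _ h4.1 h4.2.1).2
      have := (hb.2.2.2 _ h5.1 h5.2.1).2
      have := (hb.2.2.2 _ h6.1 h6.2.1).2
      omega
    · intro i j h1 h2 h3 h4 h5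
      exact ⟨fun hb => (hs i j h1 h2 h3 h4 h5).elim hb.1 hb.2.1,
        fun hb => (hs i j h1 h2 h3 h4 h5).elim hb.2.1 hb.1⟩
  have r₁ := h₁.entry.rt (h₁.wr hF hinj)
  have r₂ := h₂.entry.rt (h₂.wr hF.swap hinj)
  refine ⟨?_, fun k => ?_, r₁, r₂, fun k hk => ?_, fun i j hij h => ?_, fun a b h h' => ?_, ?_⟩
  · rintro rfl
    obtain ⟨i, h1, h2, h3⟩ := hc.ne
    have := hF.val₁ i h1 h2
    rw [hF.val₂ i h1 h2] at this
    exact h3 (by exact_mod_cast this.symm)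
  · obtain ⟨i, h1, h2, rfl⟩ := hF.surj k
    rw [hF.val₁ i h1 h2, hF.val₂ i h1 h2]
    exact_mod_cast hc.cov i h1 h2
  · obtain ⟨i, h1, h2, rfl⟩ := hF.surj k
    have hi : i ∉ w := by rwa [hF.wh i h1 h2] at hk
    constructor
    · by_cases h0 : σ (f i) = 0
      · refine FiniteType.pr_eq_zero fun m hm => ?_
        obtain ⟨j, h3, h4, rfl⟩ := hF.surj m
        rw [hF.val₁ i h1 h2] at h0
        rw [hF.val₁ j h3 h4] at hm
        rw [hF.mat _ _ h3 h4 h1 h2]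
        exact (hc.black i j h1 h2 h3 h4 hi).1 (by exact_mod_cast h0) (by exact_mod_cast hm)
      · exact r₁.pr_black h0 hk
    · by_cases h0 : τ (f i) = 0
      · refine FiniteType.pr_eq_zero fun m hm => ?_
        obtain ⟨j, h3, h4, rfl⟩ := hF.surj m
        rw [hF.val₂ i h1 h2] at h0
        rw [hF.val₂ j h3 h4] at hm
        rw [hF.mat _ _ h3 h4 h1 h2]
        exact (hc.black i j h1 h2 h3 h4 hi).2 (by exact_mod_cast h0) (by exact_mod_cast hm)
      · exact r₂.pr_black h0 hk
  · rcases h with h | h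
    · exact h₁.sumCond hA hF hinj d₁ i j hij h
    · exact (h₂.sumCond hA hF.swap hinj d₂ i j hij h).symm
  · have hdist : ∀ ρ : κ → ℤ, ρ = Pi.single a 1 → ρ ≠ Pi.single a 1 + Pi.single b 1 := by
      rintro ρ rfl h5
      simpa using congrFun h5 b
    rcases h with h | h <;> rcases h' with h' | h'
    · exact absurd h' (hdist _ h)
    · exact hF.not_badSimple hA hinj (fun i j h1 h2 h3 h4 h5 => (hs' i j h1 h2 h3 h4 h5).1) h h'
    · exact hF.swap.not_badSimple hA hinj (fun i j h1 h2 h3 h4 h5 => (hs' i j h1 h2 h3 h4 h5).2) h h'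
    · exact absurd h' (hdist _ h)
  · obtain ⟨i, j, h1, h2, h3, h4, h5, h6, h7⟩ := hc.conn
    refine ⟨f i, f j, ?_, ?_, ?_⟩
    · rw [hF.val₁ i h1 h2]; exact_mod_cast h5
    · rw [hF.val₂ j h3 h4]; exact_mod_cast h6
    · rwa [hF.mat _ _ h1 h2 h3 h4]

end Verification
end WeakSpherical

/-! ### The entries of the rank two table as numerical data -/

namespace WeakSpherical

/-- The Cartan matrix of type `E₆`, indexed by node numbers. -/
def cE (i j : ℕ) : ℤ :=
  if i = j then 2
  else if (i + 1 = j ∧ 3 ≤ i) ∨ (j + 1 = i ∧ 3 ≤ j) ∨ (i + 2 = j ∧ i ≤ 2) ∨ (j + 2 = i ∧ j ≤ 2) then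
    -1
  else 0

lemma cartan_E₆ (i j : Fin 6) : CartanMatrix.E₆ i j = cE (i + 1) (j + 1) := by
  fin_cases i <;> fin_cases j <;> rfl

/-- The entries of a list, numbered from `1` on. -/
def ofList (L : List ℕ) (i : ℕ) : ℕ := L.getD (i - 1) 0

/-- The position of a number in a list, counted from `1` on. -/
def posIn (L : List ℕ) (k : ℕ) : ℕ := L.idxOf k + 1

/-- For a root of type `D₂` in an infinite family the pairings of axiom 3 are sums over `1, …, n`
with `n` variable, but each has at most two non-zero terms. -/
lemma sum_Icc_pair {n a b c d : ℕ} {f g : ℕ → ℤ} (hab : 1 ≤ a ∧ a < b ∧ b ≤ n)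
    (hcd : 1 ≤ c ∧ c < d ∧ d ≤ n) (hf : ∀ i, 1 ≤ i → i ≤ n → i ≠ a → i ≠ b → f i = 0)
    (hg : ∀ i, 1 ≤ i → i ≤ n → i ≠ c → i ≠ d → g i = 0) (h : f a + f b = g c + g d) :
    ∑ i ∈ Finset.Icc 1 n, f i = ∑ i ∈ Finset.Icc 1 n, g i := by
  have key : ∀ {a b : ℕ} {f : ℕ → ℤ}, 1 ≤ a ∧ a < b ∧ b ≤ n →
      (∀ i, 1 ≤ i → i ≤ n → i ≠ a → i ≠ b → f i = 0) → ∑ i ∈ Finset.Icc 1 n, f i = f a + f b := by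
    intro a b f h hf
    refine Finset.sum_eq_add a b h.2.1.ne (fun i hi h => ?_) (fun h' => ?_) (fun h' => ?_)
    · rw [Finset.mem_Icc] at hi
      exact hf i hi.1 hi.2 h.1 h.2
    · exact absurd (Finset.mem_Icc.2 ⟨by omega, by omega⟩) h'
    · exact absurd (Finset.mem_Icc.2 ⟨by omega, by omega⟩) h'
  rw [key hab hf, key hcd hg, h]

/-- Numerical data for an entry of the table: the Cartan matrix `D` by node numbers, and the
embeddings `φ₁`, `φ₂` of the diagrams of the two roots, with inverses `ψ₁`, `ψ₂`. -/
structure Glue {n : ℕ} {C : Matrix (Fin n) (Fin n) ℤ} {s t : ℕ → ℕ} {w : Set ℕ}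
    (hT : RankTwoTable n C s t w) (D : ℕ → ℕ → ℤ) {m m' : ℕ} {D₁ D₂ : ℕ → ℕ → ℤ} {l₁ l₂ : ℕ → ℤ}
    {v₁ v₂ : ℕ → Prop} (h₁ : RtEntry m D₁ l₁ v₁) (φ₁ ψ₁ : ℕ → ℕ) (h₂ : RtEntry m' D₂ l₂ v₂)
    (φ₂ ψ₂ : ℕ → ℕ) : Prop where
  cartan : ∀ i j, C i j = D (i + 1) (j + 1)
  sum₁ : SumData n D s t m D₁ φ₁
  sum₂ : SumData n D t s m' D₂ φ₂
  conn : ∃ c d, (1 ≤ c ∧ c ≤ n ∧ 1 ≤ d ∧ d ≤ n ∧ s c ≠ 0 ∧ t d ≠ 0 ∧ D c d ≠ 0) ∧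
    (s 1 ≠ t 1 ∨ s n ≠ t n)
  node₁ : ∀ i, 1 ≤ i → i ≤ m →
    1 ≤ φ₁ i ∧ φ₁ i ≤ n ∧ (s (φ₁ i) : ℤ) = l₁ i ∧ 1 ≤ l₁ i ∧ (φ₁ i ∈ w ↔ v₁ i)
  node₂ : ∀ i, 1 ≤ i → i ≤ m' →
    1 ≤ φ₂ i ∧ φ₂ i ≤ n ∧ (t (φ₂ i) : ℤ) = l₂ i ∧ 1 ≤ l₂ i ∧ (φ₂ i ∈ w ↔ v₂ i)
  mat₁ : ∀ i j, 1 ≤ i → i ≤ m → 1 ≤ j → j ≤ m → D (φ₁ i) (φ₁ j) = D₁ i j ∧ (φ₁ i = φ₁ j → i = j)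
  mat₂ : ∀ i j, 1 ≤ i → i ≤ m' → 1 ≤ j → j ≤ m' → D (φ₂ i) (φ₂ j) = D₂ i j ∧ (φ₂ i = φ₂ j → i = j)
  cov : ∀ i, 1 ≤ i → i ≤ n → (s i ≠ 0 → 1 ≤ ψ₁ i ∧ ψ₁ i ≤ m ∧ i = φ₁ (ψ₁ i)) ∧
    (t i ≠ 0 → 1 ≤ ψ₂ i ∧ ψ₂ i ≤ m' ∧ i = φ₂ (ψ₂ i)) ∧ (s i ≠ 0 ∨ t i ≠ 0)
  black : ∀ i j, 1 ≤ i → i ≤ n → 1 ≤ j → j ≤ n → i ∉ w →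
    (s i = 0 → s j ≠ 0 → D j i = 0) ∧ (t i = 0 → t j ≠ 0 → D j i = 0)
  sr : (2 ≤ m ∧ 2 ≤ m') ∨ 3 ≤ m' ∨
    ∀ i j, 1 ≤ i → i ≤ n → 1 ≤ j → j ≤ n → D j i = -1 → s i = 0 ∨ t i = 0

lemma Glue.sys {κ : Type*} [Fintype κ] [DecidableEq κ] {A : κ → κ → ℤ} {W : κ → Prop}
    {σ τ : κ → ℤ} (hA : FiniteType A) {n : ℕ} {C : Matrix (Fin n) (Fin n) ℤ} {s t : ℕ → ℕ} {w : Set ℕ}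
    {hT : RankTwoTable n C s t w} {D : ℕ → ℕ → ℤ} {m m' : ℕ} {D₁ D₂ : ℕ → ℕ → ℤ} {l₁ l₂ : ℕ → ℤ}
    {v₁ v₂ : ℕ → Prop} {r₁ : RtEntry m D₁ l₁ v₁} {φ₁ ψ₁ : ℕ → ℕ} {r₂ : RtEntry m' D₂ l₂ v₂}
    {φ₂ ψ₂ : ℕ → ℕ} (h : Glue hT D r₁ φ₁ ψ₁ r₂ φ₂ ψ₂) (g : Fin n → κ) (hg : Function.Bijective g)
    (hm : ∀ i j, A (g i) (g j) = C i j) (hw : ∀ i, W (g i) ↔ (i : ℕ) + 1 ∈ w)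
    (hv : (∀ i, σ (g i) = s (i + 1) ∧ τ (g i) = t (i + 1)) ∨
      ∀ i, τ (g i) = s (i + 1) ∧ σ (g i) = t (i + 1)) : Sys A W σ τ := by
  obtain ⟨c, d, hcd, hne⟩ := h.conn
  have hn : 0 < n := by omega
  have s₁ : Sub n D s w m D₁ l₁ v₁ φ₁ ψ₁ :=
    ⟨r₁, h.node₁, h.mat₁, fun k h1 h2 => (h.cov k h1 h2).1⟩
  have s₂ : Sub n D t w m' D₂ l₂ v₂ φ₂ ψ₂ :=
    ⟨r₂, h.node₂, h.mat₂, fun k h1 h2 => (h.cov k h1 h2).2.1⟩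
  -- In every entry the two roots already differ at the first or at the last node.
  have hc : Compat n D s t w := ⟨hne.elim (fun h => ⟨1, le_rfl, hn, h⟩) (fun h => ⟨n, hn, le_rfl, h⟩),
    fun k h1 h2 => (h.cov k h1 h2).2.2, h.black, c, d, hcd⟩
  rcases hv with hv | hv
  · obtain ⟨f, hF, hinj⟩ := Fits.of_fin g hn hg hm hw hv h.cartan
    exact hF.sys hA hinj s₁ s₂ h.sum₁ h.sum₂ hc h.sr
  · obtain ⟨f, hF, hinj⟩ := Fits.of_fin g hn hg hm hw hv h.cartan
    exact (hF.sys hA hinj s₁ s₂ h.sum₁ h.sum₂ hc h.sr).swap hA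

instance (n : ℕ) (D : ℕ → ℕ → ℤ) (s t : ℕ → ℕ) (m : ℕ) (D' : ℕ → ℕ → ℤ) (φ : ℕ → ℕ) :
    Decidable (SumData n D s t m D' φ) := by unfold SumData; infer_instance

/-- For an entry of fixed rank everything is decidable once the set `w` is replaced by a list. The
conditions are evaluated together as one Boolean. -/
lemma Glue.of_lists {n : ℕ} {C : Matrix (Fin n) (Fin n) ℤ} {s t : ℕ → ℕ} {w : Set ℕ}
    {hT : RankTwoTable n C s t w} {D : ℕ → ℕ → ℤ} {m m' : ℕ} {D₁ D₂ : ℕ → ℕ → ℤ} {l₁ l₂ : ℕ → ℤ}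
    {v₁ v₂ : ℕ → Prop} {h₁ : RtEntry m D₁ l₁ v₁} {L₁ L₂ : List ℕ} {h₂ : RtEntry m' D₂ l₂ v₂}
    (hC : ∀ i j, C i j = D (i + 1) (j + 1)) (L : List ℕ) (hL : ∀ k, k ∈ w ↔ k ∈ L) (c d : ℕ)
    [DecidablePred v₁] [DecidablePred v₂]
    (h : (decide (SumData n D s t m D₁ (ofList L₁) ∧ SumData n D t s m' D₂ (ofList L₂)) &&
      decide ((1 ≤ c ∧ c ≤ n ∧ 1 ≤ d ∧ d ≤ n ∧ s c ≠ 0 ∧ t d ≠ 0 ∧ D c d ≠ 0) ∧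
        (s 1 ≠ t 1 ∨ s n ≠ t n)) &&
      decide (∀ i ∈ List.range' 1 m, 1 ≤ ofList L₁ i ∧ ofList L₁ i ≤ n ∧ (s (ofList L₁ i) : ℤ) = l₁ i ∧
        1 ≤ l₁ i ∧ (ofList L₁ i ∈ L ↔ v₁ i)) &&
      decide (∀ i ∈ List.range' 1 m', 1 ≤ ofList L₂ i ∧ ofList L₂ i ≤ n ∧ (t (ofList L₂ i) : ℤ) = l₂ i ∧
        1 ≤ l₂ i ∧ (ofList L₂ i ∈ L ↔ v₂ i)) &&
      decide (∀ i ∈ List.range' 1 m, ∀ j ∈ List.range' 1 m, D (ofList L₁ i) (ofList L₁ j) = D₁ i j ∧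
        (ofList L₁ i = ofList L₁ j → i = j)) &&
      decide (∀ i ∈ List.range' 1 m', ∀ j ∈ List.range' 1 m', D (ofList L₂ i) (ofList L₂ j) = D₂ i j ∧
        (ofList L₂ i = ofList L₂ j → i = j)) &&
      decide (∀ i ∈ List.range' 1 n,
        (s i ≠ 0 → 1 ≤ posIn L₁ i ∧ posIn L₁ i ≤ m ∧ i = ofList L₁ (posIn L₁ i)) ∧
        (t i ≠ 0 → 1 ≤ posIn L₂ i ∧ posIn L₂ i ≤ m' ∧ i = ofList L₂ (posIn L₂ i)) ∧
        (s i ≠ 0 ∨ t i ≠ 0)) &&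
      decide (∀ i ∈ List.range' 1 n, ∀ j ∈ List.range' 1 n, i ∉ L →
        (s i = 0 → s j ≠ 0 → D j i = 0) ∧ (t i = 0 → t j ≠ 0 → D j i = 0)) &&
      decide ((2 ≤ m ∧ 2 ≤ m') ∨ 3 ≤ m' ∨
        ∀ i ∈ List.range' 1 n, ∀ j ∈ List.range' 1 n, D j i = -1 → s i = 0 ∨ t i = 0)) = true) :
    Glue hT D h₁ (ofList L₁) (posIn L₁) h₂ (ofList L₂) (posIn L₂) := by
  simp only [Bool.and_eq_true, decide_eq_true_eq] at h
  obtain ⟨⟨⟨⟨⟨⟨⟨⟨⟨d₁, d₂⟩, hc⟩, n₁⟩, n₂⟩, m₁⟩, m₂⟩, hv⟩, hb⟩, hs⟩ := h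
  simp only [List.mem_range'_1, add_comm 1, Nat.lt_succ_iff, and_imp] at n₁ n₂ m₁ m₂ hv hb hs
  refine ⟨hC, d₁, d₂, ⟨c, d, hc⟩, ?_, ?_, fun i j a b c d => m₁ i a b j c d,
    fun i j a b c d => m₂ i a b j c d, hv, ?_, ?_⟩
  · simpa only [hL] using n₁
  · simpa only [hL] using n₂
  · simp only [hL]
    exact fun i j a b c d => hb i a b j c d
  · exact hs.imp id (Or.imp id fun hs i j a b c d => hs i a b j c d)

/-- In an infinite family all conditions are linear arithmetic in the node numbers with case
distinctions. The other families follow the same pattern, each with its own embeddings. -/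
lemma glue_A_a (n l : ℕ) (hl : 1 ≤ l) (hn : l + 1 ≤ n) : Glue (.A_a n l hl hn) cA (.A l hl)
    (fun i => i) (fun i => i) (.A (n - l) (by omega)) (· + l) (· - l) := by
  refine ⟨cartan_A n, .inl ?_, .inl ?_, ⟨l, l + 1, ?_⟩, ?_, ?_, ?_, ?_, ?_, ?_, ?_⟩
  all_goals first
    | omega
    | simp only [α, seg, Pi.add_apply, Pi.smul_apply, smul_eq_mul, Set.mem_insert_iff,
        Set.mem_singleton_iff, lC, lD, cA, cB, cC, cD, cSum]
      grind (splits := 20)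

lemma glue_A_b (n : ℕ) (hn : 4 ≤ n) : Glue (.A_b n hn) cA .D₂ (fun i => if i = 1 then 1 else n)
    (fun i => if i = 1 then 1 else 2) (.A (n - 2) (by omega)) (· + 1) (· - 1) := by
  refine
      ⟨cartan_A n, .inr ⟨rfl, sum_Icc_pair (a := 1) (b := n) (c := 1) (d := n) ?_ ?_ ?_ ?_ ?_,
      sum_Icc_pair (a := 1) (b := 2) (c := n - 1) (d := n) ?_ ?_ ?_ ?_ ?_⟩, .inl ?_, ⟨1, 2, ?_⟩,
      ?_, ?_, ?_, ?_, ?_, ?_, ?_⟩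
  all_goals first
    | omega
    | simp only [α, seg, Pi.add_apply, Pi.smul_apply, smul_eq_mul, Set.mem_insert_iff,
        Set.mem_singleton_iff, lC, lD, cA, cB, cC, cD, cSum]
      grind (splits := 20)

/-- In the numbering of `D 3` the first and only white node is the middle one of the chain; hence
the order `2, 1, 3`. -/
lemma glue_A_c : Glue (.A_c) cA (.D 3 le_rfl) (ofList [2, 1, 3]) (posIn [2, 1, 3]) (.D 3 le_rfl)
    (ofList [4, 3, 5]) (posIn [4, 3, 5]) :=
  .of_lists (cartan_A 5) [2, 4] (by simp) 3 3 rfl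

lemma glue_AA : Glue (.AA) (cSum 2 cA cA) .D₂ (ofList [1, 3]) (posIn [1, 3]) .D₂ (ofList [2, 4])
    (posIn [2, 4]) :=
  .of_lists (cartan_sum (cartan_A 2) (cartan_A 2)) [1, 2, 3, 4] (by simp) 1 2 rfl

/-- For `n = p + 1` the second root is the simple root `α_n`, hence of type `A 1` instead of `B`. -/
lemma glue_B_a_one (p : ℕ) (hp : 1 ≤ p) : Glue (.B_a (p + 1) p hp le_rfl) (cB (p + 1)) (.A p hp)
    (fun i => i) (fun i => i) (.A 1 le_rfl) (· + p) (· - p) := by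
  refine ⟨cartan_B _, .inl ?_, .inl ?_, ⟨p, p + 1, ?_⟩, ?_, ?_, ?_, ?_, ?_, ?_, ?_⟩
  all_goals first
    | omega
    | simp only [α, seg, Pi.add_apply, Pi.smul_apply, smul_eq_mul, Set.mem_insert_iff,
        Set.mem_singleton_iff, lC, lD, cA, cB, cC, cD, cSum]
      grind (splits := 20)

lemma glue_B_a' (n p : ℕ) (hp : 1 ≤ p) (hn : p + 2 ≤ n) : Glue (.B_a' n p hp (by omega)) (cB n)
    (.A p hp) (fun i => i) (fun i => i) (.B (n - p) (by omega)) (· + p) (· - p) := by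
  refine ⟨cartan_B n, .inl ?_, .inl ?_, ⟨p, p + 1, ?_⟩, ?_, ?_, ?_, ?_, ?_, ?_, ?_⟩
  all_goals first
    | omega
    | simp only [α, seg, Pi.add_apply, Pi.smul_apply, smul_eq_mul, Set.mem_insert_iff,
        Set.mem_singleton_iff, lC, lD, cA, cB, cC, cD, cSum]
      grind (splits := 20)

lemma glue_B_a (n p : ℕ) (hp : 1 ≤ p) (hn : p + 2 ≤ n) : Glue (.B_a n p hp (by omega)) (cB n)
    (.A p hp) (fun i => i) (fun i => i) (.B' (n - p) (by omega)) (· + p) (· - p) := by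
  refine ⟨cartan_B n, .inl ?_, .inl ?_, ⟨p, p + 1, ?_⟩, ?_, ?_, ?_, ?_, ?_, ?_, ?_⟩
  all_goals first
    | omega
    | simp only [α, seg, Pi.add_apply, Pi.smul_apply, smul_eq_mul, Set.mem_insert_iff,
        Set.mem_singleton_iff, lC, lD, cA, cB, cC, cD, cSum]
      grind (splits := 20)

lemma glue_B_b : Glue (.B_b) (cB 3) (.A 2 one_le_two) (ofList [1, 2]) (posIn [1, 2]) (.B' 2 le_rfl)
    (ofList [2, 3]) (posIn [2, 3]) :=
  .of_lists (cartan_B 3) [1, 2, 3] (by simp) 2 2 rfl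

lemma glue_B_c : Glue (.B_c) (cB 4) (.B' 4 (by omega)) (ofList [1, 2, 3, 4]) (posIn [1, 2, 3, 4])
    .B₃ (ofList [2, 3, 4]) (posIn [2, 3, 4]) :=
  .of_lists (cartan_B 4) [1, 4] (by simp) 2 2 rfl

/-- Roots of type `C` start in rank three. In rank two the root is one of type `B 2`, with the nodes
in the opposite order; the same happens at the lower boundary of the other families of type `C`. -/
lemma glue_C_a_two : Glue (.C_a 2 le_rfl) (cC 2) (.A 1 le_rfl) (ofList [1]) (posIn [1])
    (.B' 2 le_rfl) (ofList [2, 1]) (posIn [2, 1]) :=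
  .of_lists (cartan_C 2) [1, 2] (by simp) 1 1 rfl

lemma glue_C_a (n : ℕ) (hn : 3 ≤ n) : Glue (.C_a n (by omega)) (cC n) (.A 1 le_rfl) (fun i => i)
    (fun i => i) (.C' n hn) (fun i => i) (fun i => i) := by
  refine ⟨cartan_C n, .inl ?_, .inl ?_, ⟨1, 1, ?_⟩, ?_, ?_, ?_, ?_, ?_, ?_, ?_⟩
  all_goals first
    | omega
    | simp only [α, seg, Pi.add_apply, Pi.smul_apply, smul_eq_mul, Set.mem_insert_iff,
        Set.mem_singleton_iff, lC, lD, cA, cB, cC, cD, cSum]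
      grind (splits := 20)

lemma glue_C_b_three : Glue (.C_b 3 le_rfl) (cC 3) (.A 2 one_le_two) (ofList [1, 2]) (posIn [1, 2])
    (.B' 2 le_rfl) (ofList [3, 2]) (posIn [3, 2]) :=
  .of_lists (cartan_C 3) [1, 2, 3] (by simp) 2 2 rfl

lemma glue_C_b (n : ℕ) (hn : 4 ≤ n) : Glue (.C_b n (by omega)) (cC n) (.A 2 one_le_two) (fun i => i)
    (fun i => i) (.C' (n - 1) (by omega)) (· + 1) (· - 1) := by
  refine ⟨cartan_C n, .inl ?_, .inl ?_, ⟨2, 2, ?_⟩, ?_, ?_, ?_, ?_, ?_, ?_, ?_⟩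
  all_goals first
    | omega
    | simp only [α, seg, Pi.add_apply, Pi.smul_apply, smul_eq_mul, Set.mem_insert_iff,
        Set.mem_singleton_iff, lC, lD, cA, cB, cC, cD, cSum]
      grind (splits := 20)

lemma glue_C_c_four : Glue (.C_c 4 le_rfl) (cC 4) (.D 3 le_rfl) (ofList [2, 1, 3]) (posIn [2, 1, 3])
    (.B 2 le_rfl) (ofList [4, 3]) (posIn [4, 3]) :=
  .of_lists (cartan_C 4) [2, 4] (by simp) 3 3 rfl

lemma glue_C_c (n : ℕ) (hn : 5 ≤ n) : Glue (.C_c n (by omega)) (cC n) (.D 3 le_rfl)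
    (fun i => if i = 1 then 2 else if i = 2 then 1 else i)
    (fun i => if i = 1 then 2 else if i = 2 then 1 else i) (.C (n - 2) (by omega)) (· + 2) (· - 2)
    := by
  refine ⟨cartan_C n, .inl ?_, .inl ?_, ⟨3, 3, ?_⟩, ?_, ?_, ?_, ?_, ?_, ?_, ?_⟩
  all_goals first
    | omega
    | simp only [α, seg, Pi.add_apply, Pi.smul_apply, smul_eq_mul, Set.mem_insert_iff,
        Set.mem_singleton_iff, lC, lD, cA, cB, cC, cD, cSum]
      grind (splits := 20)

lemma glue_C_d_two (p : ℕ) (hp : 1 ≤ p) : Glue (.C_d (p + 2) p hp le_rfl) (cC (p + 2)) (.A p hp)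
    (fun i => i) (fun i => i) (.B' 2 le_rfl) (fun i => p + 3 - i) (fun i => p + 3 - i) := by
  refine ⟨cartan_C _, .inl ?_, .inl ?_, ⟨p, p + 1, ?_⟩, ?_, ?_, ?_, ?_, ?_, ?_, ?_⟩
  all_goals first
    | omega
    | simp only [α, seg, Pi.add_apply, Pi.smul_apply, smul_eq_mul, Set.mem_insert_iff,
        Set.mem_singleton_iff, lC, lD, cA, cB, cC, cD, cSum]
      grind (splits := 20)

lemma glue_C_d (n p : ℕ) (hp : 1 ≤ p) (hn : p + 3 ≤ n) : Glue (.C_d n p hp (by omega)) (cC n)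
    (.A p hp) (fun i => i) (fun i => i) (.C' (n - p) (by omega)) (· + p) (· - p) := by
  refine ⟨cartan_C n, .inl ?_, .inl ?_, ⟨p, p + 1, ?_⟩, ?_, ?_, ?_, ?_, ?_, ?_, ?_⟩
  all_goals first
    | omega
    | simp only [α, seg, Pi.add_apply, Pi.smul_apply, smul_eq_mul, Set.mem_insert_iff,
        Set.mem_singleton_iff, lC, lD, cA, cB, cC, cD, cSum]
      grind (splits := 20)

lemma glue_CA_two : Glue (.CA 2 le_rfl) (cSum 2 (cC 2) cA) .D₂ (ofList [1, 3]) (posIn [1, 3])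
    (.B' 2 le_rfl) (ofList [2, 1]) (posIn [2, 1]) :=
  .of_lists (cartan_sum (cartan_C 2) (cartan_A 1)) [1, 2, 3] (by simp) 1 1 rfl

lemma glue_CA (n : ℕ) (hn : 3 ≤ n) : Glue (.CA n (by omega)) (cSum n (cC n) cA) .D₂
    (fun i => if i = 1 then 1 else n + 1) (fun i => if i = 1 then 1 else 2) (.C' n hn) (fun i => i)
    (fun i => i) := by
  refine
      ⟨cartan_sum (cartan_C n) (cartan_A 1), .inr ⟨rfl,
      sum_Icc_pair (a := 1) (b := n + 1) (c := 1) (d := n + 1) ?_ ?_ ?_ ?_ ?_,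
      sum_Icc_pair (a := 1) (b := 2) (c := 1) (d := 2) ?_ ?_ ?_ ?_ ?_⟩, .inl ?_, ⟨1, 1, ?_⟩, ?_,
      ?_, ?_, ?_, ?_, ?_, ?_⟩
  all_goals first
    | omega
    | simp only [α, seg, Pi.add_apply, Pi.smul_apply, smul_eq_mul, Set.mem_insert_iff,
        Set.mem_singleton_iff, lC, lD, cA, cB, cC, cD, cSum]
      grind (splits := 20)

lemma glue_C_e (n : ℕ) (hn : 2 ≤ n) : Glue (.C_e n hn) (cC n) (.A (n - 1) (by omega)) (fun i => i)
    (fun i => i) (.A 1 le_rfl) (· + (n - 1)) (· - (n - 1)) := by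
  refine ⟨cartan_C n, .inl ?_, .inl ?_, ⟨n - 1, n, ?_⟩, ?_, ?_, ?_, ?_, ?_, ?_, ?_⟩
  all_goals first
    | omega
    | simp only [α, seg, Pi.add_apply, Pi.smul_apply, smul_eq_mul, Set.mem_insert_iff,
        Set.mem_singleton_iff, lC, lD, cA, cB, cC, cD, cSum]
      grind (splits := 20)

lemma glue_C_f (n : ℕ) (hn : 3 ≤ n) : Glue (.C_f n hn) (cC n) .D₂ (fun i => if i = 1 then 1 else n)
    (fun i => if i = 1 then 1 else 2) (.A (n - 2) (by omega)) (· + 1) (· - 1) := by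
  refine
      ⟨cartan_C n, .inr ⟨rfl, sum_Icc_pair (a := 1) (b := n) (c := 1) (d := n) ?_ ?_ ?_ ?_ ?_,
      sum_Icc_pair (a := 1) (b := 2) (c := n - 1) (d := n) ?_ ?_ ?_ ?_ ?_⟩, .inl ?_, ⟨1, 2, ?_⟩,
      ?_, ?_, ?_, ?_, ?_, ?_, ?_⟩
  all_goals first
    | omega
    | simp only [α, seg, Pi.add_apply, Pi.smul_apply, smul_eq_mul, Set.mem_insert_iff,
        Set.mem_singleton_iff, lC, lD, cA, cB, cC, cD, cSum]
      grind (splits := 20)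

lemma glue_CC : Glue (.CC) (cSum 2 (cC 2) (cC 2)) .D₂ (ofList [1, 3]) (posIn [1, 3]) .D₂
    (ofList [2, 4]) (posIn [2, 4]) :=
  .of_lists (cartan_sum (cartan_C 2) (cartan_C 2)) [1, 2, 3, 4] (by simp) 1 2 rfl

lemma glue_D_a (n p : ℕ) (hp : 1 ≤ p) (hn : p + 3 ≤ n) : Glue (.D_a n p hp hn) (cD n) (.A p hp)
    (fun i => i) (fun i => i) (.D (n - p) (by omega)) (· + p) (· - p) := by
  refine ⟨cartan_D n (by omega), .inl ?_, .inl ?_, ⟨p, p + 1, ?_⟩, ?_, ?_, ?_, ?_, ?_, ?_, ?_⟩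
  all_goals first
    | omega
    | simp only [α, seg, Pi.add_apply, Pi.smul_apply, smul_eq_mul, Set.mem_insert_iff,
        Set.mem_singleton_iff, lC, lD, cA, cB, cC, cD, cSum]
      grind (splits := 20)

lemma glue_D_b (n : ℕ) (hn : 3 ≤ n) : Glue (.D_b n hn) (cD n) (.A (n - 2) (by omega)) (fun i => i)
    (fun i => i) .D₂ (fun i => i + (n - 2)) (fun i => i - (n - 2)) := by
  refine
      ⟨cartan_D n (by omega), .inl ?_, .inr ⟨rfl,
      sum_Icc_pair (a := n - 1) (b := n) (c := n - 1) (d := n) ?_ ?_ ?_ ?_ ?_,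
      sum_Icc_pair (a := n - 2) (b := n - 1) (c := n - 2) (d := n - 1) ?_ ?_ ?_ ?_ ?_⟩, ⟨n - 2, n,
      ?_⟩, ?_, ?_, ?_, ?_, ?_, ?_, ?_⟩
  all_goals first
    | omega
    | simp only [α, seg, Pi.add_apply, Pi.smul_apply, smul_eq_mul, Set.mem_insert_iff,
        Set.mem_singleton_iff, lC, lD, cA, cB, cC, cD, cSum]
      grind (splits := 20)

lemma glue_D_c : Glue (.D_c) (cD 5) (.D 3 le_rfl) (ofList [2, 1, 3]) (posIn [2, 1, 3])
    (.A 3 (by omega)) (ofList [4, 3, 5]) (posIn [4, 3, 5]) :=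
  .of_lists (cartan_D 5 (by omega)) [2, 4, 5] (by simp) 3 3 rfl

lemma glue_D_d (n : ℕ) (hn : 3 ≤ n) : Glue (.D_d n hn) (cD n) (.A (n - 1) (by omega)) (fun i => i)
    (fun i => i) (.A (n - 1) (by omega)) (fun i => if i + 1 = n then n else i)
    (fun i => if i = n then n - 1 else i) := by
  refine ⟨cartan_D n (by omega), .inl ?_, .inl ?_, ⟨1, 1, ?_⟩, ?_, ?_, ?_, ?_, ?_, ?_, ?_⟩
  all_goals first
    | omega
    | simp only [α, seg, Pi.add_apply, Pi.smul_apply, smul_eq_mul, Set.mem_insert_iff,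
        Set.mem_singleton_iff, lC, lD, cA, cB, cC, cD, cSum]
      grind (splits := 20)

lemma glue_E₆_a : Glue (.E₆_a) cE (.D 5 (by omega)) (ofList [1, 3, 4, 2, 5]) (posIn [1, 3, 4, 2, 5])
    (.D 5 (by omega)) (ofList [6, 5, 4, 3, 2]) (posIn [6, 5, 4, 3, 2]) :=
  .of_lists (cartan_E₆) [1, 6] (by simp) 2 2 rfl

lemma glue_E₆_b : Glue (.E₆_b) cE (.A 5 (by omega)) (ofList [1, 3, 4, 5, 6]) (posIn [1, 3, 4, 5, 6])
    (.D 4 (by omega)) (ofList [2, 4, 3, 5]) (posIn [2, 4, 3, 5]) :=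
  .of_lists (cartan_E₆) [1, 2, 6] (by simp) 3 3 rfl

lemma glue_F₄_a : Glue (.F₄_a) (cB 3) (.A 2 one_le_two) (ofList [1, 2]) (posIn [1, 2])
    (.A 2 one_le_two) (ofList [3, 4]) (posIn [3, 4]) :=
  .of_lists (cartan_F₄) [1, 2, 3, 4] (by simp) 2 3 rfl

lemma glue_F₄_b : Glue (.F₄_b) (cB 3) (.B' 3 (by omega)) (ofList [1, 2, 3]) (posIn [1, 2, 3])
    (.A 1 le_rfl) (ofList [4]) (posIn [4]) :=
  .of_lists (cartan_F₄) [1, 3, 4] (by simp) 3 4 rfl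

lemma glue_F₄_c : Glue (.F₄_c) (cB 3) (.B' 3 (by omega)) (ofList [1, 2, 3]) (posIn [1, 2, 3])
    (.C' 3 le_rfl) (ofList [4, 3, 2]) (posIn [4, 3, 2]) :=
  .of_lists (cartan_F₄) [1, 3, 4] (by simp) 3 3 rfl

lemma glue_F₄_d : Glue (.F₄_d) (cB 3) .D₂ (ofList [1, 4]) (posIn [1, 4]) (.B' 2 le_rfl)
    (ofList [2, 3]) (posIn [2, 3]) :=
  .of_lists (cartan_F₄) [1, 2, 3, 4] (by simp) 1 2 rfl

lemma glue_F₄_e : Glue (.F₄_e) (cB 3) .B₃ (ofList [1, 2, 3]) (posIn [1, 2, 3]) (.A 1 le_rfl)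
    (ofList [4]) (posIn [4]) :=
  .of_lists (cartan_F₄) [3, 4] (by simp) 3 4 rfl

lemma glue_G₂_a : Glue (.G₂_a) cG (.A 1 le_rfl) (ofList [1]) (posIn [1]) (.A 1 le_rfl) (ofList [2])
    (posIn [2]) :=
  .of_lists (cartan_G₂) [1, 2] (by simp) 1 2 rfl

lemma glue_G₂_b : Glue (.G₂_b) cG (.A 1 le_rfl) (ofList [1]) (posIn [1]) .G₂' (ofList [1, 2])
    (posIn [1, 2]) :=
  .of_lists (cartan_G₂) [1, 2] (by simp) 1 1 rfl

lemma glue_GG : Glue (.GG) (cSum 2 cG cG) .D₂ (ofList [1, 3]) (posIn [1, 3]) .D₂ (ofList [2, 4])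
    (posIn [2, 4]) :=
  .of_lists (cartan_sum cartan_G₂ cartan_G₂) [1, 2, 3, 4] (by simp) 1 2 rfl

lemma InTable.sys {κ : Type*} [Fintype κ] [DecidableEq κ] {A : κ → κ → ℤ} {W : κ → Prop}
    {σ τ : κ → ℤ} (hA : FiniteType A) (h : InTable A W σ τ) : Sys A W σ τ := by
  obtain ⟨n, C, s, t, w, hT, g, hg, hm, hw, hv⟩ := h
  cases hT
  case A_a l hl hn => exact (glue_A_a n l hl hn).sys hA g hg hm hw hv
  case A_b hn => exact (glue_A_b n hn).sys hA g hg hm hw hv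
  case A_c => exact glue_A_c.sys hA g hg hm hw hv
  case AA => exact glue_AA.sys hA g hg hm hw hv
  case B_a p hp hn =>
    rcases hn.eq_or_lt with rfl | hn'
    · exact (glue_B_a_one p hp).sys hA g hg hm hw hv
    · exact (glue_B_a n p hp hn').sys hA g hg hm hw hv
  case B_a' p hp hn =>
    rcases hn.eq_or_lt with rfl | hn'
    -- For `n = p + 1` the sets `{1, p, p + 1}` and `{1, p, p + 1, n}` coincide.
    · exact (glue_B_a_one p hp).sys hA g hg hm (by simpa using hw) hv
    · exact (glue_B_a' n p hp hn').sys hA g hg hm hw hv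
  case B_b => exact glue_B_b.sys hA g hg hm hw hv
  case B_c => exact glue_B_c.sys hA g hg hm hw hv
  case C_a hn =>
    rcases hn.eq_or_lt with rfl | hn'
    · exact glue_C_a_two.sys hA g hg hm hw hv
    · exact (glue_C_a n hn').sys hA g hg hm hw hv
  case C_b hn =>
    rcases hn.eq_or_lt with rfl | hn'
    · exact glue_C_b_three.sys hA g hg hm hw hv
    · exact (glue_C_b n hn').sys hA g hg hm hw hv
  case C_c hn =>
    rcases hn.eq_or_lt with rfl | hn'
    · exact glue_C_c_four.sys hA g hg hm hw hv
    · exact (glue_C_c n hn').sys hA g hg hm hw hv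
  case C_d p hp hn =>
    rcases hn.eq_or_lt with rfl | hn'
    · exact (glue_C_d_two p hp).sys hA g hg hm hw hv
    · exact (glue_C_d n p hp hn').sys hA g hg hm hw hv
  case CA n hn =>
    rcases hn.eq_or_lt with rfl | hn'
    · exact glue_CA_two.sys hA g hg hm hw hv
    · exact (glue_CA n hn').sys hA g hg hm hw hv
  case C_e hn => exact (glue_C_e n hn).sys hA g hg hm hw hv
  case C_f hn => exact (glue_C_f n hn).sys hA g hg hm hw hv
  case CC => exact glue_CC.sys hA g hg hm hw hv
  case D_a p hp hn => exact (glue_D_a n p hp hn).sys hA g hg hm hw hv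
  case D_b hn => exact (glue_D_b n hn).sys hA g hg hm hw hv
  case D_c => exact glue_D_c.sys hA g hg hm hw hv
  case D_d hn => exact (glue_D_d n hn).sys hA g hg hm hw hv
  case E₆_a => exact glue_E₆_a.sys hA g hg hm hw hv
  case E₆_b => exact glue_E₆_b.sys hA g hg hm hw hv
  case F₄_a => exact glue_F₄_a.sys hA g hg hm hw hv
  case F₄_b => exact glue_F₄_b.sys hA g hg hm hw hv
  case F₄_c => exact glue_F₄_c.sys hA g hg hm hw hv
  case F₄_d => exact glue_F₄_d.sys hA g hg hm hw hv
  case F₄_e => exact glue_F₄_e.sys hA g hg hm hw hv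
  case G₂_a => exact glue_G₂_a.sys hA g hg hm hw hv
  case G₂_b => exact glue_G₂_b.sys hA g hg hm hw hv
  case GG => exact glue_GG.sys hA g hg hm hw hv

end WeakSpherical

namespace WeakSpherical

section Gluing

variable {κ : Type*} [Fintype κ] [DecidableEq κ] {A : κ → κ → ℤ} {W : κ → Prop} {σ τ : κ → ℤ}
  {n : ℕ} {C : Matrix (Fin n) (Fin n) ℤ} {s t : ℕ → ℕ} {w : Set ℕ}
  {hT : RankTwoTable n C s t w} {D : ℕ → ℕ → ℤ} {m m' : ℕ} {D₁ D₂ : ℕ → ℕ → ℤ} {l₁ l₂ : ℕ → ℤ}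
  {v₁ v₂ : ℕ → Prop} {r₁ : RtEntry m D₁ l₁ v₁} {φ₁ ψ₁ : ℕ → ℕ} {r₂ : RtEntry m' D₂ l₂ v₂}
  {φ₂ ψ₂ : ℕ → ℕ} {e g : ℕ → κ}

/-! ### Recognizing the entries of the table -/

/-- The numberings of the two supports are merged into one of the whole diagram. Matrix entries
within one support are known from the type of its root, so besides the coincidence of common nodes
it is only the entries between nodes private to either support that have to be compared. -/
lemma Glue.inTable (h : Glue hT D r₁ φ₁ ψ₁ r₂ φ₂ ψ₂) (hA : FiniteType A)
    (he : WR A W σ m D₁ l₁ v₁ e) (hg : WR A W τ m' D₂ l₂ v₂ g) (hcov : ∀ k, σ k ≠ 0 ∨ τ k ≠ 0)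
    (Hs : ∀ j, 1 ≤ j → j ≤ m' → s (φ₂ j) = 0 → σ (g j) = 0)
    (Ht : ∀ i, 1 ≤ i → i ≤ m → t (φ₁ i) = 0 → τ (e i) = 0)
    (H : ∀ i j, 1 ≤ i → i ≤ m → 1 ≤ j → j ≤ m' → (φ₁ i = φ₂ j → e i = g j) ∧
      (t (φ₁ i) = 0 → s (φ₂ j) = 0 →
        A (e i) (g j) = D (φ₁ i) (φ₂ j) ∧ A (g j) (e i) = D (φ₂ j) (φ₁ i))) :
    InTable A W σ τ := by
  have c₁ := fun k a b hk => (h.cov k a b).1 hk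
  have c₂ := fun k a b hk => (h.cov k a b).2.1 hk
  have sh : ∀ k, 1 ≤ k → k ≤ n → s k ≠ 0 → t k ≠ 0 → e (ψ₁ k) = g (ψ₂ k) := by
    intro k a b hs ht
    obtain ⟨a₁, b₁, d₁⟩ := c₁ k a b hs
    obtain ⟨a₂, b₂, d₂⟩ := c₂ k a b ht
    exact (H _ _ a₁ b₁ a₂ b₂).1 (d₁.symm.trans d₂)
  have ht : ∀ k, 1 ≤ k → k ≤ n → s k = 0 → t k ≠ 0 := fun k a b hk =>
    (h.cov k a b).2.2.resolve_left (by simp [hk])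
  have sm : ∀ {i j}, 1 ≤ i → i ≤ n → 1 ≤ j → j ≤ n → s i ≠ 0 → s j ≠ 0 →
      A (e (ψ₁ i)) (e (ψ₁ j)) = D i j := by
    intro i j a b a' b' hi hj
    obtain ⟨a₁, b₁, d₁⟩ := c₁ i a b hi
    obtain ⟨a₂, b₂, d₂⟩ := c₁ j a' b' hj
    rw [he.mat _ _ a₁ b₁ a₂ b₂, ← (h.mat₁ _ _ a₁ b₁ a₂ b₂).1, ← d₁, ← d₂]
  have tm : ∀ {i j}, 1 ≤ i → i ≤ n → 1 ≤ j → j ≤ n → t i ≠ 0 → t j ≠ 0 →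
      A (g (ψ₂ i)) (g (ψ₂ j)) = D i j := by
    intro i j a b a' b' hi hj
    obtain ⟨a₁, b₁, d₁⟩ := c₂ i a b hi
    obtain ⟨a₂, b₂, d₂⟩ := c₂ j a' b' hj
    rw [hg.mat _ _ a₁ b₁ a₂ b₂, ← (h.mat₂ _ _ a₁ b₁ a₂ b₂).1, ← d₁, ← d₂]
  have cross : ∀ {i j}, 1 ≤ i → i ≤ n → 1 ≤ j → j ≤ n → s i ≠ 0 → s j = 0 →
      A (e (ψ₁ i)) (g (ψ₂ j)) = D i j ∧ A (g (ψ₂ j)) (e (ψ₁ i)) = D j i := by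
    intro i j a b a' b' hi hj
    have hj' := ht j a' b' hj
    by_cases hi' : t i = 0
    · obtain ⟨a₁, b₁, d₁⟩ := c₁ i a b hi
      obtain ⟨a₂, b₂, d₂⟩ := c₂ j a' b' hj'
      have := (H _ _ a₁ b₁ a₂ b₂).2
      rw [← d₁, ← d₂] at this
      exact this hi' hj
    · rw [sh i a b hi hi']
      exact ⟨tm a b a' b' hi' hj', tm a' b' a b hj' hi'⟩
  -- The numbering of the first support takes precedence; on common nodes both agree by `sh`.
  refine Fits.inTable hA (f := fun k => if s k ≠ 0 then e (ψ₁ k) else g (ψ₂ k))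
    ⟨?_, ?_, ?_, ?_, ?_⟩ hT h.cartan
  · intro i j a b a' b'
    by_cases hi : s i = 0 <;> by_cases hj : s j = 0 <;> simp only [hi, hj, ne_eq, not_true_eq_false,
      not_false_eq_true, if_true, if_false]
    · exact tm a b a' b' (ht i a b hi) (ht j a' b' hj)
    · exact (cross a' b' a b hj hi).2
    · exact (cross a b a' b' hi hj).1
    · exact sm a b a' b' hi hj
  · intro i a b
    by_cases hi : s i = 0 <;> simp only [hi, ne_eq, not_true_eq_false, not_false_eq_true, if_true,
      if_false]
    · obtain ⟨a₂, b₂, d₂⟩ := c₂ i a b (ht i a b hi)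
      exact_mod_cast Hs _ a₂ b₂ (d₂ ▸ hi)
    · obtain ⟨a₁, b₁, d₁⟩ := c₁ i a b hi
      rw [he.val _ a₁ b₁, ← (h.node₁ _ a₁ b₁).2.2.1, ← d₁]
  · intro i a b
    by_cases hi : s i = 0 <;> simp only [hi, ne_eq, not_true_eq_false, not_false_eq_true, if_true,
      if_false]
    · obtain ⟨a₂, b₂, d₂⟩ := c₂ i a b (ht i a b hi)
      rw [hg.val _ a₂ b₂, ← (h.node₂ _ a₂ b₂).2.2.1, ← d₂]
    · by_cases hi' : t i = 0
      · obtain ⟨a₁, b₁, d₁⟩ := c₁ i a b hi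
        rw [Ht _ a₁ b₁ (d₁ ▸ hi'), hi']; rfl
      · obtain ⟨a₂, b₂, d₂⟩ := c₂ i a b hi'
        rw [sh i a b hi hi', hg.val _ a₂ b₂, ← (h.node₂ _ a₂ b₂).2.2.1, ← d₂]
  · intro i a b
    by_cases hi : s i = 0 <;> simp only [hi, ne_eq, not_true_eq_false, not_false_eq_true, if_true,
      if_false]
    · obtain ⟨a₂, b₂, d₂⟩ := c₂ i a b (ht i a b hi)
      rw [hg.wh _ a₂ b₂, ← (h.node₂ _ a₂ b₂).2.2.2.2, ← d₂]
    · obtain ⟨a₁, b₁, d₁⟩ := c₁ i a b hi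
      rw [he.wh _ a₁ b₁, ← (h.node₁ _ a₁ b₁).2.2.2.2, ← d₁]
  · have ks : ∀ i, 1 ≤ i → i ≤ m → s (φ₁ i) ≠ 0 := fun i a b h0 => by
      have := h.node₁ i a b
      rw [h0] at this
      have := this.2.2.1
      push_cast at this; omega
    have kt : ∀ i, 1 ≤ i → i ≤ m' → t (φ₂ i) ≠ 0 := fun i a b h0 => by
      have := h.node₂ i a b
      rw [h0] at this
      have := this.2.2.1
      push_cast at this; omega
    intro k
    rcases hcov k with hk | hk
    · obtain ⟨a, a₁, b₁, rfl⟩ := he.cov k hk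
      have hn := h.node₁ a a₁ b₁
      obtain ⟨a₂, b₂, d₂⟩ := c₁ _ hn.1 hn.2.1 (ks a a₁ b₁)
      refine ⟨φ₁ a, hn.1, hn.2.1, ?_⟩
      simp only [ks a a₁ b₁, ne_eq, not_false_eq_true, if_true]
      rw [← (h.mat₁ _ _ a₁ b₁ a₂ b₂).2 d₂]
    · obtain ⟨a, a₁, b₁, rfl⟩ := hg.cov k hk
      have hn := h.node₂ a a₁ b₁
      obtain ⟨a₂, b₂, d₂⟩ := c₂ _ hn.1 hn.2.1 (kt a a₁ b₁)
      have ha := (h.mat₂ _ _ a₁ b₁ a₂ b₂).2 d₂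
      refine ⟨φ₂ a, hn.1, hn.2.1, ?_⟩
      by_cases hi : s (φ₂ a) = 0 <;> simp only [hi, ne_eq, not_true_eq_false, not_false_eq_true,
        if_true, if_false]
      · rw [← ha]
      · rw [sh _ hn.1 hn.2.1 hi (kt a a₁ b₁), ← ha]

/-- Without common nodes the matching conditions on coefficients and on shared nodes are vacuous. -/
lemma Glue.inTable_of_disjoint (h : Glue hT D r₁ φ₁ ψ₁ r₂ φ₂ ψ₂) (hA : FiniteType A)
    (he : WR A W σ m D₁ l₁ v₁ e) (hg : WR A W τ m' D₂ l₂ v₂ g) (hcov : ∀ k, σ k ≠ 0 ∨ τ k ≠ 0)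
    (hd : ∀ k, σ k = 0 ∨ τ k = 0) (hst : ∀ k, s k = 0 ∨ t k = 0)
    (H : ∀ i j, 1 ≤ i → i ≤ m → 1 ≤ j → j ≤ m' →
        A (e i) (g j) = D (φ₁ i) (φ₂ j) ∧ A (g j) (e i) = D (φ₂ j) (φ₁ i)) :
    InTable A W σ τ := by
  refine h.inTable hA he hg hcov (fun j a b _ => (hd _).resolve_right (hg.val_ne a b))
    (fun i a b _ => (hd _).resolve_left (he.val_ne a b)) fun i j a b a' b' => ⟨fun hij => ?_,
      fun _ _ => H i j a b a' b'⟩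
  have h1 := h.node₁ i a b
  have h2 := h.node₂ j a' b'
  rw [← hij] at h2
  rcases hst (φ₁ i) with h0 | h0
  · have := h1.2.2.1
    rw [h0] at this
    push_cast at this; omega
  · have := h2.2.2.1
    rw [h0] at this
    push_cast at this; omega

end Gluing

end WeakSpherical

namespace WeakSpherical

section Profiles

variable {κ : Type*} [Fintype κ] [DecidableEq κ] {A : κ → κ → ℤ} {W : κ → Prop} {σ τ ρ : κ → ℤ}
  {n : ℕ} {C : ℕ → ℕ → ℤ} {l : ℕ → ℤ} {w : ℕ → Prop} {e : ℕ → κ}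

/-! ### Common properties of weak spherical roots with connected support -/

/-- The properties shared by all weak spherical roots with connected support. -/
structure Prof (A : κ → κ → ℤ) (W : κ → Prop) (ρ : κ → ℤ) : Prop where
  nonneg : ∀ k, 0 ≤ ρ k
  black : ∀ k, ρ k ≠ 0 → ¬ W k → pr A ρ k = 0
  two : ∀ u u', ρ u ≠ 0 → ρ u' ≠ 0 → W u → W u' → u ≠ u' →
    pr A ρ u ≤ 1 ∧ ∀ k, ρ k ≠ 0 → W k → k = u ∨ k = u'
  one : ∃ k, ρ k = 1
  white : ∃ k, ρ k ≠ 0 ∧ W k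
  pos : ∀ u, ρ u ≠ 0 → W u → (∀ k, ρ k ≠ 0 → W k → k = u) → pr A ρ u = 1 ∨ pr A ρ u = 2
  conn : ∀ P : κ → Prop, (∃ k, ρ k ≠ 0 ∧ P k) → (∃ k, ρ k ≠ 0 ∧ ¬ P k) →
    ∃ i j, ρ i ≠ 0 ∧ ρ j ≠ 0 ∧ P i ∧ ¬ P j ∧ A i j ≠ 0

/-- Each node but the first is joined to an earlier one, so a predicate that does not change along
edges has the same value everywhere as at the first node. -/
lemma WR.connected (hA : FiniteType A) (h : WR A W ρ n C l w e)
    (hC : ∀ i, 2 ≤ i → i ≤ n → ∃ j, 1 ≤ j ∧ j < i ∧ C j i ≠ 0) (P : κ → Prop)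
    (h1 : ∃ k, ρ k ≠ 0 ∧ P k) (h2 : ∃ k, ρ k ≠ 0 ∧ ¬ P k) :
    ∃ i j, ρ i ≠ 0 ∧ ρ j ≠ 0 ∧ P i ∧ ¬ P j ∧ A i j ≠ 0 := by
  by_contra hc
  push Not at hc
  have key : ∀ i, 1 ≤ i → i ≤ n → (P (e i) ↔ P (e 1)) := by
    intro i
    induction i using Nat.strong_induction_on with
    | _ i ih =>
      intro a b
      rcases a.eq_or_lt with rfl | a'
      · rfl
      obtain ⟨j, c, d, hj⟩ := hC i a' b
      rw [← ih j d c (by omega)]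
      rw [← h.mat j i c (by omega) a b] at hj
      have v1 := h.val_ne a b
      have v2 := h.val_ne c (show j ≤ n by omega)
      by_contra hP
      by_cases hi : P (e i)
      · exact hA.ne_zero_symm hj (hc _ _ v1 v2 hi (by tauto))
      · exact hj (hc _ _ v2 v1 (by tauto) hi)
  obtain ⟨k, hk, hP⟩ := h1
  obtain ⟨k', hk', hP'⟩ := h2
  obtain ⟨i, a, b, rfl⟩ := h.cov k hk
  obtain ⟨j, c, d, rfl⟩ := h.cov k' hk'
  rw [key i a b] at hP
  rw [key j c d] at hP'
  exact hP' hP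

/-- The hypothesis `hw` separates the two shapes of a root with connected support: one white node
with pairing 1 or 2, or two white nodes with pairings at most 1. -/
lemma WR.prof (hA : FiniteType A) (h : WR A W ρ n C l w e) (hr : Rt A W ρ)
    (hC : ∀ i, 2 ≤ i → i ≤ n → ∃ j, 1 ≤ j ∧ j < i ∧ C j i ≠ 0) (hl : ∃ i, 1 ≤ i ∧ i ≤ n ∧ l i = 1)
    (hw : ∃ i, 1 ≤ i ∧ i ≤ n ∧ w i ∧
      ((∀ j, 1 ≤ j → j ≤ n → w j → j = i) ∧ (pr A ρ (e i) = 1 ∨ pr A ρ (e i) = 2) ∨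
        ∃ k, 1 ≤ k ∧ k ≤ n ∧ w k ∧ k ≠ i ∧ pr A ρ (e i) ≤ 1 ∧ pr A ρ (e k) ≤ 1 ∧
          ∀ j, 1 ≤ j → j ≤ n → w j → j = i ∨ j = k)) : Prof A W ρ := by
  obtain ⟨i, a, b, wi, hw⟩ := hw
  have cov : ∀ u, ρ u ≠ 0 → W u → ∃ j, 1 ≤ j ∧ j ≤ n ∧ w j ∧ u = e j := by
    intro u hu hW
    obtain ⟨j, c, d, rfl⟩ := h.cov u hu
    exact ⟨j, c, d, (h.wh j c d).1 hW, rfl⟩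
  refine ⟨h.nonneg, fun k hk hW => hr.pr_black hk hW, ?_, ?_, ⟨e i, h.val_ne a b, (h.wh i a b).2 wi⟩,
    ?_, h.connected hA hC⟩
  · intro u u' hu hu' hW hW' huu
    obtain ⟨j, c, d, wj, rfl⟩ := cov u hu hW
    obtain ⟨j', c', d', wj', rfl⟩ := cov u' hu' hW'
    have hjj : j ≠ j' := by rintro rfl; exact huu rfl
    rcases hw with ⟨hw, -⟩ | ⟨k, a', b', wk, hk, p₁, p₂, hw⟩
    · exact absurd ((hw j c d wj).trans (hw j' c' d' wj').symm) hjj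
    · have h3 := hw j c d wj
      have h4 := hw j' c' d' wj'
      refine ⟨by rcases h3 with rfl | rfl <;> assumption, fun m hm hmW => ?_⟩
      obtain ⟨q, c'', d'', wq, rfl⟩ := cov m hm hmW
      have h5 := hw q c'' d'' wq
      have : q = j ∨ q = j' := by omega
      rcases this with rfl | rfl <;> simp
  · obtain ⟨j, c, d, hj⟩ := hl
    exact ⟨e j, by rw [h.val j c d, hj]⟩
  · intro u hu hW huu
    obtain ⟨j, c, d, wj, rfl⟩ := cov u hu hW
    rcases hw with ⟨hw, hp⟩ | ⟨k, a', b', wk, hk, p₁, p₂, hw⟩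
    · obtain rfl := hw j c d wj
      exact hp
    · have h3 := h.inj _ _ a b c d (huu _ (h.val_ne a b) ((h.wh i a b).2 wi))
      have h4 := h.inj _ _ a' b' c d (huu _ (h.val_ne a' b') ((h.wh k a' b').2 wk))
      omega

lemma Rt.prof_or (hA : FiniteType A) (h : Rt A W ρ) :
    Prof A W ρ ∨ ∃ e, WR A W ρ 2 (cD 2) (fun _ => 1) (fun i => i = 1 ∨ i = 2) e := by
  have hr := h
  rcases h with ⟨n, e, hn, h⟩ | ⟨n, e, hn, h⟩ | ⟨n, e, hn, h⟩ | ⟨n, e, hn, h⟩ | ⟨n, e, hn, h⟩ |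
    ⟨e, h⟩ | ⟨e, h⟩ | ⟨e, h⟩ | ⟨e, h⟩ | ⟨n, e, hn, h⟩ | ⟨e, h⟩
  case D₂ => exact Or.inr ⟨e, h⟩
  all_goals left
  case A =>
    refine h.prof hA hr (fun i a b => ⟨i - 1, by omega, by omega, ?_⟩) ⟨1, le_rfl, hn, rfl⟩
      ⟨1, le_rfl, hn, Or.inl rfl, ?_⟩
    · unfold cA; split_ifs <;> omega
    · rcases hn.eq_or_lt with rfl | hn'
      · refine Or.inl ⟨by omega, Or.inr ?_⟩
        rw [pr_A h le_rfl le_rfl]; rfl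
      · refine Or.inr ⟨n, by omega, le_rfl, Or.inr rfl, by omega, ?_, ?_, by omega⟩
        · rw [pr_A h le_rfl hn]; split_ifs <;> omega
        · rw [pr_A h hn le_rfl]; split_ifs <;> omega
  case B =>
    refine h.prof hA hr (fun i a b => ⟨i - 1, by omega, by omega, ?_⟩) ⟨1, le_rfl, by omega, rfl⟩
      ⟨1, le_rfl, by omega, rfl, Or.inl ⟨fun _ _ _ => id, Or.inl ?_⟩⟩
    · unfold cB; split_ifs <;> omega
    · rw [pr_B hn h le_rfl (by omega)]; rfl
  case B' =>
    refine h.prof hA hr (fun i a b => ⟨i - 1, by omega, by omega, ?_⟩) ⟨1, le_rfl, by omega, rfl⟩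
      ⟨1, le_rfl, by omega, Or.inl rfl, Or.inr ⟨n, by omega, le_rfl, Or.inr rfl, by omega, ?_, ?_,
        by omega⟩⟩
    · unfold cB; split_ifs <;> omega
    · rw [pr_B hn h le_rfl (by omega)]; rfl
    · rw [pr_B hn h (by omega) le_rfl]; split_ifs <;> omega
  case C =>
    refine h.prof hA hr (fun i a b => ⟨i - 1, by omega, by omega, ?_⟩) ⟨1, le_rfl, by omega, rfl⟩
      ⟨2, by omega, by omega, rfl, Or.inl ⟨fun _ _ _ => id, Or.inl ?_⟩⟩
    · unfold cC; split_ifs <;> omega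
    · rw [pr_C hn h (by omega) (by omega)]; rfl
  case C' =>
    refine h.prof hA hr (fun i a b => ⟨i - 1, by omega, by omega, ?_⟩) ⟨1, le_rfl, by omega, rfl⟩
      ⟨1, by omega, by omega, Or.inl rfl, Or.inr ⟨2, by omega, by omega, Or.inr rfl, by omega, ?_, ?_,
        by omega⟩⟩
    · unfold cC; split_ifs <;> omega
    · rw [pr_C hn h (by omega) (by omega)]; norm_num
    · rw [pr_C hn h (by omega) (by omega)]; norm_num
  case F₄ =>
    refine h.prof hA hr (fun i a b => ⟨i - 1, by omega, by omega, ?_⟩) ⟨1, le_rfl, by omega, rfl⟩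
      ⟨4, by omega, by omega, rfl, Or.inl ⟨fun _ _ _ => id, Or.inl ?_⟩⟩
    · unfold cB; split_ifs <;> omega
    · rw [pr_F₄ h (by omega) (by omega)]; rfl
  case G₂ =>
    refine h.prof hA hr (fun i a b => ⟨i - 1, by omega, by omega, ?_⟩) ⟨2, by omega, by omega, rfl⟩
      ⟨1, by omega, by omega, rfl, Or.inl ⟨fun _ _ _ => id, Or.inl ?_⟩⟩
    · unfold cG; split_ifs <;> omega
    · rw [pr_G₂ h (by omega) (by omega)]; rfl
  case G₂' =>
    refine h.prof hA hr (fun i a b => ⟨i - 1, by omega, by omega, ?_⟩) ⟨1, by omega, by omega, rfl⟩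
      ⟨1, by omega, by omega, Or.inl rfl, Or.inr ⟨2, by omega, by omega, Or.inr rfl, by omega, ?_, ?_,
        by omega⟩⟩
    · unfold cG; split_ifs <;> omega
    · rw [pr_G₂' h (by omega) (by omega)]; norm_num
    · rw [pr_G₂' h (by omega) (by omega)]; norm_num
  case D =>
    refine h.prof hA hr (fun i a b => ?_) ⟨n, by omega, le_rfl, by simp [lD]⟩
      ⟨1, by omega, by omega, rfl, Or.inl ⟨fun _ _ _ => id, Or.inr ?_⟩⟩
    · by_cases hi : i = n
      · exact ⟨i - 2, by omega, by omega, by unfold cD; split_ifs <;> omega⟩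
      · exact ⟨i - 1, by omega, by omega, by unfold cD; split_ifs <;> omega⟩
    · rw [pr_D hn h (by omega) (by omega)]; rfl
  case B₃ =>
    refine h.prof hA hr (fun i a b => ⟨i - 1, by omega, by omega, ?_⟩) ⟨1, by omega, by omega, rfl⟩
      ⟨3, by omega, by omega, rfl, Or.inl ⟨fun _ _ _ => id, Or.inr ?_⟩⟩
    · unfold cB; split_ifs <;> omega
    · rw [pr_B₃ h (by omega) (by omega)]; rfl

lemma SuperHeavy.heavy {u : κ} (h : SuperHeavy A σ u) : Heavy A σ u := by
  obtain ⟨x, h1, h2, h3, h4, h5⟩ := h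
  exact ⟨x, h1, h2, h3, by omega, h5⟩

/-- The root itself is the witness, provided that it pairs positively with at most one simple coroot
of its support. -/
lemma WR.superHeavy_of (h : WR A W ρ n C l w e) {j : ℕ} (hj : 1 ≤ j) (hjn : j ≤ n)
    (hp : 2 * pr A ρ (e j) ≤ l j) (hk : ∀ i, 1 ≤ i → i ≤ n → i ≠ j → pr A ρ (e i) ≤ 0) :
    SuperHeavy A ρ (e j) := by
  refine ⟨ρ, h.nonneg, fun _ => id, ?_, ?_, fun k hk0 hk1 => ?_⟩
  · have := h.val_pos hj hjn; omega
  · rwa [h.val j hj hjn]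
  · obtain ⟨i, a, b, rfl⟩ := h.cov k hk1
    exact hk i a b (by rintro rfl; exact hk0 rfl)

lemma WR.heavy_of (h : WR A W ρ n C l w e) {j : ℕ} (hj : 1 ≤ j) (hjn : j ≤ n)
    (hp : pr A ρ (e j) ≤ l j) (hk : ∀ i, 1 ≤ i → i ≤ n → i ≠ j → pr A ρ (e i) ≤ 0) :
    Heavy A ρ (e j) := by
  refine ⟨ρ, h.nonneg, fun _ => id, ?_, ?_, fun k hk0 hk1 => ?_⟩
  · have := h.val_pos hj hjn; omega
  · rwa [h.val j hj hjn]
  · obtain ⟨i, a, b, rfl⟩ := h.cov k hk1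
    exact hk i a b (by rintro rfl; exact hk0 rfl)

/-- The combination `a α_i + b α_j` of two nodes of the support. -/
lemma WR.pair_test (h : WR A W ρ n C l w e) {i j : ℕ} (hi : 1 ≤ i) (hin : i ≤ n) (hj : 1 ≤ j)
    (hjn : j ≤ n) (hij : i ≠ j) {a b : ℤ} (ha : 0 ≤ a) (hb : 0 < b) :
    let x : κ → ℤ := Pi.single (e i) a + Pi.single (e j) b
    (∀ k, 0 ≤ x k) ∧ (∀ k, x k ≠ 0 → ρ k ≠ 0) ∧ x (e j) = b ∧
      pr A x (e j) = a * C i j + b * C j j ∧ pr A x (e i) = a * C i i + b * C j i ∧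
      ∀ k, k ≠ e j → x k ≠ 0 → k = e i := by
  intro x
  have hne := h.ne hi hin hj hjn hij
  have hx : ∀ k, k ≠ e j → x k ≠ 0 → k = e i := by
    intro k hk hk0
    by_contra hki
    exact hk0 (by simp [x, hk, hki])
  refine ⟨fun k => ?_, fun k hk => ?_, by simp [x, hne.symm], ?_, ?_, hx⟩
  · rcases eq_or_ne k (e j) with rfl | hkj
    · simp [x, hne.symm, hb.le]
    · rcases eq_or_ne k (e i) with rfl | hki
      · simp [x, hne, ha]
      · simp [x, hkj, hki]
  · rcases eq_or_ne k (e j) with rfl | hkj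
    · exact h.val_ne hj hjn
    · rw [hx k hkj hk]; exact h.val_ne hi hin
  · simp [x, h.mat _ _ hi hin hj hjn, h.mat _ _ hj hjn hj hjn]
  · simp [x, h.mat _ _ hi hin hi hin, h.mat _ _ hj hjn hi hin]

/-- The root itself does not help, as it pairs to 1 with the first node. The witness `α_{n-1} + 2
α_n` pairs to 2 with the last coroot and to 0 with the one before. -/
lemma heavy_B'_last (hn : 2 ≤ n) (h : WR A W ρ n (cB n) (fun _ => 1) w e) : Heavy A ρ (e n) := by
  obtain ⟨h1, h2, h3, h4, h5, h6⟩ := h.pair_test (i := n - 1) (j := n) (by omega) (by omega)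
    (by omega) le_rfl (by omega) (a := 1) (b := 2) (by norm_num) (by norm_num)
  refine ⟨_, h1, h2, by omega, ?_, fun k hk hk0 => ?_⟩
  · rw [h4, h3]; unfold cB; split_ifs <;> omega
  · rw [h6 k hk hk0, h5]; unfold cB; split_ifs <;> omega

/-- The witnesses are the dominant roots of `G₂`: the short one `2 α₁ + α₂` for the first node, the
highest root `3 α₁ + 2 α₂` for the second. -/
lemma superHeavy_G₂' (h : WR A W ρ 2 cG (fun _ => 1) w e) :
    SuperHeavy A ρ (e 1) ∧ SuperHeavy A ρ (e 2) := by
  constructor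
  · obtain ⟨h1, h2, h3, h4, h5, h6⟩ := h.pair_test (i := 2) (j := 1) (by omega) (by omega)
      (by omega) (by omega) (by omega) (a := 1) (b := 2) (by norm_num) (by norm_num)
    refine ⟨_, h1, h2, by omega, ?_, fun k hk hk0 => ?_⟩
    · rw [h4, h3]; simp [cG]
    · rw [h6 k hk hk0, h5]; simp [cG]
  · obtain ⟨h1, h2, h3, h4, h5, h6⟩ := h.pair_test (i := 1) (j := 2) (by omega) (by omega)
      (by omega) (by omega) (by omega) (a := 3) (b := 2) (by norm_num) (by norm_num)
    refine ⟨_, h1, h2, by omega, ?_, fun k hk hk0 => ?_⟩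
    · rw [h4, h3]; simp [cG]
    · rw [h6 k hk hk0, h5]; simp [cG]

/-- The root has coefficient 2 at the second node and pairs there to 1. -/
lemma superHeavy_C (hn : 3 ≤ n) (h : WR A W ρ n (cC n) (lC n) w e) : SuperHeavy A ρ (e 2) := by
  refine h.superHeavy_of (by omega) (by omega) ?_ fun i a b hi => ?_
  · rw [pr_C hn h (by omega) (by omega)]; unfold lC; split_ifs <;> omega
  · rw [pr_C hn h a b]; simp [hi]

/-- Adding `α₁` to the root gives the highest root of `C_n`, which pairs to 2 with the first coroot,
where its coefficient is 2, and to 0 with the others. -/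
lemma heavy_C'_first (hA : FiniteType A) (hn : 3 ≤ n) (h : WR A W ρ n (cC n) (lC n) w e) :
    Heavy A ρ (e 1) := by
  have h1 := h.val_ne (i := 1) le_rfl (by omega)
  refine ⟨ρ + Pi.single (e 1) 1, fun k => ?_, fun k hk hk0 => ?_, ?_, ?_, fun k hk hk0 => ?_⟩
  · have := h.nonneg k
    rcases eq_or_ne k (e 1) with rfl | hk
    · simp; omega
    · simp [hk, this]
  · rcases eq_or_ne k (e 1) with rfl | hk'
    · exact h1 hk0
    · exact hk (by simp [hk', hk0])
  · have := h.val_pos (i := 1) le_rfl (by omega)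
    simp; omega
  · rw [pr_add, pr_C hn h (by omega) (by omega), pr_single, hA.diag, Pi.add_apply,
      h.val 1 (by omega) (by omega)]
    simp [lC]
  · obtain ⟨i, a, b, rfl⟩ := h.cov k (by simpa [hk] using hk0)
    have : i ≠ 1 := by rintro rfl; exact hk rfl
    rw [pr_add, pr_C hn h a b, pr_single, h.mat 1 i (by omega) (by omega) a b]
    unfold cC; split_ifs <;> omega

/-- A weak spherical root is of type `A` or `D₂`, or only simple chains can be attached to it. -/
lemma Rt.heavy_or (hA : FiniteType A) (h : Rt A W ρ) :
    (∃ n e, 1 ≤ n ∧ WR A W ρ n cA (fun _ => 1) (fun i => i = 1 ∨ i = n) e) ∨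
    (∃ e, WR A W ρ 2 (cD 2) (fun _ => 1) (fun i => i = 1 ∨ i = 2) e) ∨
    ∀ u, ρ u ≠ 0 → W u → Heavy A ρ u := by
  have key : ∀ {n C l w e}, WR A W ρ n C l w e → (∀ i, 1 ≤ i → i ≤ n → w i → Heavy A ρ (e i)) →
      ∀ u, ρ u ≠ 0 → W u → Heavy A ρ u := by
    intro n C l w e h H u hu hW
    obtain ⟨i, a, b, rfl⟩ := h.cov u hu
    exact H i a b ((h.wh i a b).1 hW)
  rcases h with ⟨n, e, hn, h⟩ | ⟨n, e, hn, h⟩ | ⟨n, e, hn, h⟩ | ⟨n, e, hn, h⟩ | ⟨n, e, hn, h⟩ |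
    ⟨e, h⟩ | ⟨e, h⟩ | ⟨e, h⟩ | ⟨e, h⟩ | ⟨n, e, hn, h⟩ | ⟨e, h⟩
  case A => exact Or.inl ⟨n, e, hn, h⟩
  case D₂ => exact Or.inr (Or.inl ⟨e, h⟩)
  all_goals refine Or.inr (Or.inr (key h fun i a b hi => ?_))
  case B =>
    subst hi
    refine h.heavy_of a b ?_ fun i a b hi => ?_ <;> rw [pr_B hn h a b] <;> simp [*]
  case B' =>
    rcases hi with rfl | rfl
    · refine h.heavy_of a b ?_ fun i a b hi => ?_ <;> rw [pr_B hn h a b] <;> simp [*]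
    · exact heavy_B'_last hn h
  case C => exact hi ▸ (superHeavy_C hn h).heavy
  case C' =>
    rcases hi with rfl | rfl
    · exact heavy_C'_first hA hn h
    · exact (superHeavy_C hn h).heavy
  case F₄ =>
    subst hi
    refine h.heavy_of a b ?_ fun i a b hi => ?_ <;> rw [pr_F₄ h a b] <;> simp [*, lF]
  case G₂ =>
    subst hi
    refine h.heavy_of a b ?_ fun i a b hi => ?_ <;> rw [pr_G₂ h a b] <;> simp [*]
  case G₂' =>
    rcases hi with rfl | rfl
    · exact (superHeavy_G₂' h).1.heavy
    · exact (superHeavy_G₂' h).2.heavy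
  case D =>
    subst hi
    refine h.heavy_of a b ?_ fun i a b hi => ?_ <;> rw [pr_D hn h a b]
    · unfold lD; split_ifs <;> omega
    · simp [hi]
  case B₃ =>
    subst hi
    refine h.heavy_of a b ?_ fun i a b hi => ?_ <;> rw [pr_B₃ h a b] <;> simp [*]

lemma superHeavy_F₄ (h : WR A W ρ 4 (cB 3) lF w e) : SuperHeavy A ρ (e 4) := by
  refine h.superHeavy_of (by omega) (by omega) ?_ fun i a b hi => ?_
  · rw [pr_F₄ h (by omega) (by omega)]; simp [lF]
  · rw [pr_F₄ h a b]; simp [hi]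

lemma superHeavy_G₂ (h : WR A W ρ 2 cG (fun i => 3 - i) w e) : SuperHeavy A ρ (e 1) := by
  refine h.superHeavy_of (by omega) (by omega) ?_ fun i a b hi => ?_
  · rw [pr_G₂ h (by omega) (by omega)]; simp
  · rw [pr_G₂ h a b]; simp [hi]

end Profiles
end WeakSpherical

namespace WeakSpherical

section Disjoint

variable {κ : Type*} [Fintype κ] [DecidableEq κ] {A : κ → κ → ℤ} {W : κ → Prop} {σ τ ρ : κ → ℤ}

/-! ### Roots with disjoint connected supports -/

lemma Rt.nonneg (h : Rt A W ρ) (k : κ) : 0 ≤ ρ k := by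
  cases h with
  | A _ _ _ h | B _ _ _ h | B' _ _ _ h | C _ _ _ h | C' _ _ _ h | F₄ _ h | G₂ _ h | G₂' _ h
  | D₂ _ h | D _ _ _ h | B₃ _ h => exact h.nonneg k

/-- At a node outside the support the pairing is a sum of nonpositive terms. It vanishes at a black
node, so each term does. -/
lemma Sys.black₁ (hA : FiniteType A) (h : Sys A W σ τ) {k j : κ} (hW : ¬ W k) (hk : σ k = 0)
    (hj : σ j ≠ 0) : A j k = 0 := by
  by_contra ha
  have h1 := (h.black k hW).1
  have h2 := hA.pr_neg h.root₁.nonneg hk hj ha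
  have := h.root₁.nonneg j
  omega

lemma Sys.black₂ (hA : FiniteType A) (h : Sys A W σ τ) {k j : κ} (hW : ¬ W k) (hk : τ k = 0)
    (hj : τ j ≠ 0) : A j k = 0 := (h.swap hA).black₁ hA hW hk hj

/-- The end nodes of an edge that is contained in neither of the supports are white. -/
lemma Sys.white_edge (hA : FiniteType A) (h : Sys A W σ τ) {i j : κ} (hi : σ i ≠ 0) (hi' : τ i = 0)
    (hj : τ j ≠ 0) (hj' : σ j = 0) (ha : A i j ≠ 0) : W i ∧ W j := by
  constructor <;> by_contra hW
  · exact hA.ne_zero_symm ha (h.black₂ hA hW hi' hj)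
  · exact ha (h.black₁ hA hW hj' hi)

/-- Two white nodes of a connected support have pairings at most 1 and all other nodes pairing 0, so
a second neighbour would close a forbidden cycle. -/
lemma Prof.unique_nbr (hA : FiniteType A) (p : Prof A W ρ) {a u u' : κ} (ha : ρ a = 0)
    (hu : ρ u ≠ 0) (hu' : ρ u' ≠ 0) (hW : W u) (hW' : W u') (h : A u a ≠ 0) (h' : A u' a ≠ 0) :
    u = u' := by
  by_contra hne
  have h2 := p.two u u' hu hu' hW hW' hne
  have h3 := p.two u' u hu' hu hW' hW (Ne.symm hne)
  refine hA.false_of_cycle p.nonneg hne hu hu' ha h h' h2.1 h3.1 fun i h4 h5 hi => ?_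
  by_cases hWi : W i
  · rcases h2.2 i hi hWi with rfl | rfl <;> contradiction
  · exact (p.black i hi hWi).le

/-- A second edge could share neither end with the first. Its ends and those of the first edge would
then be all the white nodes; each pairs to at most 1 with its own root and to at most `-1` with the
other one, so `σ + τ` would be antidominant. -/
lemma Sys.unique_edge (hA : FiniteType A) (h : Sys A W σ τ) (p : Prof A W σ) (q : Prof A W τ)
    (hd : ∀ k, σ k = 0 ∨ τ k = 0) {u v i j : κ} (hu : σ u ≠ 0) (hv : τ v ≠ 0) (huv : A u v ≠ 0)
    (hi : σ i ≠ 0) (hj : τ j ≠ 0) (hij : A i j ≠ 0) : i = u ∧ j = v := by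
  have du := (hd u).resolve_left hu
  have dv := (hd v).resolve_right hv
  have di := (hd i).resolve_left hi
  have dj := (hd j).resolve_right hj
  obtain ⟨wu, wv⟩ := h.white_edge hA hu du hv dv huv
  obtain ⟨wi, wj⟩ := h.white_edge hA hi di hj dj hij
  have key₁ : i = u → j = v := by
    rintro rfl
    exact q.unique_nbr hA di hj hv wj wv (hA.ne_zero_symm hij) (hA.ne_zero_symm huv)
  have key₂ : j = v → i = u := by
    rintro rfl
    exact p.unique_nbr hA dj hi hu wi wu hij huv
  by_contra hne
  have h1 : i ≠ u := fun h => hne ⟨h, key₁ h⟩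
  have h2 : j ≠ v := fun h => hne ⟨key₂ h, h⟩
  refine hA.false_of_add p.nonneg q.nonneg (fun k => ?_) hu
  have hσ : ∀ {k}, τ k = 0 → pr A τ k ≤ 0 := fun h => hA.pr_nonpos q.nonneg h
  have hτ : ∀ {k}, σ k = 0 → pr A σ k ≤ 0 := fun h => hA.pr_nonpos p.nonneg h
  by_cases hW : W k
  · by_cases hk : σ k = 0
    · have hk' := (h.cover k).resolve_left (by simp [hk])
      have nn := p.nonneg
      rcases (q.two j v hj hv wj wv h2).2 k hk' hW with rfl | rfl
      · have := (q.two k v hj hv wj wv h2).1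
        have := hA.pr_neg nn hk hi hij
        have := nn i
        omega
      · have := (q.two k j hv hj wv wj h2.symm).1
        have := hA.pr_neg nn hk hu huv
        have := nn u
        omega
    · have hk' := (hd k).resolve_left hk
      have nn := q.nonneg
      rcases (p.two i u hi hu wi wu h1).2 k hk hW with rfl | rfl
      · have := (p.two k u hi hu wi wu h1).1
        have := hA.pr_neg nn hk' hj (hA.ne_zero_symm hij)
        have := nn j
        omega
      · have := (p.two k i hu hi wu wi h1.symm).1
        have := hA.pr_neg nn hk' hv (hA.ne_zero_symm huv)
        have := nn v
        omega
  · have := h.black k hW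
    omega

lemma WR.rev {n : ℕ} {e : ℕ → κ}
    (h : WR A W ρ n cA (fun _ => 1) (fun i => i = 1 ∨ i = n) e) :
    WR A W ρ n cA (fun _ => 1) (fun i => i = 1 ∨ i = n) (fun i => e (n + 1 - i)) where
  mat i j a b c d := by
    rw [h.mat _ _ (by omega) (by omega) (by omega) (by omega)]
    unfold cA; split_ifs <;> omega
  val i a b := h.val _ (by omega) (by omega)
  cov k hk := by
    obtain ⟨i, a, b, rfl⟩ := h.cov k hk
    exact ⟨n + 1 - i, by omega, by omega, by congr 1; omega⟩
  wh i a b := by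
    rw [h.wh _ (by omega) (by omega)]
    omega
  inj i j a b c d hij := by
    have := h.inj _ _ (by omega) (by omega) (by omega) (by omega) hij
    omega
  pos i a b := by norm_num

variable {p q n m : ℕ} {e g : ℕ → κ} {C D C₁ C₂ : ℕ → ℕ → ℤ} {l l₁ l₂ : ℕ → ℤ} {v v₁ v₂ : ℕ → Prop}

lemma WR.edge (h : WR A W ρ n C l v e) {i j : ℕ} (hi : 1 ≤ i ∧ i ≤ n) (hj : 1 ≤ j ∧ j ≤ n)
    (hC : C i j ≠ 0) : A (e i) (e j) ≠ 0 := by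
  rwa [h.mat i j hi.1 hi.2 hj.1 hj.2]

lemma WR.nodup (h : WR A W ρ n C l v e) {L : List ℕ} (hL : L.Nodup) (hn : ∀ i ∈ L, 1 ≤ i ∧ i ≤ n) :
    (L.map e).Nodup := by
  refine hL.map_on fun i hi j hj hij => ?_
  exact h.inj _ _ (hn i hi).1 (hn i hi).2 (hn j hj).1 (hn j hj).2 hij

/-- Nodes of two disjoint supports are distinct. -/
lemma nodup_of_disjoint (hd : ∀ k, σ k = 0 ∨ τ k = 0) (he : WR A W σ n C₁ l₁ v₁ e)
    (hg : WR A W τ m C₂ l₂ v₂ g) (L M : List ℕ) (hL : L.Nodup) (hM : M.Nodup)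
    (hLn : ∀ i ∈ L, 1 ≤ i ∧ i ≤ n) (hMm : ∀ i ∈ M, 1 ≤ i ∧ i ≤ m) :
    (L.map e ++ M.map g).Nodup := by
  refine (he.nodup hL hLn).append (hg.nodup hM hMm) ?_
  intro x hx hx'
  obtain ⟨i, hi, rfl⟩ := List.mem_map.1 hx
  obtain ⟨j, hj, hij⟩ := List.mem_map.1 hx'
  have h1 := he.val_ne (hLn i hi).1 (hLn i hi).2
  have h2 := hg.val_ne (hMm j hj).1 (hMm j hj).2
  rw [hij] at h2
  exact (hd _).elim h1 h2

/-- With a single edge between the supports, the comparison of mixed matrix entries reduces to its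
two entries and to zeros elsewhere. -/
lemma Glue.inTable_of_edge {C : Matrix (Fin n) (Fin n) ℤ} {s t : ℕ → ℕ} {w : Set ℕ}
    {hT : RankTwoTable n C s t w} {r₁ : RtEntry p C₁ l₁ v₁} {φ₁ ψ₁ : ℕ → ℕ}
    {r₂ : RtEntry q C₂ l₂ v₂} {φ₂ ψ₂ : ℕ → ℕ} (h : Glue hT D r₁ φ₁ ψ₁ r₂ φ₂ ψ₂) (hA : FiniteType A)
    (he : WR A W σ p C₁ l₁ v₁ e) (hg : WR A W τ q C₂ l₂ v₂ g) (hcov : ∀ k, σ k ≠ 0 ∨ τ k ≠ 0)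
    (hd : ∀ k, σ k = 0 ∨ τ k = 0) {a b : ℕ} {x y : ℤ} (hx : A (e a) (g b) = x)
    (hy : A (g b) (e a) = y)
    (hc : ∀ i j, 1 ≤ i → i ≤ p → 1 ≤ j → j ≤ q → i = a ∧ j = b ∨ A (e i) (g j) = 0)
    (hst : ∀ k, s k = 0 ∨ t k = 0)
    (hD : D (φ₁ a) (φ₂ b) = x ∧ D (φ₂ b) (φ₁ a) = y ∧ ∀ i j, 1 ≤ i → i ≤ p → 1 ≤ j → j ≤ q →
      i = a ∧ j = b ∨ D (φ₁ i) (φ₂ j) = 0 ∧ D (φ₂ j) (φ₁ i) = 0) : InTable A W σ τ := by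
  refine h.inTable_of_disjoint hA he hg hcov hd hst fun i j a₁ b₁ a₂ b₂ => ?_
  by_cases hij : i = a ∧ j = b
  · obtain ⟨rfl, rfl⟩ := hij
    exact ⟨hx.trans hD.1.symm, hy.trans hD.2.1.symm⟩
  · have h1 := (hc i j a₁ b₁ a₂ b₂).resolve_left hij
    have h2 := (hD.2.2 i j a₁ b₁ a₂ b₂).resolve_left hij
    exact ⟨h1.trans h2.1.symm, (hA.symm _ _ h1).trans h2.2.symm⟩

/-- The edge between the two chains decides: a simple one gives type `A`, a double one `B`, `C` or
`F₄`, a triple one `G₂`. Longer chains next to a multiple edge contain an affine diagram. An edge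
always has an entry `-1`; the last hypothesis fixes which one it is. -/
lemma disjoint_A_A (hA : FiniteType A) (h : Sys A W σ τ) (hd : ∀ k, σ k = 0 ∨ τ k = 0) (hp : 1 ≤ p)
    (hq : 1 ≤ q) (he : WR A W σ p cA (fun _ => 1) (fun i => i = 1 ∨ i = p) e)
    (hg : WR A W τ q cA (fun _ => 1) (fun i => i = 1 ∨ i = q) g)
    (hc : ∀ i j, 1 ≤ i → i ≤ p → 1 ≤ j → j ≤ q → i = p ∧ j = 1 ∨ A (e i) (g j) = 0)
    (h1 : A (g 1) (e p) = -1) : InTable A W σ τ := by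
  have hg' : WR A W τ (p + q - p) cA (fun _ => 1) (fun i => i = 1 ∨ i = p + q - p) g := by
    rwa [Nat.add_sub_cancel_left]
  have n₀ : e p ≠ g 1 := by
    simpa using nodup_of_disjoint hd he hg [p] [1] (by simp) (by simp) (by simp; omega)
      (by simp; omega)
  have ee : ∀ i j, 1 ≤ i → i ≤ p → 1 ≤ j → j ≤ p → i + 1 = j ∨ j + 1 = i →
      A (e i) (e j) ≠ 0 := fun i j a b c d hij =>
    he.edge ⟨a, b⟩ ⟨c, d⟩ (by unfold cA; split_ifs <;> omega)
  have gg : ∀ i j, 1 ≤ i → i ≤ q → 1 ≤ j → j ≤ q → i + 1 = j ∨ j + 1 = i →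
      A (g i) (g j) ≠ 0 := fun i j a b c d hij =>
    hg.edge ⟨a, b⟩ ⟨c, d⟩ (by unfold cA; split_ifs <;> omega)
  have h0 : A (e p) (g 1) ≠ 0 := hA.ne_zero_symm (by omega)
  rcases hA.edge_cases n₀ h0 with h2 | h2 | h2 | h2 | h2
  · refine (glue_A_a (p + q) p hp (by omega)).inTable_of_edge hA he hg' h.cover hd h2.1 h2.2
      (fun i j a b c d => hc i j a b c (by omega)) ?_ ⟨?_, ?_, ?_⟩
    · intro k; unfold seg; split_ifs <;> omega
    · simp only [cA]; split_ifs <;> omega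
    · simp only [cA]; split_ifs <;> omega
    · intro i j a b c d; simp only [cA]; split_ifs <;> omega
  · rcases hq.eq_or_lt with rfl | hq'
    · refine (glue_B_a_one p hp).inTable_of_edge hA he hg h.cover hd h2.1 h2.2 hc ?_ ⟨?_, ?_, ?_⟩
      · intro k; unfold seg; split_ifs <;> omega
      · simp only [cB]; split_ifs <;> omega
      · simp only [cB]; split_ifs <;> omega
      · intro i j a b c d; simp only [cB]; split_ifs <;> omega
    -- For `p = 1` the node `e 1` is the long end of `C_{q+1}`. The chain `g` has to be read
    -- backwards, and the two roots change roles.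
    rcases hp.eq_or_lt with rfl | hp'
    · have hg₁ : WR A W τ (q + 1 - 1) cA (fun _ => 1) (fun i => i = 1 ∨ i = q + 1 - 1) g := by
        rwa [Nat.add_sub_cancel]
      have hr : g (q + 1 - 1 + 1 - q) = g 1 := by congr 1; omega
      refine InTable.swap ((glue_C_e (q + 1) (by omega)).inTable_of_edge hA hg₁.rev he
        (h.swap hA).cover (fun k => (hd k).symm) (a := q) (b := 1) (hr ▸ h2.2) (hr ▸ h2.1) ?_ ?_
          ⟨?_, ?_, ?_⟩)
      · intro i j a b c d
        refine (hc j (q + 1 - 1 + 1 - i) c d (by omega) (by omega)).imp (fun h => ?_)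
          (hA.symm _ _)
        omega
      · intro k; unfold seg α; split_ifs <;> omega
      · simp only [cC]; split_ifs <;> omega
      · simp only [cC]; split_ifs <;> omega
      · intro i j a b c d; simp only [cC]; split_ifs <;> omega
    by_cases h22 : p = 2 ∧ q = 2
    · obtain ⟨rfl, rfl⟩ := h22
      refine glue_F₄_a.inTable_of_edge hA he hg h.cover hd h2.1 h2.2 hc ?_ ⟨rfl, rfl, ?_⟩
      · intro k; simp only [α, Pi.add_apply]; split_ifs <;> omega
      · intro i j a b c d
        interval_cases i <;> interval_cases j <;> simp [cB, ofList]
    · exfalso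
      by_cases hq3 : 3 ≤ q
      · exact hA.false_of_F (x₁ := g 3) (x₂ := g 2) (x₃ := g 1) (x₄ := e p) (x₅ := e (p - 1))
          (nodup_of_disjoint (fun k => (hd k).symm) hg he [3, 2, 1] [p, p - 1] (by simp)
            (by simp; omega) (by simp; omega) (by simp; omega))
          (gg _ _ (by omega) hq3 (by omega) (by omega) (by omega))
          (gg _ _ (by omega) (by omega) (by omega) (by omega) (by omega)) (by omega)
          (ee _ _ (by omega) (by omega) (by omega) (by omega) (by omega)) (by omega)
      · exact hA.false_of_F (x₁ := e (p - 2)) (x₂ := e (p - 1)) (x₃ := e p) (x₄ := g 1) (x₅ := g 2)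
          (nodup_of_disjoint hd he hg [p - 2, p - 1, p] [1, 2] (by simp; omega)
            (by simp) (by simp; omega) (by simp; omega))
          (ee _ _ (by omega) (by omega) (by omega) (by omega) (by omega))
          (ee _ _ (by omega) (by omega) (by omega) (by omega) (by omega)) h0
          (gg _ _ (by omega) (by omega) (by omega) (by omega) (by omega)) (by omega)
  · by_cases hp' : p = 1
    · subst hp'
      by_cases hq' : q = 1
      · subst hq'
        refine InTable.swap (glue_G₂_a.inTable_of_edge hA hg he (h.swap hA).cover
          (fun k => (hd k).symm) (a := 1) (b := 1) h2.2 h2.1 (fun i j a b c d => by omega) ?_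
          ⟨rfl, rfl, fun i j a b c d => by omega⟩)
        intro k; simp only [α]; split_ifs <;> omega
      · have := nodup_of_disjoint (fun k => (hd k).symm) hg he [2, 1] [1] (by simp) (by simp)
          (by simp; omega) (by simp)
        simp at this
        exact (hA.false_of_triple this.1.1 this.1.2 this.2
          (gg 2 1 (by omega) (by omega) (by omega) (by omega) (by omega)) (by omega)).elim
    · have := nodup_of_disjoint hd he hg [p - 1, p] [1] (by simp; omega) (by simp)
        (by simp; omega) (by simp; omega)
      simp at this
      exact (hA.false_of_triple this.1.1 this.1.2 this.2
        (ee (p - 1) p (by omega) (by omega) (by omega) (by omega) (by omega)) (by omega)).elim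
  · omega
  · omega

end Disjoint
end WeakSpherical

namespace WeakSpherical

/-! ### Disjoint connected supports, one root being of type `A` -/

section DisjointConnected

variable {κ : Type*} [Fintype κ] [DecidableEq κ] {A : κ → κ → ℤ} {W : κ → Prop} {σ τ ρ : κ → ℤ}
  {p q n m : ℕ} {e g : ℕ → κ} {C : ℕ → ℕ → ℤ} {l : ℕ → ℤ} {w : ℕ → Prop}

/-- A root of type `D₂` pairs to 2 with each of its two white nodes, where a profile with two white
nodes allows at most 1. -/
lemma WR.not_prof (h : WR A W ρ 2 (cD 2) (fun _ => 1) w e) (hw : ∀ i, 1 ≤ i → i ≤ 2 → w i)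
    (hp : Prof A W ρ) : False := by
  have h1 := (hp.two (e 1) (e 2) (h.val_ne le_rfl (by omega)) (h.val_ne (by omega) le_rfl)
    ((h.wh 1 le_rfl (by omega)).2 (hw 1 le_rfl (by omega)))
    ((h.wh 2 (by omega) le_rfl).2 (hw 2 (by omega) le_rfl))
    (h.ne le_rfl (by omega) (by omega) le_rfl (by omega))).1
  rw [pr_D₂ h le_rfl (by omega)] at h1
  omega

lemma disjoint_A (hA : FiniteType A) (h : Sys A W σ τ) (hd : ∀ k, σ k = 0 ∨ τ k = 0)
    (pσ : Prof A W σ) (pτ : Prof A W τ) (hp : 1 ≤ p)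
    (he : WR A W σ p cA (fun _ => 1) (fun i => i = 1 ∨ i = p) e) {v : κ} (hv : τ v ≠ 0)
    (ha : A (e p) v ≠ 0) : InTable A W σ τ := by
  have hu := he.val_ne hp le_rfl
  have hne : e p ≠ v := by
    rintro rfl
    exact (hd _).elim hu hv
  have hvσ := (hd v).resolve_right hv
  have hW := (h.white_edge hA hu ((hd _).resolve_left hu) hv hvσ ha).2
  have hd' : ∀ k, τ k = 0 ∨ σ k = 0 := fun k => (hd k).symm
  have ee : ∀ i j, 1 ≤ i → i ≤ p → 1 ≤ j → j ≤ p → i + 1 = j ∨ j + 1 = i →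
      A (e i) (e j) ≠ 0 := fun i j a b c d hij =>
    he.edge ⟨a, b⟩ ⟨c, d⟩ (by unfold cA; split_ifs <;> omega)
  have uniq : ∀ {m C l w g b}, WR A W τ m C l w g → 1 ≤ b → b ≤ m → v = g b →
      ∀ i j, 1 ≤ i → i ≤ p → 1 ≤ j → j ≤ m → i = p ∧ j = b ∨ A (e i) (g j) = 0 := by
    intro m C l w g b hg b₁ b₂ hb i j a₁ a₂ c₁ c₂
    by_contra! hc
    have h1 := h.unique_edge hA pσ pτ hd hu hv ha (he.val_ne a₁ a₂) (hg.val_ne c₁ c₂) hc.2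
    rw [hb] at h1
    exact hc.1 (he.inj _ _ a₁ a₂ hp le_rfl h1.1) (hg.inj _ _ c₁ c₂ b₁ b₂ h1.2)
  have typeA : ∀ {m g}, 1 ≤ m → WR A W τ m cA (fun _ => 1) (fun i => i = 1 ∨ i = m) g →
      InTable A W σ τ := by
    intro m g hm hg
    obtain ⟨f, hf, hfv⟩ : ∃ f, WR A W τ m cA (fun _ => 1) (fun i => i = 1 ∨ i = m) f ∧ v = f 1 := by
      obtain ⟨b, b₁, b₂, hb⟩ := hg.cov v hv
      rcases (hg.wh b b₁ b₂).1 (hb ▸ hW) with rfl | rfl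
      · exact ⟨g, hg, hb⟩
      · exact ⟨_, hg.rev, hb⟩
    have hc := uniq hf le_rfl hm hfv
    subst hfv
    -- If this entry is not `-1`, the opposite one is: exchange the roots and reverse both chains.
    by_cases h1 : A (f 1) (e p) = -1
    · exact disjoint_A_A hA h hd hp hm he hf hc h1
    · have hrf : f (m + 1 - m) = f 1 := by congr 1; omega
      refine InTable.swap (disjoint_A_A hA (h.swap hA) hd' hm hp hf.rev he.rev ?_ ?_)
      · intro i j a b c d
        refine (hc (p + 1 - j) (m + 1 - i) (by omega) (by omega) (by omega) (by omega)).imp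
          (fun h => by omega) (hA.symm _ _)
      · have := hA.edge_cases hne ha
        rw [hrf]
        simp only [Nat.add_sub_cancel]
        omega
  rcases h.root₂.heavy_or hA with ⟨m, g, hm, hg⟩ | ⟨g, hg⟩ | hH
  · exact typeA hm hg
  · exact (hg.not_prof (fun i a b => by omega) pτ).elim
  replace hH := hH v hv hW
  obtain ⟨s₂, s₁⟩ := hH.simple hA ((hd _).resolve_left hu) (hA.ne_zero_symm ha)
  have sup : ¬ SuperHeavy A τ v := fun hs => hA.ne_zero_symm ha (hs.isolated hA ((hd _).resolve_left hu))
  have r := h.root₂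
  rcases r with ⟨m, g, hm, hg⟩ | ⟨m, g, hm, hg⟩ | ⟨m, g, hm, hg⟩ | ⟨m, g, hm, hg⟩ | ⟨m, g, hm, hg⟩ |
    ⟨g, hg⟩ | ⟨g, hg⟩ | ⟨g, hg⟩ | ⟨g, hg⟩ | ⟨m, g, hm, hg⟩ | ⟨g, hg⟩
  all_goals
    obtain ⟨b, b₁, b₂, rfl⟩ := hg.cov v hv
    have hc := uniq hg b₁ b₂ rfl
    have hb := (hg.wh b b₁ b₂).1 hW
  case A => exact typeA hm hg
  case B =>
    subst hb
    refine (glue_B_a' (p + m) p hp (by omega)).inTable_of_edge hA he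
      (by rwa [Nat.add_sub_cancel_left]) h.cover hd s₁ s₂
      (fun i j a b c d => hc i j a b c (by omega)) ?_ ⟨?_, ?_, ?_⟩
    · intro k; unfold seg; split_ifs <;> omega
    · simp only [cB]; split_ifs <;> omega
    · simp only [cB]; split_ifs <;> omega
    · intro i j a b c d; simp only [cB]; split_ifs <;> omega
  case B' =>
    rcases hb with rfl | rfl
    · refine (glue_B_a (p + m) p hp (by omega)).inTable_of_edge hA he
        (by rwa [Nat.add_sub_cancel_left]) h.cover hd s₁ s₂
        (fun i j a b c d => hc i j a b c (by omega)) ?_ ⟨?_, ?_, ?_⟩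
      · intro k; unfold seg; split_ifs <;> omega
      · simp only [cB]; split_ifs <;> omega
      · simp only [cB]; split_ifs <;> omega
      · intro i j a b c d; simp only [cB]; split_ifs <;> omega
    have gg : ∀ i j, 1 ≤ i → i ≤ b → 1 ≤ j → j ≤ b → i + 1 = j ∨ j + 1 = i →
        A (g i) (g j) ≠ 0 := fun i j a₁ a₂ c d hij =>
      hg.edge ⟨a₁, a₂⟩ ⟨c, d⟩ (by unfold cB; split_ifs <;> omega)
    have gd : A (g (b - 1)) (g b) ≤ -2 := by
      rw [hg.mat _ _ (by omega) (by omega) b₁ b₂]; unfold cB; split_ifs <;> omega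
    -- Attaching a chain to the short end of `B_b` gives type `C` for `b = 2`, and `F₄` for `b = 3`
    -- and `p = 1`; beyond that there is a forbidden chain of five nodes.
    obtain rfl | rfl | hb4 : b = 2 ∨ b = 3 ∨ 4 ≤ b := by omega
    · refine (glue_C_d_two p hp).inTable_of_edge hA he hg h.cover hd s₁ s₂ hc ?_ ⟨?_, ?_, ?_⟩
      · intro k
        simp only [seg, α, Pi.add_apply, Pi.smul_apply, smul_eq_mul]; split_ifs <;> omega
      · simp only [cC]; split_ifs <;> omega
      · simp only [cC]; split_ifs <;> omega
      · intro i j a b c d; simp only [cC]; split_ifs <;> omega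
    · rcases hp.eq_or_lt with rfl | hp'
      · refine InTable.swap (glue_F₄_b.inTable_of_edge hA hg he (h.swap hA).cover hd' (a := 3)
          (b := 1) s₂ s₁ ?_ ?_ ⟨rfl, rfl, ?_⟩)
        · intro i j a b c d
          exact (hc j i c d a b).imp (fun h => h.symm) (hA.symm _ _)
        · intro k
          simp only [α, Pi.add_apply]; split_ifs <;> omega
        · intro i j a b c d
          interval_cases i <;> interval_cases j <;> simp [cB, ofList]
      · exact (hA.false_of_F (x₁ := e (p - 1)) (x₂ := e p) (x₃ := g 3) (x₄ := g 2) (x₅ := g 1)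
          (nodup_of_disjoint hd he hg [p - 1, p] [3, 2, 1] (by simp; omega) (by simp)
            (by simp; omega) (by simp))
          (ee _ _ (by omega) (by omega) (by omega) (by omega) (by omega)) ha
          (gg _ _ (by omega) (by omega) (by omega) (by omega) (by omega))
          (gg _ _ (by omega) (by omega) (by omega) (by omega) (by omega)) (Or.inr gd)).elim
    · exact (hA.false_of_F (x₁ := g (b - 3)) (x₂ := g (b - 2)) (x₃ := g (b - 1)) (x₄ := g b)
          (x₅ := e p)
          (nodup_of_disjoint hd' hg he [b - 3, b - 2, b - 1, b] [p] (by simp; omega) (by simp)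
            (by simp; omega) (by simp; omega))
          (gg _ _ (by omega) (by omega) (by omega) (by omega) (by omega))
          (gg _ _ (by omega) (by omega) (by omega) (by omega) (by omega))
          (gg _ _ (by omega) (by omega) (by omega) (by omega) (by omega))
          (hA.ne_zero_symm ha) (Or.inl gd)).elim
  case C => exact (sup (hb ▸ superHeavy_C hm hg)).elim
  case C' =>
    rcases hb with rfl | rfl
    · refine (glue_C_d (p + m) p hp (by omega)).inTable_of_edge hA he
        (by rwa [Nat.add_sub_cancel_left]) h.cover hd s₁ s₂
        (fun i j a b c d => hc i j a b c (by omega)) ?_ ⟨?_, ?_, ?_⟩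
      · intro k
        simp only [seg, α, Pi.add_apply, Pi.smul_apply, smul_eq_mul]; split_ifs <;> omega
      · simp only [cC]; split_ifs <;> omega
      · simp only [cC]; split_ifs <;> omega
      · intro i j a b c d; simp only [cC]; split_ifs <;> omega
    · exact (sup (superHeavy_C hm hg)).elim
  case F₄ => exact (sup (hb ▸ superHeavy_F₄ hg)).elim
  case G₂ => exact (sup (hb ▸ superHeavy_G₂ hg)).elim
  case G₂' =>
    rcases hb with rfl | rfl
    exacts [(sup (superHeavy_G₂' hg).1).elim, (sup (superHeavy_G₂' hg).2).elim]
  case D₂ => exact (hg.not_prof (fun i a b => by omega) pτ).elim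
  case D =>
    subst hb
    refine (glue_D_a (p + m) p hp (by omega)).inTable_of_edge hA he
      (by rwa [Nat.add_sub_cancel_left]) h.cover hd s₁ s₂
      (fun i j a b c d => hc i j a b c (by omega)) ?_ ⟨?_, ?_, ?_⟩
    · intro k
      simp only [seg, α, Pi.add_apply, Pi.smul_apply, smul_eq_mul]; split_ifs <;> omega
    · simp only [cD]; split_ifs <;> omega
    · simp only [cD]; split_ifs <;> omega
    · intro i j a b c d; simp only [cD]; split_ifs <;> omega
  case B₃ =>
    subst hb
    rcases hp.eq_or_lt with rfl | hp'
    · refine InTable.swap (glue_F₄_e.inTable_of_edge hA hg he (h.swap hA).cover hd' (a := 3)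
        (b := 1) s₂ s₁ ?_ ?_ ⟨rfl, rfl, ?_⟩)
      · intro i j a b c d
        exact (hc j i c d a b).imp (fun h => h.symm) (hA.symm _ _)
      · intro k
        simp only [α, Pi.add_apply, Pi.smul_apply, smul_eq_mul]; split_ifs <;> omega
      · intro i j a b c d
        interval_cases i <;> interval_cases j <;> simp [cB, ofList]
    · have gg : ∀ i j, 1 ≤ i → i ≤ 3 → 1 ≤ j → j ≤ 3 → i + 1 = j ∨ j + 1 = i →
          A (g i) (g j) ≠ 0 := fun i j a₁ a₂ c d hij =>
        hg.edge ⟨a₁, a₂⟩ ⟨c, d⟩ (by unfold cB; split_ifs <;> omega)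
      exact (hA.false_of_F (x₁ := e (p - 1)) (x₂ := e p) (x₃ := g 3) (x₄ := g 2) (x₅ := g 1)
          (nodup_of_disjoint hd he hg [p - 1, p] [3, 2, 1] (by simp; omega) (by simp)
            (by simp; omega) (by simp))
          (ee _ _ (by omega) (by omega) (by omega) (by omega) (by omega)) ha
          (gg _ _ (by omega) (by omega) (by omega) (by omega) (by omega))
          (gg _ _ (by omega) (by omega) (by omega) (by omega) (by omega))
          (Or.inr (by rw [hg.mat 2 3 (by omega) (by omega) (by omega) (by omega)]; simp [cB]))).elim

/-- Two weak spherical roots with disjoint connected supports. -/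
lemma disjoint_connected (hA : FiniteType A) (h : Sys A W σ τ) (hd : ∀ k, σ k = 0 ∨ τ k = 0)
    (pσ : Prof A W σ) (pτ : Prof A W τ) : InTable A W σ τ := by
  have key : ∀ {σ τ u v} {p : ℕ} {e : ℕ → κ}, Sys A W σ τ → (∀ k, σ k = 0 ∨ τ k = 0) →
      Prof A W σ → Prof A W τ → 1 ≤ p →
      WR A W σ p cA (fun _ => 1) (fun i => i = 1 ∨ i = p) e → σ u ≠ 0 → τ v ≠ 0 → W u →
      A u v ≠ 0 → InTable A W σ τ := by
    intro σ τ u v p e h hd pσ pτ hp he hu hv hW ha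
    obtain ⟨i, a, b, rfl⟩ := he.cov u hu
    rcases (he.wh i a b).1 hW with rfl | rfl
    · exact disjoint_A hA h hd pσ pτ hp he.rev hv (by simpa using ha)
    · exact disjoint_A hA h hd pσ pτ hp he hv ha
  obtain ⟨u, v, hu, hv, ha⟩ := h.conn
  obtain ⟨wu, wv⟩ := h.white_edge hA hu ((hd u).resolve_left hu) hv ((hd v).resolve_right hv) ha
  -- The ends of the edge cannot both be heavy, and type `D₂` is excluded by connectedness; so one
  -- of the roots is of type `A`.
  rcases h.root₁.heavy_or hA with ⟨p, e, hp, he⟩ | ⟨e, he⟩ | hu'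
  · exact key h hd pσ pτ hp he hu hv wu ha
  · exact (he.not_prof (fun i a b => by omega) pσ).elim
  rcases h.root₂.heavy_or hA with ⟨p, e, hp, he⟩ | ⟨e, he⟩ | hv'
  · exact (key (h.swap hA) (fun k => (hd k).symm) pτ pσ hp he hv hu wv (hA.ne_zero_symm ha)).swap
  · exact (he.not_prof (fun i a b => by omega) pτ).elim
  · exact ((hu' u hu wu).false_of_heavy hA (hv' v hv wv) hd ha).elim

end DisjointConnected
end WeakSpherical

namespace WeakSpherical

section TypeDTwo

variable {κ : Type*} [Fintype κ] [DecidableEq κ] {A : κ → κ → ℤ} {W : κ → Prop} {σ τ ρ : κ → ℤ}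
  {p q n m : ℕ} {e g : ℕ → κ} {C : ℕ → ℕ → ℤ} {l : ℕ → ℤ} {w : ℕ → Prop}

/-! ### Roots of type `D₂` -/

/-- The root `ρ` is the sum of the two orthogonal simple roots `e 1`, `e 2`. -/
abbrev IsD₂ (A : κ → κ → ℤ) (W : κ → Prop) (ρ : κ → ℤ) (e : ℕ → κ) : Prop :=
  WR A W ρ 2 (cD 2) (fun _ => 1) (fun i => i = 1 ∨ i = 2) e

/-- The root `ρ` is of type `A n`. -/
abbrev IsA (A : κ → κ → ℤ) (W : κ → Prop) (ρ : κ → ℤ) (n : ℕ) (e : ℕ → κ) : Prop :=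
  WR A W ρ n cA (fun _ => 1) (fun i => i = 1 ∨ i = n) e

lemma IsD₂.swap (h : IsD₂ A W ρ e) : IsD₂ A W ρ (fun i => e (3 - i)) where
  mat i j a b c d := by
    rw [h.mat _ _ (by omega) (by omega) (by omega) (by omega)]
    unfold cD; split_ifs <;> omega
  val i a b := h.val _ (by omega) (by omega)
  cov k hk := by
    obtain ⟨i, a, b, rfl⟩ := h.cov k hk
    exact ⟨3 - i, by omega, by omega, by congr 1; omega⟩
  wh i a b := by
    rw [h.wh _ (by omega) (by omega)]
    omega
  inj i j a b c d hij := by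
    have := h.inj _ _ (by omega) (by omega) (by omega) (by omega) hij
    omega
  pos i a b := by norm_num

lemma WR.pr_two (h : WR A W ρ 2 C (fun _ => 1) w e) (k : κ) :
    pr A ρ k = A (e 1) k + A (e 2) k := by
  rw [h.pr_sum]; simp [Finset.sum_Icc_succ_top]

lemma WR.pr_eq_of_unique (h : WR A W ρ n C l w e) {j : ℕ} (hj : 1 ≤ j) (hjn : j ≤ n) {k : κ}
    (H : ∀ i, 1 ≤ i → i ≤ n → i ≠ j → A (e i) k = 0) : pr A ρ k = l j * A (e j) k := by
  rw [h.pr_sum, Finset.sum_eq_single j]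
  · intro i hi hij
    rw [Finset.mem_Icc] at hi
    rw [H i hi.1 hi.2 hij, mul_zero]
  · intro hj'
    exact absurd (Finset.mem_Icc.2 ⟨hj, hjn⟩) hj'

lemma IsD₂.cov_two (h : IsD₂ A W ρ e) {k : κ} (hk : ρ k ≠ 0) : k = e 1 ∨ k = e 2 := by
  obtain ⟨i, a, b, rfl⟩ := h.cov k hk
  obtain rfl | rfl : i = 1 ∨ i = 2 := by omega
  exacts [Or.inl rfl, Or.inr rfl]

lemma IsD₂.facts (h : IsD₂ A W ρ e) : e 1 ≠ e 2 ∧ A (e 1) (e 2) = 0 ∧ A (e 2) (e 1) = 0 ∧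
    ρ (e 1) = 1 ∧ ρ (e 2) = 1 ∧ W (e 1) ∧ W (e 2) ∧ pr A ρ (e 1) = 2 ∧ pr A ρ (e 2) = 2 := by
  refine ⟨h.ne le_rfl (by omega) (by omega) le_rfl (by omega), ?_, ?_, h.val 1 le_rfl (by omega),
    h.val 2 (by omega) le_rfl, (h.wh 1 le_rfl (by omega)).2 (Or.inl rfl),
    (h.wh 2 (by omega) le_rfl).2 (Or.inr rfl), pr_D₂ h le_rfl (by omega), pr_D₂ h (by omega) le_rfl⟩
  · rw [h.mat 1 2 (by omega) (by omega) (by omega) (by omega)]; rfl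
  · rw [h.mat 2 1 (by omega) (by omega) (by omega) (by omega)]; rfl

lemma IsD₂.eq_single (h : IsD₂ A W ρ e) : ρ = Pi.single (e 1) 1 + Pi.single (e 2) 1 := by
  obtain ⟨h1, -, -, h2, h3, -⟩ := h.facts
  ext k
  by_cases hk : ρ k = 0
  · have h4 : k ≠ e 1 := by rintro rfl; omega
    have h5 : k ≠ e 2 := by rintro rfl; omega
    simp [hk, h4, h5]
  · rcases h.cov_two hk with rfl | rfl
    · simp [h2, h1]
    · simp [h3, h1.symm]

/-- Axiom 3 for the root `σ`, evaluated on the other root. All arguments about type `D₂` start from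
this equality. -/
lemma IsD₂.pr_eq (he : IsD₂ A W σ e) (h : Sys A W σ τ) : pr A τ (e 1) = pr A τ (e 2) :=
  (h.d2 _ _ he.facts.2.1 (Or.inl he.eq_single)).2

/-- By axiom 3 for `τ` the two edges have the same multiplicity. A simple, double or triple edge
gives two copies of `A₂`, `C₂` or `G₂`. -/
lemma d2_d2_matched (hA : FiniteType A) (h : Sys A W σ τ) (hd : ∀ k, σ k = 0 ∨ τ k = 0)
    (he : IsD₂ A W σ e) (hg : IsD₂ A W τ g) (h1 : A (g 1) (e 1) = -1) (h2 : A (g 2) (e 2) = -1)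
    (h3 : A (g 2) (e 1) = 0) (h4 : A (g 1) (e 2) = 0) : InTable A W σ τ := by
  have hd' : ∀ k, τ k = 0 ∨ σ k = 0 := fun k => (hd k).symm
  have h5 := hA.symm _ _ h3
  have h6 := hA.symm _ _ h4
  have h7 := hg.pr_eq (h.swap hA)
  rw [he.pr_two, he.pr_two, h6, h5] at h7
  have hne : e 1 ≠ g 1 := by
    intro h0
    have := hA.diag (e 1)
    rw [← h0] at h1
    omega
  rcases hA.edge_cases hne (hA.ne_zero_symm (by omega)) with h8 | h8 | h8 | h8 | h8
  · refine glue_AA.inTable_of_disjoint hA he hg h.cover hd ?_ ?_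
    · intro k; simp only [α, Pi.add_apply]; split_ifs <;> omega
    · intro i j a b c d
      interval_cases i <;> interval_cases j <;> simp [cSum, cA, ofList] <;> omega
  · refine InTable.swap (glue_CC.inTable_of_disjoint hA hg he (h.swap hA).cover hd' ?_ ?_)
    · intro k; simp only [α, Pi.add_apply]; split_ifs <;> omega
    · intro i j a b c d
      interval_cases i <;> interval_cases j <;> simp [cSum, cC, ofList] <;> omega
  · refine InTable.swap (glue_GG.inTable_of_disjoint hA hg he (h.swap hA).cover hd' ?_ ?_)
    · intro k; simp only [α, Pi.add_apply]; split_ifs <;> omega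
    · intro i j a b c d
      interval_cases i <;> interval_cases j <;> simp [cSum, cG, ofList] <;> omega
  · omega
  · omega

/-- A root of type `D₂` pairs to 2 with its nodes and to at most 0 with others. By axiom 3 the
supports are therefore disjoint or equal, and in the latter case the roots agree. If neither root
pairs to `-1` with the nodes of the other, all mixed pairings are at most `-2` and `σ + τ` is
antidominant. Otherwise every node of one support has exactly one neighbour in the other support,
and axiom 3 for the other root makes these neighbours distinct. -/
lemma d2_d2 (hA : FiniteType A) (h : Sys A W σ τ) (he : IsD₂ A W σ e) (hg : IsD₂ A W τ g) :
    InTable A W σ τ := by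
  obtain ⟨e₁, e₂, e₃, e₄, e₅, -, -, e₆, e₇⟩ := he.facts
  obtain ⟨g₁, g₂, g₃, g₄, g₅, -, -, g₆, g₇⟩ := hg.facts
  have hp := he.pr_eq h
  have hq := hg.pr_eq (h.swap hA)
  have hσ : ∀ {k}, σ k = 0 → pr A σ k ≤ 0 := fun hk => hA.pr_nonpos he.nonneg hk
  have hτ : ∀ {k}, τ k = 0 → pr A τ k ≤ 0 := fun hk => hA.pr_nonpos hg.nonneg hk
  have hσ' : ∀ {k}, σ k ≠ 0 → pr A σ k = 2 := fun hk => by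
    rcases he.cov_two hk with rfl | rfl <;> assumption
  have hd₁ : σ (g 1) = 0 ∧ σ (g 2) = 0 := by
    by_contra hc
    have h1 : σ (g 1) ≠ 0 ∧ σ (g 2) ≠ 0 := by
      constructor <;> intro h0
      · have := hσ h0
        have := hσ' (fun h1 => hc ⟨h0, h1⟩)
        omega
      · have := hσ h0
        have := hσ' (fun h1 => hc ⟨h1, h0⟩)
        omega
    refine h.ne ?_
    rw [he.eq_single, hg.eq_single]
    rcases he.cov_two h1.1 with h2 | h2 <;> rcases he.cov_two h1.2 with h3 | h3
    · exact absurd (h2.trans h3.symm) g₁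
    · rw [h2, h3]
    · rw [h2, h3, add_comm]
    · exact absurd (h2.trans h3.symm) g₁
  have hd : ∀ k, σ k = 0 ∨ τ k = 0 := fun k => by
    by_contra! hc
    rcases hg.cov_two hc.2 with rfl | rfl
    exacts [hc.1 hd₁.1, hc.1 hd₁.2]
  have main : ∀ {σ τ : κ → ℤ} {e g : ℕ → κ}, Sys A W σ τ → (∀ k, σ k = 0 ∨ τ k = 0) →
      IsD₂ A W σ e → IsD₂ A W τ g → pr A τ (e 1) = -1 → InTable A W σ τ := by
    intro σ τ e g h hd he hg hs
    have hs' := he.pr_eq h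
    have hq := hg.pr_eq (h.swap hA)
    have ne : ∀ i j, 1 ≤ i → i ≤ 2 → 1 ≤ j → j ≤ 2 → g j ≠ e i := fun i j a b c d hij => by
      have h1 := he.val_ne a b
      have h2 := hg.val_ne c d
      rw [hij] at h2
      exact (hd _).elim h1 h2
    have n₁ := hA.nonpos _ _ (ne 1 1 (by omega) (by omega) (by omega) (by omega))
    have n₂ := hA.nonpos _ _ (ne 1 2 (by omega) (by omega) (by omega) (by omega))
    have n₃ := hA.nonpos _ _ (ne 2 1 (by omega) (by omega) (by omega) (by omega))
    have n₄ := hA.nonpos _ _ (ne 2 2 (by omega) (by omega) (by omega) (by omega))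
    have aux : ∀ {i j}, g j ≠ e i → A (g j) (e i) = -1 → A (e i) (g j) ≤ -1 := fun hne ha =>
      (hA.neg hne (by omega)).2
    have m₁ := aux (ne 1 1 (by omega) (by omega) (by omega) (by omega))
    have m₂ := aux (ne 1 2 (by omega) (by omega) (by omega) (by omega))
    have m₃ := aux (ne 2 1 (by omega) (by omega) (by omega) (by omega))
    have m₄ := aux (ne 2 2 (by omega) (by omega) (by omega) (by omega))
    have z₁ := hA.symm (g 1) (e 1)
    have z₂ := hA.symm (g 2) (e 1)
    have z₃ := hA.symm (g 1) (e 2)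
    have z₄ := hA.symm (g 2) (e 2)
    rw [hg.pr_two] at hs
    rw [hg.pr_two, hg.pr_two] at hs'
    rw [he.pr_two, he.pr_two] at hq
    obtain ⟨h1, h2⟩ | ⟨h1, h2⟩ : (A (g 1) (e 1) = -1 ∧ A (g 2) (e 1) = 0) ∨
      (A (g 1) (e 1) = 0 ∧ A (g 2) (e 1) = -1) := by omega
    · obtain ⟨h3, h4⟩ : A (g 1) (e 2) = 0 ∧ A (g 2) (e 2) = -1 := by
        by_contra hc
        have h3 : A (g 1) (e 2) = -1 := by omega
        have h4 : A (g 2) (e 2) = 0 := by omega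
        have := m₁ h1
        have := m₃ h3
        have := z₂ h2
        have := z₄ h4
        omega
      exact d2_d2_matched hA h hd he hg h1 h4 h2 h3
    · obtain ⟨h3, h4⟩ : A (g 1) (e 2) = -1 ∧ A (g 2) (e 2) = 0 := by
        by_contra hc
        have h3 : A (g 1) (e 2) = 0 := by omega
        have h4 : A (g 2) (e 2) = -1 := by omega
        have := m₂ h2
        have := m₄ h4
        have := z₁ h1
        have := z₃ h3
        omega
      exact d2_d2_matched hA h hd he hg.swap h2 h3 h1 h4
  obtain ⟨u, v, hu, hv, ha⟩ := h.conn
  have h1 := hA.pr_neg hg.nonneg ((hd u).resolve_left hu) hv (hA.ne_zero_symm ha)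
  have h2 := hA.pr_neg he.nonneg ((hd v).resolve_right hv) hu ha
  have h3 : pr A τ (e 1) ≤ -1 := by
    have := hg.nonneg v
    rcases he.cov_two hu with rfl | rfl <;> omega
  have h4 : pr A σ (g 1) ≤ -1 := by
    have := he.nonneg u
    rcases hg.cov_two hv with rfl | rfl <;> omega
  by_cases h5 : pr A τ (e 1) = -1
  · exact main h hd he hg h5
  by_cases h6 : pr A σ (g 1) = -1
  · exact (main (h.swap hA) (fun k => (hd k).symm) hg he h6).swap
  refine (hA.false_of_add he.nonneg hg.nonneg (fun k => ?_) hu).elim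
  by_cases hk : σ k = 0
  · rcases hg.cov_two ((h.cover k).resolve_left (by simp [hk])) with rfl | rfl <;> omega
  · rcases he.cov_two hk with rfl | rfl <;> omega

/-- One of the two simple roots of a root of type `D₂` belongs to the other support. -/
lemma d2_overlap_one (hA : FiniteType A) (h : Sys A W σ τ) (he : IsD₂ A W σ e) (pτ : Prof A W τ)
    (h1 : τ (e 1) ≠ 0) (h2 : τ (e 2) = 0) : InTable A W σ τ := by
  obtain ⟨e₁, e₂, e₃, e₄, e₅, w₁, w₂, e₆, e₇⟩ := he.facts
  have hp := he.pr_eq h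
  have h3 := hA.pr_nonpos pτ.nonneg h2
  have mem : ∀ {k}, τ k ≠ 0 → σ k ≠ 0 → k = e 1 := fun hk hk' => by
    rcases he.cov_two hk' with rfl | rfl
    exacts [rfl, absurd h2 hk]
  have iso : pr A τ (e 1) = 0 → ∀ {k}, τ k ≠ 0 → A k (e 2) = 0 := fun h0 k hk => by
    by_contra ha
    have h4 := hA.pr_neg pτ.nonneg h2 hk ha
    have := pτ.nonneg k
    omega
  -- The common pairing of `τ` with both nodes is nonpositive because `e 2` lies outside its
  -- support. Yet `e 1` is a white node of `τ`: this happens only at the last node of `B` and at the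
  -- first nodes of `C` and `G₂` with two white nodes.
  have hr := h.root₂
  rcases hr with ⟨m, g, hm, hg⟩ | ⟨m, g, hm, hg⟩ | ⟨m, g, hm, hg⟩ | ⟨m, g, hm, hg⟩ | ⟨m, g, hm, hg⟩ |
    ⟨g, hg⟩ | ⟨g, hg⟩ | ⟨g, hg⟩ | ⟨g, hg⟩ | ⟨m, g, hm, hg⟩ | ⟨g, hg⟩
  all_goals
    obtain ⟨b, b₁, b₂, hb⟩ := hg.cov _ h1
    have wb := (hg.wh b b₁ b₂).1 (hb ▸ w₁)
    rw [← hp, hb] at h3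
    rw [hb] at iso
  case A => rw [pr_A hg b₁ b₂] at h3; split_ifs at h3 <;> omega
  case B => rw [pr_B hm hg b₁ b₂, if_pos wb] at h3; omega
  case C => rw [pr_C hm hg b₁ b₂, if_pos wb] at h3; omega
  case F₄ => rw [pr_F₄ hg b₁ b₂, if_pos wb] at h3; omega
  case G₂ => rw [pr_G₂ hg b₁ b₂, if_pos wb] at h3; omega
  case D => rw [pr_D hm hg b₁ b₂, if_pos wb] at h3; omega
  case B₃ => rw [pr_B₃ hg b₁ b₂, if_pos wb] at h3; omega
  case D₂ => exact (hg.not_prof (fun i a b => by omega) pτ).elim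
  case B' =>
    rw [pr_B hm hg b₁ b₂] at h3
    obtain rfl : b = m := by split_ifs at h3 <;> omega
    replace iso := fun {k} => iso (by rw [pr_B hm hg b₁ b₂]; split_ifs <;> omega) (k := k)
    rcases hm.eq_or_lt with rfl | hm'
    · have i₁ := iso (hg.val_ne (i := 1) le_rfl (by omega))
      refine glue_CA_two.inTable hA he hg h.cover ?_ ?_ ?_
      · intro j c d hj
        obtain rfl | rfl : j = 1 ∨ j = 2 := by omega
        · by_contra h0
          exact hg.ne le_rfl (by omega) (by omega) le_rfl (by omega)
            ((mem (hg.val_ne c d) h0).trans hb)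
        · simp [α, ofList] at hj
      · intro i c d hi
        obtain rfl | rfl : i = 1 ∨ i = 2 := by omega
        · simp [α, seg, ofList] at hi
        · exact h2
      · intro i j a b c d
        have i₂ := hA.symm _ _ i₁
        interval_cases i <;> interval_cases j <;> simp [α, seg, ofList, cSum, i₁, i₂, hb]
    -- For `b ≥ 3` the neighbour of `e 1` in `τ` is black and outside the support of `σ`, so it may
    -- not be joined to it.
    · exfalso
      have hne := hg.ne (i := b - 1) (j := b) (by omega) (by omega) b₁ b₂ (by omega)
      have hbl : ¬ W (g (b - 1)) := by rw [hg.wh _ (by omega) (by omega)]; omega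
      have := h.black₁ hA hbl (j := e 1) (by
        by_contra h0
        exact hne ((mem (hg.val_ne (by omega) (by omega)) h0).trans hb)) (by omega)
      rw [hb] at this
      exact hg.edge (i := b) (j := b - 1) ⟨b₁, b₂⟩ ⟨by omega, by omega⟩
        (by unfold cB; split_ifs <;> omega) this
  case C' =>
    rw [pr_C hm hg b₁ b₂] at h3
    obtain rfl : b = 1 := by split_ifs at h3 <;> omega
    replace iso := fun {k} => iso (by rw [pr_C hm hg b₁ b₂]; split_ifs <;> omega) (k := k)
    refine (glue_CA m hm).inTable hA he hg h.cover ?_ ?_ ?_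
    · intro j c d hj
      by_contra h0
      obtain rfl := hg.inj _ _ c d b₁ b₂ ((mem (hg.val_ne c d) h0).trans hb)
      simp [α] at hj
    · intro i c d hi
      obtain rfl | rfl : i = 1 ∨ i = 2 := by omega
      · simp [α] at hi
      · exact h2
    · intro i j a b c d
      have i₁ := iso (hg.val_ne c d)
      have i₂ := hA.symm _ _ i₁
      obtain rfl | rfl : i = 1 ∨ i = 2 := by omega
      · refine ⟨?_, ?_⟩
        · rintro rfl; exact hb
        · simp [α]
      · refine ⟨fun h0 => absurd h0 (by simp; omega), fun _ _ => ?_⟩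
        rw [i₁, i₂]
        simp only [cSum]; split_ifs <;> omega
  -- The pairing `-1` at `e 1` recurs at `e 2`, which is therefore joined to `g 2`, next to a triple
  -- edge.
  case G₂' =>
    rw [pr_G₂' hg b₁ b₂] at h3
    obtain rfl : b = 1 := by split_ifs at h3 <;> omega
    have h4 := hp
    rw [hb, pr_G₂' hg b₁ b₂, hg.pr_two, ← hb, e₂] at h4
    have h5 := hg.ne (i := 1) (j := 2) le_rfl (by omega) (by omega) le_rfl (by omega)
    have h6 : e 2 ≠ g 2 := by
      intro h0
      rw [h0] at h2
      exact hg.val_ne (by omega) le_rfl h2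
    refine (hA.false_of_triple (x := e 2) (y := g 2) (z := g 1) h6 (hb ▸ e₁.symm) h5.symm
      (hA.ne_zero_symm ?_) (Or.inl ?_)).elim
    · simp at h4; omega
    · rw [hg.mat 2 1 (by omega) (by omega) (by omega) (by omega)]; simp [cG]

/-- A root of type `D₂` meeting a connected support. -/
lemma d2_overlap (hA : FiniteType A) (h : Sys A W σ τ) (he : IsD₂ A W σ e) (pτ : Prof A W τ)
    (hI : ∃ k, σ k ≠ 0 ∧ τ k ≠ 0) : InTable A W σ τ := by
  obtain ⟨e₁, e₂, e₃, e₄, e₅, w₁, w₂, e₆, e₇⟩ := he.facts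
  obtain ⟨k, hk, hk'⟩ := hI
  by_cases h1 : τ (e 1) = 0
  · rcases he.cov_two hk with rfl | rfl
    · exact absurd h1 hk'
    · exact d2_overlap_one hA h he.swap pτ hk' h1
  by_cases h2 : τ (e 2) = 0
  · exact d2_overlap_one hA h he pτ h1 h2
  -- Now `e 1` and `e 2` are the two white nodes of `τ`. Being orthogonal, they are the ends of a
  -- chain with black nodes in between; the second node of that chain is joined to `σ` without
  -- belonging to it.
  exfalso
  have two := (pτ.two _ _ h1 h2 w₁ w₂ e₁).2
  have end₁ : ∀ {k}, τ k ≠ 0 → ¬ W k → A (e 1) k ≠ 0 → False := fun {k} hk hW ha => by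
    refine ha (h.black₁ hA hW ?_ (by omega))
    by_contra h0
    rcases he.cov_two h0 with rfl | rfl <;> contradiction
  have end₂ : ∀ {k}, τ k ≠ 0 → ¬ W k → A (e 2) k ≠ 0 → False := fun {k} hk hW ha => by
    refine ha (h.black₁ hA hW ?_ (by omega))
    by_contra h0
    rcases he.cov_two h0 with rfl | rfl <;> contradiction
  have hr := h.root₂
  rcases hr with ⟨m, g, hm, hg⟩ | ⟨m, g, hm, hg⟩ | ⟨m, g, hm, hg⟩ | ⟨m, g, hm, hg⟩ | ⟨m, g, hm, hg⟩ |
    ⟨g, hg⟩ | ⟨g, hg⟩ | ⟨g, hg⟩ | ⟨g, hg⟩ | ⟨m, g, hm, hg⟩ | ⟨g, hg⟩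
  case D₂ => exact (hg.not_prof (fun i a b => by omega) pτ).elim
  all_goals
    obtain ⟨b, b₁, b₂, hb⟩ := hg.cov _ h1
    have wb := (hg.wh b b₁ b₂).1 (hb ▸ w₁)
    obtain ⟨c, c₁, c₂, hc⟩ := hg.cov _ h2
    have wc := (hg.wh c c₁ c₂).1 (hc ▸ w₂)
    have hbc : b ≠ c := by rintro rfl; exact e₁ (hb.trans hc.symm)
    rw [hb, hc, hg.mat b c b₁ b₂ c₁ c₂] at e₂
  case A =>
    have h3 : 3 ≤ m := by unfold cA at e₂; split_ifs at e₂ <;> omega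
    have h4 : ¬ W (g 2) := by rw [hg.wh _ (by omega) (by omega)]; omega
    obtain rfl | rfl : b = 1 ∨ c = 1 := by omega
    · exact end₁ (hg.val_ne (by omega) (by omega)) h4
        (hb ▸ hg.edge ⟨b₁, b₂⟩ ⟨by omega, by omega⟩ (by simp [cA]))
    · exact end₂ (hg.val_ne (by omega) (by omega)) h4
        (hc ▸ hg.edge ⟨c₁, c₂⟩ ⟨by omega, by omega⟩ (by simp [cA]))
  case B' =>
    have h3 : 3 ≤ m := by unfold cB at e₂; split_ifs at e₂ <;> omega
    have h4 : ¬ W (g 2) := by rw [hg.wh _ (by omega) (by omega)]; omega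
    obtain rfl | rfl : b = 1 ∨ c = 1 := by omega
    · exact end₁ (hg.val_ne (by omega) (by omega)) h4
        (hb ▸ hg.edge ⟨b₁, b₂⟩ ⟨by omega, by omega⟩ (by unfold cB; split_ifs <;> omega))
    · exact end₂ (hg.val_ne (by omega) (by omega)) h4
        (hc ▸ hg.edge ⟨c₁, c₂⟩ ⟨by omega, by omega⟩ (by unfold cB; split_ifs <;> omega))
  case C' => unfold cC at e₂; split_ifs at e₂ <;> omega
  case G₂' => unfold cG at e₂; split_ifs at e₂ <;> omega
  all_goals omega

end TypeDTwo
end WeakSpherical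

namespace WeakSpherical

/-! ### A root of type `D₂` and a disjoint connected support -/

section TypeDTwoDisjoint

variable {κ : Type*} [Fintype κ] [DecidableEq κ] {A : κ → κ → ℤ} {W : κ → Prop} {σ τ ρ : κ → ℤ}
  {p q n m : ℕ} {e g : ℕ → κ} {C : ℕ → ℕ → ℤ} {l : ℕ → ℤ} {w : ℕ → Prop}

/-- Both nodes attached by simple edges to the same end of the chain form the fork of `D_{m+2}`. -/
lemma d2_A_end (hA : FiniteType A) (h : Sys A W σ τ) (hd : ∀ k, σ k = 0 ∨ τ k = 0) (he : IsD₂ A W σ e)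
    (hm : 1 ≤ m) (hg : IsA A W τ m g)
    (h1 : ∀ j, 1 ≤ j → j ≤ 2 → A (g m) (e j) = -1 ∧ A (e j) (g m) = -1)
    (hc : ∀ i j, 1 ≤ i → i ≤ m → 1 ≤ j → j ≤ 2 → i ≠ m → A (g i) (e j) = 0) :
    InTable A W σ τ := by
  refine InTable.swap ((glue_D_b (m + 2) (by omega)).inTable_of_disjoint hA hg he (h.swap hA).cover
    (fun k => (hd k).symm) ?_ ?_)
  · intro k
    simp only [seg, α, Pi.add_apply]; split_ifs <;> omega
  · intro i j a b c d
    rcases eq_or_ne i m with rfl | hi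
    · rw [(h1 j c d).1, (h1 j c d).2]
      simp only [cD]; split_ifs <;> omega
    · rw [hc i j a b c d hi, hA.symm _ _ (hc i j a b c d hi)]
      have : i < m := lt_of_le_of_ne b hi
      simp only [cD]; split_ifs <;> omega

/-- The chain is prolonged at both ends, giving type `A` or, with a double edge at one end, type
`C`. The simple alternative requires `2 ≤ m`, as for `m = 1` the diagram is listed as `D 3`. -/
lemma d2_A_path (hA : FiniteType A) (h : Sys A W σ τ) (hd : ∀ k, σ k = 0 ∨ τ k = 0)
    (he : IsD₂ A W σ e) (hm : 1 ≤ m) (hg : IsA A W τ m g)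
    (h1 : A (g 1) (e 1) = -1 ∧ A (e 1) (g 1) = -1) (h2 : A (g m) (e 2) = -1)
    (h3 : A (e 2) (g m) = -1 ∧ 2 ≤ m ∨ A (e 2) (g m) = -2)
    (hc₁ : ∀ i, 1 ≤ i → i ≤ m → i ≠ 1 → A (g i) (e 1) = 0)
    (hc₂ : ∀ i, 1 ≤ i → i ≤ m → i ≠ m → A (g i) (e 2) = 0) : InTable A W σ τ := by
  rcases h3 with ⟨h3, hm'⟩ | h3
  · refine (glue_A_b (m + 2) (by omega)).inTable_of_disjoint hA he hg h.cover hd ?_ ?_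
    · intro k
      simp only [seg, α, Pi.add_apply]; split_ifs <;> omega
    · intro i j a b c d
      obtain rfl | rfl : i = 1 ∨ i = 2 := by omega
      · rcases eq_or_ne j 1 with rfl | hj
        · rw [h1.1, h1.2]; simp only [cA]; split_ifs <;> omega
        · rw [hc₁ j c d hj, hA.symm _ _ (hc₁ j c d hj)]
          simp only [cA]; split_ifs <;> omega
      · rcases eq_or_ne j m with rfl | hj
        · rw [h2, h3]; simp only [cA]; split_ifs <;> omega
        · rw [hc₂ j c d hj, hA.symm _ _ (hc₂ j c d hj)]
          simp only [cA]; split_ifs <;> omega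
  · refine (glue_C_f (m + 2) (by omega)).inTable_of_disjoint hA he hg h.cover hd ?_ ?_
    · intro k
      simp only [seg, α, Pi.add_apply]; split_ifs <;> omega
    · intro i j a b c d
      obtain rfl | rfl : i = 1 ∨ i = 2 := by omega
      · rcases eq_or_ne j 1 with rfl | hj
        · rw [h1.1, h1.2]; simp only [cC]; split_ifs <;> omega
        · rw [hc₁ j c d hj, hA.symm _ _ (hc₁ j c d hj)]
          simp only [cC]; split_ifs <;> omega
      · rcases eq_or_ne j m with rfl | hj
        · rw [h2, h3]; simp only [cC]; split_ifs <;> omega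
        · rw [hc₂ j c d hj, hA.symm _ _ (hc₂ j c d hj)]
          simp only [cC]; split_ifs <;> omega

/-- With `A (g 1) (e 1) ≤ -2`, the sum `σ + τ` is antidominant; with `A (e 1) (g 1) + A (e 2) (g 1)
≤ -4`, it is `σ + 2 τ`. What remains are two simple edges, giving `D 3`, or one simple and one
double edge, giving `C 3`. -/
lemma d2_A_one (hA : FiniteType A) (h : Sys A W σ τ) (hd : ∀ k, σ k = 0 ∨ τ k = 0)
    (he : IsD₂ A W σ e) (hg : IsA A W τ 1 g) (ha₁ : A (e 1) (g 1) ≠ 0) (ha₂ : A (e 2) (g 1) ≠ 0) :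
    InTable A W σ τ := by
  obtain ⟨e₁, e₂, e₃, e₄, e₅, w₁, w₂, e₆, e₇⟩ := he.facts
  have hp := he.pr_eq h
  have hτ : ∀ k, pr A τ k = A (g 1) k := fun k => by
    rw [hg.pr_eq_of_unique le_rfl le_rfl fun i a b c => by omega, one_mul]
  have hσg := (hd (g 1)).resolve_right (hg.val_ne le_rfl le_rfl)
  have n₁ : e 1 ≠ g 1 := by intro h0; rw [h0] at e₄; omega
  have n₂ : e 2 ≠ g 1 := by intro h0; rw [h0] at e₅; omega
  rw [hτ, hτ] at hp
  have covτ : ∀ {k}, τ k ≠ 0 → k = g 1 := fun hk => by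
    obtain ⟨i, a, b, rfl⟩ := hg.cov _ hk
    congr 1; omega
  have b₁ := hA.neg n₁ ha₁
  have b₂ := hA.neg n₂ ha₂
  have g₂ : pr A τ (g 1) = 2 := by rw [hτ, hA.diag]
  have hσ := he.pr_two (g 1)
  by_cases hk : A (g 1) (e 1) = -1
  · by_cases hs : A (e 1) (g 1) + A (e 2) (g 1) ≤ -4
    · refine (hA.false_of_add he.nonneg (τ := τ + τ) (i := e 1)
        (fun k => add_nonneg (hg.nonneg k) (hg.nonneg k)) (fun k => ?_) (by omega)).elim
      rw [pr_add]
      rcases h.cover k with hk' | hk'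
      · rcases he.cov_two hk' with rfl | rfl <;> rw [hτ] <;> omega
      · rw [covτ hk']; omega
    · have hk' : A (g 1) (e 2) = -1 := by omega
      by_cases h1 : A (e 1) (g 1) = -1
      · by_cases h2 : A (e 2) (g 1) = -1
        · refine d2_A_end hA h hd he le_rfl hg (fun j c d => ?_) (fun i j a b c d => by omega)
          obtain rfl | rfl : j = 1 ∨ j = 2 := by omega
          exacts [⟨hk, h1⟩, ⟨hk', h2⟩]
        · exact d2_A_path hA h hd he le_rfl hg ⟨hk, h1⟩ hk' (Or.inr (by omega))
            (fun i a b c => by omega) (fun i a b c => by omega)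
      · exact d2_A_path hA h hd he.swap le_rfl hg ⟨hk', by show A (e 2) (g 1) = -1; omega⟩ hk
          (Or.inr (by show A (e 1) (g 1) = -2; omega))
          (fun i a b c => by omega) (fun i a b c => by omega)
  · refine (hA.false_of_add he.nonneg hg.nonneg (i := e 1) (fun k => ?_) (by omega)).elim
    rcases h.cover k with hk' | hk'
    · rcases he.cov_two hk' with rfl | rfl <;> rw [hτ] <;> omega
    · rw [covτ hk']; omega

lemma d2_A (hA : FiniteType A) (h : Sys A W σ τ) (hd : ∀ k, σ k = 0 ∨ τ k = 0) (he : IsD₂ A W σ e)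
    (pτ : Prof A W τ) (hm : 1 ≤ m) (hg : IsA A W τ m g) {v v' : κ} (hv : τ v ≠ 0) (hv' : τ v' ≠ 0)
    (ha₁ : A (e 1) v ≠ 0) (ha₂ : A (e 2) v' ≠ 0) : InTable A W σ τ := by
  obtain ⟨e₁, e₂, e₃, e₄, e₅, w₁, w₂, e₆, e₇⟩ := he.facts
  have hp := he.pr_eq h
  have d₁ := (hd (e 1)).resolve_left (by omega)
  have d₂ := (hd (e 2)).resolve_left (by omega)
  have dτ : ∀ {k}, τ k ≠ 0 → σ k = 0 := fun hk => (hd _).resolve_right hk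
  have wv := (h.white_edge hA (by omega) d₁ hv (dτ hv) ha₁).2
  have wv' := (h.white_edge hA (by omega) d₂ hv' (dτ hv') ha₂).2
  obtain ⟨f, hf, hfv⟩ : ∃ f, IsA A W τ m f ∧ v' = f m := by
    obtain ⟨b, b₁, b₂, hb⟩ := hg.cov v' hv'
    rcases (hg.wh b b₁ b₂).1 (hb ▸ wv') with rfl | rfl
    · exact ⟨_, hg.rev, by simpa using hb⟩
    · exact ⟨g, hg, hb⟩
  subst hfv
  have uniq₁ : ∀ {k}, τ k ≠ 0 → k ≠ v → A k (e 1) = 0 := fun {k} hk hkv => by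
    by_contra ha
    exact hkv (pτ.unique_nbr hA d₁ hk hv
      (h.white_edge hA (by omega) d₁ hk (dτ hk) (hA.ne_zero_symm ha)).2 wv ha (hA.ne_zero_symm ha₁))
  have uniq₂ : ∀ {k}, τ k ≠ 0 → k ≠ f m → A k (e 2) = 0 := fun {k} hk hkv => by
    by_contra ha
    exact hkv (pτ.unique_nbr hA d₂ hk hv'
      (h.white_edge hA (by omega) d₂ hk (dτ hk) (hA.ne_zero_symm ha)).2 wv' ha
      (hA.ne_zero_symm ha₂))
  have ff : ∀ i j, 1 ≤ i → i ≤ m → 1 ≤ j → j ≤ m → i + 1 = j ∨ j + 1 = i →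
      A (f i) (f j) ≠ 0 := fun i j a b c d hij =>
    hf.edge ⟨a, b⟩ ⟨c, d⟩ (by unfold cA; split_ifs <;> omega)
  obtain ⟨b, b₁, b₂, rfl⟩ := hf.cov v hv
  have hb := (hf.wh b b₁ b₂).1 wv
  rcases hm.eq_or_lt with rfl | hm'
  · obtain rfl : b = 1 := by omega
    exact d2_A_one hA h hd he hf ha₁ ha₂
  have p₂ : pr A τ (e 2) = A (f m) (e 2) := by
    rw [hf.pr_eq_of_unique hm le_rfl fun i a b c =>
      uniq₂ (hf.val_ne a b) (hf.ne a b hm le_rfl c), one_mul]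
  have p₁ : pr A τ (e 1) = A (f b) (e 1) := by
    rw [hf.pr_eq_of_unique b₁ b₂ fun i a b c =>
      uniq₁ (hf.val_ne a b) (hf.ne a b b₁ b₂ c), one_mul]
  rw [p₁, p₂] at hp
  have n₁ : e 1 ≠ f b := by intro h0; rw [h0] at d₁; exact hv d₁
  have n₂ : e 2 ≠ f m := by intro h0; rw [h0] at d₂; exact hv' d₂
  have s₁ := hA.edge_cases n₁ ha₁
  have s₂ := hA.edge_cases n₂ ha₂
  rcases hb with rfl | rfl
  · -- the two simple roots are attached to different ends
    have q₁ : pr A σ (f 1) ≤ A (e 1) (f 1) := by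
      have := hA.pr_le he.nonneg (dτ hv) (e 1)
      rwa [e₄, one_mul] at this
    have q₂ : pr A σ (f m) ≤ A (e 2) (f m) := by
      have := hA.pr_le he.nonneg (dτ hv') (e 2)
      rwa [e₅, one_mul] at this
    have q : ∀ i, 1 ≤ i → i ≤ m → pr A σ (f i) ≤ 0 := fun i a b =>
      hA.pr_nonpos he.nonneg (dτ (hf.val_ne a b))
    -- The combination is `σ + c τ`; `c = 1` excludes common pairings of at most `-2` with `e 1` and
    -- `e 2`, and `c = 2` excludes double edges at both ends.
    have kill : ∀ c : ℤ, 0 ≤ c → 2 + c * A (f m) (e 2) ≤ 0 → c + A (e 1) (f 1) ≤ 0 →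
        c + A (e 2) (f m) ≤ 0 → False := by
      intro c hc c₁ c₂ c₃
      refine hA.false_of_add he.nonneg (τ := c • τ) (i := e 1)
        (fun k => smul_nonneg hc (hf.nonneg k)) (fun k => ?_) (by omega)
      rw [pr_smul]
      rcases h.cover k with hk | hk
      · rcases he.cov_two hk with rfl | rfl
        · rw [p₁, hp]; omega
        · rw [p₂]; omega
      · obtain ⟨i, a, b, rfl⟩ := hf.cov k hk
        rw [pr_A hf a b]
        have h1 := q i a b
        rcases eq_or_ne i 1 with rfl | hi
        · rw [if_pos rfl, if_neg (by omega)]; omega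
        rcases eq_or_ne i m with rfl | hi'
        · rw [if_neg hi, if_pos rfl]; omega
        · rw [if_neg hi, if_neg hi']; omega
    have t₁ : ¬ A (e 1) (f 1) ≤ -3 := fun h3 => by
      have := nodup_of_disjoint (fun k => (hd k).symm) hf he [2, 1] [1] (by simp) (by simp)
        (by simp; omega) (by simp)
      simp at this
      exact hA.false_of_triple this.1.1 this.1.2 this.2
        (ff 2 1 (by omega) (by omega) (by omega) (by omega) (by omega)) (Or.inr h3)
    have t₂ : ¬ A (e 2) (f m) ≤ -3 := fun h3 => by
      have := nodup_of_disjoint (fun k => (hd k).symm) hf he [m - 1, m] [2] (by simp; omega)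
        (by simp) (by simp; omega) (by simp)
      simp at this
      exact hA.false_of_triple this.1.1 this.1.2 this.2
        (ff (m - 1) m (by omega) (by omega) (by omega) (by omega) (by omega)) (Or.inr h3)
    have h3 : A (f m) (e 2) = -1 := by
      by_contra h3
      exact kill 1 (by omega) (by omega) (by omega) (by omega)
    have k₂ : ¬ (A (e 1) (f 1) ≤ -2 ∧ A (e 2) (f m) ≤ -2) := fun h4 =>
      kill 2 (by omega) (by omega) (by omega) (by omega)
    have c₁ : ∀ i, 1 ≤ i → i ≤ m → i ≠ 1 → A (f i) (e 1) = 0 := fun i a b hi =>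
      uniq₁ (hf.val_ne a b) (hf.ne a b b₁ b₂ hi)
    have c₂ : ∀ i, 1 ≤ i → i ≤ m → i ≠ m → A (f i) (e 2) = 0 := fun i a b hi =>
      uniq₂ (hf.val_ne a b) (hf.ne a b hm le_rfl hi)
    by_cases h4 : A (e 1) (f 1) = -1
    · exact d2_A_path hA h hd he hm hf ⟨by omega, h4⟩ h3 (by omega) c₁ c₂
    · have r : f (m + 1 - m) = f 1 := by congr 1; omega
      refine d2_A_path hA h hd he.swap hm hf.rev ?_ ?_ ?_ (fun i a b hi => c₂ _ (by omega) (by omega)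
        (by omega)) (fun i a b hi => c₁ _ (by omega) (by omega) (by omega))
      · show A (f m) (e 2) = -1 ∧ A (e 2) (f m) = -1
        omega
      · rw [r]; show A (f 1) (e 1) = -1; omega
      · rw [r]; show A (e 1) (f 1) = -1 ∧ _ ∨ A (e 1) (f 1) = -2; omega
  · -- the two simple roots are attached to the same end
    have fork : ∀ i j, 1 ≤ i → i ≤ 2 → 1 ≤ j → j ≤ 2 → i ≠ j → A (e i) (f b) ≠ 0 →
        A (f b) (e j) ≤ -2 ∨ A (e j) (f b) ≤ -2 → False := by
      intro i j a₁ a₂ c₁ c₂ hij ha hs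
      have := nodup_of_disjoint hd he hf [i, j] [b - 1, b] (by simp; omega)
        (by simp; omega) (by simp; omega) (by simp; omega)
      simp at this
      obtain ⟨⟨n₁, n₂, n₃⟩, ⟨n₄, n₅⟩, n₆⟩ := this
      refine hA.false_of_fork (x := e i) (x' := f (b - 1)) (y := f b) (z := e j) ?_ ha
        (ff (b - 1) b (by omega) (by omega) (by omega) (by omega) (by omega)) hs
      simp [n₁, n₂, n₃, n₆, Ne.symm n₄, Ne.symm n₅]
    have k₁ := fork 1 2 (by omega) (by omega) (by omega) (by omega) (by omega) ha₁
    have k₂ := fork 2 1 (by omega) (by omega) (by omega) (by omega) (by omega) ha₂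
    refine d2_A_end hA h hd he hm hf (fun j c d => ?_) fun i j a b c d hi => ?_
    · obtain rfl | rfl : j = 1 ∨ j = 2 := by omega
      · by_contra h0
        exact k₂ (by omega)
      · by_contra h0
        exact k₁ (by omega)
    · obtain rfl | rfl : j = 1 ∨ j = 2 := by omega
      · exact uniq₁ (hf.val_ne a b) (hf.ne a b b₁ b₂ hi)
      · exact uniq₂ (hf.val_ne a b) (hf.ne a b b₁ b₂ hi)

/-- The two simple roots are attached to the first and last node of a support of type `B`. -/
lemma d2_B' (hA : FiniteType A) (h : Sys A W σ τ) (hd : ∀ k, σ k = 0 ∨ τ k = 0) (he : IsD₂ A W σ e)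
    (hm : 2 ≤ m) (hg : WR A W τ m (cB m) (fun _ => 1) (fun i => i = 1 ∨ i = m) g)
    (h1 : A (g 1) (e 1) = -1 ∧ A (e 1) (g 1) = -1) (h2 : A (g m) (e 2) = -1 ∧ A (e 2) (g m) = -1)
    (h3 : A (g m) (e 1) = 0) (h4 : A (g 1) (e 2) = 0) : InTable A W σ τ := by
  have hd' : ∀ k, τ k = 0 ∨ σ k = 0 := fun k => (hd k).symm
  rcases hm.eq_or_lt with rfl | hm'
  · refine glue_F₄_d.inTable_of_disjoint hA he hg h.cover hd ?_ ?_
    · intro k; simp only [α, Pi.add_apply]; split_ifs <;> omega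
    · intro i j a b c d
      have h5 := hA.symm _ _ h3
      have h6 := hA.symm _ _ h4
      interval_cases i <;> interval_cases j <;> simp [cB, ofList] <;> omega
  exfalso
  have gg : ∀ i j, 1 ≤ i → i ≤ m → 1 ≤ j → j ≤ m → i + 1 = j ∨ j + 1 = i →
      A (g i) (g j) ≠ 0 := fun i j a₁ a₂ c d hij =>
    hg.edge ⟨a₁, a₂⟩ ⟨c, d⟩ (by unfold cB; split_ifs <;> omega)
  have gd : A (g (m - 1)) (g m) ≤ -2 := by
    rw [hg.mat _ _ (by omega) (by omega) (by omega) le_rfl]; unfold cB; split_ifs <;> omega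
  rcases (show 3 ≤ m from hm').eq_or_lt with rfl | hm₄
  · have := nodup_of_disjoint hd he hg [1, 2] [1, 2, 3] (by simp) (by simp) (by simp) (by simp)
    refine hA.false_of_F (x₁ := e 1) (x₂ := g 1) (x₃ := g 2) (x₄ := g 3) (x₅ := e 2) ?_ (by omega)
      (gg _ _ (by omega) (by omega) (by omega) (by omega) (by omega))
      (gg _ _ (by omega) (by omega) (by omega) (by omega) (by omega)) (by omega) (Or.inl gd)
    simp at this ⊢
    tauto
  · exact hA.false_of_F (x₁ := g (m - 3)) (x₂ := g (m - 2)) (x₃ := g (m - 1)) (x₄ := g m)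
      (x₅ := e 2)
      (nodup_of_disjoint hd' hg he [m - 3, m - 2, m - 1, m] [2] (by simp; omega) (by simp)
        (by simp; omega) (by simp))
      (gg _ _ (by omega) (by omega) (by omega) (by omega) (by omega))
      (gg _ _ (by omega) (by omega) (by omega) (by omega) (by omega))
      (gg _ _ (by omega) (by omega) (by omega) (by omega) (by omega)) (by omega) (Or.inl gd)

/-- A root of type `D₂` and a disjoint connected support. -/
lemma d2_disjoint (hA : FiniteType A) (h : Sys A W σ τ) (hd : ∀ k, σ k = 0 ∨ τ k = 0)
    (he : IsD₂ A W σ e) (pτ : Prof A W τ) : InTable A W σ τ := by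
  obtain ⟨e₁, e₂, e₃, e₄, e₅, w₁, w₂, e₆, e₇⟩ := he.facts
  have hp := he.pr_eq h
  have d₁ := (hd (e 1)).resolve_left (by omega)
  have d₂ := (hd (e 2)).resolve_left (by omega)
  have dτ : ∀ {k}, τ k ≠ 0 → σ k = 0 := fun hk => (hd _).resolve_right hk
  have attached : ∀ {k}, τ k = 0 → pr A τ k ≠ 0 → ∃ v, τ v ≠ 0 ∧ A k v ≠ 0 := fun {k} hk h0 => by
    by_contra! hc
    refine h0 (Finset.sum_eq_zero fun j _ => ?_)
    by_cases hj : τ j = 0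
    · rw [hj, zero_mul]
    · rw [hA.symm _ _ (hc j hj), mul_zero]
  -- Some node of `σ` is joined to `τ`, so one of the two pairings is negative. By axiom 3 both are,
  -- and both nodes are attached to `τ`.
  have neg : pr A τ (e 1) < 0 := by
    obtain ⟨u, v, hu, hv, ha⟩ := h.conn
    have h1 := hA.pr_neg pτ.nonneg ((hd u).resolve_left hu) hv (hA.ne_zero_symm ha)
    have := pτ.nonneg v
    rcases he.cov_two hu with rfl | rfl <;> omega
  obtain ⟨v, hv, ha₁⟩ := attached d₁ (by omega)
  obtain ⟨v', hv', ha₂⟩ := attached d₂ (by omega)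
  have wv := (h.white_edge hA (by omega) d₁ hv (dτ hv) ha₁).2
  have wv' := (h.white_edge hA (by omega) d₂ hv' (dτ hv') ha₂).2
  rcases h.root₂.heavy_or hA with ⟨m, g, hm, hg⟩ | ⟨g, hg⟩ | hH
  · exact d2_A hA h hd he pτ hm hg hv hv' ha₁ ha₂
  · exact (hg.not_prof (fun i a b => by omega) pτ).elim
  have hvv : v ≠ v' := by
    rintro rfl
    exact (hH v hv wv).false_of_two hA e₁ d₁ d₂ (hA.ne_zero_symm ha₁) (hA.ne_zero_symm ha₂)
  have s₁ := (hH v hv wv).simple hA d₁ (hA.ne_zero_symm ha₁)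
  have s₂ := (hH v' hv' wv').simple hA d₂ (hA.ne_zero_symm ha₂)
  have sup₁ : ¬ SuperHeavy A τ v := fun hs => hA.ne_zero_symm ha₁ (hs.isolated hA d₁)
  have sup₂ : ¬ SuperHeavy A τ v' := fun hs => hA.ne_zero_symm ha₂ (hs.isolated hA d₂)
  have z₁ : A v' (e 1) = 0 := by
    by_contra h0
    exact hvv (pτ.unique_nbr hA d₁ hv hv' wv wv' (hA.ne_zero_symm ha₁) h0)
  have z₂ : A v (e 2) = 0 := by
    by_contra h0
    exact hvv (pτ.unique_nbr hA d₂ hv hv' wv wv' h0 (hA.ne_zero_symm ha₂))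
  have hr := h.root₂
  rcases hr with ⟨m, g, hm, hg⟩ | ⟨m, g, hm, hg⟩ | ⟨m, g, hm, hg⟩ | ⟨m, g, hm, hg⟩ | ⟨m, g, hm, hg⟩ |
    ⟨g, hg⟩ | ⟨g, hg⟩ | ⟨g, hg⟩ | ⟨g, hg⟩ | ⟨m, g, hm, hg⟩ | ⟨g, hg⟩
  case A => exact d2_A hA h hd he pτ hm hg hv hv' ha₁ ha₂
  case D₂ => exact (hg.not_prof (fun i a b => by omega) pτ).elim
  all_goals
    obtain ⟨b, b₁, b₂, rfl⟩ := hg.cov _ hv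
    have wb := (hg.wh b b₁ b₂).1 wv
    obtain ⟨c, c₁, c₂, rfl⟩ := hg.cov _ hv'
    have wc := (hg.wh c c₁ c₂).1 wv'
    have hbc : b ≠ c := fun hbc => hvv (by rw [hbc])
  case B' =>
    obtain ⟨rfl, rfl⟩ | ⟨rfl, rfl⟩ : (b = 1 ∧ c = m) ∨ (b = m ∧ c = 1) := by omega
    · exact d2_B' hA h hd he hm hg s₁ s₂ z₁ z₂
    · exact d2_B' hA h hd he.swap hm hg s₂ s₁ z₂ z₁
  case C' =>
    obtain rfl | rfl : b = 2 ∨ c = 2 := by omega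
    exacts [(sup₁ (superHeavy_C hm hg)).elim, (sup₂ (superHeavy_C hm hg)).elim]
  case G₂' =>
    obtain rfl | rfl : b = 1 ∨ c = 1 := by omega
    exacts [(sup₁ (superHeavy_G₂' hg).1).elim, (sup₂ (superHeavy_G₂' hg).1).elim]
  all_goals omega

/-- A root of type `D₂` and a root with connected support. -/
lemma d2_connected (hA : FiniteType A) (h : Sys A W σ τ) (he : IsD₂ A W σ e) (pτ : Prof A W τ) :
    InTable A W σ τ := by
  by_cases hI : ∃ k, σ k ≠ 0 ∧ τ k ≠ 0
  · exact d2_overlap hA h he pτ hI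
  · exact d2_disjoint hA h (fun k => by by_contra! hc; exact hI ⟨k, hc⟩) he pτ

end TypeDTwoDisjoint
end WeakSpherical

namespace WeakSpherical

section Overlap

variable {κ : Type*} [Fintype κ] [DecidableEq κ] {A : κ → κ → ℤ} {W : κ → Prop} {σ τ ρ : κ → ℤ}
  {p q n m : ℕ} {e g : ℕ → κ} {C D : ℕ → ℕ → ℤ} {l l' : ℕ → ℤ} {w w' : ℕ → Prop}

/-! ### Chains -/

/-- The diagram of the Cartan matrix `C` is a chain with `n` nodes. -/
structure IsChain (C : ℕ → ℕ → ℤ) (n : ℕ) : Prop where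
  near : ∀ i, 1 ≤ i → i < n → C i (i + 1) ≠ 0 ∧ C (i + 1) i ≠ 0
  far : ∀ i j, 1 ≤ i → i ≤ n → 1 ≤ j → j ≤ n → i ≠ j → j ≠ i + 1 → i ≠ j + 1 → C i j = 0

lemma isChain_A (n : ℕ) : IsChain cA n := by
  constructor
  · intro i a b; simp [cA]
  · intro i j a b c d e f g; simp only [cA]; split_ifs <;> omega

lemma isChain_B (n m : ℕ) : IsChain (cB n) m := by
  constructor
  · intro i a b; constructor <;> simp only [cB] <;> split_ifs <;> omega
  · intro i j a b c d e f g; simp only [cB]; split_ifs <;> omega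

lemma isChain_C (n m : ℕ) : IsChain (cC n) m := by
  constructor
  · intro i a b; constructor <;> simp only [cC] <;> split_ifs <;> omega
  · intro i j a b c d e f g; simp only [cC]; split_ifs <;> omega

lemma isChain_G : IsChain cG 2 := by
  constructor
  · intro i a b; obtain rfl : i = 1 := by omega
    simp [cG]
  · intro i j a b c d e f g; omega

lemma WR.nbr (h : WR A W ρ n C l w e) (hC : IsChain C n) {i : ℕ} (hi : 1 ≤ i) (hin : i ≤ n) {k : κ}
    (hk : ρ k ≠ 0) (hne : k ≠ e i) (ha : A (e i) k ≠ 0) :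
    ∃ j, 1 ≤ j ∧ j ≤ n ∧ k = e j ∧ (j = i + 1 ∨ i = j + 1) := by
  obtain ⟨j, a, b, rfl⟩ := h.cov k hk
  refine ⟨j, a, b, rfl, ?_⟩
  by_contra! hc
  rw [h.mat i j hi hin a b] at ha
  exact ha (hC.far i j hi hin a b (fun hij => hne (by rw [hij])) hc.1 hc.2)

lemma WR.adj (h : WR A W ρ n C l w e) (hC : IsChain C n) {i j : ℕ} (hi : 1 ≤ i) (hin : i ≤ n)
    (hj : 1 ≤ j) (hjn : j ≤ n) (hij : j = i + 1 ∨ i = j + 1) : A (e i) (e j) ≠ 0 := by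
  rw [h.mat i j hi hin hj hjn]
  rcases hij with rfl | rfl
  exacts [(hC.near i hi (by omega)).1, (hC.near j hj (by omega)).2]

/-- A node of a chain does not have three neighbours. -/
lemma WR.not_three (h : WR A W ρ n C l w e) (hC : IsChain C n) {x k₁ k₂ k₃ : κ} (hx : ρ x ≠ 0)
    (h₁ : ρ k₁ ≠ 0) (h₂ : ρ k₂ ≠ 0) (h₃ : ρ k₃ ≠ 0) (hd : [x, k₁, k₂, k₃].Nodup) (a₁ : A x k₁ ≠ 0)
    (a₂ : A x k₂ ≠ 0) (a₃ : A x k₃ ≠ 0) : False := by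
  simp at hd
  obtain ⟨⟨n₁, n₂, n₃⟩, ⟨n₄, n₅⟩, n₆⟩ := hd
  obtain ⟨i, hi, hin, rfl⟩ := h.cov x hx
  obtain ⟨j₁, b₁, c₁, rfl, d₁⟩ := h.nbr hC hi hin h₁ (Ne.symm n₁) a₁
  obtain ⟨j₂, b₂, c₂, rfl, d₂⟩ := h.nbr hC hi hin h₂ (Ne.symm n₂) a₂
  obtain ⟨j₃, b₃, c₃, rfl, d₃⟩ := h.nbr hC hi hin h₃ (Ne.symm n₃) a₃
  have m₁ : j₁ ≠ j₂ := by rintro rfl; exact n₄ rfl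
  have m₂ : j₁ ≠ j₃ := by rintro rfl; exact n₅ rfl
  have m₃ : j₂ ≠ j₃ := by rintro rfl; exact n₆ rfl
  omega

/-- An end node of a chain does not have two neighbours. -/
lemma WR.not_two (h : WR A W ρ n C l w e) (hC : IsChain C n) {i : ℕ} (hi : 1 ≤ i) (hin : i ≤ n)
    (hi' : i = 1 ∨ i = n) {k₁ k₂ : κ} (h₁ : ρ k₁ ≠ 0) (h₂ : ρ k₂ ≠ 0) (n₁ : k₁ ≠ e i) (n₂ : k₂ ≠ e i)
    (hne : k₁ ≠ k₂) (a₁ : A (e i) k₁ ≠ 0) (a₂ : A (e i) k₂ ≠ 0) : False := by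
  obtain ⟨j₁, b₁, c₁, rfl, d₁⟩ := h.nbr hC hi hin h₁ n₁ a₁
  obtain ⟨j₂, b₂, c₂, rfl, d₂⟩ := h.nbr hC hi hin h₂ n₂ a₂
  have m₁ : j₁ ≠ j₂ := by rintro rfl; exact hne rfl
  omega

/-- Membership in a support spreads along edges to black nodes. This is what forces overlapping
supports to share long pieces. -/
lemma Sys.mem₁ (hA : FiniteType A) (h : Sys A W σ τ) {k j : κ} (hW : ¬ W k) (hj : σ j ≠ 0)
    (ha : A j k ≠ 0) : σ k ≠ 0 := fun h0 => ha (h.black₁ hA hW h0 hj)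

lemma Sys.mem₂ (hA : FiniteType A) (h : Sys A W σ τ) {k j : κ} (hW : ¬ W k) (hj : τ j ≠ 0)
    (ha : A j k ≠ 0) : τ k ≠ 0 := fun h0 => ha (h.black₂ hA hW h0 hj)

/-- A chain of black nodes that meets the other support is contained in it. -/
lemma WR.walk (hA : FiniteType A) (h : Sys A W σ τ) (he : WR A W ρ n C l w e) (hC : IsChain C n)
    {a b j : ℕ} (ha : 1 ≤ a) (hb : b ≤ n) (hW : ∀ i, a ≤ i → i ≤ b → i ≠ j → ¬ W (e i)) (haj : a ≤ j)
    (hjb : j ≤ b) (hj : τ (e j) ≠ 0) : ∀ i, a ≤ i → i ≤ b → τ (e i) ≠ 0 := by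
  have up : ∀ d, j + d ≤ b → τ (e (j + d)) ≠ 0 := by
    intro d
    induction d with
    | zero => exact fun _ => hj
    | succ d ih =>
      intro hd
      exact h.mem₂ hA (hW _ (by omega) hd (by omega)) (ih (by omega))
        (he.adj hC (by omega) (by omega) (by omega) (by omega) (by omega))
  have down : ∀ d, a + d ≤ j → τ (e (j - d)) ≠ 0 := by
    intro d
    induction d with
    | zero => exact fun _ => hj
    | succ d ih =>
      intro hd
      exact h.mem₂ hA (hW _ (by omega) (by omega) (by omega)) (ih (by omega))
        (he.adj hC (by omega) (by omega) (by omega) (by omega) (by omega))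
  intro i hi hib
  rcases le_total i j with hij | hij
  · have := down (j - i) (by omega)
    rwa [show j - (j - i) = i by omega] at this
  · have := up (i - j) (by omega)
    rwa [show j + (i - j) = i by omega] at this

lemma WR.ge_neg_one (h : WR A W ρ n C l w e)
    (hC : ∀ i j, 1 ≤ i → i ≤ n → 1 ≤ j → j ≤ n → -1 ≤ C i j) {j k : κ} (hj : ρ j ≠ 0) (hk : ρ k ≠ 0) :
    -1 ≤ A j k := by
  obtain ⟨i, a, b, rfl⟩ := h.cov j hj
  obtain ⟨i', c, d, rfl⟩ := h.cov k hk
  rw [h.mat i i' a b c d]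
  exact hC i i' a b c d

lemma IsA.ge_neg_one (h : IsA A W ρ n e) {j k : κ} (hj : ρ j ≠ 0) (hk : ρ k ≠ 0) : -1 ≤ A j k :=
  WR.ge_neg_one h (fun i j _ _ _ _ => by unfold cA; split_ifs <;> omega) hj hk

/-! ### Roots with the same support -/

/-- By axiom 2 the roots agree on black coroots too, and the Cartan matrix is non-degenerate. -/
lemma Sys.false_of_pr_eq (hA : FiniteType A) (h : Sys A W σ τ)
    (hp : ∀ k, W k → pr A σ k = pr A τ k) : False := by
  refine h.ne (sub_eq_zero.1 (funext (hA.nondeg (σ - τ) fun k => ?_)))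
  have h1 : pr A (σ - τ) k = pr A σ k - pr A τ k := by
    rw [sub_eq_add_neg, pr_add, ← neg_one_smul ℤ τ, pr_smul]; ring
  rw [h1]
  by_cases hW : W k
  · rw [hp k hW, sub_self]
  · rw [(h.black k hW).1, (h.black k hW).2, sub_self]

/-- It would follow that `τ = 2 σ`, but every root with connected support has a coefficient 1. -/
lemma Sys.false_of_double_pr (hA : FiniteType A) (h : Sys A W σ τ) (pτ : Prof A W τ)
    (hp : ∀ k, W k → 2 * pr A σ k = pr A τ k) : False := by
  have h1 := hA.nondeg (2 • σ - τ) fun k => by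
    have h1 : pr A (2 • σ - τ) k = 2 * pr A σ k - pr A τ k := by
      rw [sub_eq_add_neg, pr_add, ← neg_one_smul ℤ τ, pr_smul, two_smul, pr_add]; ring
    rw [h1]
    by_cases hW : W k
    · rw [hp k hW, sub_self]
    · rw [(h.black k hW).1, (h.black k hW).2]; rfl
  obtain ⟨k, hk⟩ := pτ.one
  have := h1 k
  simp [hk] at this
  omega

/-- The weak spherical roots with two white nodes and connected support. -/
lemma Rt.two_white (h : Rt A W ρ) (p : Prof A W ρ) {x y : κ} (hx : ρ x ≠ 0) (hy : ρ y ≠ 0) (wx : W x)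
    (wy : W y) (hxy : x ≠ y) :
    (∃ n e, 2 ≤ n ∧ IsA A W ρ n e ∧ x = e 1 ∧ y = e n) ∨
    (∃ n e, 2 ≤ n ∧ WR A W ρ n (cB n) (fun _ => 1) (fun i => i = 1 ∨ i = n) e ∧
      (x = e 1 ∧ y = e n ∨ x = e n ∧ y = e 1)) ∨
    (∃ n e, 3 ≤ n ∧ WR A W ρ n (cC n) (lC n) (fun i => i = 1 ∨ i = 2) e ∧
      (x = e 1 ∧ y = e 2 ∨ x = e 2 ∧ y = e 1)) ∨
    ∃ e, WR A W ρ 2 cG (fun _ => 1) (fun i => i = 1 ∨ i = 2) e ∧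
      (x = e 1 ∧ y = e 2 ∨ x = e 2 ∧ y = e 1) := by
  rcases h with ⟨m, g, hm, hg⟩ | ⟨m, g, hm, hg⟩ | ⟨m, g, hm, hg⟩ | ⟨m, g, hm, hg⟩ | ⟨m, g, hm, hg⟩ |
    ⟨g, hg⟩ | ⟨g, hg⟩ | ⟨g, hg⟩ | ⟨g, hg⟩ | ⟨m, g, hm, hg⟩ | ⟨g, hg⟩
  all_goals
    obtain ⟨b, b₁, b₂, rfl⟩ := hg.cov _ hx
    have wb := (hg.wh b b₁ b₂).1 wx
    obtain ⟨c, c₁, c₂, rfl⟩ := hg.cov _ hy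
    have wc := (hg.wh c c₁ c₂).1 wy
    have hbc : b ≠ c := fun hbc => hxy (by rw [hbc])
  case A =>
    left
    obtain ⟨rfl, rfl⟩ | ⟨rfl, rfl⟩ : (b = 1 ∧ c = m) ∨ (b = m ∧ c = 1) := by omega
    · exact ⟨c, g, by omega, hg, rfl, rfl⟩
    · exact ⟨b, _, by omega, hg.rev, by simp, by congr 1; omega⟩
  case B' =>
    right; left
    obtain ⟨rfl, rfl⟩ | ⟨rfl, rfl⟩ : (b = 1 ∧ c = m) ∨ (b = m ∧ c = 1) := by omega
    · exact ⟨c, g, hm, hg, Or.inl ⟨rfl, rfl⟩⟩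
    · exact ⟨b, g, hm, hg, Or.inr ⟨rfl, rfl⟩⟩
  case C' =>
    right; right; left
    obtain ⟨rfl, rfl⟩ | ⟨rfl, rfl⟩ : (b = 1 ∧ c = 2) ∨ (b = 2 ∧ c = 1) := by omega
    · exact ⟨m, g, hm, hg, Or.inl ⟨rfl, rfl⟩⟩
    · exact ⟨m, g, hm, hg, Or.inr ⟨rfl, rfl⟩⟩
  case G₂' =>
    right; right; right
    obtain ⟨rfl, rfl⟩ | ⟨rfl, rfl⟩ : (b = 1 ∧ c = 2) ∨ (b = 2 ∧ c = 1) := by omega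
    · exact ⟨g, hg, Or.inl ⟨rfl, rfl⟩⟩
    · exact ⟨g, hg, Or.inr ⟨rfl, rfl⟩⟩
  case D₂ => exact (hg.not_prof (fun i a b => by omega) p).elim
  all_goals omega

lemma B'_edge (hn : 2 ≤ n) (h : WR A W ρ n (cB n) (fun _ => 1) w e) :
    A (e (n - 1)) (e n) = -2 := by
  rw [h.mat _ _ (by omega) (by omega) (by omega) le_rfl]; unfold cB; split_ifs <;> omega

lemma C_edge (hn : 3 ≤ n) (h : WR A W ρ n (cC n) (lC n) w e) : A (e n) (e (n - 1)) = -2 := by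
  rw [h.mat _ _ (by omega) le_rfl (by omega) (by omega)]; unfold cC; split_ifs <;> omega

lemma G₂_edge (h : WR A W ρ 2 cG l w e) : A (e 2) (e 1) = -3 ∧ A (e 1) (e 2) = -1 := by
  rw [h.mat 2 1 (by omega) (by omega) (by omega) (by omega),
    h.mat 1 2 (by omega) (by omega) (by omega) (by omega)]; simp [cG]

lemma WR.ge_neg_two (h : WR A W ρ n C l w e)
    (hC : ∀ i j, 1 ≤ i → i ≤ n → 1 ≤ j → j ≤ n → -2 ≤ C i j) {j k : κ} (hj : ρ j ≠ 0) (hk : ρ k ≠ 0) :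
    -2 ≤ A j k := by
  obtain ⟨i, a, b, rfl⟩ := h.cov j hj
  obtain ⟨i', c, d, rfl⟩ := h.cov k hk
  rw [h.mat i i' a b c d]
  exact hC i i' a b c d

lemma cB_ge (n i j : ℕ) : -2 ≤ cB n i j := by unfold cB; split_ifs <;> omega
lemma cC_ge (n i j : ℕ) : -2 ≤ cC n i j := by unfold cC; split_ifs <;> omega

/-- Two different connected weak spherical roots do not have the same support. -/
lemma Sys.false_of_same_supp (hA : FiniteType A) (h : Sys A W σ τ) (pσ : Prof A W σ)
    (pτ : Prof A W τ) (hs : ∀ k, σ k ≠ 0) (ht : ∀ k, τ k ≠ 0) : False := by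
  obtain ⟨x, -, wx⟩ := pσ.white
  by_cases hy : ∃ y, W y ∧ x ≠ y
  · obtain ⟨y, wy, hxy⟩ := hy
    have two : ∀ k, W k → k = x ∨ k = y := fun k hk =>
      (pσ.two x y (hs x) (hs y) wx wy hxy).2 k (hs k) hk
    by_cases hp : pr A σ x = pr A τ x ∧ pr A σ y = pr A τ y
    · refine h.false_of_pr_eq hA fun k hk => ?_
      rcases two k hk with rfl | rfl
      exacts [hp.1, hp.2]
    -- Edge multiplicities, their directions and the position of the white nodes tell the types
    -- apart. So both roots are of the same type with `x` and `y` in the same places, and their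
    -- pairings agree.
    have main : ∀ {σ τ : κ → ℤ} {x y : κ}, W x → W y → x ≠ y → Rt A W σ → Rt A W τ → Prof A W σ → Prof A W τ → (∀ k, σ k ≠ 0) →
        (∀ k, τ k ≠ 0) → ¬ (pr A σ x = pr A τ x ∧ pr A σ y = pr A τ y) →
        (∃ n e, 2 ≤ n ∧ IsA A W σ n e ∧ x = e 1 ∧ y = e n) ∨
        (∃ n e, 2 ≤ n ∧ WR A W σ n (cB n) (fun _ => 1) (fun i => i = 1 ∨ i = n) e ∧
          (x = e 1 ∧ y = e n)) ∨
        (∃ n e, 3 ≤ n ∧ WR A W σ n (cC n) (lC n) (fun i => i = 1 ∨ i = 2) e ∧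
          (x = e 1 ∧ y = e 2)) ∨
        (∃ e, WR A W σ 2 cG (fun _ => 1) (fun i => i = 1 ∨ i = 2) e ∧ (x = e 1 ∧ y = e 2)) →
        False := by
      intro σ τ x y wx wy hxy rσ rτ pσ pτ hs ht hp hσ
      rcases hσ with ⟨n, e, hn, he, hx, hy⟩ | ⟨n, e, hn, he, hx, hy⟩ | ⟨n, e, hn, he, hx, hy⟩ |
        ⟨e, he, hx, hy⟩ <;>
      rcases rτ.two_white pτ (ht x) (ht y) wx wy hxy with ⟨m, g, hm, hg, hx', hy'⟩ |
        ⟨m, g, hm, hg, hx'⟩ | ⟨m, g, hm, hg, hx'⟩ | ⟨g, hg, hx'⟩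
      · refine hp ⟨?_, ?_⟩
        · rw [hx, pr_A he (by omega) (by omega), ← hx, hx', pr_A hg (by omega) (by omega)]
          simp only [if_true]; split_ifs <;> omega
        · rw [hy, pr_A he (by omega) (by omega), ← hy, hy', pr_A hg (by omega) (by omega)]
          simp only [if_true]; split_ifs <;> omega
      · have := B'_edge hm hg
        have := he.ge_neg_one (hs (g (m - 1))) (hs (g m))
        omega
      · have := C_edge hm hg
        have := he.ge_neg_one (hs (g m)) (hs (g (m - 1)))
        omega
      · have := G₂_edge hg
        have := he.ge_neg_one (hs (g 2)) (hs (g 1))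
        omega
      · have := B'_edge hn he
        have := hg.ge_neg_one (ht (e (n - 1))) (ht (e n))
        omega
      · rcases hx' with ⟨hx', hy'⟩ | ⟨hx', hy'⟩
        · refine hp ⟨?_, ?_⟩
          · rw [hx, pr_B hn he (by omega) (by omega), ← hx, hx', pr_B hm hg (by omega) (by omega)]
          · rw [hy, pr_B hn he (by omega) (by omega), ← hy, hy', pr_B hm hg (by omega) (by omega)]
            split_ifs <;> omega
        · have h1 := B'_edge hm hg
          obtain ⟨i, a, b, hi⟩ := he.cov (g (m - 1)) (hs _)
          rw [hi, ← hx', hx, he.mat i 1 a b (by omega) (by omega)] at h1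
          unfold cB at h1; split_ifs at h1 <;> omega
      · have h1 : A x y ≠ 0 := by
          rcases hx' with ⟨hx', hy'⟩ | ⟨hx', hy'⟩ <;> rw [hx', hy'] <;>
          exact hg.adj (isChain_C m m) (by omega) (by omega) (by omega) (by omega) (by omega)
        obtain ⟨i, a, b, hi⟩ := he.cov (g 3) (hs _)
        have h2 : ¬ W (g 3) := by rw [hg.wh 3 (by omega) (by omega)]; omega
        rw [hi, he.wh i a b] at h2
        rw [hx, hy, he.mat 1 n (by omega) (by omega) (by omega) (by omega)] at h1
        unfold cB at h1; split_ifs at h1 <;> omega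
      · have := G₂_edge hg
        have := he.ge_neg_two (fun i j _ _ _ _ => cB_ge n i j) (hs (g 2)) (hs (g 1))
        omega
      · have := C_edge hn he
        have := hg.ge_neg_one (ht (e n)) (ht (e (n - 1)))
        omega
      · have h1 : A x y ≠ 0 := by
          rw [hx, hy]
          exact he.adj (isChain_C n n) (by omega) (by omega) (by omega) (by omega) (by omega)
        obtain ⟨i, a, b, hi⟩ := hg.cov (e 3) (ht _)
        have h2 : ¬ W (e 3) := by rw [he.wh 3 (by omega) (by omega)]; omega
        rw [hi, hg.wh i a b] at h2
        rcases hx' with ⟨hx', hy'⟩ | ⟨hx', hy'⟩ <;>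
          rw [hx', hy', hg.mat _ _ (by omega) (by omega) (by omega) (by omega)] at h1 <;>
          unfold cB at h1 <;> split_ifs at h1 <;> omega
      · rcases hx' with ⟨hx', hy'⟩ | ⟨hx', hy'⟩
        · refine hp ⟨?_, ?_⟩
          · rw [hx, pr_C hn he (by omega) (by omega), ← hx, hx', pr_C hm hg (by omega) (by omega)]
          · rw [hy, pr_C hn he (by omega) (by omega), ← hy, hy', pr_C hm hg (by omega) (by omega)]
        · have h1 := he.adj (isChain_C n n) (i := 2) (j := 3) (by omega) (by omega) (by omega) hn
            (by omega)
          rw [← hy, hy'] at h1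
          obtain ⟨j, a, b, hj, hj'⟩ := hg.nbr (isChain_C m m) (by omega) (by omega) (ht _) (by
            rw [← hy', hy]
            exact he.ne (by omega) hn (by omega) (by omega) (by omega)) h1
          obtain rfl : j = 2 := by omega
          rw [← hx', hx] at hj
          exact he.ne (by omega) hn (by omega) (by omega) (by omega) hj
      · have := G₂_edge hg
        have := he.ge_neg_two (fun i j _ _ _ _ => cC_ge n i j) (hs (g 2)) (hs (g 1))
        omega
      · have := G₂_edge he
        have := hg.ge_neg_one (ht (e 2)) (ht (e 1))
        omega
      · have := G₂_edge he
        have := hg.ge_neg_two (fun i j _ _ _ _ => cB_ge m i j) (ht (e 2)) (ht (e 1))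
        omega
      · have := G₂_edge he
        have := hg.ge_neg_two (fun i j _ _ _ _ => cC_ge m i j) (ht (e 2)) (ht (e 1))
        omega
      · rcases hx' with ⟨hx', hy'⟩ | ⟨hx', hy'⟩
        · refine hp ⟨?_, ?_⟩
          · rw [hx, pr_G₂' he (by omega) (by omega), ← hx, hx', pr_G₂' hg (by omega) (by omega)]
          · rw [hy, pr_G₂' he (by omega) (by omega), ← hy, hy', pr_G₂' hg (by omega) (by omega)]
        · have h1 := G₂_edge he
          have h2 := G₂_edge hg
          rw [← hx, ← hy, hx', hy'] at h1
          omega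
    rcases h.root₁.two_white pσ (hs x) (hs y) wx wy hxy with ⟨n, e, hn, he, he'⟩ |
        ⟨n, e, hn, he, he'⟩ | ⟨n, e, hn, he, he'⟩ | ⟨e, he, he'⟩
    · exact main wx wy hxy h.root₁ h.root₂ pσ pτ hs ht hp (Or.inl ⟨n, e, hn, he, he'⟩)
    all_goals rcases he' with he' | ⟨hx, hy⟩
    · exact main wx wy hxy h.root₁ h.root₂ pσ pτ hs ht hp (Or.inr (Or.inl ⟨n, e, hn, he, he'⟩))
    · exact main wy wx hxy.symm h.root₁ h.root₂ pσ pτ hs ht (fun h => hp h.symm)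
        (Or.inr (Or.inl ⟨n, e, hn, he, hy, hx⟩))
    · exact main wx wy hxy h.root₁ h.root₂ pσ pτ hs ht hp
        (Or.inr (Or.inr (Or.inl ⟨n, e, hn, he, he'⟩)))
    · exact main wy wx hxy.symm h.root₁ h.root₂ pσ pτ hs ht (fun h => hp h.symm)
        (Or.inr (Or.inr (Or.inl ⟨n, e, hn, he, hy, hx⟩)))
    · exact main wx wy hxy h.root₁ h.root₂ pσ pτ hs ht hp (Or.inr (Or.inr (Or.inr ⟨e, he, he'⟩)))
    · exact main wy wx hxy.symm h.root₁ h.root₂ pσ pτ hs ht (fun h => hp h.symm)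
        (Or.inr (Or.inr (Or.inr ⟨e, he, hy, hx⟩)))
  · push Not at hy
    have hy' : ∀ k, W k → k = x := fun k hk => (hy k hk).symm
    have h1 := pσ.pos x (hs x) wx fun k _ => hy' k
    have h2 := pτ.pos x (ht x) wx fun k _ => hy' k
    -- Both roots pair to 1 or 2 with the only white coroot, hence one is the other one or its
    -- double.
    obtain h3 | h3 | h3 : pr A σ x = pr A τ x ∨ 2 * pr A σ x = pr A τ x ∨
      2 * pr A τ x = pr A σ x := by omega
    · exact h.false_of_pr_eq hA fun k hk => by rwa [hy' k hk]
    · exact h.false_of_double_pr hA pτ fun k hk => by rwa [hy' k hk]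
    · exact (h.swap hA).false_of_double_pr hA pσ fun k hk => by rwa [hy' k hk]

end Overlap
end WeakSpherical

namespace WeakSpherical

section Contained

variable {κ : Type*} [Fintype κ] [DecidableEq κ] {A : κ → κ → ℤ} {W : κ → Prop} {σ τ ρ : κ → ℤ}
  {p q n m : ℕ} {e g : ℕ → κ} {C D : ℕ → ℕ → ℤ} {l l' : ℕ → ℤ} {w w' : ℕ → Prop}

/-! ### A support that contains the other one -/

lemma WR.eq_single_one (h : WR A W ρ 1 C (fun _ => 1) w e) : ρ = Pi.single (e 1) 1 := by
  ext k
  by_cases hk : ρ k = 0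
  · have h4 : k ≠ e 1 := by rintro rfl; exact h.val_ne le_rfl le_rfl hk
    simp [hk, h4]
  · obtain ⟨i, a, b, rfl⟩ := h.cov k hk
    obtain rfl : i = 1 := by omega
    simp [h.val 1 a b]

lemma WR.eq_single_two (h : WR A W ρ 2 C (fun _ => 1) w e) :
    ρ = Pi.single (e 1) 1 + Pi.single (e 2) 1 := by
  have hne := h.ne (i := 1) (j := 2) le_rfl (by omega) (by omega) le_rfl (by omega)
  ext k
  by_cases hk : ρ k = 0
  · have h4 : k ≠ e 1 := by rintro rfl; exact h.val_ne le_rfl (by omega) hk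
    have h5 : k ≠ e 2 := by rintro rfl; exact h.val_ne (by omega) le_rfl hk
    simp [hk, h4, h5]
  · obtain ⟨i, a, b, rfl⟩ := h.cov k hk
    obtain rfl | rfl : i = 1 ∨ i = 2 := by omega
    · simp [h.val 1 a b, hne]
    · simp [h.val 2 a b, hne.symm]

/-- The weak spherical roots with one white node and connected support. -/
lemma Rt.one_white (h : Rt A W ρ) (p : Prof A W ρ) {x : κ} (hx : ρ x ≠ 0) (wx : W x)
    (hu : ∀ k, ρ k ≠ 0 → W k → k = x) :
    (∃ e, IsA A W ρ 1 e ∧ x = e 1) ∨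
    (∃ n e, 2 ≤ n ∧ WR A W ρ n (cB n) (fun _ => 1) (fun i => i = 1) e ∧ x = e 1) ∨
    (∃ n e, 3 ≤ n ∧ WR A W ρ n (cC n) (lC n) (fun i => i = 2) e ∧ x = e 2) ∨
    (∃ e, WR A W ρ 4 (cB 3) lF (fun i => i = 4) e ∧ x = e 4) ∨
    (∃ e, WR A W ρ 2 cG (fun i => 3 - i) (fun i => i = 1) e ∧ x = e 1) ∨
    (∃ n e, 3 ≤ n ∧ WR A W ρ n (cD n) (lD n) (fun i => i = 1) e ∧ x = e 1) ∨
    ∃ e, WR A W ρ 3 (cB 3) (fun i => i) (fun i => i = 3) e ∧ x = e 3 := by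
  rcases h with ⟨m, g, hm, hg⟩ | ⟨m, g, hm, hg⟩ | ⟨m, g, hm, hg⟩ | ⟨m, g, hm, hg⟩ | ⟨m, g, hm, hg⟩ |
    ⟨g, hg⟩ | ⟨g, hg⟩ | ⟨g, hg⟩ | ⟨g, hg⟩ | ⟨m, g, hm, hg⟩ | ⟨g, hg⟩
  all_goals
    obtain ⟨b, b₁, b₂, rfl⟩ := hg.cov _ hx
    have wb := (hg.wh b b₁ b₂).1 wx
    have hu' : ∀ i, 1 ≤ i → i ≤ _ → _ → i = b := fun i c d hi =>
      hg.inj _ _ c d b₁ b₂ (hu _ (hg.val_ne c d) ((hg.wh i c d).2 hi))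
  case A =>
    have h1 := hu' 1 le_rfl hm (Or.inl rfl)
    have h2 := hu' m hm le_rfl (Or.inr rfl)
    obtain rfl : m = 1 := by omega
    exact Or.inl ⟨g, hg, by rw [h1]⟩
  case B => exact Or.inr (Or.inl ⟨m, g, hm, hg, by rw [wb]⟩)
  case B' =>
    have h1 := hu' 1 le_rfl (by omega) (Or.inl rfl)
    have h2 := hu' m (by omega) le_rfl (Or.inr rfl)
    omega
  case C => exact Or.inr (Or.inr (Or.inl ⟨m, g, hm, hg, by rw [wb]⟩))
  case C' =>
    have h1 := hu' 1 le_rfl (by omega) (Or.inl rfl)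
    have h2 := hu' 2 (by omega) (by omega) (Or.inr rfl)
    omega
  case F₄ => exact Or.inr (Or.inr (Or.inr (Or.inl ⟨g, hg, by rw [wb]⟩)))
  case G₂ => exact Or.inr (Or.inr (Or.inr (Or.inr (Or.inl ⟨g, hg, by rw [wb]⟩))))
  case G₂' =>
    have h1 := hu' 1 le_rfl (by omega) (Or.inl rfl)
    have h2 := hu' 2 (by omega) (by omega) (Or.inr rfl)
    omega
  case D₂ => exact (hg.not_prof (fun i a b => by omega) p).elim
  case D => exact Or.inr (Or.inr (Or.inr (Or.inr (Or.inr (Or.inl ⟨m, g, hm, hg, by rw [wb]⟩)))))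
  case B₃ => exact Or.inr (Or.inr (Or.inr (Or.inr (Or.inr (Or.inr ⟨g, hg, by rw [wb]⟩)))))

lemma cB₃_edge (hn : 3 ≤ n) (h : WR A W ρ n (cB 3) l w e) : A (e 2) (e 3) = -2 := by
  rw [h.mat 2 3 (by omega) (by omega) (by omega) hn]; simp [cB]

lemma D_adj (h : WR A W ρ n (cD n) l w e) {i j : ℕ} (hi : 1 ≤ i) (hin : i ≤ n)
    (hj : 1 ≤ j) (hjn : j ≤ n)
    (hij : (i + 1 = j ∧ j < n) ∨ (j + 1 = i ∧ i < n) ∨ (i + 2 = j ∧ j = n) ∨ (j + 2 = i ∧ i = n)) :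
    A (e i) (e j) ≠ 0 := by
  rw [h.mat i j hi hin hj hjn]; unfold cD; split_ifs <;> omega

lemma WR.node_of_D (hn : 4 ≤ n) (h : WR A W ρ n (cD n) l w e) :
    [e (n - 2), e (n - 3), e (n - 1), e n].Nodup ∧ A (e (n - 2)) (e (n - 3)) ≠ 0 ∧
      A (e (n - 2)) (e (n - 1)) ≠ 0 ∧ A (e (n - 2)) (e n) ≠ 0 :=
  ⟨h.nodup (L := [n - 2, n - 3, n - 1, n]) (by simp; omega) (by simp; omega),
    D_adj h (by omega) (by omega) (by omega) (by omega) (by omega),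
    D_adj h (by omega) (by omega) (by omega) (by omega) (by omega),
    D_adj h (by omega) (by omega) (by omega) (by omega) (by omega)⟩

/-- The inner nodes are black, so `τ` contains all nodes but the last one, and its only white node
is the end `e 1` of a chain without multiple edges. Every type with one white node other than `A 1`
has a multiple edge, a fork, or a white node in the middle. Type `A 1` forces `n = 2`, where axiom 4
applies. -/
lemma contained_chain_false (hA : FiniteType A) (h : Sys A W σ τ) (pτ : Prof A W τ)
    (hV : ∀ k, σ k ≠ 0) (hn : 2 ≤ n) (he : WR A W σ n C (fun _ => 1) w e) (hC : IsChain C n)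
    (hx : τ (e 1) ≠ 0) (hy : τ (e n) = 0) (wx : W (e 1)) (hb : ∀ i, 1 < i → i < n → ¬ W (e i))
    (hCA : ∀ i j, 1 ≤ i → i < n → 1 ≤ j → j < n → -1 ≤ C i j) (hCn : n = 2 → C 2 1 = -1) : False := by
  have hu : ∀ k, τ k ≠ 0 → W k → k = e 1 := by
    intro k hk hW
    obtain ⟨i, a, b, rfl⟩ := he.cov k (hV k)
    by_contra hne
    have h1 : i ≠ 1 := by rintro rfl; exact hne rfl
    have h2 : i ≠ n := by rintro rfl; exact hk hy
    exact hb i (by omega) (by omega) hW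
  have mem := WR.walk hA h he hC (a := 1) (b := n - 1) (j := 1) le_rfl (by omega)
    (fun i a b c => hb i (by omega) (by omega)) le_rfl (by omega) hx
  have ge : ∀ {j k}, τ j ≠ 0 → τ k ≠ 0 → -1 ≤ A j k := by
    intro j k hj hk
    obtain ⟨i, a, b, rfl⟩ := he.cov j (hV j)
    obtain ⟨i', c, d, rfl⟩ := he.cov k (hV k)
    have h1 : i ≠ n := by rintro rfl; exact hj hy
    have h2 : i' ≠ n := by rintro rfl; exact hk hy
    rw [he.mat i i' a b c d]
    exact hCA i i' a (by omega) c (by omega)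
  rcases h.root₂.one_white pτ hx wx hu with ⟨g, hg, hx'⟩ | ⟨m, g, hm, hg, hx'⟩ | ⟨m, g, hm, hg, hx'⟩ |
    ⟨g, hg, hx'⟩ | ⟨g, hg, hx'⟩ | ⟨m, g, hm, hg, hx'⟩ | ⟨g, hg, hx'⟩
  · rcases hn.eq_or_lt with rfl | hn'
    · refine h.sr (e 1) (e 2) (Or.inr ?_) (Or.inl he.eq_single_two) ?_
      · rw [hx']; exact hg.eq_single_one
      · rw [he.mat 2 1 (by omega) (by omega) (by omega) (by omega)]; exact hCn rfl
    · obtain ⟨i, a, b, hi⟩ := hg.cov _ (mem 2 (by omega) (by omega))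
      obtain rfl : i = 1 := by omega
      exact he.ne (by omega) (by omega) (by omega) (by omega) (by omega) (hi.trans hx'.symm)
  · have := B'_edge hm hg
    have := ge (hg.val_ne (i := m - 1) (by omega) (by omega)) (hg.val_ne (i := m) (by omega) le_rfl)
    omega
  · have := C_edge hm hg
    have := ge (hg.val_ne (i := m) (by omega) le_rfl) (hg.val_ne (i := m - 1) (by omega) (by omega))
    omega
  · have := cB₃_edge (by omega) hg
    have := ge (hg.val_ne (i := 2) (by omega) (by omega)) (hg.val_ne (i := 3) (by omega) (by omega))
    omega
  · have := G₂_edge hg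
    have := ge (hg.val_ne (i := 2) (by omega) (by omega)) (hg.val_ne (i := 1) (by omega) (by omega))
    omega
  · rcases hm.eq_or_lt with rfl | hm'
    · refine he.not_two hC (i := 1) le_rfl (by omega) (Or.inl rfl) (hV (g 2)) (hV (g 3)) ?_ ?_ ?_ ?_ ?_
      · rw [hx']; exact hg.ne (by omega) (by omega) (by omega) (by omega) (by omega)
      · rw [hx']; exact hg.ne (by omega) (by omega) (by omega) (by omega) (by omega)
      · exact hg.ne (by omega) (by omega) (by omega) (by omega) (by omega)
      · rw [hx']; exact D_adj hg (by omega) (by omega) (by omega) (by omega) (by omega)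
      · rw [hx']; exact D_adj hg (by omega) (by omega) (by omega) (by omega) (by omega)
    · obtain ⟨h1, h2, h3, h4⟩ := WR.node_of_D hm' hg
      exact he.not_three hC (hV _) (hV _) (hV _) (hV _) h1 h2 h3 h4
  · have := cB₃_edge (by omega) hg
    have := ge (hg.val_ne (i := 2) (by omega) (by omega)) (hg.val_ne (i := 3) (by omega) (by omega))
    omega

/-- Here `τ` fills the nodes `e 2, …, e n`, and its white node is the short end. For `n = 2` it is a
simple root. Otherwise the entry `-2` at its white node leaves only the exceptional root on `B 3`,
so that `n = 4`. -/
lemma contained_B'_last (hA : FiniteType A) (h : Sys A W σ τ) (pτ : Prof A W τ)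
    (hV : ∀ k, σ k ≠ 0) (hn : 2 ≤ n)
    (he : WR A W σ n (cB n) (fun _ => 1) (fun i => i = 1 ∨ i = n) e)
    (hx : τ (e n) ≠ 0) (hy : τ (e 1) = 0) : InTable A W σ τ := by
  have hC := isChain_B n n
  have hb : ∀ i, 1 < i → i < n → ¬ W (e i) := fun i a b => by
    rw [he.wh i (by omega) (by omega)]; omega
  have wx : W (e n) := (he.wh n (by omega) le_rfl).2 (Or.inr rfl)
  have hu : ∀ k, τ k ≠ 0 → W k → k = e n := by
    intro k hk hW
    obtain ⟨i, a, b, rfl⟩ := he.cov k (hV k)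
    have h1 : i ≠ 1 := by rintro rfl; exact hk hy
    by_contra hne
    have h2 : i ≠ n := by rintro rfl; exact hne rfl
    exact hb i (by omega) (by omega) hW
  have mem := WR.walk hA h he hC (a := 2) (b := n) (j := n) (by omega) le_rfl
    (fun i a b c => hb i (by omega) (by omega)) hn le_rfl hx
  have hedge := B'_edge hn he
  have large : ∀ {j k}, A j k ≤ -2 → j = e (n - 1) ∧ k = e n := by
    intro j k ha
    obtain ⟨i, a, b, rfl⟩ := he.cov j (hV j)
    obtain ⟨i', c, d, rfl⟩ := he.cov k (hV k)
    rw [he.mat i i' a b c d] at ha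
    obtain ⟨rfl, rfl⟩ : i = n - 1 ∧ i' = n := by unfold cB at ha; split_ifs at ha <;> omega
    exact ⟨rfl, rfl⟩
  have end_two : ∀ {k₁ k₂}, τ k₁ ≠ 0 → τ k₂ ≠ 0 → k₁ ≠ e n → k₂ ≠ e n → k₁ ≠ k₂ → A (e n) k₁ ≠ 0 →
      A (e n) k₂ ≠ 0 → False := fun _ _ n₁ n₂ hne a₁ a₂ =>
    he.not_two hC (by omega) le_rfl (Or.inr rfl) (hV _) (hV _) n₁ n₂ hne a₁ a₂
  rcases hn.eq_or_lt with rfl | hn'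
  · have only : ∀ {k}, τ k ≠ 0 → k = e 2 := fun {k} hk => by
      obtain ⟨i, a, b, rfl⟩ := he.cov k (hV k)
      obtain rfl | rfl : i = 1 ∨ i = 2 := by omega
      exacts [absurd hy hk, rfl]
    have none : ∀ {m C l w} {g : ℕ → κ}, WR A W τ m C l w g → 2 ≤ m → False := fun hg hm =>
      hg.ne (i := 1) (j := 2) le_rfl (by omega) (by omega) hm (by omega)
        ((only (hg.val_ne le_rfl (by omega))).trans (only (hg.val_ne (by omega) hm)).symm)
    rcases h.root₂.one_white pτ hx wx hu with ⟨g, hg, hx'⟩ | ⟨m, g, hm, hg, hx'⟩ |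
      ⟨m, g, hm, hg, hx'⟩ | ⟨g, hg, hx'⟩ | ⟨g, hg, hx'⟩ | ⟨m, g, hm, hg, hx'⟩ | ⟨g, hg, hx'⟩
    · refine InTable.swap (glue_C_a_two.inTable hA hg he (fun k => Or.inr (hV k)) ?_ ?_ ?_)
      · intro j a b hj
        obtain rfl | rfl : j = 1 ∨ j = 2 := by omega
        · exact hy
        · simp [α, ofList] at hj
      · intro i a b hi
        obtain rfl : i = 1 := by omega
        simp [α, seg, ofList] at hi
      · intro i j a b c d
        obtain rfl : i = 1 := by omega
        interval_cases j <;> simp [α, seg, ofList, hx']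
    all_goals exact (none hg (by omega)).elim
  have hm₁ := mem (n - 1) (by omega) (by omega)
  have other : ∀ {m C l w} {g : ℕ → κ} {c : ℕ}, WR A W τ m C l w g → 1 ≤ c → c ≤ m → e n = g c →
      (∀ i, 1 ≤ i → i ≤ m → C i c ≠ -2) → False := by
    intro m C l w g c hg c₁ c₂ hc H
    obtain ⟨i, a, b, hi⟩ := hg.cov _ hm₁
    rw [hi, hc, hg.mat i c a b c₁ c₂] at hedge
    exact H i a b hedge
  rcases h.root₂.one_white pτ hx wx hu with ⟨g, hg, hx'⟩ | ⟨m, g, hm, hg, hx'⟩ |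
    ⟨m, g, hm, hg, hx'⟩ | ⟨g, hg, hx'⟩ | ⟨g, hg, hx'⟩ | ⟨m, g, hm, hg, hx'⟩ | ⟨g, hg, hx'⟩
  · refine (other hg (by omega) (by omega) hx' fun i a b => ?_).elim
    unfold cA; split_ifs <;> omega
  · refine (other hg (by omega) (by omega) hx' fun i a b => ?_).elim
    unfold cB; split_ifs <;> omega
  · exact (end_two (hg.val_ne (i := 1) (by omega) (by omega)) (hg.val_ne (i := 3) (by omega) (by omega))
      (by rw [hx']; exact hg.ne (by omega) (by omega) (by omega) (by omega) (by omega))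
      (by rw [hx']; exact hg.ne (by omega) (by omega) (by omega) (by omega) (by omega))
      (hg.ne (by omega) (by omega) (by omega) (by omega) (by omega))
      (by
        rw [hx']
        exact hg.adj (isChain_C m m) (by omega) (by omega) (by omega) (by omega) (by omega))
      (by
        rw [hx']
        exact hg.adj (isChain_C m m) (by omega) (by omega) (by omega) (by omega) (by omega))).elim
  · refine (other hg (by omega) (by omega) hx' fun i a b => ?_).elim
    unfold cB; split_ifs <;> omega
  · refine (other hg (by omega) (by omega) hx' fun i a b => ?_).elim
    unfold cG; split_ifs <;> omega
  · refine (other hg (by omega) (by omega) hx' fun i a b => ?_).elim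
    unfold cD; split_ifs <;> omega
  · obtain ⟨h2, h3⟩ := large (cB₃_edge le_rfl hg).le
    have hg₁ := hg.val_ne (i := 1) (by omega) (by omega)
    obtain ⟨j, c, d, hj, hj'⟩ := he.nbr hC (i := n - 1) (by omega) (by omega) (hV (g 1))
      (by rw [← h2]; exact hg.ne (by omega) (by omega) (by omega) (by omega) (by omega))
      (by
        rw [← h2]
        exact hg.adj (isChain_B 3 3) (by omega) (by omega) (by omega) (by omega) (by omega))
    have j₁ : j ≠ n := by
      rintro rfl
      exact hg.ne (by omega) (by omega) (by omega) (by omega) (by omega) (hj.trans h3.symm)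
    have j₂ : j ≠ 1 := by
      rintro rfl
      exact hg₁ (hj ▸ hy)
    obtain rfl : n = 4 := by
      obtain ⟨k, k₁, k₂, hk⟩ := hg.cov _ (mem 2 (by omega) (by omega))
      obtain rfl | rfl | rfl : k = 1 ∨ k = 2 ∨ k = 3 := by omega
      · have := he.inj _ _ (by omega) (by omega) (by omega) (by omega) (hk.trans hj)
        omega
      · have := he.inj _ _ (by omega) (by omega) (by omega) (by omega) (hk.trans h2)
        omega
      · have := he.inj _ _ (by omega) (by omega) (by omega) (by omega) (hk.trans h3)
        omega
    obtain rfl : j = 2 := by omega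
    simp only [Nat.reduceSub] at h2
    refine glue_B_c.inTable hA he hg (fun k => Or.inl (hV k)) ?_ ?_ ?_
    · intro j a b hj
      interval_cases j <;> simp [α, ofList] at hj
    · intro i a b hi
      interval_cases i
      · exact hy
      all_goals simp [α, ofList] at hi
    · intro i j a b c d
      interval_cases i <;> interval_cases j <;> simp [α, ofList, hj, h2, h3]

/-- The only neighbour of `e 1` is outside the support of `τ`, so connectedness reduces `τ` to the
simple root. -/
lemma contained_C'_first (hA : FiniteType A) (h : Sys A W σ τ) (pτ : Prof A W τ)
    (hV : ∀ k, σ k ≠ 0) (hn : 3 ≤ n)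
    (he : WR A W σ n (cC n) (lC n) (fun i => i = 1 ∨ i = 2) e)
    (hx : τ (e 1) ≠ 0) (hy : τ (e 2) = 0) : InTable A W σ τ := by
  have only : ∀ {k}, τ k ≠ 0 → k = e 1 := fun {k} hk => by
    by_contra hne
    obtain ⟨i, j, -, hj, rfl, hj', ha⟩ := pτ.conn (fun k => k = e 1) ⟨_, hx, rfl⟩ ⟨k, hk, hne⟩
    obtain ⟨j, c, d, rfl, hjj⟩ := he.nbr (isChain_C n n) le_rfl (by omega) (hV j) hj' ha
    obtain rfl : j = 2 := by omega
    exact hj hy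
  have none : ∀ {m C l w} {g : ℕ → κ}, WR A W τ m C l w g → 2 ≤ m → False := fun hg hm =>
    hg.ne (i := 1) (j := 2) le_rfl (by omega) (by omega) hm (by omega)
      ((only (hg.val_ne le_rfl (by omega))).trans (only (hg.val_ne (by omega) hm)).symm)
  rcases h.root₂.one_white pτ hx ((he.wh 1 le_rfl (by omega)).2 (Or.inl rfl)) (fun k hk _ => only hk)
    with ⟨g, hg, hx'⟩ | ⟨m, g, hm, hg, hx'⟩ | ⟨m, g, hm, hg, hx'⟩ | ⟨g, hg, hx'⟩ | ⟨g, hg, hx'⟩ |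
      ⟨m, g, hm, hg, hx'⟩ | ⟨g, hg, hx'⟩
  · refine InTable.swap ((glue_C_a n hn).inTable hA hg he (fun k => Or.inr (hV k)) ?_ ?_ ?_)
    · intro j a b hj
      by_contra h0
      have := he.inj _ _ a b le_rfl (by omega) (only h0)
      simp [α] at hj
      omega
    · intro i a b hi
      obtain rfl : i = 1 := by omega
      simp [α] at hi
    · intro i j a b c d
      obtain rfl : i = 1 := by omega
      refine ⟨?_, fun h0 => by simp [α] at h0⟩
      rintro rfl
      exact hx'.symm
  all_goals exact (none hg (by omega)).elim

/-- The support of `τ` contains the double edge of `C_n`, and its white node `e 2` has the neighbour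
`e 1` outside, so it is not superheavy. A `B` type would have to place its double edge so that the
end `e n` is either the white node or has two neighbours. -/
lemma contained_C'_second_false (hA : FiniteType A) (h : Sys A W σ τ) (pτ : Prof A W τ)
    (hV : ∀ k, σ k ≠ 0) (hn : 3 ≤ n)
    (he : WR A W σ n (cC n) (lC n) (fun i => i = 1 ∨ i = 2) e)
    (hx : τ (e 2) ≠ 0) (hy : τ (e 1) = 0) : False := by
  have hC := isChain_C n n
  have hb : ∀ i, 2 < i → i ≤ n → ¬ W (e i) := fun i a b => by
    rw [he.wh i (by omega) (by omega)]; omega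
  have wx : W (e 2) := (he.wh 2 (by omega) (by omega)).2 (Or.inr rfl)
  have hu : ∀ k, τ k ≠ 0 → W k → k = e 2 := by
    intro k hk hW
    obtain ⟨i, a, b, rfl⟩ := he.cov k (hV k)
    have h1 : i ≠ 1 := by rintro rfl; exact hk hy
    by_contra hne
    have h2 : i ≠ 2 := by rintro rfl; exact hne rfl
    exact hb i (by omega) (by omega) hW
  have mem := WR.walk hA h he hC (a := 2) (b := n) (j := 2) (by omega) le_rfl
    (fun i a b c => hb i (by omega) (by omega)) le_rfl (by omega) hx
  have hedge := C_edge hn he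
  have large : ∀ {j k}, A j k ≤ -2 → j = e n ∧ k = e (n - 1) := by
    intro j k ha
    obtain ⟨i, a, b, rfl⟩ := he.cov j (hV j)
    obtain ⟨i', c, d, rfl⟩ := he.cov k (hV k)
    rw [he.mat i i' a b c d] at ha
    obtain ⟨rfl, rfl⟩ : i = n ∧ i' = n - 1 := by unfold cC at ha; split_ifs at ha <;> omega
    exact ⟨rfl, rfl⟩
  have sup : ¬ SuperHeavy A τ (e 2) := fun hs =>
    he.adj hC (i := 2) (j := 1) (by omega) (by omega) (by omega) (by omega) (by omega)
      (hs.isolated hA hy)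
  have small : ∀ {m C l w} {g : ℕ → κ}, WR A W τ m C l w g →
      (∀ i j, 1 ≤ i → i ≤ m → 1 ≤ j → j ≤ m → -1 ≤ C i j) → False := by
    intro m C l w g hg H
    have := hg.ge_neg_one H (mem n (by omega) le_rfl) (mem (n - 1) (by omega) (by omega))
    omega
  have end_two : ∀ {k₁ k₂}, k₁ ≠ e n → k₂ ≠ e n → k₁ ≠ k₂ → A (e n) k₁ ≠ 0 →
      A (e n) k₂ ≠ 0 → False := fun n₁ n₂ hne a₁ a₂ =>
    he.not_two hC (by omega) le_rfl (Or.inr rfl) (hV _) (hV _) n₁ n₂ hne a₁ a₂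
  rcases h.root₂.one_white pτ hx wx hu with ⟨g, hg, hx'⟩ | ⟨m, g, hm, hg, hx'⟩ |
    ⟨m, g, hm, hg, hx'⟩ | ⟨g, hg, hx'⟩ | ⟨g, hg, hx'⟩ | ⟨m, g, hm, hg, hx'⟩ | ⟨g, hg, hx'⟩
  · exact small hg fun i j _ _ _ _ => by unfold cA; split_ifs <;> omega
  · obtain ⟨h1, h2⟩ := large (B'_edge hm hg).le
    rcases hm.eq_or_lt with rfl | hm'
    · exact he.ne (by omega) (by omega) (by omega) le_rfl (by omega) (hx'.trans h1)
    · have t := hg.nodup (L := [m - 2, m - 1, m]) (by simp; omega) (by simp; omega)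
      simp at t
      rw [← h1] at end_two
      exact end_two t.1.1 (Ne.symm t.2) t.1.2
        (hg.adj (isChain_B m m) (by omega) (by omega) (by omega) (by omega) (by omega))
        (hg.adj (isChain_B m m) (by omega) (by omega) (by omega) (by omega) (by omega))
  · exact sup (hx' ▸ superHeavy_C hm hg)
  · exact sup (hx' ▸ superHeavy_F₄ hg)
  · exact sup (hx' ▸ superHeavy_G₂ hg)
  · exact small hg fun i j _ _ _ _ => by unfold cD; split_ifs <;> omega
  · obtain ⟨h1, h2⟩ := large (cB₃_edge le_rfl hg).le
    rw [← h1] at end_two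
    exact end_two (k₁ := g 1) (k₂ := g 3)
      (hg.ne (by omega) (by omega) (by omega) (by omega) (by omega))
      (hg.ne (by omega) (by omega) (by omega) (by omega) (by omega))
      (hg.ne (by omega) (by omega) (by omega) (by omega) (by omega))
      (hg.adj (isChain_B 3 3) (by omega) (by omega) (by omega) (by omega) (by omega))
      (hg.adj (isChain_B 3 3) (by omega) (by omega) (by omega) (by omega) (by omega))

/-- Only one node is left for `τ`, a simple root. The long one is excluded by axiom 4, since `⟨α₁ |
α₂^∨⟩ = -1`. -/
lemma contained_G₂' (hA : FiniteType A) (h : Sys A W σ τ) (pτ : Prof A W τ) (hV : ∀ k, σ k ≠ 0)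
    (he : WR A W σ 2 cG (fun _ => 1) (fun i => i = 1 ∨ i = 2) e) {a b : ℕ}
    (hab : a = 1 ∧ b = 2 ∨ a = 2 ∧ b = 1) (hx : τ (e a) ≠ 0) (hy : τ (e b) = 0) :
    InTable A W σ τ := by
  have only : ∀ {k}, τ k ≠ 0 → k = e a := fun {k} hk => by
    obtain ⟨i, c, d, rfl⟩ := he.cov k (hV k)
    have : i ≠ b := by rintro rfl; exact hk hy
    congr 1; omega
  have none : ∀ {m C l w} {g : ℕ → κ}, WR A W τ m C l w g → 2 ≤ m → False := fun hg hm =>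
    hg.ne (i := 1) (j := 2) le_rfl (by omega) (by omega) hm (by omega)
      ((only (hg.val_ne le_rfl (by omega))).trans (only (hg.val_ne (by omega) hm)).symm)
  rcases h.root₂.one_white pτ hx ((he.wh a (by omega) (by omega)).2 (by omega))
    (fun k hk _ => only hk) with ⟨g, hg, hx'⟩ | ⟨m, g, hm, hg, hx'⟩ | ⟨m, g, hm, hg, hx'⟩ |
      ⟨g, hg, hx'⟩ | ⟨g, hg, hx'⟩ | ⟨m, g, hm, hg, hx'⟩ | ⟨g, hg, hx'⟩
  · rcases hab with ⟨rfl, rfl⟩ | ⟨rfl, rfl⟩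
    · refine InTable.swap (glue_G₂_b.inTable hA hg he (fun k => Or.inr (hV k)) ?_ ?_ ?_)
      · intro j a b hj
        obtain rfl | rfl : j = 1 ∨ j = 2 := by omega
        · simp [α, ofList] at hj
        · exact hy
      · intro i a b hi
        obtain rfl : i = 1 := by omega
        simp [α, ofList] at hi
      · intro i j a b c d
        obtain rfl : i = 1 := by omega
        interval_cases j <;> simp [α, ofList, hx']
    · refine (h.sr (e 2) (e 1) (Or.inr ?_) (Or.inl ?_) (G₂_edge he).2).elim
      · rw [hx']; exact hg.eq_single_one
      · rw [add_comm]; exact he.eq_single_two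
  all_goals exact (none hg (by omega)).elim

/-- The support of one of the roots is properly contained in the other one. -/
lemma contained (hA : FiniteType A) (h : Sys A W σ τ) (pσ : Prof A W σ) (pτ : Prof A W τ)
    (hV : ∀ k, σ k ≠ 0) (hy : ∃ y, τ y = 0) : InTable A W σ τ := by
  obtain ⟨y₀, hy₀⟩ := hy
  obtain ⟨x, hx, wx⟩ := pτ.white
  -- Where the support of `σ` leaves that of `τ`, the outer node is white; so `σ` has two white
  -- nodes, only one of them in the support of `τ`.
  obtain ⟨i, y, -, -, hi, hy, ha⟩ :=
    pσ.conn (fun k => τ k ≠ 0) ⟨x, hV x, hx⟩ ⟨y₀, hV y₀, by simpa using hy₀⟩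
  have wy : W y := by
    by_contra hW
    exact hy (h.mem₂ hA hW hi ha)
  replace hy : τ y = 0 := by simpa using hy
  have hxy : x ≠ y := by rintro rfl; exact hx hy
  rcases h.root₁.two_white pσ (hV x) (hV y) wx wy hxy with ⟨n, e, hn, he, rfl, rfl⟩ |
    ⟨n, e, hn, he, hxy⟩ | ⟨n, e, hn, he, hxy⟩ | ⟨e, he, hxy⟩
  · refine (contained_chain_false hA h pτ hV hn he (isChain_A n) hx hy wx ?_ ?_ ?_).elim
    · intro i a b; rw [he.wh i (by omega) (by omega)]; omega
    · intro i j a b c d; unfold cA; split_ifs <;> omega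
    · intro _; simp [cA]
  · rcases hxy with ⟨rfl, rfl⟩ | ⟨rfl, rfl⟩
    · refine (contained_chain_false hA h pτ hV hn he (isChain_B n n) hx hy wx ?_ ?_ ?_).elim
      · intro i a b; rw [he.wh i (by omega) (by omega)]; omega
      · intro i j a b c d; unfold cB; split_ifs <;> omega
      · rintro rfl; simp [cB]
    · exact contained_B'_last hA h pτ hV hn he hx hy
  · rcases hxy with ⟨rfl, rfl⟩ | ⟨rfl, rfl⟩
    · exact contained_C'_first hA h pτ hV hn he hx hy
    · exact (contained_C'_second_false hA h pτ hV hn he hx hy).elim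
  · rcases hxy with ⟨rfl, rfl⟩ | ⟨rfl, rfl⟩
    · exact contained_G₂' hA h pτ hV he (Or.inl ⟨rfl, rfl⟩) hx hy
    · exact contained_G₂' hA h pτ hV he (Or.inr ⟨rfl, rfl⟩) hx hy

end Contained
end WeakSpherical

namespace WeakSpherical

section WhiteOverlap

variable {κ : Type*} [Fintype κ] [DecidableEq κ] {A : κ → κ → ℤ} {W : κ → Prop} {σ τ ρ : κ → ℤ}
  {p q n m : ℕ} {e g : ℕ → κ} {C D : ℕ → ℕ → ℤ} {l l' : ℕ → ℤ} {w w' : ℕ → Prop} {x y z : κ}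

/-! ### Supports that meet in a white node -/

/-- The supports of `σ` and `τ` share the white node `x`; the white nodes `y`, `z` belong to one
support only. -/
structure WhiteOverlap (A : κ → κ → ℤ) (W : κ → Prop) (σ τ : κ → ℤ) (x y z : κ) : Prop where
  fin : FiniteType A
  sys : Sys A W σ τ
  prof₁ : Prof A W σ
  prof₂ : Prof A W τ
  x₁ : σ x ≠ 0
  x₂ : τ x ≠ 0
  y₁ : σ y ≠ 0
  y₂ : τ y = 0
  z₁ : σ z = 0
  z₂ : τ z ≠ 0
  wx : W x
  wy : W y
  wz : W z
  ay : ∃ k, σ k ≠ 0 ∧ τ k ≠ 0 ∧ A k y ≠ 0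
  az : ∃ k, σ k ≠ 0 ∧ τ k ≠ 0 ∧ A k z ≠ 0

/-- Two chains that start at the same node run together. By induction the next node of the first
chain is a neighbour of `g i` in `τ` different from the previous one, hence `g (i + 1)`; it is not
the last node of the second chain, which lies outside the support of `σ`. -/
lemma chain_unify (he : WR A W σ n C l w e) (hC : IsChain C n) (hg : WR A W τ m D l' w' g)
    (hD : IsChain D m) (h1 : e 1 = g 1) (hm : 2 ≤ m)
    (he' : ∀ i, 1 ≤ i → i < n → τ (e i) ≠ 0) (hgm : σ (g m) = 0) :
    ∀ i, 1 ≤ i → i < n → i < m ∧ e i = g i := by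
  intro i
  induction i using Nat.strong_induction_on with
  | _ i ih =>
    intro a b
    rcases a.eq_or_lt with rfl | a'
    · exact ⟨hm, h1⟩
    obtain ⟨i, rfl⟩ : ∃ k, i = k + 1 := ⟨i - 1, by omega⟩
    obtain ⟨c, d⟩ := ih i (by omega) (by omega) (by omega)
    have h2 := he.adj hC (i := i) (j := i + 1) (by omega) (by omega) (by omega) (by omega) (by omega)
    have h3 := he.ne (i := i + 1) (j := i) (by omega) (by omega) (by omega) (by omega) (by omega)
    rw [d] at h2 h3
    obtain ⟨j, j₁, j₂, hj, hj'⟩ := hg.nbr hD (by omega) (by omega) (he' _ a b) h3 h2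
    rcases hj' with rfl | rfl
    · refine ⟨lt_of_le_of_ne j₂ ?_, hj⟩
      rintro rfl
      rw [← hj] at hgm
      exact he.val_ne a b.le hgm
    · rw [← (ih j (by omega) j₁ (by omega)).2] at hj
      have := he.inj _ _ a b.le j₁ (by omega) hj
      omega

namespace WhiteOverlap

variable (H : WhiteOverlap A W σ τ x y z)
include H

lemma swap : WhiteOverlap A W τ σ x z y :=
  ⟨H.fin, H.sys.swap H.fin, H.prof₂, H.prof₁, H.x₂, H.x₁, H.z₂, H.z₁, H.y₂, H.y₁, H.wx, H.wz, H.wy,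
    let ⟨k, a, b, c⟩ := H.az; ⟨k, b, a, c⟩, let ⟨k, a, b, c⟩ := H.ay; ⟨k, b, a, c⟩⟩

lemma xy : x ≠ y := fun h => H.x₂ (h ▸ H.y₂)

lemma yz : y ≠ z := fun h => H.y₁ (h ▸ H.z₁)

lemma two {k : κ} (hk : σ k ≠ 0) (hW : W k) : k = x ∨ k = y :=
  (H.prof₁.two x y H.x₁ H.y₁ H.wx H.wy H.xy).2 k hk hW

/-- A node of the second support that is adjacent to a node of the first one is `z` or belongs to
the first support. -/
lemma mem_or {j k : κ} (hj : σ j ≠ 0) (hk : τ k ≠ 0) (ha : A j k ≠ 0) : σ k ≠ 0 ∨ k = z := by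
  by_contra! hc
  refine H.sys.mem₁ H.fin (fun hW => ?_) hj ha hc.1
  rcases H.swap.two hk hW with rfl | rfl
  exacts [H.x₁ hc.1, hc.2 rfl]

/-- As one of two white nodes, `y` pairs to at most 1 with `σ`; being joined to the support of `τ`,
it pairs to at most `-1` with `τ`. -/
lemma pr_y : pr A σ y + pr A τ y ≤ 0 := by
  obtain ⟨k, -, hk, ha⟩ := H.ay
  have h1 := H.fin.pr_neg H.prof₂.nonneg H.y₂ hk ha
  have h2 := (H.prof₁.two y x H.y₁ H.x₁ H.wy H.wx H.xy.symm).1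
  have := H.prof₂.nonneg k
  omega

/-- At `y` and `z` the sum `σ + τ` pairs nonpositively, at black nodes to zero; so it must be
positive at `x`. -/
lemma pr_x : 1 ≤ pr A σ x + pr A τ x := by
  by_contra hc
  refine H.fin.false_of_add H.prof₁.nonneg H.prof₂.nonneg (fun k => ?_) H.x₁
  have hy := H.pr_y
  have hz := H.swap.pr_y
  by_cases hW : W k
  · rcases H.sys.cover k with hk | hk
    · rcases H.two hk hW with rfl | rfl <;> omega
    · rcases H.swap.two hk hW with rfl | rfl <;> omega
  · have := H.sys.black k hW
    omega

lemma A_mem (hn : 2 ≤ n) (he : IsA A W σ n e) (hx : x = e 1) : ∀ i, 1 ≤ i → i < n → τ (e i) ≠ 0 :=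
  fun i a b => WR.walk H.fin H.sys he (isChain_A n) (a := 1) (b := n - 1) (j := 1) le_rfl (by omega)
    (fun i a b c => by rw [he.wh i (by omega) (by omega)]; omega) le_rfl (by omega) (hx ▸ H.x₂) i a
      (by omega)

lemma B_mem (hn : 2 ≤ n) (he : WR A W σ n (cB n) (fun _ => 1) (fun i => i = 1 ∨ i = n) e)
    (hx : x = e 1) : ∀ i, 1 ≤ i → i < n → τ (e i) ≠ 0 :=
  fun i a b => WR.walk H.fin H.sys he (isChain_B n n) (a := 1) (b := n - 1) (j := 1) le_rfl (by omega)
    (fun i a b c => by rw [he.wh i (by omega) (by omega)]; omega) le_rfl (by omega) (hx ▸ H.x₂) i a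
      (by omega)

lemma B_mem_last (hn : 2 ≤ n) (he : WR A W σ n (cB n) (fun _ => 1) (fun i => i = 1 ∨ i = n) e)
    (hx : x = e n) : ∀ i, 1 < i → i ≤ n → τ (e i) ≠ 0 :=
  fun i a b => WR.walk H.fin H.sys he (isChain_B n n) (a := 2) (b := n) (j := n) (by omega) le_rfl
    (fun i a b c => by rw [he.wh i (by omega) (by omega)]; omega) hn le_rfl (hx ▸ H.x₂) i a b

lemma C_mem (hn : 3 ≤ n) (he : WR A W σ n (cC n) (lC n) (fun i => i = 1 ∨ i = 2) e)
    (hx : x = e 2) : ∀ i, 2 ≤ i → i ≤ n → τ (e i) ≠ 0 :=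
  fun i a b => WR.walk H.fin H.sys he (isChain_C n n) (a := 2) (b := n) (j := 2) (by omega) le_rfl
    (fun i a b c => by rw [he.wh i (by omega) (by omega)]; omega) le_rfl (by omega) (hx ▸ H.x₂) i a b

lemma not_triangle {c : κ} (hc : σ c ≠ 0) (hc' : τ c ≠ 0) (h1 : A c y ≠ 0) (h2 : A c z ≠ 0) :
    A y z = 0 := by
  by_contra h3
  exact H.fin.false_of_triangle (x := y) (y := c) (z := z) (by rintro rfl; exact hc' H.y₂) H.yz
    (by rintro rfl; exact hc H.z₁) (H.fin.ne_zero_symm h1) h2 h3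

/-- The chains run together up to their last nodes, which are both attached to the same node and not
to each other: this is the fork of type `D`. -/
lemma A_A (hn : 2 ≤ n) (he : IsA A W σ n e) (hx : x = e 1) (hy : y = e n) (hm : 2 ≤ m)
    (hg : IsA A W τ m g) (hx' : x = g 1) (hz : z = g m) : InTable A W σ τ := by
  have h1 := chain_unify he (isChain_A n) hg (isChain_A m) (hx.symm.trans hx') hm
    (H.A_mem hn he hx) (hz ▸ H.z₁)
  have h2 := chain_unify hg (isChain_A m) he (isChain_A n) (hx'.symm.trans hx) hn
    (H.swap.A_mem hm hg hx') (hy ▸ H.y₂)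
  obtain rfl : n = m := by
    have := (h1 (n - 1) (by omega) (by omega)).1
    have := (h2 (m - 1) (by omega) (by omega)).1
    omega
  have h3 : A y z = 0 := by
    have h4 := (h1 (n - 1) (by omega) (by omega)).2
    refine H.not_triangle (c := e (n - 1)) (he.val_ne (by omega) (by omega))
      (H.A_mem hn he hx _ (by omega) (by omega)) ?_ ?_
    · rw [hy]
      exact he.adj (isChain_A n) (by omega) (by omega) (by omega) (by omega) (by omega)
    · rw [h4, hz]
      exact hg.adj (isChain_A n) (by omega) (by omega) (by omega) (by omega) (by omega)
  refine (glue_D_d (n + 1) (by omega)).inTable H.fin (by rwa [Nat.add_sub_cancel])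
    (by rwa [Nat.add_sub_cancel]) H.sys.cover ?_ ?_ ?_
  · intro j a b hj
    obtain rfl : j = n := by
      simp only [seg, α, Pi.add_apply] at hj; split_ifs at hj <;> omega
    exact hz ▸ H.z₁
  · intro i a b hi
    obtain rfl : i = n := by
      simp only [seg, α, Pi.add_apply] at hi; split_ifs at hi <;> omega
    exact hy ▸ H.y₂
  · intro i j a b c d
    refine ⟨fun hij => ?_, fun hi hj => ?_⟩
    · obtain ⟨rfl, h4⟩ : i = j ∧ i < n := by split_ifs at hij <;> omega
      exact (h1 i a h4).2
    · obtain rfl : i = n := by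
        simp only [seg, α, Pi.add_apply] at hi; split_ifs at hi <;> omega
      obtain rfl : j = i := by
        simp only [seg, α, Pi.add_apply] at hj; split_ifs at hj <;> omega
      rw [← hy, ← hz, h3, H.fin.symm _ _ h3]
      simp only [cD]; split_ifs <;> omega

/-- The nodes of a chain that meets the other support in `x` only. -/
lemma A_two (he : IsA A W σ 2 e) (hx : x = e 1) (hy : y = e 2) {k : κ} (hk : σ k ≠ 0) :
    k = x ∨ k = y := by
  obtain ⟨i, a, b, rfl⟩ := he.cov k hk
  obtain rfl | rfl : i = 1 ∨ i = 2 := by omega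
  exacts [Or.inl hx.symm, Or.inr hy.symm]

lemma A_edge (he : IsA A W σ 2 e) (hx : x = e 1) (hy : y = e 2) : A x y = -1 ∧ A y x = -1 := by
  rw [hx, hy, he.mat _ _ (by omega) (by omega) (by omega) (by omega),
    he.mat _ _ (by omega) (by omega) (by omega) (by omega)]
  simp [cA]

/-- The chains differ only in their last nodes. For `n = 2` they form `B 3`; a longer common piece
would end in a fork with a double edge. -/
lemma A_B_first (hn : 2 ≤ n) (he : IsA A W σ n e) (hx : x = e 1) (hy : y = e n) (hm : 2 ≤ m)
    (hg : WR A W τ m (cB m) (fun _ => 1) (fun i => i = 1 ∨ i = m) g) (hx' : x = g 1)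
    (hz : z = g m) : InTable A W σ τ := by
  have h1 := chain_unify he (isChain_A n) hg (isChain_B m m) (hx.symm.trans hx') hm
    (H.A_mem hn he hx) (hz ▸ H.z₁)
  have h2 := chain_unify hg (isChain_B m m) he (isChain_A n) (hx'.symm.trans hx) hn
    (H.swap.B_mem hm hg hx') (hy ▸ H.y₂)
  obtain rfl : n = m := by
    have := (h1 (n - 1) (by omega) (by omega)).1
    have := (h2 (m - 1) (by omega) (by omega)).1
    omega
  rcases hn.eq_or_lt with rfl | hn'
  · have h3 : A y z = 0 := by
      refine H.not_triangle (c := x) H.x₁ H.x₂ ?_ ?_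
      · rw [hx, hy]
        exact he.adj (isChain_A 2) (by omega) (by omega) (by omega) (by omega) (by omega)
      · rw [hx', hz]
        exact hg.adj (isChain_B 2 2) (by omega) (by omega) (by omega) (by omega) (by omega)
    refine glue_B_b.inTable H.fin he.rev hg H.sys.cover ?_ ?_ ?_
    · intro j a b hj
      obtain rfl | rfl : j = 1 ∨ j = 2 := by omega
      · simp [α, ofList] at hj
      · exact hz ▸ H.z₁
    · intro i a b hi
      obtain rfl | rfl : i = 1 ∨ i = 2 := by omega
      · exact hy ▸ H.y₂
      · simp [α, ofList] at hi
    · intro i j a b c d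
      rw [hy, hz] at h3
      have h4 := H.fin.symm _ _ h3
      interval_cases i <;> interval_cases j <;>
        simp [α, ofList, cB, h3, h4, ← hx, ← hx']
  · exfalso
    have h4 := (h1 (n - 1) (by omega) (by omega)).2
    have t := hg.nodup (L := [n - 2, n - 1, n]) (by simp; omega) (by simp; omega)
    simp at t
    have n₁ : ∀ j, 1 ≤ j → j ≤ n → y ≠ g j := fun j a b hj => by
      have := hg.val_ne a b
      rw [← hj] at this
      exact this H.y₂
    refine H.fin.false_of_fork (x := y) (x' := g (n - 2)) (y := g (n - 1)) (z := g n) ?_ ?_ ?_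
      (Or.inl (B'_edge hn hg).le)
    · simp [n₁ (n - 2) (by omega) (by omega), n₁ (n - 1) (by omega) (by omega),
        n₁ n (by omega) (by omega), t]
    · rw [← h4, hy]
      exact he.adj (isChain_A n) (by omega) (by omega) (by omega) (by omega) (by omega)
    · exact hg.adj (isChain_B n n) (by omega) (by omega) (by omega) (by omega) (by omega)

/-- For `m ≥ 3` the double edge of `τ` would lie in the simply laced support of `σ`. Hence `m = 2`,
which also forces `n = 2`. -/
lemma A_B_last (hn : 2 ≤ n) (he : IsA A W σ n e) (hx : x = e 1) (hy : y = e n) (hm : 2 ≤ m)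
    (hg : WR A W τ m (cB m) (fun _ => 1) (fun i => i = 1 ∨ i = m) g) (hx' : x = g m)
    (hz : z = g 1) : InTable A W σ τ := by
  rcases hm.eq_or_lt with rfl | hm'
  · obtain rfl : n = 2 := by
      by_contra hn'
      have h1 := H.A_mem hn he hx 2 (by omega) (by omega)
      obtain ⟨j, a, b, hj⟩ := hg.cov _ h1
      obtain rfl | rfl : j = 1 ∨ j = 2 := by omega
      · have := he.val_ne (i := 2) (by omega) (by omega)
        rw [hj, ← hz] at this
        exact this H.z₁
      · exact he.ne (by omega) (by omega) (by omega) (by omega) (by omega)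
          (hj.trans (hx'.symm.trans hx))
    have h3 : A y z = 0 := by
      refine H.not_triangle (c := x) H.x₁ H.x₂ ?_ ?_
      · rw [hx, hy]
        exact he.adj (isChain_A 2) (by omega) (by omega) (by omega) (by omega) (by omega)
      · rw [hx', hz]
        exact hg.adj (isChain_B 2 2) (by omega) (by omega) (by omega) (by omega) (by omega)
    refine glue_C_b_three.inTable H.fin he.rev hg H.sys.cover ?_ ?_ ?_
    · intro j a b hj
      obtain rfl | rfl : j = 1 ∨ j = 2 := by omega
      · exact hz ▸ H.z₁
      · simp [α, ofList] at hj
    · intro i a b hi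
      obtain rfl | rfl : i = 1 ∨ i = 2 := by omega
      · exact hy ▸ H.y₂
      · simp [α, seg, ofList] at hi
    · intro i j a b c d
      rw [hy, hz] at h3
      have h4 := H.fin.symm _ _ h3
      interval_cases i <;> interval_cases j <;>
        simp [α, seg, ofList, cC, h3, h4, ← hx, ← hx']
  · have h1 := H.swap.B_mem_last hm hg hx'
    have h2 := he.ge_neg_one (h1 (m - 1) (by omega) (by omega)) (h1 m (by omega) le_rfl)
    have := B'_edge hm hg
    omega

/-- The only neighbour of `x` in `τ` is `z`, outside the support of `σ`, so the chain of `σ` has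
only two nodes. -/
lemma A_C_first (hn : 2 ≤ n) (he : IsA A W σ n e) (hx : x = e 1) (hy : y = e n) (hm : 3 ≤ m)
    (hg : WR A W τ m (cC m) (lC m) (fun i => i = 1 ∨ i = 2) g) (hx' : x = g 1)
    (hz : z = g 2) : InTable A W σ τ := by
  rcases hn.eq_or_lt with rfl | hn'
  · have hxy := H.A_edge he hx hy
    have h3 : A y z = 0 := by
      refine H.not_triangle (c := x) H.x₁ H.x₂ (by omega) ?_
      rw [hx', hz]
      exact hg.adj (isChain_C m m) (by omega) (by omega) (by omega) (by omega) (by omega)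
    have h5 : ∀ j, 1 < j → j ≤ m → σ (g j) = 0 := fun j a b => by
      by_contra h0
      rcases H.A_two he hx hy h0 with h1 | h1
      · exact hg.ne (by omega) b (by omega) (by omega) (by omega) (h1.trans hx')
      · exact hg.val_ne (by omega) b (h1 ▸ H.y₂)
    have h6 : ∀ j, 1 < j → j ≤ m → A y (g j) = 0 := fun j a b => by
      by_contra h0
      rcases H.mem_or H.y₁ (hg.val_ne (by omega) b) h0 with h1 | h1
      · exact h1 (h5 j a b)
      · exact h0 (h1 ▸ h3)
    refine (glue_C_b (m + 1) (by omega)).inTable H.fin he.rev (by rwa [Nat.add_sub_cancel])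
      H.sys.cover ?_ ?_ ?_
    · intro j a b hj
      refine h5 j ?_ (by omega)
      by_contra h0
      obtain rfl : j = 1 := by omega
      simp [α] at hj
    · intro i a b hi
      obtain rfl | rfl : i = 1 ∨ i = 2 := by omega
      · exact hy ▸ H.y₂
      · simp [α, seg] at hi
    · intro i j a b c d
      obtain rfl | rfl : i = 1 ∨ i = 2 := by omega
      · refine ⟨fun h0 => by omega, fun _ hj => ?_⟩
        have h7 : 1 < j := by
          by_contra h0
          obtain rfl : j = 1 := by omega
          simp [α] at hj
        show A (e 2) (g j) = _ ∧ A (g j) (e 2) = _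
        rw [← hy, h6 j h7 (by omega), H.fin.symm _ _ (h6 j h7 (by omega))]
        simp only [cC]; split_ifs <;> omega
      · refine ⟨fun h0 => ?_, fun h0 => ?_⟩
        · obtain rfl : j = 1 := by omega
          exact hx.symm.trans hx'
        · simp [α, seg] at h0
  · exfalso
    have h1 := H.A_mem hn he hx 2 (by omega) (by omega)
    have h2 := he.adj (isChain_A n) (i := 1) (j := 2) (by omega) (by omega) (by omega) (by omega)
      (by omega)
    have h3 := he.ne (i := 2) (j := 1) (by omega) (by omega) (by omega) (by omega) (by omega)
    rw [← hx, hx'] at h2 h3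
    obtain ⟨j, a, b, hj, hj'⟩ := hg.nbr (isChain_C m m) (by omega) (by omega) h1 h3 h2
    obtain rfl : j = 2 := by omega
    have := he.val_ne (i := 2) (by omega) (by omega)
    rw [hj, ← hz] at this
    exact this H.z₁

lemma A_C_second_false (he : IsA A W σ n e) (hm : 3 ≤ m)
    (hg : WR A W τ m (cC m) (lC m) (fun i => i = 1 ∨ i = 2) g) (hx' : x = g 2) : False := by
  have h1 := H.swap.C_mem hm hg hx'
  have h2 := he.ge_neg_one (h1 m (by omega) (by omega)) (h1 (m - 1) (by omega) (by omega))
  have := C_edge hm hg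
  omega

end WhiteOverlap
end WhiteOverlap
end WeakSpherical

namespace WeakSpherical

/-! ### A common white node: roots of types `B`, `C` and `G₂` -/

section WhiteOverlap

variable {κ : Type*} [Fintype κ] [DecidableEq κ] {A : κ → κ → ℤ} {W : κ → Prop} {σ τ ρ : κ → ℤ}
  {p q n m : ℕ} {e g : ℕ → κ} {C D : ℕ → ℕ → ℤ} {l l' : ℕ → ℤ} {w w' : ℕ → Prop} {x y z : κ}

namespace WhiteOverlap

variable (H : WhiteOverlap A W σ τ x y z)
include H

lemma double_false {c : κ} (hc : σ c ≠ 0) (hc' : τ c ≠ 0) (h1 : A c y ≤ -2 ∨ A y c ≤ -2)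
    (h2 : A c z ≤ -2 ∨ A z c ≤ -2) : False :=
  H.fin.false_of_double (x := y) (y := c) (z := z) (by rintro rfl; exact hc' H.y₂) H.yz
    (by rintro rfl; exact hc H.z₁) h1.symm h2

lemma B_first_B_first (hn : 2 ≤ n)
    (he : WR A W σ n (cB n) (fun _ => 1) (fun i => i = 1 ∨ i = n) e) (hx : x = e 1) (hy : y = e n)
    (hm : 2 ≤ m) (hg : WR A W τ m (cB m) (fun _ => 1) (fun i => i = 1 ∨ i = m) g) (hx' : x = g 1)
    (hz : z = g m) : False := by
  have h1 := chain_unify he (isChain_B n n) hg (isChain_B m m) (hx.symm.trans hx') hm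
    (H.B_mem hn he hx) (hz ▸ H.z₁)
  have h2 := chain_unify hg (isChain_B m m) he (isChain_B n n) (hx'.symm.trans hx) hn
    (H.swap.B_mem hm hg hx') (hy ▸ H.y₂)
  obtain rfl : n = m := by
    have := (h1 (n - 1) (by omega) (by omega)).1
    have := (h2 (m - 1) (by omega) (by omega)).1
    omega
  have h4 := (h1 (n - 1) (by omega) (by omega)).2
  refine H.double_false (c := e (n - 1)) (he.val_ne (by omega) (by omega))
    (H.B_mem hn he hx _ (by omega) (by omega)) (Or.inl ?_) (Or.inl ?_)
  · rw [hy]; exact (B'_edge hn he).le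
  · rw [h4, hz]; exact (B'_edge hn hg).le

lemma B_first_B_last (hn : 2 ≤ n)
    (he : WR A W σ n (cB n) (fun _ => 1) (fun i => i = 1 ∨ i = n) e) (hx : x = e 1) (hy : y = e n)
    (hm : 2 ≤ m) (hg : WR A W τ m (cB m) (fun _ => 1) (fun i => i = 1 ∨ i = m) g) (hx' : x = g m)
    (hz : z = g 1) : False := by
  have hm' := B'_edge hm hg
  rcases hm.eq_or_lt with rfl | hm₃
  · rcases hn.eq_or_lt with rfl | hn₃
    · have h1 := B'_edge hn he
      simp only [Nat.reduceSub] at h1 hm'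
      rw [← hx, ← hy] at h1
      rw [← hx', ← hz] at hm'
      exact H.double_false H.x₁ H.x₂ (Or.inl h1.le) (Or.inr hm'.le)
    · have h1 := H.B_mem hn he hx 2 (by omega) (by omega)
      obtain ⟨j, a, b, hj⟩ := hg.cov _ h1
      obtain rfl | rfl : j = 1 ∨ j = 2 := by omega
      · have := he.val_ne (i := 2) (by omega) (by omega)
        rw [hj, ← hz] at this
        exact this H.z₁
      · exact he.ne (by omega) (by omega) (by omega) (by omega) (by omega)
          (hj.trans (hx'.symm.trans hx))
  · have h1 := H.swap.B_mem_last hm hg hx' (m - 1) (by omega) (by omega)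
    obtain ⟨j, a, b, hj⟩ := he.cov _ h1
    rw [hj, ← hx', hx, he.mat j 1 a b (by omega) (by omega)] at hm'
    unfold cB at hm'; split_ifs at hm' <;> omega

/-- For `n = 2` the double edge between `x` and `y` is attached to a heavy node of `τ`. For larger
`n` the second node of `σ` would be `z`. -/
lemma B_first_C_first (hn : 2 ≤ n)
    (he : WR A W σ n (cB n) (fun _ => 1) (fun i => i = 1 ∨ i = n) e) (hx : x = e 1) (hy : y = e n)
    (hm : 3 ≤ m) (hg : WR A W τ m (cC m) (lC m) (fun i => i = 1 ∨ i = 2) g) (hx' : x = g 1)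
    (hz : z = g 2) : False := by
  rcases hn.eq_or_lt with rfl | hn₃
  · have h1 := B'_edge hn he
    simp only [Nat.reduceSub] at h1
    rw [← hx, ← hy] at h1
    have h2 := heavy_C'_first H.fin hm hg
    rw [← hx'] at h2
    have := h2.simple H.fin H.y₂ (by omega)
    omega
  · have h1 := H.B_mem hn he hx 2 (by omega) (by omega)
    have h2 := he.adj (isChain_B n n) (i := 1) (j := 2) (by omega) (by omega) (by omega) (by omega)
      (by omega)
    have h3 := he.ne (i := 2) (j := 1) (by omega) (by omega) (by omega) (by omega) (by omega)
    rw [← hx, hx'] at h2 h3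
    obtain ⟨j, a, b, hj, hj'⟩ := hg.nbr (isChain_C m m) (by omega) (by omega) h1 h3 h2
    obtain rfl : j = 2 := by omega
    have := he.val_ne (i := 2) (by omega) (by omega)
    rw [hj, ← hz] at this
    exact this H.z₁

/-- The double edge of `τ` lies in the support of `σ`, so one of its ends is `y`, a node outside the
support of `τ`. -/
lemma B_first_C_second (hn : 2 ≤ n)
    (he : WR A W σ n (cB n) (fun _ => 1) (fun i => i = 1 ∨ i = n) e) (hy : y = e n)
    (hm : 3 ≤ m) (hg : WR A W τ m (cC m) (lC m) (fun i => i = 1 ∨ i = 2) g)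
    (hx' : x = g 2) : False := by
  have h1 := H.swap.C_mem hm hg hx'
  have h2 := C_edge hm hg
  obtain ⟨i, a, b, hi⟩ := he.cov _ (h1 m (by omega) le_rfl)
  obtain ⟨j, c, d, hj⟩ := he.cov _ (h1 (m - 1) (by omega) (by omega))
  rw [hi, hj, he.mat i j a b c d] at h2
  obtain rfl : j = n := by unfold cB at h2; split_ifs at h2 <;> omega
  have := hg.val_ne (i := m - 1) (by omega) (by omega)
  rw [hj, ← hy] at this
  exact this H.y₂

/-- The double edge of `σ` lies in `τ` and is therefore the double edge of `B_m`, which ends at `x`.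
This forces `n = 3`. The superheavy node `x` is not joined to `z`, so `m ≥ 3`, and a longer chain
would need a further black node in `σ`; hence `m = 3`, and the diagram is `F₄`. -/
lemma C_second_B_last (hn : 3 ≤ n)
    (he : WR A W σ n (cC n) (lC n) (fun i => i = 1 ∨ i = 2) e) (hx : x = e 2) (hy : y = e 1)
    (hm : 2 ≤ m) (hg : WR A W τ m (cB m) (fun _ => 1) (fun i => i = 1 ∨ i = m) g) (hx' : x = g m)
    (hz : z = g 1) : InTable A W σ τ := by
  have h1 := H.C_mem hn he hx
  have hn' := C_edge hn he
  have hs := superHeavy_C hn he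
  rw [← hx] at hs
  obtain ⟨i, a, b, hi⟩ := hg.cov _ (h1 n (by omega) le_rfl)
  obtain ⟨j, c, d, hj⟩ := hg.cov _ (h1 (n - 1) (by omega) (by omega))
  rw [hi, hj, hg.mat i j a b c d] at hn'
  obtain ⟨rfl, rfl⟩ : j = m ∧ i = m - 1 := by unfold cB at hn'; split_ifs at hn' <;> omega
  obtain rfl : n = 3 := by
    have := he.inj _ _ (by omega) (by omega) (by omega) (by omega) (hj.trans (hx'.symm.trans hx))
    omega
  have hj₃ : j = 3 := by
    have h2 : j ≠ 2 := by
      rintro rfl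
      have h3 := hg.adj (isChain_B 2 2) (i := 2) (j := 1) (by omega) (by omega) (by omega) (by omega)
        (by omega)
      rw [← hx', ← hz] at h3
      exact h3 (hs.isolated H.fin H.z₁)
    by_contra h3
    have h4 : σ (g (j - 2)) ≠ 0 := by
      refine H.sys.mem₁ H.fin (j := e 3) ?_ (he.val_ne (by omega) (by omega)) ?_
      · rw [hg.wh _ (by omega) (by omega)]; omega
      · rw [hi]
        exact hg.adj (isChain_B j j) (by omega) (by omega) (by omega) (by omega) (by omega)
    obtain ⟨k, k₁, k₂, hk, hk'⟩ := he.nbr (isChain_C 3 3) (i := 3) (by omega) (by omega) h4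
      (by rw [hi]; exact hg.ne (by omega) (by omega) (by omega) (by omega) (by omega))
      (by
        rw [hi]
        exact hg.adj (isChain_B j j) (by omega) (by omega) (by omega) (by omega) (by omega))
    obtain rfl : k = 2 := by omega
    rw [← hx, hx'] at hk
    exact hg.ne (by omega) (by omega) (by omega) (by omega) (by omega) hk
  subst hj₃
  have h3 : A y z = 0 := by
    by_contra h0
    have hxy : A x y ≠ 0 := by
      rw [hx, hy]
      exact he.adj (isChain_C 3 3) (by omega) (by omega) (by omega) (by omega) (by omega)
    have := H.prof₂.unique_nbr H.fin H.y₂ H.x₂ H.z₂ H.wx H.wz hxy (H.fin.ne_zero_symm h0)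
    exact H.x₁ (this ▸ H.z₁)
  refine InTable.swap (glue_F₄_c.inTable H.fin hg he (fun k => (H.sys.cover k).symm) ?_ ?_ ?_)
  · intro j a b hj
    interval_cases j
    · exact hy ▸ H.y₂
    all_goals simp [α, ofList] at hj
  · intro i a b hi
    interval_cases i
    · exact hz ▸ H.z₁
    all_goals simp [α, ofList] at hi
  · intro i j a b c d
    rw [hy, hz] at h3
    have h4 := H.fin.symm _ _ h3
    simp only [Nat.reduceSub] at hi hj
    interval_cases i <;> interval_cases j <;> simp [α, ofList, cB, h3, h4, hi, hj]

lemma C_second_C_first (hn : 3 ≤ n)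
    (he : WR A W σ n (cC n) (lC n) (fun i => i = 1 ∨ i = 2) e) (hx : x = e 2)
    (hm : 3 ≤ m) (hg : WR A W τ m (cC m) (lC m) (fun i => i = 1 ∨ i = 2) g)
    (hz : x = g 1 ∧ z = g 2 ∨ x = g 2 ∧ z = g 1) : False := by
  have hs := superHeavy_C hn he
  rw [← hx] at hs
  have h1 := hs.isolated H.fin H.z₁
  rcases hz with ⟨hx', hz⟩ | ⟨hx', hz⟩
  all_goals
    rw [hx', hz] at h1
    exact hg.adj (isChain_C m m) (by omega) (by omega) (by omega) (by omega) (by omega) h1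

/-- The only common node is `x`, so `z` is attached to the triple edge at `x`. -/
lemma G_false (he : WR A W σ 2 cG (fun _ => 1) (fun i => i = 1 ∨ i = 2) e)
    (hxy : x = e 1 ∧ y = e 2 ∨ x = e 2 ∧ y = e 1) : False := by
  obtain ⟨k, hk, hk', ha⟩ := H.az
  obtain rfl : k = x := by
    obtain ⟨i, a, b, rfl⟩ := he.cov k hk
    by_contra hne
    have : e i = y := by
      obtain rfl | rfl : i = 1 ∨ i = 2 := by omega
      · rcases hxy with ⟨h1, h2⟩ | ⟨h1, h2⟩
        exacts [absurd h1.symm hne, h2.symm]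
      · rcases hxy with ⟨h1, h2⟩ | ⟨h1, h2⟩
        exacts [h2.symm, absurd h1.symm hne]
    exact hk' (this ▸ H.y₂)
  refine H.fin.false_of_triple (x := z) (y := k) (z := y) (by rintro rfl; exact H.x₁ H.z₁) H.yz.symm
    H.xy (H.fin.ne_zero_symm ha) ?_
  rcases hxy with ⟨h1, h2⟩ | ⟨h1, h2⟩ <;> rw [h1, h2]
  · exact Or.inr (G₂_edge he).1.le
  · exact Or.inl (G₂_edge he).1.le

lemma inTable : InTable A W σ τ := by
  have main : ∀ {σ τ y z}, WhiteOverlap A W σ τ x y z →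
      (∃ n e, 2 ≤ n ∧ IsA A W σ n e ∧ x = e 1 ∧ y = e n) → InTable A W σ τ := by
    rintro σ τ y z H ⟨n, e, hn, he, hx, hy⟩
    rcases H.sys.root₂.two_white H.prof₂ H.x₂ H.z₂ H.wx H.wz H.swap.xy with
      ⟨m, g, hm, hg, hx', hz⟩ | ⟨m, g, hm, hg, ⟨hx', hz⟩ | ⟨hx', hz⟩⟩ |
      ⟨m, g, hm, hg, ⟨hx', hz⟩ | ⟨hx', hz⟩⟩ | ⟨g, hg, hg'⟩
    · exact H.A_A hn he hx hy hm hg hx' hz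
    · exact H.A_B_first hn he hx hy hm hg hx' hz
    · exact H.A_B_last hn he hx hy hm hg hx' hz
    · exact H.A_C_first hn he hx hy hm hg hx' hz
    · exact (H.A_C_second_false he hm hg hx').elim
    · exact (H.swap.G_false hg hg').elim
  rcases H.sys.root₁.two_white H.prof₁ H.x₁ H.y₁ H.wx H.wy H.xy with h₁ | h₁
  · exact main H h₁
  rcases H.sys.root₂.two_white H.prof₂ H.x₂ H.z₂ H.wx H.wz H.swap.xy with h₂ | h₂
  · exact (main H.swap h₂).swap
  -- Neither root is of type `A` from here on. The inequality removes the cases in which both roots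
  -- pair to 0 with `x`, namely those with `x` the last node of `B` or the first of `C` on both
  -- sides.
  have hp := H.pr_x
  rcases h₁ with ⟨n, e, hn, he, ⟨hx, hy⟩ | ⟨hx, hy⟩⟩ | ⟨n, e, hn, he, ⟨hx, hy⟩ | ⟨hx, hy⟩⟩ |
    ⟨e, he, he'⟩ <;>
  rcases h₂ with ⟨m, g, hm, hg, ⟨hx', hz⟩ | ⟨hx', hz⟩⟩ | ⟨m, g, hm, hg, ⟨hx', hz⟩ | ⟨hx', hz⟩⟩ |
    ⟨g, hg, hg'⟩
  any_goals first
    | exact (H.G_false he he').elim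
    | exact (H.swap.G_false hg hg').elim
  · exact (H.B_first_B_first hn he hx hy hm hg hx' hz).elim
  · exact (H.B_first_B_last hn he hx hy hm hg hx' hz).elim
  · exact (H.B_first_C_first hn he hx hy hm hg hx' hz).elim
  · exact (H.B_first_C_second hn he hy hm hg hx').elim
  · exact (H.swap.B_first_B_last hm hg hx' hz hn he hx hy).elim
  · rw [hx, pr_B hn he (by omega) (by omega), ← hx, hx', pr_B hm hg (by omega) (by omega)] at hp
    split_ifs at hp <;> omega
  · rw [hx, pr_B hn he (by omega) (by omega), ← hx, hx', pr_C hm hg (by omega) (by omega)] at hp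
    split_ifs at hp <;> omega
  · exact (H.swap.C_second_B_last hm hg hx' hz hn he hx hy).swap
  · exact (H.swap.B_first_C_first hm hg hx' hz hn he hx hy).elim
  · rw [hx, pr_C hn he (by omega) (by omega), ← hx, hx', pr_B hm hg (by omega) (by omega)] at hp
    split_ifs at hp <;> omega
  · rw [hx, pr_C hn he (by omega) (by omega), ← hx, hx', pr_C hm hg (by omega) (by omega)] at hp
    split_ifs at hp <;> omega
  · exact (H.swap.C_second_C_first hm hg hx' hn he (Or.inl ⟨hx, hy⟩)).elim
  · exact (H.swap.B_first_C_second hm hg hz hn he hx).elim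
  · exact H.C_second_B_last hn he hx hy hm hg hx' hz
  · exact (H.C_second_C_first hn he hx hm hg (Or.inl ⟨hx', hz⟩)).elim
  · exact (H.C_second_C_first hn he hx hm hg (Or.inr ⟨hx', hz⟩)).elim

end WhiteOverlap

/-- Two supports meet in a white node, and none contains the other. -/
lemma white_overlap (hA : FiniteType A) (h : Sys A W σ τ) (pσ : Prof A W σ) (pτ : Prof A W τ)
    (hx : σ x ≠ 0) (hx' : τ x ≠ 0) (wx : W x) (hy : ∃ y, τ y = 0) (hz : ∃ z, σ z = 0) :
    InTable A W σ τ := by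
  have key : ∀ {σ τ : κ → ℤ}, Sys A W σ τ → Prof A W σ → σ x ≠ 0 → τ x ≠ 0 → (∃ y, τ y = 0) →
      ∃ k y, σ k ≠ 0 ∧ τ k ≠ 0 ∧ A k y ≠ 0 ∧ σ y ≠ 0 ∧ τ y = 0 ∧ W y := by
    rintro σ τ h pσ hx hx' ⟨y, hy⟩
    obtain ⟨k, y, hk, hy₁, hk', hy₂, ha⟩ := pσ.conn (fun k => τ k ≠ 0) ⟨x, hx, hx'⟩
      ⟨y, (h.cover y).resolve_right (by simpa using hy), by simpa using hy⟩
    refine ⟨k, y, hk, hk', ha, hy₁, by simpa using hy₂, ?_⟩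
    by_contra hW
    exact hy₂ (h.mem₂ hA hW hk' ha)
  obtain ⟨k, y, hk, hk', ha, hy₁, hy₂, wy⟩ := key h pσ hx hx' hy
  obtain ⟨j, z, hj, hj', hb, hz₁, hz₂, wz⟩ := key (h.swap hA) pτ hx' hx hz
  exact WhiteOverlap.inTable ⟨hA, h, pσ, pτ, hx, hx', hy₁, hy₂, hz₂, hz₁, wx, wy, wz,
    ⟨k, hk, hk', ha⟩, ⟨j, hj', hj, hb⟩⟩

end WhiteOverlap
end WeakSpherical

namespace WeakSpherical

section BlackOverlap

variable {κ : Type*} [Fintype κ] [DecidableEq κ] {A : κ → κ → ℤ} {W : κ → Prop} {σ τ ρ : κ → ℤ}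
  {p q n m : ℕ} {e g : ℕ → κ} {C D : ℕ → ℕ → ℤ} {l l' : ℕ → ℤ} {w w' : ℕ → Prop} {c : κ}

/-! ### Supports that meet in black nodes only -/

lemma WR.swap_last (hn : 3 ≤ n) (h : WR A W ρ n (cD n) (lD n) (fun i => i = 1) e) :
    WR A W ρ n (cD n) (lD n) (fun i => i = 1)
      (fun i => e (if i + 1 = n then n else if i = n then n - 1 else i)) where
  mat i j a b c d := by
    rw [h.mat _ _ (by split_ifs <;> omega) (by split_ifs <;> omega) (by split_ifs <;> omega)
      (by split_ifs <;> omega)]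
    unfold cD; split_ifs <;> omega
  val i a b := by
    rw [h.val _ (by split_ifs <;> omega) (by split_ifs <;> omega)]
    unfold lD; split_ifs <;> omega
  cov k hk := by
    obtain ⟨i, a, b, rfl⟩ := h.cov k hk
    refine ⟨if i + 1 = n then n else if i = n then n - 1 else i, by split_ifs <;> omega,
      by split_ifs <;> omega, ?_⟩
    congr 1; split_ifs <;> omega
  wh i a b := by
    rw [h.wh _ (by split_ifs <;> omega) (by split_ifs <;> omega)]
    split_ifs <;> omega
  inj i j a b c d hij := by
    have := h.inj _ _ (by split_ifs <;> omega) (by split_ifs <;> omega) (by split_ifs <;> omega)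
      (by split_ifs <;> omega) hij
    split_ifs at this <;> omega
  pos := h.pos

lemma D_nbr (h : WR A W ρ n (cD n) l w e) {i : ℕ} (hi : 1 ≤ i) (hin : i ≤ n) {k : κ}
    (hk : ρ k ≠ 0) (hne : k ≠ e i) (ha : A (e i) k ≠ 0) : ∃ j, 1 ≤ j ∧ j ≤ n ∧ k = e j ∧
      ((i + 1 = j ∧ j < n) ∨ (j + 1 = i ∧ i < n) ∨ (i + 2 = j ∧ j = n) ∨ (j + 2 = i ∧ i = n)) := by
  obtain ⟨j, a, b, rfl⟩ := h.cov k hk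
  refine ⟨j, a, b, rfl, ?_⟩
  have hij : i ≠ j := by rintro rfl; exact hne rfl
  rw [h.mat i j hi hin a b] at ha
  unfold cD at ha
  split_ifs at ha <;> omega

/-- If two supports meet in black nodes only, `⟨σ + τ | α^∨⟩ ≤ 0` for `α` in the support of `σ`,
unless `σ` is of type `D`. -/
lemma Sys.sum_nonpos_or (hA : FiniteType A) (h : Sys A W σ τ) (pσ : Prof A W σ) (pτ : Prof A W τ)
    (hI : ∃ k, σ k ≠ 0 ∧ τ k ≠ 0) (hB : ∀ k, σ k ≠ 0 → τ k ≠ 0 → ¬ W k) :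
    (∀ k, σ k ≠ 0 → pr A σ k + pr A τ k ≤ 0) ∨
      ∃ n e, 3 ≤ n ∧ WR A W σ n (cD n) (lD n) (fun i => i = 1) e ∧ -1 ≤ pr A τ (e 1) := by
  have out : ∀ {k}, σ k ≠ 0 → W k → τ k = 0 := fun hk hW => by
    by_contra h0
    exact hB _ hk h0 hW
  have np : ∀ {k}, σ k ≠ 0 → W k → pr A τ k ≤ 0 := fun hk hW =>
    hA.pr_nonpos pτ.nonneg (out hk hW)
  have nb : ∀ {j k}, σ k ≠ 0 → W k → τ j ≠ 0 → A j k ≠ 0 → pr A τ k ≤ -1 := fun {j k} hk hW hj ha => by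
    have := hA.pr_neg pτ.nonneg (out hk hW) hj ha
    have := pτ.nonneg j
    omega
  have white : (∀ k, σ k ≠ 0 → W k → pr A σ k + pr A τ k ≤ 0) →
      ∀ k, σ k ≠ 0 → pr A σ k + pr A τ k ≤ 0 := fun H k hk => by
    by_cases hW : W k
    · exact H k hk hW
    · have := h.black k hW
      omega
  -- The white nodes of `σ` lie outside the support of `τ`; on the way to one of them the common
  -- part is left at a white node.
  have attached : ∃ i j, σ i ≠ 0 ∧ σ j ≠ 0 ∧ W j ∧ τ i ≠ 0 ∧ A i j ≠ 0 := by
    obtain ⟨u, hu, wu⟩ := pσ.white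
    obtain ⟨x, hx, hx'⟩ := hI
    obtain ⟨i, j, hi, hj, hi', hj', ha⟩ := pσ.conn (fun k => τ k ≠ 0) ⟨x, hx, hx'⟩
      ⟨u, hu, by simpa using out hu wu⟩
    refine ⟨i, j, hi, hj, ?_, hi', ha⟩
    by_contra hW
    exact hj' (h.mem₂ hA hW hi' ha)
  obtain ⟨x, hx, hx'⟩ := hI
  have hr := h.root₁
  rcases hr with ⟨m, g, hm, hg⟩ | ⟨m, g, hm, hg⟩ | ⟨m, g, hm, hg⟩ | ⟨m, g, hm, hg⟩ | ⟨m, g, hm, hg⟩ |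
    ⟨g, hg⟩ | ⟨g, hg⟩ | ⟨g, hg⟩ | ⟨g, hg⟩ | ⟨m, g, hm, hg⟩ | ⟨g, hg⟩
  case D₂ => exact (hg.not_prof (fun i a b => by omega) pσ).elim
  all_goals
    obtain ⟨b, b₁, b₂, rfl⟩ := hg.cov x hx
    have wb := hB _ hx hx'
    rw [hg.wh b b₁ b₂] at wb
    obtain ⟨i', j', hi, hj, hW, hi', ha⟩ := attached
    obtain ⟨i, i₁, i₂, rfl⟩ := hg.cov i' hi
    obtain ⟨j, j₁, j₂, rfl⟩ := hg.cov j' hj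
    have wj := (hg.wh j j₁ j₂).1 hW
  case A =>
    left
    refine white fun k hk hW => ?_
    have hC := isChain_A m
    have walk := WR.walk hA h hg hC (a := 2) (b := m - 1) (j := b) (by omega) (by omega)
      (fun i a b c => by rw [hg.wh i (by omega) (by omega)]; omega) (by omega) (by omega) hx'
    obtain ⟨k, k₁, k₂, rfl⟩ := hg.cov k hk
    have wk := (hg.wh k k₁ k₂).1 hW
    have : pr A τ (g k) ≤ -1 := by
      rcases wk with rfl | rfl
      · exact nb hk hW (walk 2 (by omega) (by omega))
          (hg.adj hC (by omega) (by omega) (by omega) (by omega) (by omega))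
      · exact nb hk hW (walk (k - 1) (by omega) (by omega))
          (hg.adj hC (by omega) (by omega) (by omega) (by omega) (by omega))
    rw [pr_A hg k₁ k₂]
    split_ifs <;> omega
  case B' =>
    left
    refine white fun k hk hW => ?_
    have hC := isChain_B m m
    have walk := WR.walk hA h hg hC (a := 2) (b := m - 1) (j := b) (by omega) (by omega)
      (fun i a b c => by rw [hg.wh i (by omega) (by omega)]; omega) (by omega) (by omega) hx'
    obtain ⟨k, k₁, k₂, rfl⟩ := hg.cov k hk
    have wk := (hg.wh k k₁ k₂).1 hW
    rw [pr_B hm hg k₁ k₂]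
    have := np hk hW
    rcases wk with rfl | rfl
    · have := nb hk hW (walk 2 (by omega) (by omega))
          (hg.adj hC (by omega) (by omega) (by omega) (by omega) (by omega))
      split_ifs <;> omega
    · split_ifs <;> omega
  case C' =>
    left
    refine white fun k hk hW => ?_
    have hC := isChain_C m m
    have walk := WR.walk hA h hg hC (a := 3) (b := m) (j := b) (by omega) (by omega)
      (fun i a b c => by rw [hg.wh i (by omega) (by omega)]; omega) (by omega) (by omega) hx'
    obtain ⟨k, k₁, k₂, rfl⟩ := hg.cov k hk
    have wk := (hg.wh k k₁ k₂).1 hW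
    rw [pr_C hm hg k₁ k₂]
    have := np hk hW
    rcases wk with rfl | rfl
    · split_ifs <;> omega
    · have := nb hk hW (walk 3 (by omega) (by omega))
          (hg.adj hC (by omega) (by omega) (by omega) (by omega) (by omega))
      split_ifs <;> omega
  case G₂' => omega
  case D =>
    by_cases hp : -1 ≤ pr A τ (g 1)
    · exact Or.inr ⟨m, g, hm, hg, hp⟩
    · left
      refine white fun k hk hW => ?_
      obtain ⟨k, k₁, k₂, rfl⟩ := hg.cov k hk
      obtain rfl := (hg.wh k k₁ k₂).1 hW
      rw [pr_D hm hg k₁ k₂, if_pos rfl]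
      omega
  -- Here the pairing of `σ` with its white node is 2, but the double edge also makes `τ` pair to at
  -- most `-2` with it.
  case B₃ =>
    left
    subst wj
    refine white fun k hk hW => ?_
    obtain ⟨k, k₁, k₂, rfl⟩ := hg.cov k hk
    obtain rfl := (hg.wh k k₁ k₂).1 hW
    have h3 : i ≠ 3 := by rintro rfl; exact hi' (out hk hW)
    have h4 : i = 2 := by
      rw [hg.mat i 3 i₁ i₂ (by omega) (by omega)] at ha
      unfold cB at ha; split_ifs at ha <;> omega
    subst h4
    have h5 := hA.pr_le pτ.nonneg (out hk hW) (g 2)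
    rw [cB₃_edge le_rfl hg] at h5
    have := pτ.nonneg (g 2)
    rw [pr_B₃ hg (by omega) (by omega), if_pos rfl]
    omega
  all_goals
    left
    have h1 := nb hj hW hi' ha
    refine white fun k hk hW => ?_
    obtain ⟨k, k₁, k₂, rfl⟩ := hg.cov k hk
    have wk := (hg.wh k k₁ k₂).1 hW
    obtain rfl : k = j := by omega
  case B => rw [pr_B hm hg k₁ k₂]; split_ifs <;> omega
  case C => rw [pr_C hm hg k₁ k₂]; split_ifs <;> omega
  case F₄ => rw [pr_F₄ hg k₁ k₂]; split_ifs <;> omega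
  case G₂ => rw [pr_G₂ hg k₁ k₂]; split_ifs <;> omega

/-- The support of `σ`, of type `D n`, meets that of `τ` in black nodes only, and `c` is the only
node of the latter that is adjacent to the white node of the former. -/
structure BlackOverlap (A : κ → κ → ℤ) (W : κ → Prop) (σ τ : κ → ℤ) (n : ℕ) (e : ℕ → κ) (c : κ) :
    Prop where
  fin : FiniteType A
  sys : Sys A W σ τ
  prof : Prof A W τ
  le : 3 ≤ n
  root : WR A W σ n (cD n) (lD n) (fun i => i = 1) e
  mem : σ c ≠ 0
  one : τ c = 1
  zero : τ (e 1) = 0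
  adj : A c (e 1) ≠ 0
  uniq : ∀ k, τ k ≠ 0 → k ≠ c → A k (e 1) = 0

/-- A pairing of at least `-1` leaves room for only one neighbour of `e 1` in `τ`, with coefficient
1. Such a neighbour exists in the common part, as that is where `σ` is left towards a white node. -/
lemma blackOverlap_of (hA : FiniteType A) (h : Sys A W σ τ) (pσ : Prof A W σ) (pτ : Prof A W τ)
    (hI : ∃ k, σ k ≠ 0 ∧ τ k ≠ 0) (hB : ∀ k, σ k ≠ 0 → τ k ≠ 0 → ¬ W k) (hn : 3 ≤ n)
    (he : WR A W σ n (cD n) (lD n) (fun i => i = 1) e) (hp : -1 ≤ pr A τ (e 1)) :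
    ∃ c, BlackOverlap A W σ τ n e c := by
  have w₁ : W (e 1) := (he.wh 1 le_rfl (by omega)).2 rfl
  have h1 : τ (e 1) = 0 := by
    by_contra h0
    exact hB _ (he.val_ne le_rfl (by omega)) h0 w₁
  obtain ⟨x, hx, hx'⟩ := hI
  obtain ⟨c, j, hc, hj, hc', hj', ha⟩ := pσ.conn (fun k => τ k ≠ 0) ⟨x, hx, hx'⟩
      ⟨e 1, he.val_ne le_rfl (by omega), by simpa using h1⟩
  have hW : W j := by
    by_contra hW
    exact hj' (h.mem₂ hA hW hc' ha)
  obtain ⟨j, a, b, rfl⟩ := he.cov j hj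
  obtain rfl := (he.wh j a b).1 hW
  have h2 := pτ.nonneg c
  refine ⟨c, hA, h, pτ, hn, he, hc, ?_, h1, ha, fun k hk hkc => ?_⟩
  · have := hA.pr_neg pτ.nonneg h1 hc' ha
    omega
  · by_contra hk'
    have h3 := hA.pr_le_two pτ.nonneg h1 (Ne.symm hkc)
    have n₁ : c ≠ e 1 := by rintro rfl; exact hc' h1
    have n₂ : k ≠ e 1 := by rintro rfl; exact hk h1
    have h4 := (hA.neg n₁ ha).1
    have h5 := (hA.neg n₂ hk').1
    have h6 := pτ.nonneg k
    have h7 : τ c * A c (e 1) ≤ -1 := by nlinarith [show 1 ≤ τ c by omega]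
    have h8 : τ k * A k (e 1) ≤ -1 := by nlinarith [show 1 ≤ τ k by omega]
    omega

end BlackOverlap
end WeakSpherical

namespace WeakSpherical

section BlackOverlap

variable {κ : Type*} [Fintype κ] [DecidableEq κ] {A : κ → κ → ℤ} {W : κ → Prop} {σ τ ρ : κ → ℤ}
  {p q n m : ℕ} {e g : ℕ → κ} {C D : ℕ → ℕ → ℤ} {l l' : ℕ → ℤ} {w w' : ℕ → Prop} {c : κ}

lemma D_leaf (hm : 3 ≤ m) (hg : WR A W τ m (cD m) l w g) {i : ℕ} (hi : i + 1 = m ∨ i = m) {k : κ}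
    (hk : τ k ≠ 0) (hne : k ≠ g i) (ha : A (g i) k ≠ 0) : k = g (m - 2) := by
  obtain ⟨j, -, -, rfl, hj⟩ := D_nbr hg (i := i) (by omega) (by omega) hk hne ha
  congr 1; omega

namespace BlackOverlap

variable (H : BlackOverlap A W σ τ n e c)
include H

lemma swap_last (h4 : 4 ≤ n) : BlackOverlap A W σ τ n
    (fun i => e (if i + 1 = n then n else if i = n then n - 1 else i)) c := by
  have h1 : (if 1 + 1 = n then n else if 1 = n then n - 1 else 1) = 1 := by split_ifs <;> omega
  refine ⟨H.fin, H.sys, H.prof, H.le, H.root.swap_last H.le, H.mem, H.one, ?_, ?_, ?_⟩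
  all_goals simp only [h1]
  exacts [H.zero, H.adj, H.uniq]

lemma not_white {i : ℕ} (hi : 2 ≤ i) (hin : i ≤ n) : ¬ W (e i) := by
  rw [H.root.wh i (by omega) hin]; omega

lemma ne_first {k : κ} (hk : τ k ≠ 0) : k ≠ e 1 := by rintro rfl; exact hk H.zero

lemma black : ¬ W c := by
  obtain ⟨i, a, b, h⟩ := H.root.cov c H.mem
  rw [h, H.root.wh i a b]
  rintro rfl
  exact H.ne_first (by rw [H.one]; exact one_ne_zero) h

lemma val_ne : τ c ≠ 0 := by rw [H.one]; exact one_ne_zero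

lemma out_of_white {k : κ} (hk : τ k ≠ 0) (hW : W k) : σ k = 0 := by
  by_contra h0
  obtain ⟨i, a, b, rfl⟩ := H.root.cov k h0
  obtain rfl := (H.root.wh i a b).1 hW
  exact hk H.zero

/-- For `n ≥ 4` the white node of `D_n` is an end with a single neighbour. -/
lemma eq_second (h4 : 4 ≤ n) : c = e 2 := by
  have h1 := H.ne_first H.val_ne
  obtain ⟨j, a, b, rfl, hj⟩ := D_nbr H.root (i := 1) le_rfl (by omega) H.mem h1
    (H.fin.ne_zero_symm H.adj)
  congr 1; omega

/-- The nodes `e 2, …, e n` are black and connected, so membership in `τ` spreads from `e 2` to all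
of them. The last node is reached from `e (n - 2)` because of the fork. -/
lemma tail_mem (h4 : 4 ≤ n) : ∀ i, 2 ≤ i → i ≤ n → τ (e i) ≠ 0 := by
  intro i
  induction i using Nat.strong_induction_on with
  | _ i ih =>
    intro a b
    rcases a.eq_or_lt with rfl | a'
    · rw [← H.eq_second h4]; exact H.val_ne
    have hj : τ (e (if i = n then n - 2 else i - 1)) ≠ 0 :=
      ih _ (by split_ifs <;> omega) (by split_ifs <;> omega) (by split_ifs <;> omega)
    exact H.sys.mem₂ H.fin (H.not_white a b) hj (D_adj H.root (by split_ifs <;> omega)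
      (by split_ifs <;> omega) (by omega) b (by split_ifs <;> omega))

end BlackOverlap

/-! #### The case of `D 3` -/

namespace BlackOverlap

lemma swap_three (H : BlackOverlap A W σ τ 3 e c) : BlackOverlap A W σ τ 3
    (fun i => e (if i + 1 = 3 then 3 else if i = 3 then 3 - 1 else i)) c :=
  ⟨H.fin, H.sys, H.prof, H.le, H.root.swap_last H.le, H.mem, H.one, H.zero, H.adj, H.uniq⟩


lemma second_zero (H : BlackOverlap A W σ τ 3 e (e 3)) : τ (e 2) = 0 := by
  by_contra h0
  exact D_adj H.root (i := 2) (j := 1) (by omega) (by omega) (by omega) (by omega) (by omega)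
    (H.uniq _ h0 (H.root.ne (by omega) (by omega) (by omega) (by omega) (by omega)))

lemma mem_iff (H : BlackOverlap A W σ τ 3 e (e 3)) {k : κ} (hk : τ k ≠ 0) (hne : k ≠ e 3) :
    σ k = 0 := by
  by_contra h0
  obtain ⟨i, a, b, rfl⟩ := H.root.cov k h0
  obtain rfl | rfl | rfl : i = 1 ∨ i = 2 ∨ i = 3 := by omega
  exacts [hk H.zero, hk H.second_zero, hne rfl]

/-- A black neighbour would belong to the support of `σ`, but `e 3` is the only common node. -/
lemma white_nbr (H : BlackOverlap A W σ τ 3 e (e 3)) {k : κ} (hk : τ k ≠ 0) (hne : k ≠ e 3)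
    (ha : A (e 3) k ≠ 0) : W k := by
  by_contra hW
  exact H.sys.mem₁ H.fin hW H.mem ha (H.mem_iff hk hne)

/-- The supports share only `e 3`; the other two nodes of `σ` are not joined to the rest of `τ`, one
by uniqueness of the neighbour of `e 1`, the other because it is black. -/
lemma glue_three (H : BlackOverlap A W σ τ 3 e (e 3)) {p : ℕ} {P : Matrix (Fin p) (Fin p) ℤ}
    {s t : ℕ → ℕ} {v : Set ℕ} {hT : RankTwoTable p P s t v} {φ₁ ψ₁ φ₂ ψ₂ : ℕ → ℕ}
    {r : RtEntry m C l w} (G : Glue hT D (.D 3 le_rfl) φ₁ ψ₁ r φ₂ ψ₂) (hg : WR A W τ m C l w g)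
    {i₀ : ℕ} (h₁ : 1 ≤ i₀) (h₂ : i₀ ≤ m) (h₀ : e 3 = g i₀) (hφ₀ : φ₁ 3 = φ₂ i₀)
    (hφ : ∀ i j, 1 ≤ i → i ≤ 2 → 1 ≤ j → j ≤ m → φ₁ i ≠ φ₂ j)
    (hD : ∀ i j, 1 ≤ i → i ≤ 2 → 1 ≤ j → j ≤ m → j ≠ i₀ →
      D (φ₁ i) (φ₂ j) = 0 ∧ D (φ₂ j) (φ₁ i) = 0) : InTable A W σ τ := by
  have hs : s (φ₂ i₀) ≠ 0 := fun h0 => by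
    have := (G.node₁ 3 (by omega) le_rfl).2.2.1
    rw [hφ₀, h0] at this
    simp [lD] at this
  have ht : t (φ₁ 3) ≠ 0 := fun h0 => by
    have h3 := (G.node₂ i₀ h₁ h₂).2.2.1
    have h4 := hg.pos i₀ h₁ h₂
    rw [← hφ₀, h0] at h3
    push_cast at h3; omega
  have hne : ∀ {j}, 1 ≤ j → j ≤ m → j ≠ i₀ → g j ≠ e 3 := fun a b hj => by
    rw [h₀]; exact hg.ne a b h₁ h₂ hj
  have hz : ∀ i, 1 ≤ i → i ≤ 2 → τ (e i) = 0 := fun i a b => by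
    obtain rfl | rfl : i = 1 ∨ i = 2 := by omega
    exacts [H.zero, H.second_zero]
  have h3 : ∀ i, 1 ≤ i → i ≤ 3 → t (φ₁ i) = 0 → i ≤ 2 := fun i a b hi => by
    by_contra h0
    obtain rfl : i = 3 := by omega
    exact ht hi
  refine G.inTable H.fin H.root hg H.sys.cover (fun j a b hj => ?_) (fun i a b hi => ?_)
    fun i j a b a' b' => ⟨fun hij => ?_, fun hi hj => ?_⟩
  · exact H.mem_iff (hg.val_ne a b) (hne a b (by rintro rfl; exact hs hj))
  · exact hz i a (h3 i a b hi)
  · have hi : i = 3 := by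
      by_contra h0
      exact hφ i j a (by omega) a' b' hij
    subst hi
    rw [h₀, (G.mat₂ _ _ h₁ h₂ a' b').2 (hφ₀.symm.trans hij)]
  · have b'' := h3 i a b hi
    have hj' : j ≠ i₀ := by rintro rfl; exact hs hj
    have hA0 : A (g j) (e i) = 0 := by
      obtain rfl | rfl : i = 1 ∨ i = 2 := by omega
      · exact H.uniq _ (hg.val_ne a' b') (hne a' b' hj')
      · exact H.sys.black₂ H.fin (H.not_white le_rfl (by omega)) H.second_zero (hg.val_ne a' b')
    rw [hA0, H.fin.symm _ _ hA0, (hD i j a b'' a' b' hj').1, (hD i j a b'' a' b' hj').2]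
    exact ⟨rfl, rfl⟩

/-- In `τ` the node `e 3` is black with coefficient 1, and all its neighbours are white. It is thus
the middle of `A 3`, the last node of `B 2`, the first node of `C`, or an end of `D 3`. The other
candidates contain an affine diagram, since `e 1` is attached at `e 3`. -/
lemma inTable_three (H : BlackOverlap A W σ τ 3 e (e 3)) : InTable A W σ τ := by
  have nbr : ∀ {m C l w g}, WR A W τ m C l w g → ∀ {i j}, 1 ≤ i → i ≤ m → 1 ≤ j → j ≤ m → j ≠ i →
      e 3 = g i → C i j ≠ 0 → w j := fun {m C l w g} hg {i j} a b c d hj hi hC => by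
    rw [← hg.wh j c d]
    refine H.white_nbr (hg.val_ne c d) ?_ ?_ <;> rw [hi]
    · exact hg.ne c d a b hj
    · rwa [hg.mat i j a b c d]
  have hr := H.sys.root₂
  rcases hr with ⟨m, g, hm, hg⟩ | ⟨m, g, hm, hg⟩ | ⟨m, g, hm, hg⟩ | ⟨m, g, hm, hg⟩ | ⟨m, g, hm, hg⟩ |
    ⟨g, hg⟩ | ⟨g, hg⟩ | ⟨g, hg⟩ | ⟨g, hg⟩ | ⟨m, g, hm, hg⟩ | ⟨g, hg⟩
  case D₂ => exact (hg.not_prof (fun i a b => by omega) H.prof).elim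
  all_goals
    obtain ⟨i, a, b, hi⟩ := hg.cov _ H.val_ne
    have hb := H.black
    have h1 := H.one
    rw [hi, hg.wh i a b] at hb
    rw [hi, hg.val i a b] at h1
  case A =>
    have hC := isChain_A m
    have h2 := nbr hg a b (j := i - 1) (by omega) (by omega) (by omega) hi (by
      have := (hC.near (i - 1) (by omega) (by omega)).2
      rwa [Nat.sub_add_cancel a] at this)
    have h3 := nbr hg a b (j := i + 1) (by omega) (by omega) (by omega) hi
      (hC.near i (by omega) (by omega)).1
    obtain ⟨rfl, rfl⟩ : i = 2 ∧ m = 3 := by omega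
    refine H.glue_three glue_D_c hg (i₀ := 2) (by omega) (by omega) hi (by simp [ofList]) ?_ ?_
    · intro i j a b c d
      interval_cases i <;> interval_cases j <;> simp [ofList]
    · intro i j a b c d hj
      interval_cases i <;> interval_cases j <;> simp [ofList, cD] at hj ⊢
  case B =>
    have hC := isChain_B m m
    have h2 := nbr hg a b (j := i - 1) (by omega) (by omega) (by omega) hi (by
      have := (hC.near (i - 1) (by omega) (by omega)).2
      rwa [Nat.sub_add_cancel a] at this)
    have h3 : i = m := by
      by_contra h3
      have h3 := nbr hg a b (j := i + 1) (by omega) (by omega) (by omega) hi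
        (hC.near i (by omega) (by omega)).1
      omega
    obtain ⟨rfl, rfl⟩ : i = 2 ∧ m = 2 := by omega
    refine H.glue_three glue_C_c_four hg (i₀ := 2) (by omega) (by omega) hi (by simp [ofList]) ?_ ?_
    · intro i j a b c d
      interval_cases i <;> interval_cases j <;> simp [ofList]
    · intro i j a b c d hj
      interval_cases i <;> interval_cases j <;> simp [ofList, cC] at hj ⊢
  case B' =>
    have hC := isChain_B m m
    have h2 := nbr hg a b (j := i - 1) (by omega) (by omega) (by omega) hi (by
      have := (hC.near (i - 1) (by omega) (by omega)).2
      rwa [Nat.sub_add_cancel a] at this)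
    have h3 := nbr hg a b (j := i + 1) (by omega) (by omega) (by omega) hi
      (hC.near i (by omega) (by omega)).1
    obtain ⟨rfl, rfl⟩ : i = 2 ∧ m = 3 := by omega
    refine (H.fin.false_of_fork (x := e 1) (x' := g 1) (y := g 2) (z := g 3) ?_ ?_ ?_ ?_).elim
    · have := hg.nodup (L := [1, 2, 3]) (by simp) (by simp)
      refine List.nodup_cons.2 ⟨?_, this⟩
      simp only [List.mem_cons, List.not_mem_nil, or_false, not_or]
      exact ⟨(H.ne_first (hg.val_ne (by omega) (by omega))).symm,
        (H.ne_first (hg.val_ne (by omega) (by omega))).symm,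
        (H.ne_first (hg.val_ne (by omega) (by omega))).symm⟩
    · rw [← hi]; exact H.fin.ne_zero_symm H.adj
    · exact hg.adj hC (by omega) (by omega) (by omega) (by omega) (by omega)
    · exact Or.inl (B'_edge hm hg).le
  case C | C' =>
    have hC := isChain_C m m
    have h3 : i = 1 ∨ i = m := by
      unfold lC at h1; split_ifs at h1 <;> omega
    -- The last node of `C 3` would also be possible, but then `e 2, e 1, g 3, g 2, g 1` is an
    -- affine chain of type `F₄`.
    have h4 : ¬ (i = m ∧ m = 3) := by
      rintro ⟨rfl, rfl⟩
      refine H.fin.false_of_F (x₁ := e 2) (x₂ := e 1) (x₃ := g 3) (x₄ := g 2) (x₅ := g 1) ?_ ?_ ?_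
        ?_ ?_ ?_
      · have := hg.nodup (L := [3, 2, 1]) (by simp) (by simp)
        refine List.nodup_cons.2 ⟨?_, List.nodup_cons.2 ⟨?_, this⟩⟩
        · simp only [List.mem_cons, List.not_mem_nil, or_false, not_or]
          refine ⟨H.root.ne (by omega) (by omega) (by omega) (by omega) (by omega), ?_, ?_, ?_⟩ <;>
          · intro h0
            have := H.second_zero
            rw [h0] at this
            exact hg.val_ne (by omega) (by omega) this
        · simp only [List.mem_cons, List.not_mem_nil, or_false, not_or]
          exact ⟨(H.ne_first (hg.val_ne (by omega) (by omega))).symm,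
            (H.ne_first (hg.val_ne (by omega) (by omega))).symm,
            (H.ne_first (hg.val_ne (by omega) (by omega))).symm⟩
      · exact D_adj H.root (by omega) (by omega) (by omega) (by omega) (by omega)
      · rw [← hi]; exact H.fin.ne_zero_symm H.adj
      · exact hg.adj hC (by omega) (by omega) (by omega) (by omega) (by omega)
      · exact hg.adj hC (by omega) (by omega) (by omega) (by omega) (by omega)
      · exact Or.inl (C_edge hm hg).le
    have h5 : i = 1 := by
      by_contra h5
      have h2 := nbr hg a b (j := i - 1) (by omega) (by omega) (by omega) hi (by
        have := (hC.near (i - 1) (by omega) (by omega)).2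
        rwa [Nat.sub_add_cancel a] at this)
      omega
    subst h5
    first
    | exact absurd (Or.inl rfl) hb
    | refine H.glue_three (glue_C_c (m + 2) (by omega)) hg (i₀ := 1) (by omega) (by omega) hi
        (by simp) ?_ ?_
      · intro i j a b c d
        interval_cases i <;> simp <;> omega
      · intro i j a b c d hj
        interval_cases i <;> constructor <;> unfold cC <;> split_ifs <;> omega
  case F₄ =>
    have h2 := nbr hg a b (j := 2) (by omega) (by omega) (by
      unfold lF at h1; split_ifs at h1 <;> omega) hi (by
      unfold lF at h1; unfold cB; split_ifs at h1 ⊢ <;> omega)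
    omega
  case B₃ =>
    have h2 := nbr hg a b (j := 2) (by omega) (by omega) (by omega) hi (by
      unfold cB; split_ifs <;> omega)
    omega
  case G₂ =>
    obtain rfl : i = 2 := by omega
    refine (H.fin.false_of_triple (x := e 1) (y := g 2) (z := g 1) ?_ ?_ ?_ ?_
      (Or.inl (G₂_edge hg).1.le)).elim
    · exact (H.ne_first (hg.val_ne (by omega) (by omega))).symm
    · exact (H.ne_first (hg.val_ne (by omega) (by omega))).symm
    · exact hg.ne (by omega) (by omega) (by omega) (by omega) (by omega)
    · rw [← hi]; exact H.fin.ne_zero_symm H.adj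
  case G₂' => omega
  case D =>
    have key : ∀ {g}, WR A W τ m (cD m) (lD m) (fun i => i = 1) g → e 3 = g (m - 1) →
        InTable A W σ τ := fun {g} hg hi => by
      have h2 := nbr hg (i := m - 1) (j := m - 2) (by omega) (by omega) (by omega) (by omega)
        (by omega) hi (by unfold cD; split_ifs <;> omega)
      obtain rfl : m = 3 := by omega
      refine H.glue_three glue_A_c hg (i₀ := 2) (by omega) (by omega) hi (by simp [ofList]) ?_ ?_
      · intro i j a b c d
        interval_cases i <;> interval_cases j <;> simp [ofList]
      · intro i j a b c d hj
        interval_cases i <;> interval_cases j <;> simp [ofList, cA] at hj ⊢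
    have h2 : i + 1 = m ∨ i = m := by unfold lD at h1; split_ifs at h1 <;> omega
    rcases h2 with h2 | rfl
    · exact key hg (by rw [hi]; congr 1; omega)
    · refine key (hg.swap_last hm) ?_
      rw [if_pos (by omega)]
      exact hi

end BlackOverlap
end BlackOverlap
end WeakSpherical

namespace WeakSpherical

section BlackOverlap

variable {κ : Type*} [Fintype κ] [DecidableEq κ] {A : κ → κ → ℤ} {W : κ → Prop} {σ τ ρ : κ → ℤ}
  {p q n m : ℕ} {e g : ℕ → κ} {C D : ℕ → ℕ → ℤ} {l l' : ℕ → ℤ} {w w' : ℕ → Prop} {c : κ}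

namespace BlackOverlap

/-! #### The case of `D 4` -/

/-- A black neighbour of `e 3` or `e 4` in `τ` belongs to the support of `σ`, where such an end has
the single neighbour `e 2`. -/
lemma four_nbr (H : BlackOverlap A W σ τ 4 e (e 2)) (hg : WR A W τ m C l w g) {i j : ℕ} {k : ℕ}
    (hk : k = 3 ∨ k = 4) (hi : 1 ≤ i) (him : i ≤ m) (hj : 1 ≤ j) (hjm : j ≤ m) (hij : j ≠ i)
    (h : e k = g i) (h2 : e 2 ≠ g j) (hC : C i j ≠ 0) : w j := by
  rw [← hg.wh j hj hjm]
  by_contra hW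
  have ha : A (e k) (g j) ≠ 0 := by rwa [h, hg.mat i j hi him hj hjm]
  have h3 := H.sys.mem₁ H.fin hW (H.root.val_ne (by omega) (by omega)) ha
  obtain ⟨a, -, -, h4, h5⟩ := D_nbr H.root (by omega) (by omega) h3
    (by rw [h]; exact hg.ne hj hjm hi him hij) ha
  obtain rfl : a = 2 := by omega
  exact h2 h4.symm

/-- The nodes `e 3`, `e 2`, `e 4` are consecutive in the chain. -/
lemma four_chain (H : BlackOverlap A W σ τ 4 e (e 2)) (hg : WR A W τ m C l w g) (hC : IsChain C m) :
    ∃ i e', BlackOverlap A W σ τ 4 e' (e' 2) ∧ 2 ≤ i ∧ i + 1 ≤ m ∧ e' 2 = g i ∧ e' 3 = g (i - 1) ∧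
      e' 4 = g (i + 1) := by
  have mem := H.tail_mem le_rfl
  obtain ⟨i, a, b, hi⟩ := hg.cov _ (mem 2 le_rfl (by omega))
  have key : ∀ k, k = 3 ∨ k = 4 → ∃ j, 1 ≤ j ∧ j ≤ m ∧ e k = g j ∧ (j = i + 1 ∨ i = j + 1) :=
    fun k hk => hg.nbr hC a b (mem k (by omega) (by omega))
      (by rw [← hi]; exact H.root.ne (by omega) (by omega) (by omega) (by omega) (by omega))
      (by rw [← hi]; exact D_adj H.root (by omega) (by omega) (by omega) (by omega) (by omega))
  obtain ⟨j₃, a₃, b₃, e₃, h₃⟩ := key 3 (by omega)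
  obtain ⟨j₄, a₄, b₄, e₄, h₄⟩ := key 4 (by omega)
  have hne : j₃ ≠ j₄ := by
    rintro rfl
    exact H.root.ne (by omega) (by omega) (by omega) (by omega) (show 3 ≠ 4 by omega) (e₃.trans e₄.symm)
  rcases h₃ with rfl | rfl
  · obtain rfl : i = j₄ + 1 := by omega
    exact ⟨j₄ + 1, _, H.swap_last le_rfl, by omega, by omega, hi, e₄, e₃⟩
  · obtain rfl : j₄ = j₃ + 1 + 1 := by omega
    exact ⟨j₃ + 1, e, H, by omega, by omega, hi, e₃, e₄⟩

lemma four_chain_white (H : BlackOverlap A W σ τ 4 e (e 2)) (hg : WR A W τ m C l w g)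
    (hC : IsChain C m) {i : ℕ} (hi : 2 ≤ i) (him : i + 1 ≤ m) (h2 : e 2 = g i) (h3 : e 3 = g (i - 1))
    (h4 : e 4 = g (i + 1)) : ¬ w (i - 1) ∧ ¬ w i ∧ ¬ w (i + 1) ∧ (3 ≤ i → w (i - 2)) ∧
      (i + 2 ≤ m → w (i + 2)) := by
  have b2 := H.not_white (i := 2) (by omega) (by omega)
  have b3 := H.not_white (i := 3) (by omega) (by omega)
  have b4 := H.not_white (i := 4) (by omega) (by omega)
  rw [h2, hg.wh _ (by omega) (by omega)] at b2
  rw [h3, hg.wh _ (by omega) (by omega)] at b3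
  rw [h4, hg.wh _ (by omega) (by omega)] at b4
  refine ⟨b3, b2, b4, fun h => ?_, fun h => ?_⟩
  · refine H.four_nbr hg (Or.inl rfl) (by omega) (by omega) (by omega) (by omega) (by omega) h3 ?_ ?_
    · rw [h2]; exact hg.ne (by omega) (by omega) (by omega) (by omega) (by omega)
    · have := (hC.near (i - 2) (by omega) (by omega)).2
      rwa [show i - 2 + 1 = i - 1 by omega] at this
  · refine H.four_nbr hg (Or.inr rfl) (by omega) (by omega) (by omega) (by omega) (by omega) h4 ?_ ?_
    · rw [h2]; exact hg.ne (by omega) (by omega) (by omega) (by omega) (by omega)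
    · exact (hC.near (i + 1) (by omega) (by omega)).1

/-- Between `e 3` and `e 4`, the node `e 2` is an inner node of the chain; it is black and has
coefficient 1 in `τ`. -/
lemma four_false_of_end (H : BlackOverlap A W σ τ 4 e (e 2)) (hg : WR A W τ m C l w g)
    (hC : IsChain C m) (hl : ∀ i, 1 ≤ i → i ≤ m → l i = 1 → ¬ w i → i = 1 ∨ i = m) : False := by
  obtain ⟨i, e', H', h1, h2, h3, h4, h5⟩ := H.four_chain hg hC
  have h6 := H'.one
  have h7 := (H'.four_chain_white hg hC h1 h2 h3 h4 h5).2.1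
  rw [h3, hg.val i (by omega) (by omega)] at h6
  have := hl i (by omega) (by omega) h6 h7
  omega

/-- In a chain, `e 3, e 2, e 4` are three consecutive black nodes, next to which there are only
white nodes or ends. This fixes the length: `A 5` leads to `E₆`, types `B` are excluded, and in the
remaining chains no inner black node has coefficient 1. In type `D` the two neighbours `e 3` and `e
4` of an end would coincide. -/
lemma inTable_four (H : BlackOverlap A W σ τ 4 e (e 2)) : InTable A W σ τ := by
  have hr := H.sys.root₂
  rcases hr with ⟨m, g, hm, hg⟩ | ⟨m, g, hm, hg⟩ | ⟨m, g, hm, hg⟩ | ⟨m, g, hm, hg⟩ | ⟨m, g, hm, hg⟩ |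
    ⟨g, hg⟩ | ⟨g, hg⟩ | ⟨g, hg⟩ | ⟨g, hg⟩ | ⟨m, g, hm, hg⟩ | ⟨g, hg⟩
  case D₂ => exact (hg.not_prof (fun i a b => by omega) H.prof).elim
  case A =>
    have hC := isChain_A m
    obtain ⟨i, e, H, h1, h2, h3, h4, h5⟩ := H.four_chain hg hC
    have hw := H.four_chain_white hg hC h1 h2 h3 h4 h5
    obtain ⟨rfl, rfl⟩ : i = 3 ∧ m = 5 := by omega
    simp only [Nat.reduceSub, Nat.reduceAdd] at h4 h5
    have out : ∀ j, j = 1 ∨ j = 5 → σ (g j) = 0 := fun j hj =>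
      H.out_of_white (hg.val_ne (by omega) (by omega)) ((hg.wh j (by omega) (by omega)).2 hj)
    refine InTable.swap (glue_E₆_b.inTable H.fin hg H.root (fun k => (H.sys.cover k).symm) ?_ ?_ ?_)
    · intro j a b hj
      interval_cases j
      · exact H.zero
      all_goals simp [α, ofList] at hj
    · intro i a b hi
      interval_cases i
      · exact out 1 (by omega)
      all_goals first | exact out 5 (by omega) | simp [α, ofList] at hi
    · intro i j a b c d
      refine ⟨fun hij => ?_, fun hi hj => ?_⟩
      · interval_cases i <;> interval_cases j <;> simp [ofList] at hij <;> simp only [h3, h4, h5]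
      · have hj : j = 1 := by interval_cases j <;> simp [α, ofList] at hj ⊢
        have hi : i = 1 ∨ i = 5 := by interval_cases i <;> simp [α, ofList] at hi ⊢
        subst hj
        have h6 : A (g i) (e 1) = 0 := H.uniq _ (hg.val_ne a b) (by
          rw [h3]; exact hg.ne a b (by omega) (by omega) (by omega))
        rw [h6, H.fin.symm _ _ h6]
        rcases hi with rfl | rfl <;> simp [ofList, cE]
  case B =>
    have hC := isChain_B m m
    obtain ⟨i, e, H, h1, h2, h3, h4, h5⟩ := H.four_chain hg hC
    have hw := H.four_chain_white hg hC h1 h2 h3 h4 h5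
    obtain ⟨rfl, rfl⟩ : i = 3 ∧ m = 4 := by omega
    have h6 := B'_edge hm hg
    have h7 := H.root.mat 2 4 (by omega) (by omega) (by omega) (by omega)
    rw [h3, h5] at h7
    simp only [Nat.reduceSub, Nat.reduceAdd] at h6 h7
    rw [h6] at h7
    simp [cD] at h7
  case B' =>
    have hC := isChain_B m m
    obtain ⟨i, e, H, h1, h2, h3, h4, h5⟩ := H.four_chain hg hC
    have hw := H.four_chain_white hg hC h1 h2 h3 h4 h5
    obtain ⟨rfl, rfl⟩ : i = 3 ∧ m = 5 := by omega
    have z : ∀ j, 1 ≤ j → j ≤ 5 → j ≠ 3 → A (g j) (e 1) = 0 ∧ A (e 1) (g j) = 0 := fun j a b hj => by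
      have h6 : A (g j) (e 1) = 0 := H.uniq _ (hg.val_ne a b) (by
        rw [h3]; exact hg.ne a b (by omega) (by omega) (by omega))
      exact ⟨h6, H.fin.symm _ _ h6⟩
    have h6 := H.root.mat 2 1 (by omega) (by omega) (by omega) (by omega)
    have h7 := H.root.mat 1 2 (by omega) (by omega) (by omega) (by omega)
    rw [h3] at h6 h7
    -- These nodes form the affine diagram of type `B₄`, with the fork at `g 3`; the coefficients
    -- are those of its null root.
    refine (H.fin.false_of_sum ![e 1, g 2, g 3, g 4, g 5] ![1, 1, 2, 2, 2] (by decide) ?_).elim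
    have hd := H.fin.diag (e 1)
    have M : ∀ i j, 1 ≤ i → i ≤ 5 → 1 ≤ j → j ≤ 5 → A (g i) (g j) = cB 5 i j := hg.mat
    intro j
    fin_cases j <;> simp [Fin.sum_univ_five, M, z, h6, h7, hd, cB, cD]
  case D =>
    have mem := H.tail_mem le_rfl
    obtain ⟨i, a, b, hi⟩ := hg.cov _ H.val_ne
    have h1 := H.one
    rw [hi, hg.val i a b] at h1
    have key : ∀ k, k = 3 ∨ k = 4 → e k = g (m - 2) := fun k hk => by
      refine D_leaf hm hg (i := i) ?_ (mem k (by omega) (by omega)) ?_ ?_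
      · unfold lD at h1; split_ifs at h1 <;> omega
      · rw [← hi]; exact H.root.ne (by omega) (by omega) (by omega) (by omega) (by omega)
      · rw [← hi]; exact D_adj H.root (by omega) (by omega) (by omega) (by omega) (by omega)
    exact (H.root.ne (by omega) (by omega) (by omega) (by omega) (show 3 ≠ 4 by omega)
      ((key 3 (by omega)).trans (key 4 (by omega)).symm)).elim
  case G₂ => exact (H.four_false_of_end hg isChain_G (fun i _ _ _ _ => by omega)).elim
  case G₂' => exact (H.four_false_of_end hg isChain_G (fun i _ _ _ _ => by omega)).elim
  case F₄ =>
    refine (H.four_false_of_end hg (isChain_B 3 4) (fun i _ _ h _ => ?_)).elim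
    unfold lF at h; split_ifs at h <;> omega
  case B₃ => exact (H.four_false_of_end hg (isChain_B 3 3) (fun i _ _ _ _ => by omega)).elim
  all_goals
    refine (H.four_false_of_end hg (isChain_C m m) (fun i _ _ h _ => ?_)).elim
    unfold lC at h; split_ifs at h <;> omega

end BlackOverlap
end BlackOverlap
end WeakSpherical

namespace WeakSpherical

section BlackOverlap

variable {κ : Type*} [Fintype κ] [DecidableEq κ] {A : κ → κ → ℤ} {W : κ → Prop} {σ τ ρ : κ → ℤ}
  {p q n m : ℕ} {e g : ℕ → κ} {C D : ℕ → ℕ → ℤ} {l l' : ℕ → ℤ} {w w' : ℕ → Prop} {c : κ}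

namespace BlackOverlap

/-! #### The case of `D n` with `n ≥ 5` -/

/-- For `n ≥ 5` the branching node of `D_n` and its three neighbours all belong to `τ`. -/
lemma five_not_chain (H : BlackOverlap A W σ τ n e c) (hn : 5 ≤ n) (hg : WR A W τ m C l w g)
    (hC : IsChain C m) : False := by
  have mem := H.tail_mem (by omega)
  obtain ⟨hd, a₁, a₂, a₃⟩ := H.root.node_of_D (by omega)
  exact hg.not_three hC (mem _ (by omega) (by omega)) (mem _ (by omega) (by omega))
    (mem _ (by omega) (by omega)) (mem _ (by omega) le_rfl) hd a₁ a₂ a₃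

/-- As an end of the fork of `τ`, the node `e 2` has only one neighbour there, the branching node.
-/
lemma five_third (H : BlackOverlap A W σ τ n e (e 2)) (hn : 5 ≤ n) (hm : 3 ≤ m)
    (hg : WR A W τ m (cD m) (lD m) (fun i => i = 1) g) (h2 : e 2 = g (m - 1)) : e 3 = g (m - 2) := by
  refine D_leaf hm hg (i := m - 1) (by omega) (H.tail_mem (by omega) 3 (by omega) (by omega)) ?_ ?_
  · rw [← h2]; exact H.root.ne (by omega) (by omega) (by omega) (by omega) (by omega)
  · rw [← h2]; exact D_adj H.root (by omega) (by omega) (by omega) (by omega) (by omega)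

/-- The last node of `τ` is a neighbour of `e 3`. -/
lemma five_last (H : BlackOverlap A W σ τ n e (e 2)) (hn : 5 ≤ n) (hm : 3 ≤ m)
    (hg : WR A W τ m (cD m) (lD m) (fun i => i = 1) g) (h2 : e 2 = g (m - 1)) :
    g m = e 4 ∨ n = 5 ∧ g m = e 5 := by
  have h3 := H.five_third hn hm hg h2
  have hW : ¬ W (g m) := by rw [hg.wh m (by omega) le_rfl]; omega
  have hne : g m ≠ g (m - 2) := hg.ne (by omega) (by omega) (by omega) (by omega) (by omega)
  have ha : A (e 3) (g m) ≠ 0 := by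
    rw [h3]; exact D_adj hg (by omega) (by omega) (by omega) (by omega) (by omega)
  have h4 := H.sys.mem₁ H.fin hW (H.root.val_ne (by omega) (by omega)) ha
  obtain ⟨j, a, b, hj, hj'⟩ := D_nbr H.root (by omega) (by omega) h4 (by rwa [h3]) ha
  have h5 : j ≠ 2 := by
    rintro rfl
    rw [h2] at hj
    exact hg.ne (by omega) (by omega) (by omega) (by omega) (by omega) hj
  have h6 : j = 4 ∨ n = 5 ∧ j = 5 := by omega
  rcases h6 with rfl | ⟨h6, rfl⟩
  exacts [Or.inl hj, Or.inr ⟨h6, hj⟩]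

/-- For `n ≥ 6` the end `g m` of the fork of `τ` would be `e 4`, which has the two neighbours `e 3`
and `e 5` in `τ`. -/
lemma five_eq (H : BlackOverlap A W σ τ n e (e 2)) (hn : 5 ≤ n) (hm : 3 ≤ m)
    (hg : WR A W τ m (cD m) (lD m) (fun i => i = 1) g) (h2 : e 2 = g (m - 1)) : n = 5 := by
  by_contra hn'
  have h3 := H.five_third hn hm hg h2
  have h4 := (H.five_last hn hm hg h2).resolve_right (by omega)
  have h5 : e 5 = g (m - 2) := by
    refine D_leaf hm hg (i := m) (by omega) (H.tail_mem (by omega) 5 (by omega) (by omega)) ?_ ?_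
    · rw [h4]; exact H.root.ne (by omega) (by omega) (by omega) (by omega) (by omega)
    · rw [h4]; exact D_adj H.root (by omega) (by omega) (by omega) (by omega) (by omega)
  exact H.root.ne (by omega) (by omega) (by omega) (by omega) (show 5 ≠ 3 by omega)
    (h5.trans h3.symm)

/-- Both branching nodes are `e 3`, and its three neighbours are matched, which leaves `e 5 = g (m -
3)`. This node is black, so `m ≥ 5`. -/
lemma inTable_five_aux (H : BlackOverlap A W σ τ 5 e (e 2)) (hm : 3 ≤ m)
    (hg : WR A W τ m (cD m) (lD m) (fun i => i = 1) g) (h2 : e 2 = g (m - 1)) (h4 : e 4 = g m) :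
    InTable A W σ τ := by
  have h3 := H.five_third le_rfl hm hg h2
  have h5 : e 5 = g (m - 3) ∧ 4 ≤ m := by
    obtain ⟨j, a, b, hj, hj'⟩ := D_nbr hg (i := m - 2) (by omega) (by omega)
      (H.tail_mem (by omega) 5 (by omega) (by omega))
      (by rw [← h3]; exact H.root.ne (by omega) (by omega) (by omega) (by omega) (by omega))
      (by rw [← h3]; exact D_adj H.root (by omega) (by omega) (by omega) (by omega) (by omega))
    have n₁ : j ≠ m := by
      rintro rfl
      exact H.root.ne (by omega) (by omega) (by omega) (by omega) (show 5 ≠ 4 by omega)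
        (hj.trans h4.symm)
    have n₂ : j ≠ m - 1 := by
      rintro rfl
      exact H.root.ne (by omega) (by omega) (by omega) (by omega) (show 5 ≠ 2 by omega)
        (hj.trans h2.symm)
    have : j = m - 3 := by omega
    exact ⟨this ▸ hj, by omega⟩
  obtain ⟨h5, hm'⟩ := h5
  have hb := H.not_white (i := 5) (by omega) (by omega)
  rw [h5, hg.wh _ (by omega) (by omega)] at hb
  -- For larger `m` the next node `g (m - 4)` is black, hence in the support of `σ`, where the end
  -- `e 5` has no neighbour but `e 3`.
  have hm5 : m = 5 := by
    by_contra hm5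
    have hW : ¬ W (g (m - 4)) := by rw [hg.wh _ (by omega) (by omega)]; omega
    have hne : g (m - 4) ≠ g (m - 3) :=
      hg.ne (by omega) (by omega) (by omega) (by omega) (by omega)
    have ha : A (e 5) (g (m - 4)) ≠ 0 := by
      rw [h5]; exact D_adj hg (by omega) (by omega) (by omega) (by omega) (by omega)
    have h6 : g (m - 4) = e 3 := D_leaf (by omega) H.root (i := 5) (by omega)
      (H.sys.mem₁ H.fin hW (H.root.val_ne (by omega) (by omega)) ha) (by rwa [h5]) ha
    rw [h3] at h6
    exact hg.ne (by omega) (by omega) (by omega) (by omega) (by omega) h6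
  subst hm5
  simp only [Nat.reduceSub] at h2 h3 h5
  refine glue_E₆_a.inTable H.fin H.root hg H.sys.cover ?_ ?_ ?_
  · intro j a b hj
    interval_cases j
    · exact H.out_of_white (hg.val_ne (by omega) (by omega)) ((hg.wh 1 (by omega) (by omega)).2 rfl)
    all_goals simp [α, ofList] at hj
  · intro i a b hi
    interval_cases i
    · exact H.zero
    all_goals simp [α, ofList] at hi
  · intro i j a b c d
    refine ⟨fun hij => ?_, fun hi hj => ?_⟩
    · interval_cases i <;> interval_cases j <;> simp [ofList] at hij <;>
        simp only [h2, h3, h4, h5]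
    · have hj : j = 1 := by interval_cases j <;> simp [α, ofList] at hj ⊢
      have hi : i = 1 := by interval_cases i <;> simp [α, ofList] at hi ⊢
      subst hi hj
      have h6 : A (g 1) (e 1) = 0 := H.uniq _ (hg.val_ne (by omega) (by omega)) (by
        rw [h2]; exact hg.ne (by omega) (by omega) (by omega) (by omega) (by omega))
      rw [h6, H.fin.symm _ _ h6]
      simp [ofList, cE]

lemma inTable_five (H : BlackOverlap A W σ τ n e (e 2)) (hn : 5 ≤ n) : InTable A W σ τ := by
  have hr := H.sys.root₂
  rcases hr with ⟨m, g, hm, hg⟩ | ⟨m, g, hm, hg⟩ | ⟨m, g, hm, hg⟩ | ⟨m, g, hm, hg⟩ | ⟨m, g, hm, hg⟩ |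
    ⟨g, hg⟩ | ⟨g, hg⟩ | ⟨g, hg⟩ | ⟨g, hg⟩ | ⟨m, g, hm, hg⟩ | ⟨g, hg⟩
  case D₂ => exact (hg.not_prof (fun i a b => by omega) H.prof).elim
  case A => exact (H.five_not_chain hn hg (isChain_A m)).elim
  case B | B' => exact (H.five_not_chain hn hg (isChain_B m m)).elim
  case C | C' => exact (H.five_not_chain hn hg (isChain_C m m)).elim
  case G₂ | G₂' => exact (H.five_not_chain hn hg isChain_G).elim
  case F₄ => exact (H.five_not_chain hn hg (isChain_B 3 4)).elim
  case B₃ => exact (H.five_not_chain hn hg (isChain_B 3 3)).elim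
  case D =>
    have key : ∀ {g}, WR A W τ m (cD m) (lD m) (fun i => i = 1) g → e 2 = g (m - 1) →
        InTable A W σ τ := fun {g} hg h2 => by
      obtain rfl := H.five_eq hn hm hg h2
      rcases H.five_last hn hm hg h2 with h4 | ⟨-, h4⟩
      · exact H.inTable_five_aux hm hg h2 h4.symm
      · exact (H.swap_last (by omega)).inTable_five_aux hm hg h2 h4.symm
    obtain ⟨i, a, b, hi⟩ := hg.cov _ H.val_ne
    have h1 := H.one
    rw [hi, hg.val i a b] at h1
    have h2 : i + 1 = m ∨ i = m := by unfold lD at h1; split_ifs at h1 <;> omega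
    rcases h2 with h2 | rfl
    · exact key hg (by rw [hi]; congr 1; omega)
    · refine key (hg.swap_last hm) ?_
      rw [if_pos (by omega)]
      exact hi

lemma inTable (H : BlackOverlap A W σ τ n e c) : InTable A W σ τ := by
  have hn := H.le
  by_cases h3 : n = 3
  · subst h3
    obtain ⟨j, a, b, rfl, hj⟩ := D_nbr H.root (i := 1) le_rfl (by omega) H.mem
      (H.ne_first H.val_ne) (H.fin.ne_zero_symm H.adj)
    obtain rfl | rfl : j = 2 ∨ j = 3 := by omega
    · exact H.swap_three.inTable_three
    · exact H.inTable_three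
  obtain rfl := H.eq_second (by omega)
  by_cases h4 : n = 4
  · subst h4; exact H.inTable_four
  · exact H.inTable_five (by omega)

end BlackOverlap

/-- Two supports meet in black nodes only. -/
lemma black_overlap (hA : FiniteType A) (h : Sys A W σ τ) (pσ : Prof A W σ) (pτ : Prof A W τ)
    (hI : ∃ k, σ k ≠ 0 ∧ τ k ≠ 0) (hB : ∀ k, σ k ≠ 0 → τ k ≠ 0 → ¬ W k) : InTable A W σ τ := by
  have hI' : ∃ k, τ k ≠ 0 ∧ σ k ≠ 0 := by simpa [and_comm] using hI
  have hB' : ∀ k, τ k ≠ 0 → σ k ≠ 0 → ¬ W k := fun k a b => hB k b a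
  rcases h.sum_nonpos_or hA pσ pτ hI hB with h₁ | ⟨n, e, hn, he, hp⟩
  · rcases (h.swap hA).sum_nonpos_or hA pτ pσ hI' hB' with h₂ | ⟨n, e, hn, he, hp⟩
    · obtain ⟨k, hk, -⟩ := hI
      refine (hA.false_of_add pσ.nonneg pτ.nonneg (fun k => ?_) hk).elim
      rcases h.cover k with hk | hk
      · exact h₁ k hk
      · rw [add_comm]; exact h₂ k hk
    · obtain ⟨c, H⟩ := blackOverlap_of hA (h.swap hA) pτ pσ hI' hB' hn he hp
      exact H.inTable.swap
  · obtain ⟨c, H⟩ := blackOverlap_of hA h pσ pτ hI hB hn he hp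
    exact H.inTable

end BlackOverlap

/-! ### The classification for Cartan matrices of finite type -/

section Classification

variable {κ : Type*} [Fintype κ] [DecidableEq κ] {A : κ → κ → ℤ} {W : κ → Prop} {σ τ : κ → ℤ}

/-- Indecomposable weak spherical systems of rank two appear in the table. -/
theorem Sys.inTable (hA : FiniteType A) (h : Sys A W σ τ) : InTable A W σ τ := by
  rcases h.root₁.prof_or hA with pσ | ⟨e, he⟩ <;> rcases h.root₂.prof_or hA with pτ | ⟨g, hg⟩
  · by_cases hd : ∀ k, σ k = 0 ∨ τ k = 0
    · exact disjoint_connected hA h hd pσ pτ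
    by_cases hσ : ∀ k, σ k ≠ 0
    · by_cases hτ : ∀ k, τ k ≠ 0
      · exact (h.false_of_same_supp hA pσ pτ hσ hτ).elim
      · push Not at hτ
        exact contained hA h pσ pτ hσ hτ
    push Not at hσ
    by_cases hτ : ∀ k, τ k ≠ 0
    · exact (contained hA (h.swap hA) pτ pσ hτ hσ).swap
    push Not at hτ hd
    by_cases hB : ∀ k, σ k ≠ 0 → τ k ≠ 0 → ¬ W k
    · exact black_overlap hA h pσ pτ hd hB
    · push Not at hB
      obtain ⟨x, hx, hx', wx⟩ := hB
      exact white_overlap hA h pσ pτ hx hx' wx hτ hσ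
  · exact (d2_connected hA (h.swap hA) hg pσ).swap
  · exact d2_connected hA h he pτ
  · exact d2_d2 hA h he hg

theorem sys_iff_inTable (hA : FiniteType A) : Sys A W σ τ ↔ InTable A W σ τ :=
  ⟨Sys.inTable hA, InTable.sys hA⟩

end Classification
end WeakSpherical

namespace WeakSpherical

/-! ### The table of weak spherical roots, by node numbers -/

/-- The entry `(C, l, w)` of the table of weak spherical roots has the Cartan matrix `D`, the labels
`l'` and the white nodes `v`. -/
structure WeakEntry (n : ℕ) (C : Matrix (Fin n) (Fin n) ℤ) (l : ℕ → ℕ) (w : Set ℕ)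
    (D : ℕ → ℕ → ℤ) (l' : ℕ → ℤ) (v : ℕ → Prop) : Prop where
  table : WeakRootTable n C l w
  entry : RtEntry n D l' v
  mat : ∀ i j, C i j = D (i + 1) (j + 1)
  val : ∀ i, 1 ≤ i → i ≤ n → (l i : ℤ) = l' i
  wh : ∀ i, i ∈ w ↔ v i

lemma weakEntry_A (n : ℕ) (hn : 2 ≤ n) : WeakEntry n (CartanMatrix.A n) (seg 1 n) {1, n} cA
    (fun _ => 1) (fun i => i = 1 ∨ i = n) :=
  ⟨.A n hn, .A n (by omega), cartan_A n, fun i a b => by simp [seg, a, b], fun i => by simp⟩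

lemma weakEntry_A₁ : WeakEntry 1 (CartanMatrix.A 1) (α 1) {1} cA
    (fun _ => 1) (fun i => i = 1 ∨ i = 1) :=
  ⟨.A₁, .A 1 le_rfl, cartan_A 1, fun i a b => by simp [α, show i = 1 by omega], fun i => by simp⟩

lemma weakEntry_B (n : ℕ) (hn : 2 ≤ n) : WeakEntry n (CartanMatrix.B n) (seg 1 n) {1} (cB n)
    (fun _ => 1) (fun i => i = 1) :=
  ⟨.B n hn, .B n hn, cartan_B n, fun i a b => by simp [seg, a, b], fun i => by simp⟩

lemma weakEntry_B' (n : ℕ) (hn : 2 ≤ n) : WeakEntry n (CartanMatrix.B n) (seg 1 n) {1, n} (cB n)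
    (fun _ => 1) (fun i => i = 1 ∨ i = n) :=
  ⟨.B' n hn, .B' n hn, cartan_B n, fun i a b => by simp [seg, a, b], fun i => by simp⟩

lemma val_C (n : ℕ) (hn : 3 ≤ n) (i : ℕ) (a : 1 ≤ i) (b : i ≤ n) :
    ((α 1 + 2 • seg 2 (n - 1) + α n) i : ℤ) = lC n i := by
  simp only [α, seg, lC, Pi.add_apply, Pi.smul_apply, smul_eq_mul]
  split_ifs <;> omega

lemma val_D (n : ℕ) (hn : 3 ≤ n) (i : ℕ) (a : 1 ≤ i) (b : i ≤ n) :
    ((2 • seg 1 (n - 2) + α (n - 1) + α n) i : ℤ) = lD n i := by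
  simp only [α, seg, lD, Pi.add_apply, Pi.smul_apply, smul_eq_mul]
  split_ifs <;> omega

lemma weakEntry_C (n : ℕ) (hn : 3 ≤ n) : WeakEntry n (CartanMatrix.C n)
    (α 1 + 2 • seg 2 (n - 1) + α n) {2} (cC n) (lC n) (fun i => i = 2) :=
  ⟨.C n hn, .C n hn, cartan_C n, val_C n hn, fun i => by simp⟩

lemma weakEntry_C' (n : ℕ) (hn : 3 ≤ n) : WeakEntry n (CartanMatrix.C n)
    (α 1 + 2 • seg 2 (n - 1) + α n) {1, 2} (cC n) (lC n) (fun i => i = 1 ∨ i = 2) :=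
  ⟨.C' n hn, .C' n hn, cartan_C n, val_C n hn, fun i => by simp⟩

lemma weakEntry_F₄ : WeakEntry 4 CartanMatrix.F₄ (α 1 + 2 • α 2 + 3 • α 3 + 2 • α 4) {4} (cB 3) lF
    (fun i => i = 4) :=
  ⟨.F₄, .F₄, cartan_F₄, fun i a b => by interval_cases i <;> simp [α, lF], fun i => by simp⟩

lemma weakEntry_G₂ : WeakEntry 2 cartanG₂ (2 • α 1 + α 2) {1} cG (fun i => 3 - i)
    (fun i => i = 1) :=
  ⟨.G₂, .G₂, cartan_G₂, fun i a b => by interval_cases i <;> simp [α], fun i => by simp⟩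

lemma weakEntry_G₂' : WeakEntry 2 cartanG₂ (α 1 + α 2) {1, 2} cG (fun _ => 1)
    (fun i => i = 1 ∨ i = 2) :=
  ⟨.G₂', .G₂', cartan_G₂, fun i a b => by interval_cases i <;> simp [α], fun i => by simp⟩

lemma weakEntry_D₂ : WeakEntry 2 (CartanMatrix.D 2) (α 1 + α 2) {1, 2} (cD 2) (fun _ => 1)
    (fun i => i = 1 ∨ i = 2) :=
  ⟨.D₂, .D₂, cartan_D 2 le_rfl, fun i a b => by interval_cases i <;> simp [α], fun i => by simp⟩

lemma weakEntry_D (n : ℕ) (hn : 3 ≤ n) : WeakEntry n (CartanMatrix.D n)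
    (2 • seg 1 (n - 2) + α (n - 1) + α n) {1} (cD n) (lD n) (fun i => i = 1) :=
  ⟨.D n hn, .D n hn, cartan_D n (by omega), val_D n hn, fun i => by simp⟩

lemma weakEntry_B₃ : WeakEntry 3 (CartanMatrix.B 3) (α 1 + 2 • α 2 + 3 • α 3) {3} (cB 3)
    (fun i => i) (fun i => i = 3) :=
  ⟨.B₃, .B₃, cartan_B 3, fun i a b => by interval_cases i <;> simp [α], fun i => by simp⟩

lemma WeakRootTable.entry {n : ℕ} {C : Matrix (Fin n) (Fin n) ℤ} {l : ℕ → ℕ} {w : Set ℕ}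
    (h : WeakRootTable n C l w) : ∃ D l' v, WeakEntry n C l w D l' v := by
  cases h with
  | A₁ => exact ⟨_, _, _, weakEntry_A₁⟩
  | A _ hn => exact ⟨_, _, _, weakEntry_A n hn⟩
  | B _ hn => exact ⟨_, _, _, weakEntry_B n hn⟩
  | B' _ hn => exact ⟨_, _, _, weakEntry_B' n hn⟩
  | C _ hn => exact ⟨_, _, _, weakEntry_C n hn⟩
  | C' _ hn => exact ⟨_, _, _, weakEntry_C' n hn⟩
  | F₄ => exact ⟨_, _, _, weakEntry_F₄⟩
  | G₂ => exact ⟨_, _, _, weakEntry_G₂⟩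
  | G₂' => exact ⟨_, _, _, weakEntry_G₂'⟩
  | D₂ => exact ⟨_, _, _, weakEntry_D₂⟩
  | D _ hn => exact ⟨_, _, _, weakEntry_D n hn⟩
  | B₃ => exact ⟨_, _, _, weakEntry_B₃⟩

section Roots

variable {κ : Type*} [Fintype κ] [DecidableEq κ] {A : κ → κ → ℤ} {W : κ → Prop} {σ : κ → ℤ}

lemma Rt.entry (h : Rt A W σ) : ∃ n C l w D l' v e, WeakEntry n C l w D l' v ∧ WR A W σ n D l' v e := by
  rcases h with ⟨n, e, hn, he⟩ | ⟨n, e, hn, he⟩ | ⟨n, e, hn, he⟩ | ⟨n, e, hn, he⟩ | ⟨n, e, hn, he⟩ |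
    ⟨e, he⟩ | ⟨e, he⟩ | ⟨e, he⟩ | ⟨e, he⟩ | ⟨n, e, hn, he⟩ | ⟨e, he⟩
  case A =>
    rcases hn.eq_or_lt with rfl | hn
    · exact ⟨_, _, _, _, _, _, _, e, weakEntry_A₁, he⟩
    · exact ⟨_, _, _, _, _, _, _, e, weakEntry_A n hn, he⟩
  case B => exact ⟨_, _, _, _, _, _, _, e, weakEntry_B n hn, he⟩
  case B' => exact ⟨_, _, _, _, _, _, _, e, weakEntry_B' n hn, he⟩
  case C => exact ⟨_, _, _, _, _, _, _, e, weakEntry_C n hn, he⟩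
  case C' => exact ⟨_, _, _, _, _, _, _, e, weakEntry_C' n hn, he⟩
  case F₄ => exact ⟨_, _, _, _, _, _, _, e, weakEntry_F₄, he⟩
  case G₂ => exact ⟨_, _, _, _, _, _, _, e, weakEntry_G₂, he⟩
  case G₂' => exact ⟨_, _, _, _, _, _, _, e, weakEntry_G₂', he⟩
  case D₂ => exact ⟨_, _, _, _, _, _, _, e, weakEntry_D₂, he⟩
  case D => exact ⟨_, _, _, _, _, _, _, e, weakEntry_D n hn, he⟩
  case B₃ => exact ⟨_, _, _, _, _, _, _, e, weakEntry_B₃, he⟩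

lemma RtEntry.pos {n : ℕ} {D : ℕ → ℕ → ℤ} {l : ℕ → ℤ} {v : ℕ → Prop} (h : RtEntry n D l v) :
    1 ≤ n ∧ ∀ i, 1 ≤ i → i ≤ n → 1 ≤ l i := by
  cases h <;> refine ⟨by omega, fun i a b => ?_⟩ <;> dsimp only [lC, lD, lF] <;> (try split_ifs) <;>
    omega

end Roots

section RootData

variable {ι X Y : Type*} [AddCommGroup X] [AddCommGroup Y] {P : RootDatum ι X Y} {b : P.Base}
  {S Sp : Set ι} [Fintype S]

/-! ### Root data and Cartan matrices -/

/-- The Cartan matrix of a set of simple roots. -/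
def cartan (P : RootDatum ι X Y) (S : Set ι) (i j : S) : ℤ := P.pairing i j

/-- The combination of the roots in `S` with coefficients `c`. -/
def lin (P : RootDatum ι X Y) {S : Set ι} [Fintype S] (c : S → ℤ) : X := ∑ k, c k • P.root k

lemma lin_injective (hS : S ⊆ b.support) : Function.Injective (lin P (S := S)) := by
  intro c c' h
  have hli := Fintype.linearIndependent_iff.1 (b.linearIndepOn_root.mono hS).linearIndependent
  refine sub_eq_zero.1 (funext (hli (c - c') ?_))
  simpa [lin, sub_smul, sub_eq_zero] using h

lemma toLinearMap_lin (c : S → ℤ) (k : S) :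
    P.toLinearMap (lin P c) (P.coroot k) = pr (cartan P S) c k := by
  simp [lin, pr, cartan]

/-- For an invariant form, `2 (α_m, α_k) = ⟨α_m | α_k^∨⟩ (α_k, α_k)`; this expresses the norm
through the pairings. -/
lemma two_mul_rootForm_lin [Fintype ι] (c : S → ℤ) :
    2 * P.RootForm (lin P c) (lin P c) =
      ∑ k, c k * (pr (cartan P S) c k * P.RootForm (P.root k) (P.root k)) := by
  have h1 : ∀ k : S, 2 * P.RootForm (lin P c) (P.root k) =
      pr (cartan P S) c k * P.RootForm (P.root k) (P.root k) := fun k => by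
    have h2 := fun m : S => P.toInvariantForm.two_mul_apply_root_root m k
    simp only [RootPairing.toInvariantForm_form] at h2
    simp only [lin, map_sum, LinearMap.sum_apply, map_smul, LinearMap.smul_apply, smul_eq_mul, pr,
      Finset.mul_sum, Finset.sum_mul, cartan]
    refine Finset.sum_congr rfl fun m _ => ?_
    rw [mul_assoc, ← h2]; ring
  calc 2 * P.RootForm (lin P c) (lin P c)
      = ∑ k, c k * (2 * P.RootForm (lin P c) (P.root k)) := by
        conv_lhs => rw [show lin P c = ∑ k, c k • P.root k from rfl]
        rw [map_sum, Finset.mul_sum]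
        refine Finset.sum_congr rfl fun m _ => ?_
        rw [map_smul, smul_eq_mul]
        simp only [lin]; ring
    _ = _ := by simp only [h1]

/-- The norm of the combination is then nonpositive. The form is positive definite on the root span,
and simple roots are linearly independent. -/
lemma eq_zero_of_pr_nonpos [Finite ι] (hS : S ⊆ b.support) {c : S → ℤ}
    (hc : ∀ k, c k * pr (cartan P S) c k ≤ 0) : c = 0 := by
  have := Fintype.ofFinite ι
  have h1 : ∑ k, c k * (pr (cartan P S) c k * P.RootForm (P.root k) (P.root k)) ≤ 0 := by
    refine Finset.sum_nonpos fun k _ => ?_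
    rw [← mul_assoc]
    exact mul_nonpos_of_nonpos_of_nonneg (hc k) (P.zero_le_rootForm _)
  rw [← two_mul_rootForm_lin] at h1
  have h2 := P.zero_le_rootForm (lin P c)
  have h3 : lin P c ∈ P.rootSpan ℤ := by
    refine Submodule.sum_mem _ fun k _ => Submodule.smul_mem _ _ (Submodule.subset_span ⟨k, rfl⟩)
  have h4 := P.eq_zero_of_mem_rootSpan_of_rootForm_self_eq_zero h3 (by omega)
  exact lin_injective hS (by rw [h4]; simp [lin])

lemma finiteType [Finite ι] [Module.Free ℤ X] (hS : S ⊆ b.support) : FiniteType (cartan P S) where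
  diag i := P.pairing_same i
  nonpos i j hij := by
    have := b.pairingIn_le_zero_of_ne (fun h => hij (Subtype.ext h)) (hS i.2) (hS j.2)
    have h := P.algebraMap_pairingIn ℤ i j
    rw [Algebra.algebraMap_self_apply] at h
    rwa [h] at this
  symm i j h := P.pairing_eq_zero_iff.1 h
  effective c h0 hk := by
    refine congrFun (eq_zero_of_pr_nonpos hS fun k => ?_)
    by_cases hc : c k = 0
    · simp [hc]
    · exact mul_nonpos_of_nonneg_of_nonpos (h0 k) (hk k hc)
  nondeg c h0 := congrFun (eq_zero_of_pr_nonpos hS fun k => by simp [h0])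

end RootData

end WeakSpherical

namespace WeakSpherical

section Translation

variable {ι X Y : Type*} [AddCommGroup X] [AddCommGroup Y] {P : RootDatum ι X Y} {b : P.Base}
  {S Sp : Set ι} [Fintype S] [DecidableEq S] {c d : S → ℤ}

/-! ### From root data to Cartan matrices -/

lemma lin_add (c d : S → ℤ) : lin P (c + d) = lin P c + lin P d := by
  simp [lin, add_smul, Finset.sum_add_distrib]

lemma lin_single (i : S) : lin P (Pi.single i 1) = P.root i := by
  rw [lin, Finset.sum_eq_single i] <;> simp +contextual

/-- Summing over all preimages of a node avoids any assumption of injectivity on the numbering. -/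
lemma comb_eq_lin {n : ℕ} (g : Fin n → S) (s : ℕ → ℕ) : comb P (fun i => (g i : ι)) s =
    lin P (fun k => ∑ i, if g i = k then (s (i + 1) : ℤ) else 0) := by
  simp only [comb, lin, Finset.sum_smul, ite_smul, zero_smul]
  rw [Finset.sum_comm]
  simp

lemma lin_eq_comb_iff (hS : S ⊆ b.support) {n : ℕ} {g : Fin n → S} (hg : Function.Injective g)
    (s : ℕ → ℕ) : lin P c = comb P (fun i => (g i : ι)) s ↔
      (∀ i, c (g i) = s (i + 1)) ∧ ∀ k, (∀ i, g i ≠ k) → c k = 0 := by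
  rw [comb_eq_lin, (lin_injective hS).eq_iff]
  refine ⟨?_, fun ⟨h1, h2⟩ => funext fun k => ?_⟩
  · rintro rfl
    exact ⟨fun i => by simp [hg.eq_iff], fun k hk => Finset.sum_eq_zero fun i _ => if_neg (hk i)⟩
  · by_cases hk : ∃ i, g i = k
    · obtain ⟨i, rfl⟩ := hk
      simp [hg.eq_iff, h1]
    · push Not at hk
      rw [h2 k hk, Finset.sum_eq_zero fun i _ => if_neg (hk i)]

lemma isWeakSphericalRoot_iff (hS : S ⊆ b.support) :
    IsWeakSphericalRoot P S (S ∩ Sp) (lin P c) ↔ Rt (cartan P S) (fun k => (k : ι) ∉ Sp) c := by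
  constructor
  · rintro ⟨n, C, l, w, hT, e, he, hm, hc, hw⟩
    obtain ⟨D, l', v, hE⟩ := hT.entry
    obtain ⟨hn, hl⟩ := hE.entry.pos
    have hg : Function.Injective fun i => (⟨e i, he i⟩ : S) := fun i j hij =>
      e.injective (congrArg Subtype.val hij)
    obtain ⟨h1, h2⟩ := (lin_eq_comb_iff hS hg l).1 hc
    have hi : ∀ i, 1 ≤ i → i ≤ n → (i - 1) % n + 1 = i := fun i h1 h2 => by
      rw [Nat.mod_eq_of_lt (by omega)]; omega
    refine hE.entry.rt (e := fun k => ⟨e ⟨(k - 1) % n, Nat.mod_lt _ hn⟩, he _⟩) ⟨?_, ?_, ?_, ?_, ?_, hl⟩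
    · intro i j a b a' b'
      simp only [cartan, hm, hE.mat, hi i a b, hi j a' b']
    · intro i a b
      rw [h1, ← hE.val i a b]
      simp only [hi i a b]
    · intro k hk
      by_contra hk'
      refine hk (h2 k fun i hik => hk' ⟨i + 1, by omega, by omega, ?_⟩)
      rw [← hik]
      simp [Nat.mod_eq_of_lt i.2]
    · intro i a b
      have h3 := hw ⟨(i - 1) % n, Nat.mod_lt _ hn⟩
      simp only [Set.mem_inter_iff, he, true_and, hi i a b] at h3
      simp only [h3, not_not, hE.wh]
    · intro i j a b a' b' hij
      have := congrArg Fin.val (hg hij)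
      simp only at this
      rw [← hi i a b, ← hi j a' b', this]
  · intro h
    obtain ⟨n, C, l, w, D, l', v, e, hE, he⟩ := h.entry
    have hg : Function.Injective fun i : Fin n => e (i + 1) := fun i j hij => by
      have := he.inj _ _ (by omega) (by omega) (by omega) (by omega) hij
      exact Fin.ext (by omega)
    refine ⟨n, C, l, w, hE.table, ⟨_, Subtype.val_injective.comp hg⟩, fun i => (e (i + 1)).2,
      fun i j => ?_, (lin_eq_comb_iff hS hg l).2 ⟨fun i => ?_, fun k hk => ?_⟩, fun i => ?_⟩
    · rw [hE.mat, ← he.mat _ _ (by omega) (by omega) (by omega) (by omega)]; rfl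
    · rw [he.val _ (by omega) (by omega), hE.val _ (by omega) (by omega)]
    · by_contra h0
      obtain ⟨i, a, b, rfl⟩ := he.cov k h0
      exact hk ⟨i - 1, by omega⟩ (by simp [Nat.sub_add_cancel a])
    · have := he.wh (i + 1) (by omega) (by omega)
      simp only [Function.Embedding.coeFn_mk, Function.comp_apply, Set.mem_inter_iff,
        Subtype.coe_prop, true_and, hE.wh, ← this, not_not]

/-- Equality of unordered pairs is what produces the two alternatives in `InTable`, and linear
independence turns equality of combinations into equality of coefficients. -/
lemma isIsomorphicTo_iff (hS : S ⊆ b.support) :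
    (∃ (n : ℕ) (C : Matrix (Fin n) (Fin n) ℤ) (s t : ℕ → ℕ) (w : Set ℕ), RankTwoTable n C s t w ∧
      IsIsomorphicTo P S (lin P c) (lin P d) (S ∩ Sp) C s t w) ↔
      InTable (cartan P S) (fun k => (k : ι) ∉ Sp) c d := by
  have key : ∀ {n : ℕ} {C : Matrix (Fin n) (Fin n) ℤ} {s t : ℕ → ℕ} {w : Set ℕ} (e : Fin n ≃ S),
      ((∀ i j, P.pairing (e i) (e j) = C i j) ∧
        ({lin P c, lin P d} : Set X) = {comb P (fun i => (e i : ι)) s, comb P (fun i => (e i : ι)) t} ∧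
        ∀ i : Fin n, (e i : ι) ∈ S ∩ Sp ↔ (i : ℕ) + 1 ∉ w) ↔
      ((∀ i j, cartan P S (e i) (e j) = C i j) ∧ (∀ i, ((e i : S) : ι) ∉ Sp ↔ (i : ℕ) + 1 ∈ w) ∧
        ((∀ i, c (e i) = s (i + 1) ∧ d (e i) = t (i + 1)) ∨
          (∀ i, d (e i) = s (i + 1) ∧ c (e i) = t (i + 1)))) := fun {n C s t w} e => by
    have hc : ∀ (c : S → ℤ) (s : ℕ → ℕ), lin P c = comb P (fun i => (e i : ι)) s ↔
        ∀ i, c (e i) = s (i + 1) := fun c s => by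
      rw [lin_eq_comb_iff hS e.injective]
      exact and_iff_left fun k hk => absurd (e.apply_symm_apply k) (hk _)
    rw [Set.pair_eq_pair_iff, hc, hc, hc, hc]
    refine and_congr Iff.rfl (and_comm.trans (and_congr (forall_congr' fun i => ?_) ?_))
    · rw [Set.mem_inter_iff, and_iff_right (e i).2, not_iff_comm]
      exact iff_comm
    · rw [forall_and, forall_and]
      exact or_congr Iff.rfl and_comm
  constructor
  · rintro ⟨n, C, s, t, w, hT, e, he⟩
    exact ⟨n, C, s, t, w, hT, e, e.bijective, (key e).1 he⟩
  · rintro ⟨n, C, s, t, w, hT, f, hf, h⟩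
    exact ⟨n, C, s, t, w, hT, Equiv.ofBijective f hf, (key (Equiv.ofBijective f hf)).2 h⟩

lemma supp_lin (hS : S ⊆ b.support) : supp b (lin P c) = {i | ∃ h : i ∈ S, c ⟨i, h⟩ ≠ 0} := by
  classical
  have hc : lin P c = ∑ j ∈ b.support, (if h : j ∈ S then c ⟨j, h⟩ else 0) • P.root j := by
    have h1 : ∑ j ∈ b.support, (if h : j ∈ S then c ⟨j, h⟩ else 0) • P.root j =
        ∑ j ∈ S.toFinset, (if h : j ∈ S then c ⟨j, h⟩ else 0) • P.root j := by
      symm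
      refine Finset.sum_subset (by simpa [Set.subset_def] using hS) fun j _ hj => ?_
      rw [Set.mem_toFinset] at hj
      rw [dif_neg hj, zero_smul]
    rw [h1, Finset.sum_subtype S.toFinset (p := (· ∈ S)) fun x => Set.mem_toFinset]
    exact Finset.sum_congr rfl fun k _ => by rw [dif_pos k.2]
  ext i
  constructor
  · rintro ⟨hi, c', hc', hne⟩
    have h1 := linearIndepOn_finset_iff.1 b.linearIndepOn_root
      (fun j => c' j - if h : j ∈ S then c ⟨j, h⟩ else 0)
      (by simp only [sub_smul, Finset.sum_sub_distrib, ← hc', ← hc, sub_self]) i hi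
    by_cases h : i ∈ S
    · rw [dif_pos h, sub_eq_zero] at h1
      exact ⟨h, h1 ▸ hne⟩
    · rw [dif_neg h, sub_zero] at h1
      exact absurd h1 hne
  · rintro ⟨h, hne⟩
    exact ⟨hS h, _, hc, by rwa [dif_pos h]⟩

/-- Vanishing on the lattice of the system need only be tested on its two generators. -/
lemma forall_mem_sup_iff {x y : X} {z : Y} :
    (∀ χ ∈ AddSubgroup.zmultiples x ⊔ AddSubgroup.zmultiples y, P.toLinearMap χ z = 0) ↔
      P.toLinearMap x z = 0 ∧ P.toLinearMap y z = 0 := by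
  constructor
  · intro h
    exact ⟨h x (AddSubgroup.mem_sup_left (AddSubgroup.mem_zmultiples x)),
      h y (AddSubgroup.mem_sup_right (AddSubgroup.mem_zmultiples y))⟩
  · rintro ⟨hx, hy⟩ χ hχ
    obtain ⟨_, h1, _, h2, rfl⟩ := AddSubgroup.mem_sup.1 hχ
    obtain ⟨m, rfl⟩ := AddSubgroup.mem_zmultiples_iff.1 h1
    obtain ⟨n, rfl⟩ := AddSubgroup.mem_zmultiples_iff.1 h2
    simp [hx, hy]

lemma isWeakSphericalSystem_iff (hS : S ⊆ b.support) :
    IsWeakSphericalSystem b S (AddSubgroup.zmultiples (lin P c) ⊔ AddSubgroup.zmultiples (lin P d))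
      {lin P c, lin P d} (S ∩ Sp) ↔
    Rt (cartan P S) (fun k => (k : ι) ∉ Sp) c ∧ Rt (cartan P S) (fun k => (k : ι) ∉ Sp) d ∧
    (∀ i : S, ¬ (i : ι) ∉ Sp → pr (cartan P S) c i = 0 ∧ pr (cartan P S) d i = 0) ∧
    (∀ i j, cartan P S i j = 0 → (c = Pi.single i 1 + Pi.single j 1 ∨
      d = Pi.single i 1 + Pi.single j 1) → pr (cartan P S) c i = pr (cartan P S) c j ∧
        pr (cartan P S) d i = pr (cartan P S) d j) ∧
    ∀ i j, (c = Pi.single i 1 ∨ d = Pi.single i 1) →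
      (c = Pi.single i 1 + Pi.single j 1 ∨ d = Pi.single i 1 + Pi.single j 1) →
        cartan P S j i ≠ -1 := by
  have inj := lin_injective (P := P) hS
  have mem₁ : ∀ i : S, P.root i ∈ ({lin P c, lin P d} : Set X) ↔
      (c = Pi.single i 1 ∨ d = Pi.single i 1) := fun i => by
    rw [← lin_single, Set.mem_insert_iff, Set.mem_singleton_iff, inj.eq_iff, inj.eq_iff, eq_comm,
      eq_comm (b := d)]
  have mem₂ : ∀ i j : S, P.root i + P.root j ∈ ({lin P c, lin P d} : Set X) ↔
      (c = Pi.single i 1 + Pi.single j 1 ∨ d = Pi.single i 1 + Pi.single j 1) := fun i j => by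
    rw [← lin_single, ← lin_single, ← lin_add, Set.mem_insert_iff, Set.mem_singleton_iff,
      inj.eq_iff, inj.eq_iff, eq_comm, eq_comm (b := d)]
  constructor
  · intro h
    refine ⟨(isWeakSphericalRoot_iff hS).1 (h.weakRoot _ (by simp)),
      (isWeakSphericalRoot_iff hS).1 (h.weakRoot _ (by simp)), fun i hi => ?_, fun i j h0 hij => ?_,
      fun i j hi hij => h.simpleRoot i i.2 j j.2 ((mem₁ i).2 hi) ((mem₂ i j).2 hij)⟩
    · have := forall_mem_sup_iff.1 (h.parabolic i ⟨i.2, not_not.1 hi⟩)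
      rwa [toLinearMap_lin, toLinearMap_lin] at this
    · have := forall_mem_sup_iff.1 (h.typeD₂ i i.2 j j.2 h0 ((mem₂ i j).2 hij))
      simpa only [map_sub, toLinearMap_lin, sub_eq_zero] using this
  · rintro ⟨h1, h2, h3, h4, h5⟩
    refine ⟨hS, ?_, Set.inter_subset_left, ?_, ?_, ?_, ?_⟩
    · rintro _ (rfl | rfl)
      exacts [AddSubgroup.mem_sup_left (AddSubgroup.mem_zmultiples _),
        AddSubgroup.mem_sup_right (AddSubgroup.mem_zmultiples _)]
    · rintro _ (rfl | rfl)
      exacts [(isWeakSphericalRoot_iff hS).2 h1, (isWeakSphericalRoot_iff hS).2 h2]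
    · rintro i ⟨hi, hi'⟩
      rw [forall_mem_sup_iff]
      have := h3 ⟨i, hi⟩ (not_not.2 hi')
      rwa [← toLinearMap_lin, ← toLinearMap_lin] at this
    · intro i hi j hj h0 hij
      rw [forall_mem_sup_iff]
      have := h4 ⟨i, hi⟩ ⟨j, hj⟩ h0 ((mem₂ ⟨i, hi⟩ ⟨j, hj⟩).1 hij)
      simpa only [map_sub, ← toLinearMap_lin, sub_eq_zero] using this
    · intro i hi j hj h0 hij
      exact h5 ⟨i, hi⟩ ⟨j, hj⟩ ((mem₁ ⟨i, hi⟩).1 h0) ((mem₂ ⟨i, hi⟩ ⟨j, hj⟩).1 hij)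

/-- If no entry between the supports is non-zero, the supports themselves form a decomposition; they
are disjoint because `A i i = 2`, so a common node counts as a connection. Conversely, in a
decomposition both supports cannot lie in the same part, since together they exhaust `S`; so they
lie in different, orthogonal parts. -/
lemma isIndecomposable_iff [Finite ι] [Module.Free ℤ X] (hS : S ⊆ b.support)
    (hcov : ∀ k, c k ≠ 0 ∨ d k ≠ 0) (hc : ∃ k, c k ≠ 0) (hd : ∃ k, d k ≠ 0) :
    IsIndecomposable b S (AddSubgroup.zmultiples (lin P c) ⊔ AddSubgroup.zmultiples (lin P d))
      {lin P c, lin P d} ↔ ∃ i j, c i ≠ 0 ∧ d j ≠ 0 ∧ cartan P S i j ≠ 0 := by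
  have hA := finiteType (P := P) hS
  constructor
  · intro h
    by_contra hcd
    push Not at hcd
    refine h ⟨supp b (lin P c), supp b (lin P d), ?_, ?_, ?_, ?_, ?_, ?_, ?_⟩
    · obtain ⟨k, hk⟩ := hc
      rw [supp_lin hS]
      exact ⟨k, k.2, hk⟩
    · obtain ⟨k, hk⟩ := hd
      rw [supp_lin hS]
      exact ⟨k, k.2, hk⟩
    · rw [supp_lin hS, supp_lin hS, Set.disjoint_left]
      rintro i ⟨h1, h2⟩ ⟨h3, h4⟩
      have := hcd _ _ h2 h4
      rw [hA.diag] at this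
      omega
    · rw [supp_lin hS, supp_lin hS]
      ext i
      constructor
      · rintro (⟨h, -⟩ | ⟨h, -⟩) <;> exact h
      · intro h
        exact (hcov ⟨i, h⟩).imp (fun h' => ⟨h, h'⟩) (fun h' => ⟨h, h'⟩)
    · rw [supp_lin hS, supp_lin hS]
      rintro i ⟨h1, h2⟩ j ⟨h3, h4⟩
      have := hcd _ _ h2 h4
      exact ⟨this, hA.symm _ _ this⟩
    · rintro _ (rfl | rfl)
      exacts [Or.inl subset_rfl, Or.inr subset_rfl]
    · have orth : ∀ {c d : S → ℤ}, (∀ i j, c i ≠ 0 → d j ≠ 0 → cartan P S i j = 0) →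
          ∀ χ ∈ AddSubgroup.zmultiples (lin P c), ∀ j ∈ supp b (lin P d),
            P.toLinearMap χ (P.coroot j) = 0 := fun {c d} hcd χ hχ j hj => by
        rw [supp_lin hS] at hj
        obtain ⟨hj, hj'⟩ := hj
        obtain ⟨m, rfl⟩ := AddSubgroup.mem_zmultiples_iff.1 hχ
        have h1 := toLinearMap_lin (P := P) c ⟨j, hj⟩
        rw [FiniteType.pr_eq_zero fun i hi => hcd i _ hi hj'] at h1
        simp [h1]
      intro χ hχ
      obtain ⟨x, hx, y, hy, rfl⟩ := AddSubgroup.mem_sup.1 hχ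
      exact ⟨x, AddSubgroup.mem_sup_left hx, y, AddSubgroup.mem_sup_right hy, rfl,
        orth hcd x hx, orth (fun i j hi hj => hA.symm _ _ (hcd j i hj hi)) y hy⟩
  · rintro ⟨i, j, hi, hj, ha⟩ ⟨S₁, S₂, ⟨x, hx⟩, ⟨y, hy⟩, hdis, hun, horth, hsupp, -⟩
    have hσ := hsupp (lin P c) (by simp)
    have hτ := hsupp (lin P d) (by simp)
    have cov : ∀ k ∈ S, k ∈ supp b (lin P c) ∨ k ∈ supp b (lin P d) := fun k hk => by
      rw [supp_lin hS, supp_lin hS]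
      exact (hcov ⟨k, hk⟩).imp (fun h' => ⟨hk, h'⟩) (fun h' => ⟨hk, h'⟩)
    have hi' : (i : ι) ∈ supp b (lin P c) := by rw [supp_lin hS]; exact ⟨i.2, hi⟩
    have hj' : (j : ι) ∈ supp b (lin P d) := by rw [supp_lin hS]; exact ⟨j.2, hj⟩
    rw [Set.disjoint_left] at hdis
    rcases hσ with hσ | hσ <;> rcases hτ with hτ | hτ
    · rcases cov y (hun ▸ Or.inr hy) with h | h
      exacts [hdis (hσ h) hy, hdis (hτ h) hy]
    · exact ha (horth i (hσ hi') j (hτ hj')).1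
    · exact ha (horth j (hτ hj') i (hσ hi')).2
    · rcases cov x (hun ▸ Or.inl hx) with h | h
      exacts [hdis hx (hσ h), hdis hx (hτ h)]

lemma Rt.exists_ne {κ : Type*} {A : κ → κ → ℤ} {W : κ → Prop} {σ : κ → ℤ} [Fintype κ]
    [DecidableEq κ] (h : Rt A W σ) : ∃ k, σ k ≠ 0 := by
  obtain ⟨n, C, l, w, D, l', v, e, hE, he⟩ := h.entry
  exact ⟨e 1, he.val_ne le_rfl hE.entry.pos.1⟩

theorem isWeakSphericalSystem_and_isIndecomposable_iff [Finite ι] [Module.Free ℤ X]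
    (hS : S ⊆ b.support) (hne : c ≠ d) (hcov : ∀ k, c k ≠ 0 ∨ d k ≠ 0) :
    (IsWeakSphericalSystem b S
        (AddSubgroup.zmultiples (lin P c) ⊔ AddSubgroup.zmultiples (lin P d))
        {lin P c, lin P d} (S ∩ Sp) ∧
      IsIndecomposable b S (AddSubgroup.zmultiples (lin P c) ⊔ AddSubgroup.zmultiples (lin P d))
        {lin P c, lin P d}) ↔ Sys (cartan P S) (fun k => (k : ι) ∉ Sp) c d := by
  rw [isWeakSphericalSystem_iff hS]
  constructor
  · rintro ⟨⟨h1, h2, h3, h4, h5⟩, h6⟩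
    exact ⟨hne, hcov, h1, h2, h3, h4, h5,
      (isIndecomposable_iff hS hcov h1.exists_ne h2.exists_ne).1 h6⟩
  · intro h
    exact ⟨⟨h.root₁, h.root₂, h.black, h.d2, h.sr⟩,
      (isIndecomposable_iff hS hcov h.root₁.exists_ne h.root₂.exists_ne).2 h.conn⟩

lemma IsWeakSphericalRoot.exists_lin {σ : X} (h : IsWeakSphericalRoot P S Sp σ) :
    ∃ c : S → ℤ, σ = lin P c := by
  obtain ⟨n, C, l, w, -, e, he, -, rfl, -⟩ := h
  exact ⟨_, comb_eq_lin (fun i => ⟨e i, he i⟩) l⟩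

lemma IsIsomorphicTo.exists_lin {σ τ : X} {n : ℕ} {C : Matrix (Fin n) (Fin n) ℤ} {s t : ℕ → ℕ}
    {w : Set ℕ} (h : IsIsomorphicTo P S σ τ Sp C s t w) :
    (∃ c : S → ℤ, σ = lin P c) ∧ ∃ d : S → ℤ, τ = lin P d := by
  obtain ⟨e, -, h, -⟩ := h
  rw [Set.pair_eq_pair_iff] at h
  rcases h with ⟨rfl, rfl⟩ | ⟨rfl, rfl⟩ <;> exact ⟨⟨_, comb_eq_lin _ _⟩, ⟨_, comb_eq_lin _ _⟩⟩

theorem isWeakSphericalSystem_and_isIndecomposable_iff_isIsomorphicTo [Finite ι] [Module.Free ℤ X]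
    {σ τ : X} (hne : σ ≠ τ) (hS : S = supp b σ ∪ supp b τ) :
    (IsWeakSphericalSystem b S (AddSubgroup.zmultiples σ ⊔ AddSubgroup.zmultiples τ) {σ, τ}
        (S ∩ Sp) ∧
      IsIndecomposable b S (AddSubgroup.zmultiples σ ⊔ AddSubgroup.zmultiples τ) {σ, τ}) ↔
    ∃ (n : ℕ) (C : Matrix (Fin n) (Fin n) ℤ) (s t : ℕ → ℕ) (w : Set ℕ),
      RankTwoTable n C s t w ∧ IsIsomorphicTo P S σ τ (S ∩ Sp) C s t w := by
  have hS' : S ⊆ b.support := by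
    rw [hS]
    rintro i (h | h) <;> exact h.1
  by_cases hl : (∃ c : S → ℤ, σ = lin P c) ∧ ∃ d : S → ℤ, τ = lin P d
  · obtain ⟨⟨c, rfl⟩, d, rfl⟩ := hl
    have hcov : ∀ k, c k ≠ 0 ∨ d k ≠ 0 := fun k => by
      have hk : (k : ι) ∈ supp b (lin P c) ∪ supp b (lin P d) := hS ▸ k.2
      rw [supp_lin hS', supp_lin hS'] at hk
      exact hk.imp (fun h => h.2) fun h => h.2
    rw [isWeakSphericalSystem_and_isIndecomposable_iff hS' (fun h => hne (congrArg _ h)) hcov,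
      isIsomorphicTo_iff hS', sys_iff_inTable (finiteType hS')]
  -- If one of the two elements is not a combination of roots in `S`, it is neither a weak spherical
  -- root nor the image of a root in the table.
  · refine iff_of_false (fun h => hl ?_) fun ⟨n, C, s, t, w, _, h⟩ => hl h.exists_lin
    exact ⟨(h.1.weakRoot σ (by simp)).exists_lin, (h.1.weakRoot τ (by simp)).exists_lin⟩

end Translation

end WeakSpherical

/-! ### The theorem for based root data -/

theorem mainTheorem10 {ι X Y : Type*} [Finite ι] [AddCommGroup X] [AddCommGroup Y]
    [Module.Free ℤ X] [Module.Finite ℤ X] [Module.Free ℤ Y] [Module.Finite ℤ Y]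
    (P : RootDatum ι X Y) [P.IsReduced] (b : P.Base)
    (σ τ : X) (hστ : σ ≠ τ) (Sp : Set ι) :
    let S : Set ι := WeakSpherical.supp b σ ∪ WeakSpherical.supp b τ
    let Ξ : AddSubgroup X := AddSubgroup.zmultiples σ ⊔ AddSubgroup.zmultiples τ
    (WeakSpherical.IsWeakSphericalSystem b S Ξ {σ, τ} (S ∩ Sp) ∧
        WeakSpherical.IsIndecomposable b S Ξ {σ, τ}) ↔
      ∃ (n : ℕ) (C : Matrix (Fin n) (Fin n) ℤ) (s t : ℕ → ℕ) (w : Set ℕ),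
        WeakSpherical.RankTwoTable n C s t w ∧
          WeakSpherical.IsIsomorphicTo P S σ τ (S ∩ Sp) C s t w := by
  intro S Ξ
  classical
  have : Finite S := Subtype.finite
  have := Fintype.ofFinite S
  exact WeakSpherical.isWeakSphericalSystem_and_isIndecomposable_iff_isIsomorphicTo hστ rfl
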